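/- **Setting.** Let $T>0$ and let $u$ be a real-valued $C^\infty$ function on $[0,\infty)\times[0,T]$, all of whose partial derivatives decay faster than any power of $x$ as $x\to\infty$, uniformly in $t$. Assume that $u$ satisfies the Degasperis–Procesi equation $$u_t-u_{txx}+3u_x+4uu_x-3u_xu_{xx}-uu_{xxx}=0\qquad\text{on }\Omega=\{0\le x<\infty,\ 0\le t<T\},$$ that $u(x,0)-u_{xx}(x,0)+1>0$ for $x\ge0$, and that $u(0,t)-u_{xx}(0,t)+1>0$ and $u(0,t)\le0$ for $0\le t<T$. Put $q=(u-u_{xx}+1)^{1/3}$, $D=\mathrm{diag}(1/q,1,q)$, $y(x,t)=\int_{(0,0)}^{(x,t)}q\,(dx'-u\,dt')$; the map $F:(x,t)\mapsto(y(x,t),t)$ is a bijection of $\Omega$ onto $F(\Omega)$. With $\omega=e^{2\pi i/3}$, for $k\in\mathbb C$ and $j=1,2,3$ let $$\lambda=\tfrac{1}{3\sqrt3}(k^3+k^{-3}),\quad l_j=\tfrac1{\sqrt3}\Bigl(\omega^jk+\tfrac1{\omega^jk}\Bigr),\quad z_j=\sqrt3\,\frac{(\omega^jk)^2+(\omega^jk)^{-2}}{k^3+k^{-3}},$$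 $\mathcal L=\mathrm{diag}(l_1,l_2,l_3)$, $\mathcal Z=\mathrm{diag}(z_1,z_2,z_3)$, $P=(l_j^{\,i-1})_{i,j=1}^3$, and $$V_1=P^{-1}\begin{pmatrix}0&0&0\\0&0&0\\\lambda(q^3-1)&0&0\end{pmatrix}P,\qquad V_2=P^{-1}\begin{pmatrix}u_x&-u&0\\u&0&-u\\u_x-\lambda uq^3&0&-u_x\end{pmatrix}P,$$ $$\tilde V_1=P^{-1}\begin{pmatrix}\frac{q_x}q&0&0\\0&0&0\\0&\frac1q-q&-\frac{q_x}q\end{pmatrix}P,\qquad \tilde V_2=P^{-1}\begin{pmatrix}-\frac{uq_x}q&0&\frac{q^2-1}\lambda\\\frac{u+1}q-1&0&0\\\frac{u_x}{q^2}&\frac1q-1+uq&\frac{uq_x}q\end{pmatrix}P.$$ Call $k$ *special* if $k\in\{0,\infty\}$, $k^6=-1$, or $k^6=1$. For $n=1,\dots,18$ let $D_n$ be the set of $k\in\mathbb C$ with $\mathrm{Re}\,l_{a}<\mathrm{Re}\,l_{b}<\mathrm{Re}\,l_{c}$ and $\mathrm{Re}\,z_{a'}<\mathrm{Re}\,z_{b'}<\mathrm{Re}\,z_{c'}$,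 where $(abc\,|\,a'b'c')$ is, in this order, $123|123$, $132|132$, $312|312$, $321|321$, $231|231$, $213|213$, $123|213$, $123|132$, $132|123$, $132|312$, $312|132$, $312|321$, $321|312$, $321|231$, $231|321$, $231|213$, $213|231$, $213|123$. Let $\gamma_1,\gamma_2,\gamma_3$ be the contours $(0,T)\to(0,t)\to(x,t)$, $(0,0)\to(0,t)\to(x,t)$ and $(\infty,t)\to(x,t)$, made of straight segments. For $k\in D_n$ put $\gamma^n_{ij}=\gamma_3$ if $\mathrm{Re}\,l_i\ge\mathrm{Re}\,l_j$; otherwise $\gamma^n_{ij}=\gamma_2$ if $\mathrm{Re}\,z_i<\mathrm{Re}\,z_j$ and $\gamma^n_{ij}=\gamma_1$ if $\mathrm{Re}\,z_i\ge\mathrm{Re}\,z_j$; this depends only on $n$. For non-special $k\in\bar D_n$, $\Phi_n(x,t,k)$ is the solution, bounded in $x$, of $$\Phi_x-[\mathcal L,\Phi]=V_1\Phi,\qquad \Phi_t-[\mathcal Z,\Phi]=V_2\Phi\qquad(x\ge0,\ 0\le t\le T)$$ with $$\Phi_{ij}(x,t)=\delta_{ij}+\int_{\gamma_{ij}^n}e^{(l_i-l_j)(x-x')+(z_i-z_j)(t-t')}\bigl((V_1dx'+V_2dt')\Phi\bigr)_{ij}(x',t'),$$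 and, for $n\le 6$, $\tilde\Phi_n(x,t,k)$ is the solution, bounded in $x$, of $$\tilde\Phi_x-[q\mathcal L,\tilde\Phi]=\tilde V_1\tilde\Phi,\qquad\tilde\Phi_t-[\mathcal Z-uq\mathcal L,\tilde\Phi]=\tilde V_2\tilde\Phi\qquad\text{on }\Omega$$ with the same integral equations in which $V_i$ is replaced by $\tilde V_i$ and $x-x'$ by $y(x,t)-y(x',t')$. Let $R>2$, $E_n=D_n\cap\{1/R<|k|<R\}$ for $n\le18$ and $E_{n+18}=D_n\cap\{|k|<1/R\text{ or }|k|>R\}$ for $n\le6$. For $(y,t)=F(x,t)\in F(\Omega)$ put $$M_n(y,t,k)=\Phi_n(x,t,k)e^{\mathcal L(k)(x-y)}\ (n\le18),\qquad M_n(y,t,k)=P^{-1}(k)D(x,t)P(k)\tilde\Phi_{n-18}(x,t,k)\ (n\ge19),$$ $$\nu_n=(1,1,1)M_n,\qquad S_n(k)=M_n(0,0,k),\qquad J_{m,n}(y,t,k)=e^{\mathcal Ly+\mathcal Zt}S_m^{-1}S_ne^{-\mathcal Ly-\mathcal Zt}.$$ **Exceptional points.** Let $\mathcal K_n$ (the set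 $\{k_j\}$ belonging to $E_n$; possibly empty) consist of - the non-special $k\in\bar E_n$ at which the above problem for $\Phi_n$ (for $\tilde\Phi_{n-18}$ if $n\ge19$) is not uniquely solvable; - if $n\le18$, those sixth roots of unity $\varkappa\in\bar E_n$ near which the spectral functions $\Delta_n,\Delta_n'$ are not both bounded away from zero, i.e. for which there are no $c>0$ and neighbourhood $U$ of $\varkappa$ such that for all $k\in U\cap E_n$ the problem is uniquely solvable and $|\Delta_n(k)|\ge c$, $|\Delta'_n(k)|\ge c$. Here, with $\mathrm{Re}\,l_a<\mathrm{Re}\,l_b<\mathrm{Re}\,l_c$ in $D_n$, $\Delta_n=\det\bigl([S_n]_a,[B_{ab}]_b,[B_{ab}]_c\bigr)$ (columns) and $\Delta_n'$ is the determinant with rows $c$ of $S_n^{-1}$, $a$ of $B_{ac}^{-1}$, $b$ of $B_{bc}^{-1}$; $B_{ij}=S(k)$ if $\gamma_{ij}^n=\gamma_1$, $B_{ij}=I$ if $\gamma^n_{ij}=\gamma_2$; and $S(k)=\mu(0)$ where $\mu_t-[\mathcal Z,\mu]=V_2(0,t,k)\mu$ on $[0,T]$, $\mu(T)=I$. **Proposition.**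 Let $n,m\in\{1,\dots,24\}$. 1. $\mathcal K_n$ has no accumulation point in $E_n$. For every $(y,t)\in F(\Omega)$, $\nu_n(y,t,\cdot)$ is analytic in $E_n\setminus\mathcal K_n$. 2. For every $(y,t)\in F(\Omega)$ there is a continuous function on $\bar E_n\setminus\mathcal K_n$, the closure being taken in the Riemann sphere (so that the special points in $\bar E_n\setminus \mathcal K_n$ are included), which equals $\nu_n(y,t,k)$ at all non-special points and is bounded outside every neighbourhood of $\mathcal K_n$. In particular $\nu_n$ is bounded in $E_n$ away from $\mathcal K_n$. Moreover $S_n$ is continuous at the non-special points of $\bar E_n\setminus\mathcal K_n$. 3. For every $(y,t)\in F(\Omega)$ and every non-special $k\in(\bar E_n\cap\bar E_m)\setminus(\mathcal K_n\cup\mathcal K_m)$, $$\nu_n=\nu_m J_{m,n},\qquad J_{m,n}J_{n,m}=I .$$ -/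

import Mathlib

open scoped Topology Matrix ContDiff

noncomputable section

namespace DegasperisProcesi

/-- Complex `3 × 3` matrices. The indices `1, 2, 3` of `l_j`, `z_j` and of matrix entries are `0, 1, 2` here. -/
abbrev Mat3 : Type := Matrix (Fin 3) (Fin 3) ℂ

/-! ### The solution `u` and the quantities built from it -/

/-- The `j`-th `x`-derivative of `u` on the half-line `x ≥ 0`, one-sided at `x = 0`. -/
def dx (u : ℝ → ℝ → ℝ) (j : ℕ) (x t : ℝ) : ℝ :=
  iteratedDerivWithin j (fun s => u s t) (Set.Ici 0) x

/-- The `t`-derivative on `[0, T]`. -/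
def dt (T : ℝ) (f : ℝ → ℝ → ℝ) (x t : ℝ) : ℝ :=
  derivWithin (fun s => f x s) (Set.Icc 0 T) t

/-- `u` is a smooth solution, rapidly decaying as `x → ∞`, of
`u_t - u_txx + 3 u_x + 4 u u_x - 3 u_x u_xx - u u_xxx = 0` for `0 ≤ x`, `0 ≤ t < T`, which is
smooth up to `t = T` and whose initial and boundary values satisfy `u₀ - u₀'' + 1 > 0`,
`g₀ - g₂ + 1 > 0` and `g₀ ≤ 0`. -/
structure IsHalfLineSolution (u : ℝ → ℝ → ℝ) (T : ℝ) : Prop where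
  smooth : ContDiffOn ℝ ∞ (Function.uncurry u) (Set.Ici 0 ×ˢ Set.Icc 0 T)
  decay : ∀ m N : ℕ, ∃ C : ℝ, ∀ x t : ℝ, 0 ≤ x → 0 ≤ t → t ≤ T →
    (1 + x) ^ N * ‖iteratedFDerivWithin ℝ m (Function.uncurry u)
      (Set.Ici 0 ×ˢ Set.Icc 0 T) (x, t)‖ ≤ C
  equation : ∀ x t : ℝ, 0 ≤ x → 0 ≤ t → t < T →
    dt T u x t - dt T (dx u 2) x t + 3 * dx u 1 x t + 4 * u x t * dx u 1 x t
      - 3 * dx u 1 x t * dx u 2 x t - u x t * dx u 3 x t = 0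
  initial_pos : ∀ x : ℝ, 0 ≤ x → 0 < u x 0 - dx u 2 x 0 + 1
  boundary_pos : ∀ t : ℝ, 0 ≤ t → t < T → 0 < u 0 t - dx u 2 0 t + 1
  boundary_nonpos : ∀ t : ℝ, 0 ≤ t → t < T → u 0 t ≤ 0

/-- `q = (u - u_xx + 1)^{1/3}`. -/
def q (u : ℝ → ℝ → ℝ) (x t : ℝ) : ℝ := (u x t - dx u 2 x t + 1) ^ (1 / 3 : ℝ)

/-- `q_x`. -/
def qx (u : ℝ → ℝ → ℝ) (x t : ℝ) : ℝ := derivWithin (fun s => q u s t) (Set.Ici 0) x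

/-- `y(x,t)`, the integral of the closed form `q (dx - u dt)` from `(0,0)` to `(x,t)`, taken along
the path `(0,0) → (0,t) → (x,t)`. -/
def yFun (u : ℝ → ℝ → ℝ) (x t : ℝ) : ℝ :=
  (∫ s in (0 : ℝ)..x, q u s t) - ∫ s in (0 : ℝ)..t, q u 0 s * u 0 s

/-- The image of `Ω = {0 ≤ x < ∞, 0 ≤ t < T}` under `F : (x, t) ↦ (y(x,t), t)`. -/
def FΩ (u : ℝ → ℝ → ℝ) (T : ℝ) : Set (ℝ × ℝ) :=
  (fun p : ℝ × ℝ => (yFun u p.1 p.2, p.2)) '' (Set.Ici 0 ×ˢ Set.Ico 0 T)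

/-- The `x`-component of `F⁻¹(y, t)`. -/
def xOf (u : ℝ → ℝ → ℝ) (y t : ℝ) : ℝ :=
  Function.invFunOn (fun x => yFun u x t) (Set.Ici 0) y

/-! ### The Lax pairs -/

/-- `ω = e^{2πi/3}`. -/
def om : ℂ := Complex.exp (2 * Real.pi * Complex.I / 3)

/-- `ω^j k` for `j = 1, 2, 3`. -/
def rot (j : Fin 3) (k : ℂ) : ℂ := om ^ ((j : ℕ) + 1) * k

def lam (k : ℂ) : ℂ := 1 / (3 * (Real.sqrt 3 : ℂ)) * (k ^ 3 + 1 / k ^ 3)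

def l (j : Fin 3) (k : ℂ) : ℂ := 1 / (Real.sqrt 3 : ℂ) * (rot j k + 1 / rot j k)

def z (j : Fin 3) (k : ℂ) : ℂ :=
  (Real.sqrt 3 : ℂ) * ((rot j k ^ 2 + 1 / rot j k ^ 2) / (k ^ 3 + 1 / k ^ 3))

/-- `𝓛 = diag(l₁, l₂, l₃)`. -/
def calL (k : ℂ) : Mat3 := Matrix.diagonal fun j => l j k

/-- `𝓩 = diag(z₁, z₂, z₃)`. -/
def calZ (k : ℂ) : Mat3 := Matrix.diagonal fun j => z j k

/-- `e^{𝓛 a + 𝓩 b}`. -/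
def expLZ (k : ℂ) (a b : ℝ) : Mat3 :=
  Matrix.diagonal fun j => Complex.exp (l j k * a + z j k * b)

def P (k : ℂ) : Mat3 :=
  !![1, 1, 1; l 0 k, l 1 k, l 2 k; l 0 k ^ 2, l 1 k ^ 2, l 2 k ^ 2]

def V1 (u : ℝ → ℝ → ℝ) (x t : ℝ) (k : ℂ) : Mat3 :=
  (P k)⁻¹ * !![0, 0, 0; 0, 0, 0; lam k * ((q u x t : ℂ) ^ 3 - 1), 0, 0] * P k

def V2 (u : ℝ → ℝ → ℝ) (x t : ℝ) (k : ℂ) : Mat3 :=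
  (P k)⁻¹ * !![(dx u 1 x t : ℂ), -(u x t : ℂ), 0;
    (u x t : ℂ), 0, -(u x t : ℂ);
    (dx u 1 x t : ℂ) - lam k * u x t * (q u x t : ℂ) ^ 3, 0, -(dx u 1 x t : ℂ)] * P k

def tV1 (u : ℝ → ℝ → ℝ) (x t : ℝ) (k : ℂ) : Mat3 :=
  (P k)⁻¹ * !![(qx u x t : ℂ) / q u x t, 0, 0;
    0, 0, 0;
    0, 1 / (q u x t : ℂ) - q u x t, -((qx u x t : ℂ) / q u x t)] * P k

def tV2 (u : ℝ → ℝ → ℝ) (x t : ℝ) (k : ℂ) : Mat3 :=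
  (P k)⁻¹ * (!![-((u x t : ℂ) * qx u x t / q u x t), 0, 0;
      ((u x t : ℂ) + 1) / q u x t - 1, 0, 0;
      (dx u 1 x t : ℂ) / (q u x t : ℂ) ^ 2, 1 / (q u x t : ℂ) - 1 + u x t * q u x t,
        (u x t : ℂ) * qx u x t / q u x t]
    + (((q u x t : ℂ) ^ 2 - 1) / lam k) • !![0, 0, 1; 0, 0, 0; 0, 0, 0]) * P k

/-- `D = diag(1/q, 1, q)`. -/
def Dmat (u : ℝ → ℝ → ℝ) (x t : ℝ) : Mat3 :=
  !![1 / (q u x t : ℂ), 0, 0; 0, 1, 0; 0, 0, (q u x t : ℂ)]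

/-- The points of `ℂ` where the Lax pairs are nonsingular: `k ≠ 0`, `λ(k) ≠ 0` (that is, `k` is
none of the `K_j`), and `P(k)` is invertible (that is, `k` is none of the sixth roots of unity). -/
def NonSpecial (k : ℂ) : Prop := k ≠ 0 ∧ k ^ 6 ≠ -1 ∧ k ^ 6 ≠ 1

/-! ### The sets `D_n` and the contours -/

/-- The indices in increasing order of `Re l_j` in `D_{n+1}`. -/
def lOrd : Fin 18 → Fin 3 → Fin 3 :=
  ![![0, 1, 2], ![0, 2, 1], ![2, 0, 1], ![2, 1, 0], ![1, 2, 0], ![1, 0, 2],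
    ![0, 1, 2], ![0, 1, 2], ![0, 2, 1], ![0, 2, 1], ![2, 0, 1], ![2, 0, 1],
    ![2, 1, 0], ![2, 1, 0], ![1, 2, 0], ![1, 2, 0], ![1, 0, 2], ![1, 0, 2]]

/-- The indices in increasing order of `Re z_j` in `D_{n+1}`. -/
def zOrd : Fin 18 → Fin 3 → Fin 3 :=
  ![![0, 1, 2], ![0, 2, 1], ![2, 0, 1], ![2, 1, 0], ![1, 2, 0], ![1, 0, 2],
    ![1, 0, 2], ![0, 2, 1], ![0, 1, 2], ![2, 0, 1], ![0, 2, 1], ![2, 1, 0],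
    ![2, 0, 1], ![1, 2, 0], ![2, 1, 0], ![1, 0, 2], ![1, 2, 0], ![0, 1, 2]]

/-- The set `D_{n+1}`. The strict inequalities exclude `0` and the `K_j`, where the values of
`l_j`, `z_j` are conventional and all equal. -/
def Dset (n : Fin 18) : Set ℂ :=
  {k | (l (lOrd n 0) k).re < (l (lOrd n 1) k).re ∧ (l (lOrd n 1) k).re < (l (lOrd n 2) k).re ∧
    (z (zOrd n 0) k).re < (z (zOrd n 1) k).re ∧ (z (zOrd n 1) k).re < (z (zOrd n 2) k).re}

/-- `i` comes strictly before `j` in the order `σ 0, σ 1, σ 2`. -/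
def Before (σ : Fin 3 → Fin 3) (i j : Fin 3) : Prop := ∃ p r, p < r ∧ σ p = i ∧ σ r = j

/-- `γ₁` runs `(0,T) → (0,t) → (x,t)`, `γ₂` runs `(0,0) → (0,t) → (x,t)` and `γ₃` runs
`(∞,t) → (x,t)`, all along straight segments. -/
inductive Contour
  | γ₁
  | γ₂
  | γ₃

open Classical in
/-- The contour `γ_{ij}^{n+1}`. -/
def contour (n : Fin 18) (i j : Fin 3) : Contour :=
  if Before (lOrd n) i j then
    if Before (zOrd n) i j then Contour.γ₂ else Contour.γ₁
  else Contour.γ₃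

/-- The integral of the one-form `a dx' + b dt'` along a contour ending at `(x, t)`. -/
def contourIntegral (T : ℝ) (c : Contour) (x t : ℝ) (a b : ℝ → ℝ → ℂ) : ℂ :=
  match c with
  | Contour.γ₁ => (∫ s in T..t, b 0 s) + ∫ s in (0 : ℝ)..x, a s t
  | Contour.γ₂ => (∫ s in (0 : ℝ)..t, b 0 s) + ∫ s in (0 : ℝ)..x, a s t
  | Contour.γ₃ => -∫ s in Set.Ioi x, a s t

/-! ### The eigenfunctions -/

/-- `Φ` is a solution of the first Lax pair on `{0 ≤ x, 0 ≤ t ≤ T}`, bounded in `x`, which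
satisfies the integral equations with the contours `γ_{ij}^{n+1}` at the spectral parameter `k`. -/
structure IsPhi (u : ℝ → ℝ → ℝ) (T : ℝ) (n : Fin 18) (k : ℂ) (Φ : ℝ → ℝ → Mat3) : Prop where
  lax_x : ∀ x t : ℝ, 0 ≤ x → 0 ≤ t → t ≤ T → ∀ i j,
    HasDerivWithinAt (fun s => Φ s t i j)
      ((calL k * Φ x t - Φ x t * calL k + V1 u x t k * Φ x t) i j) (Set.Ici 0) x
  lax_t : ∀ x t : ℝ, 0 ≤ x → 0 ≤ t → t ≤ T → ∀ i j,
    HasDerivWithinAt (fun s => Φ x s i j)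
      ((calZ k * Φ x t - Φ x t * calZ k + V2 u x t k * Φ x t) i j) (Set.Icc 0 T) t
  bounded : ∀ t : ℝ, 0 ≤ t → t ≤ T → ∃ C : ℝ, ∀ x : ℝ, 0 ≤ x → ∀ i j, ‖Φ x t i j‖ ≤ C
  integral_eq : ∀ x t : ℝ, 0 ≤ x → 0 ≤ t → t ≤ T → ∀ i j,
    Φ x t i j = (if i = j then 1 else 0) + contourIntegral T (contour n i j) x t
      (fun x' t' => Complex.exp ((l i k - l j k) * ((x - x' : ℝ) : ℂ)
        + (z i k - z j k) * ((t - t' : ℝ) : ℂ)) * (V1 u x' t' k * Φ x' t') i j)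
      (fun x' t' => Complex.exp ((l i k - l j k) * ((x - x' : ℝ) : ℂ)
        + (z i k - z j k) * ((t - t' : ℝ) : ℂ)) * (V2 u x' t' k * Φ x' t') i j)

/-- The analogue of `IsPhi` for the second Lax pair, on `{0 ≤ x, 0 ≤ t < T}`. -/
structure IsTPhi (u : ℝ → ℝ → ℝ) (T : ℝ) (n : Fin 18) (k : ℂ) (Φ : ℝ → ℝ → Mat3) : Prop where
  lax_x : ∀ x t : ℝ, 0 ≤ x → 0 ≤ t → t < T → ∀ i j,
    HasDerivWithinAt (fun s => Φ s t i j)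
      (((q u x t : ℂ) • (calL k * Φ x t - Φ x t * calL k) + tV1 u x t k * Φ x t) i j)
      (Set.Ici 0) x
  lax_t : ∀ x t : ℝ, 0 ≤ x → 0 ≤ t → t < T → ∀ i j,
    HasDerivWithinAt (fun s => Φ x s i j)
      ((calZ k * Φ x t - Φ x t * calZ k
        - ((u x t : ℂ) * q u x t) • (calL k * Φ x t - Φ x t * calL k)
        + tV2 u x t k * Φ x t) i j) (Set.Ico 0 T) t
  bounded : ∀ t : ℝ, 0 ≤ t → t < T → ∃ C : ℝ, ∀ x : ℝ, 0 ≤ x → ∀ i j, ‖Φ x t i j‖ ≤ C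
  integral_eq : ∀ x t : ℝ, 0 ≤ x → 0 ≤ t → t < T → ∀ i j,
    Φ x t i j = (if i = j then 1 else 0) + contourIntegral T (contour n i j) x t
      (fun x' t' => Complex.exp ((l i k - l j k) * ((yFun u x t - yFun u x' t' : ℝ) : ℂ)
        + (z i k - z j k) * ((t - t' : ℝ) : ℂ)) * (tV1 u x' t' k * Φ x' t') i j)
      (fun x' t' => Complex.exp ((l i k - l j k) * ((yFun u x t - yFun u x' t' : ℝ) : ℂ)
        + (z i k - z j k) * ((t - t' : ℝ) : ℂ)) * (tV2 u x' t' k * Φ x' t') i j)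

/-- The equations for `Φ_{n+1}` are uniquely solvable at `k`. -/
def Solvable (u : ℝ → ℝ → ℝ) (T : ℝ) (n : Fin 18) (k : ℂ) : Prop :=
  (∃ Φ, IsPhi u T n k Φ) ∧ ∀ Φ Φ', IsPhi u T n k Φ → IsPhi u T n k Φ' →
    ∀ x t : ℝ, 0 ≤ x → 0 ≤ t → t ≤ T → Φ x t = Φ' x t

/-- The equations for `Φ̃_{n+1}` are uniquely solvable at `k`. -/
def TSolvable (u : ℝ → ℝ → ℝ) (T : ℝ) (n : Fin 18) (k : ℂ) : Prop :=
  (∃ Φ, IsTPhi u T n k Φ) ∧ ∀ Φ Φ', IsTPhi u T n k Φ → IsTPhi u T n k Φ' →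
    ∀ x t : ℝ, 0 ≤ x → 0 ≤ t → t < T → Φ x t = Φ' x t

/-- The eigenfunction `Φ_{n+1}(x,t,k)`; meaningful where `Solvable` holds. -/
def Phi (u : ℝ → ℝ → ℝ) (T : ℝ) (n : Fin 18) (x t : ℝ) (k : ℂ) : Mat3 :=
  Classical.epsilon (IsPhi u T n k) x t

/-- The eigenfunction `Φ̃_{n+1}(x,t,k)`; meaningful where `TSolvable` holds. -/
def TPhi (u : ℝ → ℝ → ℝ) (T : ℝ) (n : Fin 18) (x t : ℝ) (k : ℂ) : Mat3 :=
  Classical.epsilon (IsTPhi u T n k) x t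

/-! ### The sets `E_n`, the functions `M_n`, `ν_n`, `S_n` and the jump matrices

`Sum.inl n` stands for the index `n + 1 ∈ {1, …, 18}` and `Sum.inr n` for the index
`n + 19 ∈ {19, …, 24}`. -/

abbrev Idx : Type := Fin 18 ⊕ Fin 6

/-- `Fin 6 ⊆ Fin 18`. -/
def emb (n : Fin 6) : Fin 18 := Fin.castLE (by norm_num) n

def E (R : ℝ) : Idx → Set ℂ
  | Sum.inl n => Dset n ∩ {k | 1 / R < ‖k‖ ∧ ‖k‖ < R}
  | Sum.inr n => Dset (emb n) ∩ {k | ‖k‖ < 1 / R ∨ R < ‖k‖}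

def M (u : ℝ → ℝ → ℝ) (T : ℝ) (n : Idx) (y t : ℝ) (k : ℂ) : Mat3 :=
  match n with
  | Sum.inl n => Phi u T n (xOf u y t) t k * expLZ k (xOf u y t - y) 0
  | Sum.inr n => (P k)⁻¹ * Dmat u (xOf u y t) t * P k * TPhi u T (emb n) (xOf u y t) t k

/-- The row vector `ν_n = (1, 1, 1) M_n`. -/
def nu (u : ℝ → ℝ → ℝ) (T : ℝ) (n : Idx) (y t : ℝ) (k : ℂ) : Fin 3 → ℂ :=
  ![1, 1, 1] ᵥ* M u T n y t k

/-- The spectral function `S_n(k) = M_n(0, 0, k)`. -/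
def S (u : ℝ → ℝ → ℝ) (T : ℝ) (n : Idx) (k : ℂ) : Mat3 := M u T n 0 0 k

/-- The jump matrix `J_{m,n} = e^{𝓛 y + 𝓩 t} S_m⁻¹ S_n e^{-𝓛 y - 𝓩 t}`. -/
def J (u : ℝ → ℝ → ℝ) (T : ℝ) (m n : Idx) (y t : ℝ) (k : ℂ) : Mat3 :=
  expLZ k y t * ((S u T m k)⁻¹ * S u T n k) * expLZ k (-y) (-t)

/-! ### The exceptional points `k_j` -/

/-- `μ` is the restriction to `x = 0` of the solution of the first Lax pair which equals the
identity at `(0, T)`. -/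
def IsBoundaryMu (u : ℝ → ℝ → ℝ) (T : ℝ) (k : ℂ) (μ : ℝ → Mat3) : Prop :=
  μ T = 1 ∧ ∀ t : ℝ, 0 ≤ t → t ≤ T → ∀ i j,
    HasDerivWithinAt (fun s => μ s i j)
      ((calZ k * μ t - μ t * calZ k + V2 u 0 t k * μ t) i j) (Set.Icc 0 T) t

/-- The spectral function `S(k)` of the boundary values, the value at `(0,0)` of the solution
normalized at `(0,T)`. -/
def SBdry (u : ℝ → ℝ → ℝ) (T : ℝ) (k : ℂ) : Mat3 :=
  Classical.epsilon (IsBoundaryMu u T k) 0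

/-- `S(k)` for entries integrated from `(0,T)`, the identity for those integrated from `(0,0)`. -/
def startMat (u : ℝ → ℝ → ℝ) (T : ℝ) (n : Fin 18) (i j : Fin 3) (k : ℂ) : Mat3 :=
  match contour n i j with
  | Contour.γ₁ => SBdry u T k
  | _ => 1

/-- The spectral function whose zeros are the poles of the column of `Φ_{n+1}` with the
intermediate exponent: with `a, b, c` the indices in increasing order of `Re l` in `D_{n+1}`, it is
the determinant with columns `[S_n]_a, [B]_b, [B]_c`, `B = startMat n a b`. It is `s₁₁` in `D₁`,
`D₈` and `W₁` in `D₇`. -/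
def deltaMid (u : ℝ → ℝ → ℝ) (T : ℝ) (n : Fin 18) (k : ℂ) : ℂ :=
  (Matrix.of fun i : Fin 3 =>
    ![S u T (Sum.inl n) k i (lOrd n 0),
      startMat u T n (lOrd n 0) (lOrd n 1) k i (lOrd n 1),
      startMat u T n (lOrd n 0) (lOrd n 1) k i (lOrd n 2)]).det

/-- The spectral function whose zeros are the poles of the column of `Φ_{n+1}` with the largest
exponent: the determinant with rows `[S_n⁻¹]_c, [B⁻¹]_a, [B'⁻¹]_b`, where `B = startMat n a c`,
`B' = startMat n b c`. It is the minor `m₃₃(s)` in `D₁`, `D₇` and `W₂` in `D₈`. -/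
def deltaTop (u : ℝ → ℝ → ℝ) (T : ℝ) (n : Fin 18) (k : ℂ) : ℂ :=
  (Matrix.of
    ![(S u T (Sum.inl n) k)⁻¹ (lOrd n 2),
      (startMat u T n (lOrd n 0) (lOrd n 2) k)⁻¹ (lOrd n 0),
      (startMat u T n (lOrd n 1) (lOrd n 2) k)⁻¹ (lOrd n 1)]).det

/-- The exceptional set `{k_j}` of the index `n`: the points of the closure of `E_n` at which the
Lax pair is nonsingular but the integral equations are not uniquely solvable (the Fredholm
determinant vanishes). A sixth root of unity on the boundary of `E_n`, where the Lax pair in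
diagonal form is itself singular, is counted as exceptional unless the two spectral functions
stay away from zero near it. -/
def sing (u : ℝ → ℝ → ℝ) (T R : ℝ) : Idx → Set ℂ
  | Sum.inl n =>
      {k | k ∈ closure (E R (Sum.inl n)) ∧ NonSpecial k ∧ ¬ Solvable u T n k} ∪
      {κ | κ ∈ closure (E R (Sum.inl n)) ∧ κ ^ 6 = 1 ∧
        ¬ ∃ c : ℝ, 0 < c ∧ ∀ᶠ k in 𝓝[E R (Sum.inl n)] κ,
          Solvable u T n k ∧ c ≤ ‖deltaMid u T n k‖ ∧ c ≤ ‖deltaTop u T n k‖}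
  | Sum.inr n =>
      {k | k ∈ closure (E R (Sum.inr n)) ∧ NonSpecial k ∧ ¬ TSolvable u T (emb n) k}

end DegasperisProcesi

end

noncomputable section

namespace DegasperisProcesi

set_option linter.unusedSectionVars false

open Set Filter MeasureTheory
open scoped Real
open Complex (exp exp_add exp_zero norm_real continuous_ofReal norm_exp add_re neg_re sub_re abs_re_le_norm normSq normSq_eq_norm_sq normSq_apply ofReal_zero ofReal_one re_mul_ofReal exp_ne_zero continuous_re inv_re I ofReal_re)
open Matrix (mulVec cons_val cons_val_zero mulVec_mulVec cons_val_one one_mulVec mulVec_smul add_mulVec smul_mulVec of_apply det_fin_three vecMul_vecMul mul_nonsing_inv nonsing_inv_mul mulVec_add mulVec_zero mul_nonsing_inv_cancel_left mul_diagonal diagonal diagonal_mul mul_apply mulVec_sub one_apply vecMul_one smul_vecMul det_mul)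
open Real (sqrt cos sin exp_pos exp_le_exp exp_le_one_iff sq_sqrt pi_pos norm_eq_abs norm_of_nonneg sin_neg sin_pi_div_six)
open Function (uncurry comp_def)
open Finset (single_le_sum sum_nonneg sum_mul sum_le_sum mul_sum sum_congr sum_sub_distrib)
open Fin (sum_univ_three)
open Sum (inl inr)
open Contour (γ₁ γ₂ γ₃)
local notation "ℂ³" => Fin 3 → ℂ

/-- The real functions of `x` and `t`. -/
local notation "𝓕" => ℝ → ℝ → ℝ

/-- The derivative of the characteristic polynomial. -/
local notation "χ[" s "]" => (3 * s ^ 2 - 1)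

/-- `n#p` is the index of the `p`-th smallest among the `Re l_j` in `D_n`. -/
local notation:max n:max "#" p:max => lOrd n p

variable {u : 𝓕} {T : ℝ} [hT : Fact (0 < T)] (hu : IsHalfLineSolution u T) {k : ℂ} {n : Fin 18}
  {p r : Fin 3} {C : ℂ³} {x t : ℝ}

/-! ### Linear ordinary differential equations -/

section ODE

variable {E : Type*} [NormedAddCommGroup E] [NormedSpace ℝ E]

/-- The terms of the Picard series of `v' = M v + g'` with `v 0 = g 0`. -/
def picardTerm (M : ℝ → E →L[ℝ] E) (g : ℝ → E) : ℕ → ℝ → E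
  | 0 => g
  | n + 1 => fun s => ∫ r in 0..s, M r (picardTerm M g n r)

lemma continuous_picardTerm {M : ℝ → E →L[ℝ] E} (hM : Continuous M) {g : ℝ → E}
    (hg : Continuous g) (n : ℕ) : Continuous (picardTerm M g n) := by
  induction n with
  | zero => exact hg
  | succ n ih =>
    exact intervalIntegral.continuous_primitive (fun a b => (hM.clm_apply ih).intervalIntegrable a b) 0

lemma norm_picardTerm_le {M : ℝ → E →L[ℝ] E} (hM : Continuous M) {g : ℝ → E}
    (hg : Continuous g) {C G ρ : ℝ} (hC : ∀ s, |s| ≤ ρ → ‖M s‖ ≤ C) (hG : ∀ s, |s| ≤ ρ → ‖g s‖ ≤ G)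
    (n : ℕ) (s : ℝ) (hs : |s| ≤ ρ) :
    ‖picardTerm M g n s‖ ≤ G * (C ^ n * |s| ^ n / n.factorial) := by
  induction n generalizing s with
  | zero => simpa [picardTerm] using hG s hs
  | succ n ih =>
    refine (intervalIntegral.norm_integral_le_integral_norm_uIoc.trans (setIntegral_mono_on
      (g := fun r => (G * C ^ (n + 1) / n.factorial) * |r - 0| ^ n)
      ((hM.clm_apply (continuous_picardTerm hM hg n)).norm.intervalIntegrable 0 s).def'
      (Continuous.intervalIntegrable (by fun_prop) 0 s).def' measurableSet_uIoc
      fun r hr => ?_)).trans (le_of_eq ?_)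
    · have hr' : |r| ≤ ρ := le_trans (by simpa using abs_sub_left_of_mem_uIcc (uIoc_subset_uIcc hr)) hs
      refine ((M r).le_of_opNorm_le_of_le (hC r hr') (ih r hr')).trans (le_of_eq ?_)
      rw [sub_zero]; ring
    · rw [integral_const_mul, integral_pow_abs_sub_uIoc, sub_zero, Nat.factorial_succ]
      push_cast
      field_simp

lemma exists_linear_ode [CompleteSpace E] {M : ℝ → E →L[ℝ] E} (hM : Continuous M) {g g' : ℝ → E}
    (hg : ∀ s, HasDerivAt g (g' s) s) :
    ∃ v : ℝ → E, v 0 = g 0 ∧ ∀ s, HasDerivAt v (M s (v s) + g' s) s := by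
  have hgc : Continuous g := continuous_iff_continuousAt.2 fun s => (hg s).continuousAt
  have hbd : ∀ ρ : ℝ, ∃ C G : ℝ, ∀ s, |s| ≤ ρ → ‖M s‖ ≤ C ∧ ‖g s‖ ≤ G := by
    intro ρ
    obtain ⟨C, hC⟩ := (isCompact_Icc (a := -ρ) (b := ρ)).exists_bound_of_continuousOn
      (hM.prodMk hgc).continuousOn
    exact ⟨C, C, fun s hs => norm_prod_le_iff.1 (hC s (abs_le.1 hs))⟩
  have hsum : ∀ s, Summable fun n => picardTerm M g n s := by
    intro s
    obtain ⟨C, G, h⟩ := hbd |s|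
    refine Summable.of_norm_bounded (g := fun n => G * ((C * |s|) ^ n / n.factorial))
      ((Real.summable_pow_div_factorial _).mul_left _) fun n => ?_
    rw [mul_pow]
    exact norm_picardTerm_le hM hgc (fun s hs => (h s hs).1) (fun s hs => (h s hs).2) n s le_rfl
  have hs0 := fun s => (hsum s).tsum_eq_zero_add
  refine ⟨fun s => ∑' n, picardTerm M g n s, ?_, fun s => ?_⟩
  · simp [hs0, picardTerm]
  · set ρ := |s| + 1
    obtain ⟨C, G, h⟩ := hbd ρ
    have hρ : |s| < ρ := by simp [ρ]
    simp only [hs0]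
    rw [← hs0, (M s).map_tsum (hsum s), add_comm]
    refine (hg s).add (hasDerivAt_tsum_of_isPreconnected (t := Ioo (-ρ) ρ)
      (g := fun n => picardTerm M g (n + 1)) (g' := fun n s => M s (picardTerm M g n s))
      (u := fun n => C * (G * ((C * ρ) ^ n / n.factorial)))
      (((Real.summable_pow_div_factorial _).mul_left _).mul_left _) isOpen_Ioo isPreconnected_Ioo
      (fun n y _ => ?_) (fun n y hy => ?_) (abs_lt.1 hρ)
      ((summable_nat_add_iff 1).2 (hsum s)) (abs_lt.1 hρ))
    · have hc := hM.clm_apply (continuous_picardTerm hM hgc n)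
      exact intervalIntegral.integral_hasDerivAt_right (hc.intervalIntegrable 0 y)
        (hc.stronglyMeasurableAtFilter _ _) hc.continuousAt
    have hy' : |y| ≤ ρ := (abs_lt.2 hy).le
    have hC0 := (norm_nonneg _).trans (h y hy').1
    have hG0 := (norm_nonneg _).trans (h y hy').2
    refine (M y).le_of_opNorm_le_of_le (h y hy').1 ((norm_picardTerm_le hM hgc
      (fun s hs => (h s hs).1) (fun s hs => (h s hs).2) n y hy').trans ?_)
    rw [← mul_pow]
    gcongr

lemma norm_le_of_norm_deriv_le {v v' : ℝ → E} {K ε X : ℝ} (hK : 0 ≤ K) (hε : 0 ≤ ε)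
    (hv : ∀ x ∈ Icc 0 X, HasDerivWithinAt v (v' x) (Icc 0 X) x)
    (hb : ∀ x ∈ Icc 0 X, ‖v' x‖ ≤ K * ‖v x‖ + ε) :
    ∀ x ∈ Icc 0 X, ‖v x‖ ≤ (‖v 0‖ + ε) * Real.exp ((K + 1) * X) := by
  intro x hx
  refine (norm_le_gronwallBound_of_norm_deriv_right_le (K := K + 1) (ε := ε)
    (fun y hy => (hv y hy).continuousWithinAt)
    (fun y hy => (hv y ⟨hy.1, hy.2.le⟩).mono_of_mem_nhdsWithin (Icc_mem_nhdsGE_of_mem hy)) le_rfl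
    (fun y hy => by linarith [hb y ⟨hy.1, hy.2.le⟩, norm_nonneg (v y)]) x hx).trans ?_
  rw [sub_zero, gronwallBound_of_K_ne_0 (by positivity)]
  have h1 := mul_le_mul_of_nonneg_right (div_le_self hε (by linarith : 1 ≤ K + 1))
    (exp_pos ((K + 1) * x)).le
  have h2 : 0 ≤ ε / (K + 1) := by positivity
  calc _ ≤ (‖v 0‖ + ε) * Real.exp ((K + 1) * x) := by linarith
    _ ≤ _ := by gcongr; exact hx.2

end ODE

/-! ### Energy estimates for diagonally dissipative systems -/

section Energy

lemma two_mul_inner_le {z μ r : ℂ} {κ : ℝ} (h : μ.re ≤ κ) :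
    2 * inner ℝ z (μ * z + r) ≤ 2 * κ * ‖z‖ ^ 2 + 2 * ‖z‖ * ‖r‖ := by
  have h1 : inner ℝ z (μ * z) = μ.re * ‖z‖ ^ 2 := by
    rw [Complex.inner, ← normSq_eq_norm_sq, normSq_apply]
    simp only [Complex.mul_re, Complex.mul_im, Complex.conj_re, Complex.conj_im]
    ring
  have h2 : inner ℝ z r ≤ ‖z‖ * ‖r‖ := real_inner_le_norm z r
  rw [inner_add_right, h1]
  nlinarith [mul_le_mul_of_nonneg_right h (sq_nonneg ‖z‖)]

lemma energy_rate_le {n : Fin 3 → ℝ} {ρ : Fin 3 → ℝ} {k ε : ℝ} (hk : 0 ≤ k)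
    (hn : ∀ i, 0 ≤ n i) (hρ : ∀ i, ρ i ≤ k * (∑ j, n j + ε)) :
    ∑ i, (2 * k * n i ^ 2 + 2 * n i * ρ i) ≤ 11 * k * (∑ i, n i ^ 2 + ε ^ 2) := by
  have h : ∀ i, 2 * n i * ρ i ≤ 2 * n i * (k * (∑ j, n j + ε)) := fun i =>
    mul_le_mul_of_nonneg_left (hρ i) (by have := hn i; positivity)
  have h0 := h 0
  have h1 := h 1
  have h2 := h 2
  simp only [sum_univ_three] at *
  have key : 2 * (n 0 + n 1 + n 2) * (n 0 + n 1 + n 2 + ε) ≤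
      9 * (n 0 ^ 2 + n 1 ^ 2 + n 2 ^ 2) + 9 * ε ^ 2 := by
    nlinarith [sq_nonneg (n 0 - n 1), sq_nonneg (n 1 - n 2), sq_nonneg (n 0 - n 2),
      sq_nonneg (n 0 + n 1 + n 2 - ε), sq_nonneg ε]
  have := mul_le_mul_of_nonneg_left key hk
  nlinarith [mul_nonneg hk (sq_nonneg ε)]

lemma hasDerivAt_neg_div_one_add (K : ℝ) (hx : 0 ≤ x) :
    HasDerivAt (fun y : ℝ => -K / (1 + y)) (K / (1 + x) ^ 2) x :=
  ((hasDerivAt_const x (-K)).div ((hasDerivAt_id x).const_add 1) (by positivity)).congr_deriv (by simp)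

variable {v Λ r : Fin 3 → ℝ → ℂ} {a b K ε : ℝ} (ha : 0 ≤ a) (hab : a ≤ b) (hK : 0 ≤ K)
  (hv : ∀ i, ∀ x ∈ Icc a b, HasDerivWithinAt (v i) (Λ i x * v i x + r i x) (Icc a b) x)
  (hr : ∀ i, ∀ x ∈ Icc a b, ‖r i x‖ ≤ K / (1 + x) ^ 2 * (∑ j, ‖v j x‖ + ε))

include ha hab hK hv hr

lemma energy_decay {σ : ℝ} (hσ : |σ| = 1) (hΛ : ∀ i, ∀ x ∈ Icc a b, σ * (Λ i x).re ≤ 0) :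
    σ * ((∑ i, ‖v i b‖ ^ 2 + ε ^ 2) * Real.exp (-(σ * 11 * (-K / (1 + b))))) ≤
      σ * ((∑ i, ‖v i a‖ ^ 2 + ε ^ 2) * Real.exp (-(σ * 11 * (-K / (1 + a))))) := by
  have hd := fun x hx => ((((HasDerivWithinAt.fun_sum fun i (_ : i ∈ Finset.univ) =>
    (hv i x hx).norm_sq).add_const (ε ^ 2)).mul (((hasDerivAt_neg_div_one_add K
      (ha.trans hx.1)).hasDerivWithinAt.const_mul (σ * 11)).neg.exp)).const_mul σ)
  refine antitoneOn_of_hasDerivWithinAt_nonpos (convex_Icc a b)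
    (fun x hx => (hd x hx).continuousWithinAt)
    (fun x hx => (hd x (interior_subset hx)).mono interior_subset) (fun x hx => ?_)
    (left_mem_Icc.2 hab) (right_mem_Icc.2 hab) hab
  have hx' := interior_subset hx
  have h0 := ha.trans hx'.1
  have h1 := (sum_le_sum fun i _ => two_mul_inner_le (z := v i x) (r := σ * r i x)
    (μ := σ * Λ i x) ((by simpa using hΛ i x hx' : _ ≤ (0 : ℝ)).trans
      (by positivity : 0 ≤ K / (1 + x) ^ 2))).trans
    (energy_rate_le (by positivity) (fun i => norm_nonneg _) fun i => by
      simpa [norm_eq_abs, hσ] using hr i x hx')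
  have h2 : ∀ i, inner ℝ (v i x) (σ * Λ i x * v i x + σ * r i x) =
      σ * inner ℝ (v i x) (Λ i x * v i x + r i x) := fun i => by
    rw [mul_assoc, ← mul_add, ← Complex.real_smul, real_inner_smul_right]
  simp only [h2, mul_left_comm 2 σ, ← mul_sum] at h1
  have h3 : σ * σ = 1 := by rw [← abs_mul_abs_self, hσ, one_mul]
  simp only [Pi.neg_apply, ← mul_sum]
  have h4 := mul_le_mul_of_nonneg_right h1 (exp_pos (-(σ * 11 * (-K / (1 + x))))).le
  linear_combination h4 - 11 * (K / (1 + x) ^ 2) * (∑ i, ‖v i x‖ ^ 2 + ε ^ 2) *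
    Real.exp (-(σ * 11 * (-K / (1 + x)))) * h3

lemma energy_forward_decay (hΛ : ∀ i, ∀ x ∈ Icc a b, (Λ i x).re ≤ 0) :
    ∑ i, ‖v i b‖ ^ 2 + ε ^ 2 ≤ (∑ i, ‖v i a‖ ^ 2 + ε ^ 2) * Real.exp (11 * K) := by
  have h := energy_decay ha hab hK hv hr abs_one (by simpa using hΛ)
  simp only [one_mul, neg_div, mul_neg, neg_neg] at h
  have hb : 0 ≤ b := ha.trans hab
  refine (le_mul_of_one_le_right (by positivity) (Real.one_le_exp (by positivity))).trans (h.trans ?_)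
  gcongr
  exact div_le_self hK (by linarith)

lemma energy_backward_decay (hΛ : ∀ i, ∀ x ∈ Icc a b, 0 ≤ (Λ i x).re) :
    ∑ i, ‖v i a‖ ^ 2 + ε ^ 2 ≤ (∑ i, ‖v i b‖ ^ 2 + ε ^ 2) * Real.exp (11 * K) := by
  have h := energy_decay ha hab hK hv hr (σ := -1) (by simp) (by simpa using hΛ)
  have hb : 0 ≤ b := ha.trans hab
  have h1 : K / (1 + a) ≤ K := div_le_self hK (by linarith)
  have h2 : 0 ≤ K / (1 + b) := by positivity
  simp only [neg_mul, one_mul, neg_div, mul_neg, neg_neg, neg_le_neg_iff] at h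
  calc _ = (∑ i, ‖v i a‖ ^ 2 + ε ^ 2) * Real.exp (-(11 * (K / (1 + a)))) *
        Real.exp (11 * (K / (1 + a))) := by rw [mul_assoc, ← Real.exp_add]; simp
    _ ≤ (∑ i, ‖v i b‖ ^ 2 + ε ^ 2) * 1 * Real.exp (11 * K) := by
      gcongr ?_ * Real.exp (11 * ?_)
      exact h.trans (mul_le_mul_of_nonneg_left (by simpa using h2) (by positivity))
    _ = _ := by rw [mul_one]

end Energy

/-! ### Smooth rapidly decaying functions on the half-strip -/

/-- The half-strip `[0, ∞) × [0, T]`. -/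
def strip (T : ℝ) : Set (ℝ × ℝ) := Ici 0 ×ˢ Icc 0 T

lemma uniqueDiffOn_strip : UniqueDiffOn ℝ (strip T) :=
  (uniqueDiffOn_Ici 0).prod (uniqueDiffOn_Icc hT.out)

/-- `f` is smooth on the half-strip and all its derivatives decay faster than any power. -/
structure RapidDecay (T : ℝ) (f : 𝓕) : Prop where
  smooth : ContDiffOn ℝ ∞ (uncurry f) (strip T)
  decay : ∀ m N : ℕ, ∃ C : ℝ, ∀ p ∈ strip T,
    (1 + p.1) ^ N * ‖iteratedFDerivWithin ℝ m (uncurry f) (strip T) p‖ ≤ C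

/-- The partial derivative in `x` on the half-strip. -/
def pdx (T : ℝ) (f : 𝓕) (x t : ℝ) : ℝ :=
  fderivWithin ℝ (uncurry f) (strip T) (x, t) (1, 0)

/-- The partial derivative in `t` on the half-strip. -/
def pdt (T : ℝ) (f : 𝓕) (x t : ℝ) : ℝ :=
  fderivWithin ℝ (uncurry f) (strip T) (x, t) (0, 1)

namespace RapidDecay

variable {f g : 𝓕}

lemma congr (hf : RapidDecay T f) (h : ∀ p ∈ strip T, g p.1 p.2 = f p.1 p.2) : RapidDecay T g := by
  have h' : EqOn (uncurry g) (uncurry f) (strip T) := fun p hp => h p hp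
  refine ⟨hf.smooth.congr h', fun m N => ?_⟩
  obtain ⟨C, hC⟩ := hf.decay m N
  refine ⟨C, fun p hp => ?_⟩
  rw [iteratedFDerivWithin_congr h' hp]
  exact hC p hp

lemma fderivWithin_apply (hf : RapidDecay T f) (v : ℝ × ℝ) :
    RapidDecay T fun x t => fderivWithin ℝ (uncurry f) (strip T) (x, t) v := by
  have hs := uniqueDiffOn_strip (T := T)
  have hfd : ContDiffOn ℝ ∞ (fderivWithin ℝ (uncurry f) (strip T)) (strip T) :=
    hf.smooth.fderivWithin hs (by simp)
  set A : (ℝ × ℝ →L[ℝ] ℝ) →L[ℝ] ℝ := ContinuousLinearMap.apply ℝ ℝ v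
  have heq : uncurry (fun x t => fderivWithin ℝ (uncurry f) (strip T) (x, t) v)
      = A ∘ fderivWithin ℝ (uncurry f) (strip T) := rfl
  refine ⟨heq ▸ A.contDiff.comp_contDiffOn hfd, fun m N => ?_⟩
  obtain ⟨C, hC⟩ := hf.decay (m + 1) N
  refine ⟨‖A‖ * C, fun p hp => ?_⟩
  rw [heq, A.iteratedFDerivWithin_comp_left (hfd p hp) hs hp (i := m) (by exact_mod_cast le_top)]
  have h1 := A.norm_compContinuousMultilinearMap_le
    (iteratedFDerivWithin ℝ m (fderivWithin ℝ (uncurry f) (strip T)) (strip T) p)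
  rw [norm_iteratedFDerivWithin_fderivWithin hs hp] at h1
  have hp0 : 0 ≤ p.1 := hp.1
  refine (mul_le_mul_of_nonneg_left h1 (by positivity)).trans ?_
  rw [mul_left_comm]
  exact mul_le_mul_of_nonneg_left (hC p hp) (norm_nonneg A)

lemma pdx (hf : RapidDecay T f) : RapidDecay T (pdx T f) := hf.fderivWithin_apply (1, 0)

lemma pdt (hf : RapidDecay T f) : RapidDecay T (pdt T f) := hf.fderivWithin_apply (0, 1)

lemma sub (hf : RapidDecay T f) (hg : RapidDecay T g) : RapidDecay T fun x t => f x t - g x t := by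
  refine ⟨hf.smooth.sub hg.smooth, fun m N => ?_⟩
  obtain ⟨C, hC⟩ := hf.decay m N
  obtain ⟨C', hC'⟩ := hg.decay m N
  refine ⟨C + C', fun p hp => ?_⟩
  have hp0 : 0 ≤ p.1 := hp.1
  rw [show uncurry (fun x t => f x t - g x t) = uncurry f - uncurry g from rfl,
    iteratedFDerivWithin_sub_apply ((hf.smooth p hp).of_le (by exact_mod_cast le_top))
    ((hg.smooth p hp).of_le (by exact_mod_cast le_top)) uniqueDiffOn_strip hp]
  refine (mul_le_mul_of_nonneg_left (norm_sub_le _ _) (by positivity)).trans ?_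
  rw [mul_add]
  exact add_le_add (hC p hp) (hC' p hp)

lemma continuousOn (hf : RapidDecay T f) : ContinuousOn (uncurry f) (strip T) := hf.smooth.continuousOn

lemma hasFDerivWithinAt (hf : RapidDecay T f) {p : ℝ × ℝ} (hp : p ∈ strip T) :
    HasFDerivWithinAt (uncurry f) (fderivWithin ℝ (uncurry f) (strip T) p) (strip T) p :=
  ((hf.smooth p hp).differentiableWithinAt (by simp)).hasFDerivWithinAt

lemma hasDeriv_x (hf : RapidDecay T f) (hx : 0 ≤ x) (ht : t ∈ Icc 0 T) :
    HasDerivWithinAt (fun s => f s t) (DegasperisProcesi.pdx T f x t) (Ici 0) x :=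
  HasFDerivWithinAt.comp_hasDerivWithinAt (f := fun s => (s, t)) x (hf.hasFDerivWithinAt ⟨hx, ht⟩)
    ((hasDerivWithinAt_id x _).prodMk (hasDerivWithinAt_const x _ t)) fun _ hs => ⟨hs, ht⟩

lemma hasDeriv_t (hf : RapidDecay T f) (hx : 0 ≤ x) (ht : t ∈ Icc 0 T) :
    HasDerivWithinAt (fun s => f x s) (DegasperisProcesi.pdt T f x t) (Icc 0 T) t :=
  HasFDerivWithinAt.comp_hasDerivWithinAt (f := fun s => (x, s)) t (hf.hasFDerivWithinAt ⟨hx, ht⟩)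
    ((hasDerivWithinAt_const t _ x).prodMk (hasDerivWithinAt_id t _)) fun _ hs => ⟨hx, hs⟩

lemma contOn_x (hf : RapidDecay T f) (ht : t ∈ Icc 0 T) : ContinuousOn (fun s => f s t) (Ici 0) :=
  fun _ hx => (hf.hasDeriv_x hx ht).continuousWithinAt

lemma contOn_t (hf : RapidDecay T f) (hx : 0 ≤ x) : ContinuousOn (fun s => f x s) (Icc 0 T) :=
  fun _ ht => (hf.hasDeriv_t hx ht).continuousWithinAt

lemma bound (hf : RapidDecay T f) (N : ℕ) : ∃ C : ℝ, 0 ≤ C ∧ ∀ x t : ℝ, 0 ≤ x → t ∈ Icc 0 T →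
    |f x t| ≤ C / (1 + x) ^ N := by
  obtain ⟨C, hC⟩ := hf.decay 0 N
  refine ⟨|C|, abs_nonneg _, fun x t hx ht => ?_⟩
  have := hC (x, t) ⟨hx, ht⟩
  rw [norm_iteratedFDerivWithin_zero] at this
  rw [le_div_iff₀ (by positivity), mul_comm]
  exact this.trans (le_abs_self C)

end RapidDecay

/-! ### One-sided extrema -/

lemma mul_deriv_nonneg_of_isMinOn {g : ℝ → ℝ} {g' a b : ℝ} {s : Set ℝ} (hs : s.OrdConnected)
    (ha : a ∈ s) (hb : b ∈ s) (hg : HasDerivWithinAt g g' s a) (h : ∀ x ∈ s, g a ≤ g x) :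
    0 ≤ (b - a) * g' := by
  have := (IsMinOn.localize (isMinOn_iff.2 h)).hasFDerivWithinAt_nonneg hg.hasFDerivWithinAt
    (sub_mem_posTangentConeAt_of_segment_subset (hs.convex.segment_subset ha hb))
  simpa using this

/-! ### The solution -/

/-- `u - u_xx`. -/
def mom (u : 𝓕) (x t : ℝ) : ℝ := u x t - dx u 2 x t

section Solution

lemma IsHalfLineSolution.rapidDecay (hu : IsHalfLineSolution u T) : RapidDecay T u :=
  ⟨hu.smooth, fun m N => by
    obtain ⟨C, hC⟩ := hu.decay m N
    exact ⟨C, fun p hp => hC p.1 p.2 hp.1 hp.2.1 hp.2.2⟩⟩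

include hu

lemma rapid_dx (j : ℕ) : RapidDecay T (dx u j) ∧
    ∀ x t, 0 ≤ x → t ∈ Icc 0 T → dx u (j + 1) x t = pdx T (dx u j) x t := by
  have key : ∀ i, RapidDecay T (dx u i) → ∀ x t, 0 ≤ x → t ∈ Icc 0 T →
      dx u (i + 1) x t = pdx T (dx u i) x t := fun i h0 x t hx ht => by
    rw [← (h0.hasDeriv_x hx ht).derivWithin (uniqueDiffOn_Ici 0 x hx)]
    simp only [dx, iteratedDerivWithin_succ]
  have h0 : RapidDecay T (dx u j) := by
    induction j with
    | zero => exact hu.rapidDecay.congr fun p _ => by simp [dx]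
    | succ j ih => exact (ih.pdx).congr fun p hp => key j ih p.1 p.2 hp.1 hp.2
  exact ⟨h0, key j h0⟩

lemma rapid_mom : RapidDecay T (mom u) := hu.rapidDecay.sub (rapid_dx hu 2).1

lemma hasDeriv_dx (j : ℕ) (hx : 0 ≤ x) (ht : t ∈ Icc 0 T) :
    HasDerivWithinAt (fun s => dx u j s t) (dx u (j + 1) x t) (Ici 0) x := by
  rw [(rapid_dx hu j).2 x t hx ht]
  exact ((rapid_dx hu j).1).hasDeriv_x hx ht

lemma hasDeriv_u_x (hx : 0 ≤ x) (ht : t ∈ Icc 0 T) :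
    HasDerivWithinAt (fun s => u s t) (dx u 1 x t) (Ici 0) x := by
  simpa [dx] using hasDeriv_dx hu 0 hx ht

lemma pdx_mom (hx : 0 ≤ x) (ht : t ∈ Icc 0 T) : pdx T (mom u) x t = dx u 1 x t - dx u 3 x t := by
  have h1 := (rapid_mom hu).hasDeriv_x hx ht
  have h2 := (hasDeriv_u_x hu hx ht).sub (hasDeriv_dx hu 2 hx ht)
  exact (uniqueDiffOn_Ici 0 x hx).eq_deriv _ h1 h2

lemma pdt_mom_of_lt (hx : 0 ≤ x) (ht0 : 0 ≤ t) (htT : t < T) :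
    pdt T (mom u) x t = -(u x t * pdx T (mom u) x t + 3 * dx u 1 x t * (mom u x t + 1)) := by
  have ht : t ∈ Icc 0 T := ⟨ht0, htT.le⟩
  have hU := uniqueDiffOn_Icc hT.out t ht
  have h1 := (rapid_mom hu).hasDeriv_t hx ht
  have h2 := hu.rapidDecay.hasDeriv_t hx ht
  have h3 := (rapid_dx hu 2).1.hasDeriv_t hx ht
  have h4 : pdt T (mom u) x t = pdt T u x t - pdt T (dx u 2) x t := hU.eq_deriv _ h1 (h2.sub h3)
  have h5 := hu.equation x t hx ht0 htT
  rw [dt, dt, h2.derivWithin hU, h3.derivWithin hU] at h5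
  rw [h4, pdx_mom hu hx ht, mom]
  linarith

lemma pdt_mom (hx : 0 ≤ x) (ht : t ∈ Icc 0 T) :
    pdt T (mom u) x t = -(u x t * pdx T (mom u) x t + 3 * dx u 1 x t * (mom u x t + 1)) := by
  have hm := rapid_mom hu
  have heq : EqOn (fun s => pdt T (mom u) x s) (fun s => -(u x s * pdx T (mom u) x s +
      3 * dx u 1 x s * (mom u x s + 1))) (Ico 0 T) := fun s hs =>
    pdt_mom_of_lt hu hx hs.1 hs.2
  have a1 := hu.rapidDecay.contOn_t hx
  have a2 := (hm.pdx).contOn_t hx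
  have a3 := (rapid_dx hu 1).1.contOn_t hx
  have a4 := hm.contOn_t hx
  exact heq.of_subset_closure ((hm.pdt).contOn_t hx) (by fun_prop) Ico_subset_Icc_self
    (by rw [closure_Ico hT.out.ne]) ht

lemma u_boundary_nonpos (ht : t ∈ Icc 0 T) : u 0 t ≤ 0 := by
  have hc := hu.rapidDecay.contOn_t le_rfl
  have h : MapsTo (fun s => u 0 s) (Ico 0 T) (Iic 0) := fun s hs => hu.boundary_nonpos s hs.1 hs.2
  have h2 := h.closure_of_continuousOn (by rwa [closure_Ico hT.out.ne])
  rw [closure_Ico hT.out.ne, isClosed_Iic.closure_eq] at h2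
  exact h2 ht

/-- By the maximum principle, `u - u_xx + 1` is bounded below by a positive constant. -/
lemma exists_lower_bound_mom : ∃ c : ℝ, 0 < c ∧ ∀ x t, 0 ≤ x → t ∈ Icc 0 T → c ≤ mom u x t + 1 := by
  have hm := rapid_mom hu
  obtain ⟨C, hC0, hC⟩ := hm.bound 1
  obtain ⟨C₁, hC₁0, hC₁⟩ := (rapid_dx hu 1).1.bound 0
  set X₀ := 2 * C with hX₀
  have hX₀0 : 0 ≤ X₀ := by positivity
  have hfar : ∀ x t, X₀ ≤ x → t ∈ Icc 0 T → 1 / 2 ≤ mom u x t + 1 := fun x t hx ht => by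
    have h1 := hC x t (hX₀0.trans hx) ht
    have h2 : C / (1 + x) ^ 1 ≤ 1 / 2 := by
      rw [pow_one, div_le_iff₀ (by linarith)]
      linarith
    linarith [neg_abs_le (mom u x t)]
  have hzero : (0 : ℝ) ∈ Icc 0 T := ⟨le_rfl, hT.out.le⟩
  obtain ⟨x₁, hx₁, hmin₁⟩ := (isCompact_Icc (a := (0 : ℝ)) (b := X₀)).exists_isMinOn
    (nonempty_Icc.2 hX₀0) ((hm.contOn_x hzero).mono Icc_subset_Ici_self)
  have hpos₁ : 0 < mom u x₁ 0 + 1 := by simpa [mom] using hu.initial_pos x₁ hx₁.1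
  set ε := min (mom u x₁ 0 + 1) (1 / 2)
  have hε0 : 0 < ε := lt_min hpos₁ (by norm_num)
  set K := 3 * C₁ + 1 with hK
  set w : ℝ → ℝ → ℝ := fun x t => Real.exp (-K * t) * (mom u x t + 1) - ε * Real.exp (-K * t) ^ 2 with hw
  have hwc : ContinuousOn (fun p : ℝ × ℝ => w p.1 p.2) (Icc 0 X₀ ×ˢ Icc 0 T) := by
    have h1 : ContinuousOn (fun p : ℝ × ℝ => mom u p.1 p.2) (Icc 0 X₀ ×ˢ Icc 0 T) :=
      hm.continuousOn.mono (prod_mono Icc_subset_Ici_self le_rfl)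
    simp only [hw]
    fun_prop
  obtain ⟨⟨x₀, t₀⟩, ⟨hx₀, ht₀⟩, hmin⟩ := (isCompact_Icc.prod isCompact_Icc).exists_isMinOn
    ((nonempty_Icc.2 hX₀0).prod (nonempty_Icc.2 hT.out.le)) hwc
  simp only at hx₀ ht₀
  replace hmin : ∀ x t, x ∈ Icc 0 X₀ → t ∈ Icc 0 T → w x₀ t₀ ≤ w x t := fun x t hx ht =>
    hmin (show (x, t) ∈ Icc 0 X₀ ×ˢ Icc 0 T from ⟨hx, ht⟩)
  have hwnn : 0 ≤ w x₀ t₀ := by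
    by_contra! hneg
    have hE := exp_pos (-K * t₀)
    have ht₀pos : 0 < t₀ := ht₀.1.lt_of_ne fun h => by
      have h2 : mom u x₁ 0 ≤ mom u x₀ 0 := hmin₁ hx₀
      simp only [hw, ← h, mul_zero, Real.exp_zero, one_mul, one_pow, mul_one] at hneg
      linarith [min_le_left (mom u x₁ 0 + 1) (1 / 2)]
    have hx₀lt : x₀ < X₀ := hx₀.2.lt_of_ne fun h => by
      have h2 := hfar x₀ t₀ h.ge ht₀
      have h4 : Real.exp (-K * t₀) ≤ 1 := exp_le_one_iff.2 (by nlinarith [ht₀.1])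
      have h6 : ε * Real.exp (-K * t₀) ≤ 1 / 2 * 1 :=
        mul_le_mul (min_le_right _ _) h4 hE.le (by norm_num)
      simp only [hw] at hneg
      nlinarith
    have hE' : HasDerivWithinAt (fun s : ℝ => Real.exp (-K * s)) (Real.exp (-K * t₀) * -K)
        (Icc 0 T) t₀ := by
      simpa using ((hasDerivWithinAt_id t₀ (Icc 0 T)).const_mul (-K)).exp
    have h1 := mul_deriv_nonneg_of_isMinOn ordConnected_Icc ht₀ hzero
      ((hE'.mul ((hm.hasDeriv_t hx₀.1 ht₀).add_const 1)).sub ((hE'.pow 2).const_mul ε))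
      fun s hs => hmin x₀ s hx₀ hs
    have hwx := fun b hb => mul_deriv_nonneg_of_isMinOn (b := b) ordConnected_Icc hx₀ hb
      (((((hm.hasDeriv_x hx₀.1 ht₀).mono Icc_subset_Ici_self).add_const 1).const_mul
        (Real.exp (-K * t₀))).sub_const (ε * Real.exp (-K * t₀) ^ 2)) fun s hs => hmin s t₀ hs ht₀
    have h2 : u x₀ t₀ * (Real.exp (-K * t₀) * pdx T (mom u) x₀ t₀) ≤ 0 := by
      have h3 := nonneg_of_mul_nonneg_right (hwx X₀ ⟨hX₀0, le_rfl⟩) (sub_pos.2 hx₀lt)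
      rcases hx₀.1.eq_or_lt with h | h
      · rw [← h] at h3 ⊢
        exact mul_nonpos_of_nonpos_of_nonneg (u_boundary_nonpos hu ht₀) h3
      · have h4 := hwx 0 ⟨le_rfl, hX₀0⟩
        rw [show Real.exp (-K * t₀) * pdx T (mom u) x₀ t₀ = 0 by nlinarith, mul_zero]
    have h3 := hC₁ x₀ t₀ hx₀.1 ht₀
    rw [pow_zero, div_one, abs_le] at h3
    rw [zero_sub, pdt_mom hu hx₀.1 ht₀] at h1
    replace h1 := nonpos_of_mul_nonneg_right h1 (neg_lt_zero.2 ht₀pos)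
    simp only [hw] at hneg
    set E := Real.exp (-K * t₀)
    have h9 := mul_pos_of_neg_of_neg hneg (show -K - 3 * dx u 1 x₀ t₀ < 0 by linarith)
    have h10 : 0 < (K - 3 * dx u 1 x₀ t₀) * (ε * E ^ 2) := mul_pos (by linarith) (by positivity)
    norm_num at h1
    linarith
  refine ⟨min (ε * Real.exp (-K * T)) (1 / 2), lt_min (by positivity) (by norm_num), fun x t hx ht => ?_⟩
  rcases le_total X₀ x with h | h
  · exact (min_le_right _ _).trans (hfar x t h ht)
  · have h1 : 0 ≤ w x t := hwnn.trans (hmin x t ⟨hx, h⟩ ht)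
    have h4 : ε * Real.exp (-K * t) ≤ mom u x t + 1 :=
      le_of_mul_le_mul_left (by linarith) (exp_pos (-K * t))
    exact ((min_le_left _ _).trans (mul_le_mul_of_nonneg_left
      (exp_le_exp.2 (by nlinarith [ht.2])) hε0.le)).trans h4

lemma mom_add_one_pos (hx : 0 ≤ x) (ht : t ∈ Icc 0 T) : 0 < mom u x t + 1 := by
  obtain ⟨c, hc, h⟩ := exists_lower_bound_mom hu
  exact hc.trans_le (h x t hx ht)

omit hu in
lemma q_eq (x t : ℝ) : q u x t = (mom u x t + 1) ^ (1 / 3 : ℝ) := rfl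

lemma q_pos (hx : 0 ≤ x) (ht : t ∈ Icc 0 T) : 0 < q u x t :=
  Real.rpow_pos_of_pos (mom_add_one_pos hu hx ht) _

lemma q_cube (hx : 0 ≤ x) (ht : t ∈ Icc 0 T) : q u x t ^ 3 = mom u x t + 1 := by
  rw [q_eq, ← Real.rpow_natCast, ← Real.rpow_mul (mom_add_one_pos hu hx ht).le]
  norm_num

lemma q_bounds : ∃ c C : ℝ, 0 < c ∧ ∀ x t, 0 ≤ x → t ∈ Icc 0 T → c ≤ q u x t ∧ q u x t ≤ C := by
  obtain ⟨c, hc, h⟩ := exists_lower_bound_mom hu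
  obtain ⟨C, hC0, hC⟩ := (rapid_mom hu).bound 0
  refine ⟨c ^ (1 / 3 : ℝ), (C + 1) ^ (1 / 3 : ℝ), Real.rpow_pos_of_pos hc _, fun x t hx ht => ?_⟩
  have h1 := h x t hx ht
  have h2 := hC x t hx ht
  rw [pow_zero, div_one] at h2
  exact ⟨Real.rpow_le_rpow hc.le h1 (by norm_num),
    Real.rpow_le_rpow (hc.le.trans h1) (show mom u x t + 1 ≤ C + 1 by linarith [le_abs_self (mom u x t)])
      (by norm_num)⟩

lemma abs_q_sub_one_le (hx : 0 ≤ x) (ht : t ∈ Icc 0 T) :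
    |q u x t - 1| ≤ |mom u x t| := by
  have h1 := q_cube hu hx ht
  have h2 := q_pos hu hx ht
  have h3 : mom u x t = (q u x t - 1) * (q u x t ^ 2 + q u x t + 1) := by linear_combination -h1
  rw [h3, abs_mul]
  have h4 : 1 ≤ |q u x t ^ 2 + q u x t + 1| := by
    rw [abs_of_pos (by positivity)]
    nlinarith
  exact le_mul_of_one_le_right (abs_nonneg _) h4

omit hu in
lemma hasDeriv_rpow_third {f : ℝ → ℝ} {f' a : ℝ} {s : Set ℝ}
    (hf : HasDerivWithinAt f f' s a) (h : 0 < f a + 1) :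
    HasDerivWithinAt (fun x => (f x + 1) ^ (1 / 3 : ℝ))
      (f' / (3 * ((f a + 1) ^ (1 / 3 : ℝ)) ^ 2)) s a := by
  refine ((hf.add_const 1).rpow_const (p := 1 / 3) (Or.inl h.ne')).congr_deriv ?_
  have h3 : (f a + 1) ^ ((1 / 3 : ℝ) - 1) * ((f a + 1) ^ (1 / 3 : ℝ)) ^ 2 = 1 := by
    rw [← Real.rpow_natCast, ← Real.rpow_mul h.le, ← Real.rpow_add h]
    norm_num
  rw [eq_div_iff (by positivity)]
  linear_combination f' * h3

lemma hasDeriv_q_x (hx : 0 ≤ x) (ht : t ∈ Icc 0 T) :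
    HasDerivWithinAt (fun s => q u s t) (pdx T (mom u) x t / (3 * q u x t ^ 2)) (Ici 0) x :=
  hasDeriv_rpow_third ((rapid_mom hu).hasDeriv_x hx ht) (mom_add_one_pos hu hx ht)

lemma hasDeriv_q_t (hx : 0 ≤ x) (ht : t ∈ Icc 0 T) :
    HasDerivWithinAt (fun s => q u x s) (pdt T (mom u) x t / (3 * q u x t ^ 2)) (Icc 0 T) t :=
  hasDeriv_rpow_third ((rapid_mom hu).hasDeriv_t hx ht) (mom_add_one_pos hu hx ht)

lemma qx_eq (hx : 0 ≤ x) (ht : t ∈ Icc 0 T) : qx u x t = pdx T (mom u) x t / (3 * q u x t ^ 2) :=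
  (hasDeriv_q_x hu hx ht).derivWithin (uniqueDiffOn_Ici 0 x hx)

/-- `q_t = -(u q)_x`. -/
lemma hasDeriv_q_t' (hx : 0 ≤ x) (ht : t ∈ Icc 0 T) :
    HasDerivWithinAt (fun s => q u x s) (-(dx u 1 x t * q u x t + u x t * qx u x t)) (Icc 0 T) t := by
  refine (hasDeriv_q_t hu hx ht).congr_deriv ?_
  have hq := q_pos hu hx ht
  rw [pdt_mom hu hx ht, qx_eq hu hx ht, ← q_cube hu hx ht]
  field_simp
  ring

end Solution

/-! ### Algebra of the spectral parameter -/

lemma fin3 {p : Fin 3 → Prop} (h0 : p 0) (h1 : p 1) (h2 : p 2) (i : Fin 3) : p i := by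
  fin_cases i <;> assumption

/-- `L₀, L₁, L₂` are the roots of `s³ - s = lm`. -/
structure IsRoots (L : ℂ³) (lm : ℂ) : Prop where
  sum : L 0 + L 1 + L 2 = 0
  pair : L 0 * L 1 + L 0 * L 2 + L 1 * L 2 = -1
  prod : L 0 * L 1 * L 2 = lm

namespace IsRoots

variable {L : ℂ³} {lm : ℂ}

lemma cubic (h : IsRoots L lm) (i : Fin 3) : L i ^ 3 - L i = lm := by
  have h1 := h.sum
  have h2 := h.pair
  have h3 := h.prod
  cases i using fin3
  · linear_combination (exp := 1) L 0 ^ 2 * h1 - L 0 * h2 + h3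
  · linear_combination (exp := 1) L 1 ^ 2 * h1 - L 1 * h2 + h3
  · linear_combination (exp := 1) L 2 ^ 2 * h1 - L 2 * h2 + h3

lemma comp (h : IsRoots L lm) {σ : Fin 3 → Fin 3} (hσ : Function.Injective σ) :
    IsRoots (fun p => L (σ p)) lm := by
  have h01 : σ 0 ≠ σ 1 := fun e => by simpa using hσ e
  have h02 : σ 0 ≠ σ 2 := fun e => by simpa using hσ e
  have h12 : σ 1 ≠ σ 2 := fun e => by simpa using hσ e
  obtain ⟨h1, h2, h3⟩ := h
  constructor <;> beta_reduce <;> generalize σ 0 = a at * <;> generalize σ 1 = b at * <;>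
    generalize σ 2 = c at * <;> cases a using fin3 <;> cases b using fin3 <;> cases c using fin3 <;>
    first | contradiction | linear_combination h1 | linear_combination h2 | linear_combination h3

lemma neg (h : IsRoots L lm) : IsRoots (fun i => -L i) (-lm) :=
  ⟨by linear_combination -h.sum, by linear_combination h.pair, by linear_combination -h.prod⟩

lemma three_sq_zero (h : IsRoots L lm) : 3 * L 0 ^ 2 - 1 = (L 0 - L 1) * (L 0 - L 2) := by
  linear_combination -h.pair + 2 * L 0 * h.sum

lemma three_sq_one (h : IsRoots L lm) : 3 * L 1 ^ 2 - 1 = (L 1 - L 0) * (L 1 - L 2) := by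
  linear_combination -h.pair + 2 * L 1 * h.sum

lemma three_sq_two (h : IsRoots L lm) : 3 * L 2 ^ 2 - 1 = (L 2 - L 0) * (L 2 - L 1) := by
  linear_combination -h.pair + 2 * L 2 * h.sum

lemma disc (h : IsRoots L lm) : ((L 0 - L 1) * (L 0 - L 2) * (L 1 - L 2)) ^ 2 = 4 - 27 * lm ^ 2 := by
  have e : L 2 = -L 0 - L 1 := by linear_combination h.sum
  have h2 := h.pair
  have h3 := h.prod
  rw [e] at h2 h3 ⊢
  rw [← h3]
  have e2 : L 1 ^ 2 = 1 - L 0 ^ 2 - L 0 * L 1 := by linear_combination -h2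
  linear_combination (exp := 1) (4 * (L 0 ^ 2 + L 0 * L 1 + L 1 ^ 2) ^ 2 +
    4 * (L 0 ^ 2 + L 0 * L 1 + L 1 ^ 2) + 4) * e2

end IsRoots

lemma om_pow_three : om ^ 3 = 1 := by
  rw [om, ← Complex.exp_nat_mul]
  have : ((3 : ℕ) : ℂ) * (2 * π * I / 3) = 2 * π * I := by
    push_cast; ring
  rw [this, Complex.exp_two_pi_mul_I]

lemma om_eq : om = ⟨-1 / 2, sqrt 3 / 2⟩ := by
  have h : (2 * π * I / 3 : ℂ) = ((2 * π / 3 : ℝ) : ℂ) * I := by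
    push_cast; ring
  have hc : cos (2 * π / 3) = -1 / 2 := by
    rw [show 2 * π / 3 = π - π / 3 by ring, Real.cos_pi_sub, Real.cos_pi_div_three]
    ring
  have hs : sin (2 * π / 3) = sqrt 3 / 2 := by
    rw [show 2 * π / 3 = π - π / 3 by ring, Real.sin_pi_sub, Real.sin_pi_div_three]
  apply Complex.ext
  · rw [om, h, Complex.exp_ofReal_mul_I_re, hc]
  · rw [om, h, Complex.exp_ofReal_mul_I_im, hs]

lemma om_sq_add : om ^ 2 + om + 1 = 0 := by
  have h3 : sqrt 3 * sqrt 3 = 3 := Real.mul_self_sqrt (by norm_num)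
  rw [om_eq, pow_two]
  apply Complex.ext <;> simp <;> nlinarith

lemma om_ne_zero : om ≠ 0 := exp_ne_zero _

lemma sqrt_three_sq : (sqrt 3 : ℂ) ^ 2 = 3 := by
  rw [← Complex.ofReal_pow, sq_sqrt (by norm_num)]; norm_num

lemma sqrt_three_ne_zero : (sqrt 3 : ℂ) ≠ 0 := by
  have := sqrt_three_sq
  intro h
  rw [h] at this
  norm_num at this

lemma rot_zero (k : ℂ) : rot 0 k = om * k := by simp [rot]

lemma rot_one (k : ℂ) : rot 1 k = om ^ 2 * k := by simp [rot]

lemma rot_two (k : ℂ) : rot 2 k = k := by simp [rot, om_pow_three]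

lemma rot_ne_zero (j : Fin 3) (hk : k ≠ 0) : rot j k ≠ 0 := mul_ne_zero (pow_ne_zero _ om_ne_zero) hk

lemma rot_neg (j : Fin 3) (k : ℂ) : rot j (-k) = -rot j k := by simp [rot]

lemma l_neg (j : Fin 3) (k : ℂ) : l j (-k) = -l j k := by
  simp only [l, rot_neg, one_div, inv_neg]; ring

lemma lam_neg (k : ℂ) : lam (-k) = -lam k := by
  have : (-k) ^ 3 = -k ^ 3 := by ring
  simp only [lam, this, one_div, inv_neg]; ring

lemma om_inv : om⁻¹ = om ^ 2 := by
  apply inv_eq_of_mul_eq_one_right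
  rw [← pow_succ', om_pow_three]

lemma isRoots_l (hk : k ≠ 0) : IsRoots (fun j => l j k) (lam k) := by
  have hs := sqrt_three_sq
  have hs0 := sqrt_three_ne_zero
  have h3 := om_pow_three
  have h2 := om_sq_add
  have e0 : l 0 k = 1 / (sqrt 3 : ℂ) * (om * k + om ^ 2 * k⁻¹) := by
    rw [l, rot_zero, one_div (om * k), mul_inv, om_inv]
  have e1 : l 1 k = 1 / (sqrt 3 : ℂ) * (om ^ 2 * k + om * k⁻¹) := by
    rw [l, rot_one, one_div (om ^ 2 * k), mul_inv, ← inv_pow, om_inv, ← pow_mul]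
    rw [show om ^ (2 * 2) = om ^ 3 * om by ring, h3, one_mul]
  have e2 : l 2 k = 1 / (sqrt 3 : ℂ) * (k + k⁻¹) := by rw [l, rot_two, one_div k]
  have hkk : k * k⁻¹ = 1 := mul_inv_cancel₀ hk
  have hsi : (1 / (sqrt 3 : ℂ)) ^ 2 = 1 / 3 := by rw [div_pow, hs]; norm_num
  have hlam : lam k = (1 / (sqrt 3 : ℂ)) ^ 3 * (k ^ 3 + k⁻¹ ^ 3) := by
    rw [lam, pow_succ (1 / (sqrt 3 : ℂ)) 2, hsi, one_div (k ^ 3), inv_pow]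
    field_simp
  refine ⟨?_, ?_, ?_⟩
  · rw [e0, e1, e2]
    linear_combination (1 / (sqrt 3 : ℂ)) * (k + k⁻¹) * h2
  · rw [e0, e1, e2]
    generalize 1 / (sqrt 3 : ℂ) = r at *
    generalize k⁻¹ = w at *
    have : r ^ 2 * ((om * k + om ^ 2 * w) * (om ^ 2 * k + om * w) + (om * k + om ^ 2 * w) * (k + w)
      + (om ^ 2 * k + om * w) * (k + w)) = r ^ 2 * (-3) := by
      congr 1
      linear_combination (exp := 1) (k ^ 2 + w ^ 2) * (h3 + h2) + k * w * (om * h3 + 3 * h2) - 3 * hkk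
    linear_combination this + -3 * hsi
  · rw [e0, e1, e2, hlam]
    generalize 1 / (sqrt 3 : ℂ) = r at *
    generalize k⁻¹ = w at *
    have : r ^ 3 * ((om * k + om ^ 2 * w) * (om ^ 2 * k + om * w) * (k + w)) =
        r ^ 3 * (k ^ 3 + w ^ 3) := by
      congr 1
      linear_combination (exp := 1) (k ^ 3 + w ^ 3 + k ^ 2 * w + k * w ^ 2 +
        om * (k ^ 2 * w + k * w ^ 2)) * h3 + (k ^ 2 * w + k * w ^ 2) * h2
    linear_combination this

lemma z_eq (j : Fin 3) (hk : k ≠ 0) : z j k = (l j k ^ 2 - 2 / 3) / lam k := by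
  have hs := sqrt_three_sq
  have hs0 := sqrt_three_ne_zero
  have hr := rot_ne_zero j hk
  have h1 : l j k ^ 2 - 2 / 3 = 1 / 3 * (rot j k ^ 2 + 1 / rot j k ^ 2) := by
    rw [l, mul_pow, div_pow, hs]
    field_simp
    ring
  rw [h1, lam, z]
  rcases eq_or_ne (k ^ 3 + 1 / k ^ 3) 0 with h | h
  · rw [h]; simp
  · field_simp

lemma lam_ne_zero (hk : NonSpecial k) : lam k ≠ 0 := by
  obtain ⟨h0, h1, -⟩ := hk
  rw [lam]
  refine mul_ne_zero (by simp) fun h => h1 ?_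
  have : k ^ 3 ≠ 0 := pow_ne_zero 3 h0
  field_simp at h
  linear_combination h

lemma lam_eq_zero (h0 : k ≠ 0) (hk : k ^ 6 = -1) : lam k = 0 := by
  have h3 : k ^ 3 ≠ 0 := pow_ne_zero 3 h0
  have : k ^ 3 + 1 / k ^ 3 = 0 := by field_simp; linear_combination hk
  rw [lam, this, mul_zero]

lemma four_sub_lam_sq (h0 : k ≠ 0) : 4 - 27 * lam k ^ 2 = -(k ^ 3 - 1 / k ^ 3) ^ 2 := by
  have h3 : k ^ 3 ≠ 0 := pow_ne_zero 3 h0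
  have hs := sqrt_three_sq
  have : lam k ^ 2 = 1 / 27 * (k ^ 3 + 1 / k ^ 3) ^ 2 := by
    rw [lam, mul_pow, div_pow, mul_pow, hs]; norm_num
  rw [this]
  field_simp
  ring

lemma disc_ne_zero (hk : NonSpecial k) : 4 - 27 * lam k ^ 2 ≠ 0 := by
  obtain ⟨h0, -, h1⟩ := hk
  have h3 : k ^ 3 ≠ 0 := pow_ne_zero 3 h0
  rw [four_sub_lam_sq h0, neg_ne_zero]
  refine pow_ne_zero 2 fun h => h1 ?_
  field_simp at h
  linear_combination h

lemma disc_eq_zero (h0 : k ≠ 0) (hk : k ^ 6 = 1) : 4 - 27 * lam k ^ 2 = 0 := by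
  have h3 : k ^ 3 ≠ 0 := pow_ne_zero 3 h0
  have : k ^ 3 - 1 / k ^ 3 = 0 := by field_simp; linear_combination hk
  rw [four_sub_lam_sq h0, this]; simp

lemma l_injective (hk : NonSpecial k) : Function.Injective fun j => l j k := by
  have hd := disc_ne_zero hk
  rw [← (isRoots_l hk.1).disc] at hd
  simp only [ne_eq, OfNat.ofNat_ne_zero, not_false_eq_true, pow_eq_zero_iff, mul_eq_zero, not_or,
    sub_eq_zero] at hd
  obtain ⟨⟨h1, h2⟩, h3⟩ := hd
  intro a b hab
  fin_cases a <;> fin_cases b <;> simp_all [eq_comm]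

namespace IsRoots

variable {L : ℂ³} {lm : ℂ}

lemma three_sq_ne_zero (h : IsRoots L lm) (hd : 4 - 27 * lm ^ 2 ≠ 0) (i : Fin 3) :
    3 * L i ^ 2 - 1 ≠ 0 := by
  rw [← h.disc] at hd
  simp only [ne_eq, OfNat.ofNat_ne_zero, not_false_eq_true, pow_eq_zero_iff, mul_eq_zero, not_or,
    sub_eq_zero] at hd
  obtain ⟨⟨h1, h2⟩, h3⟩ := hd
  cases i using fin3
  · simp only [h.three_sq_zero, ne_eq, mul_eq_zero, sub_eq_zero, not_or]
    exact ⟨h1, h2⟩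
  · simp only [h.three_sq_one, ne_eq, mul_eq_zero, sub_eq_zero, not_or]
    exact ⟨fun e => h1 e.symm, h3⟩
  · simp only [h.three_sq_two, ne_eq, mul_eq_zero, sub_eq_zero, not_or]
    exact ⟨fun e => h2 e.symm, fun e => h3 e.symm⟩

end IsRoots

/-- The right eigenvector `(1, s, s²)` of the companion matrix. -/
def pvec (s : ℂ) : ℂ³ := ![1, s, s ^ 2]

/-- The pairing of a vector with the left eigenvector `(s² - 1, s, 1)` of the companion matrix. -/
def lev (s : ℂ) (w : ℂ³) : ℂ := (s ^ 2 - 1) * w 0 + s * w 1 + w 2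

/-- The coordinate of `w` along the eigenvector `pvec s`. -/
def coord (s : ℂ) (w : ℂ³) : ℂ := lev s w / χ[s]

lemma lev_add (s : ℂ) (v w : ℂ³) : lev s (v + w) = lev s v + lev s w := by
  simp only [lev, Pi.add_apply]; ring

lemma lev_smul (s c : ℂ) (v : ℂ³) : lev s (c • v) = c * lev s v := by
  simp only [lev, Pi.smul_apply, smul_eq_mul]; ring

lemma coord_add (s : ℂ) (v w : ℂ³) : coord s (v + w) = coord s v + coord s w := by
  simp only [coord, lev_add]; ring

lemma coord_smul (s c : ℂ) (v : ℂ³) : coord s (c • v) = c * coord s v := by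
  simp only [coord, lev_smul]; ring

namespace IsRoots

variable {L : ℂ³} {lm : ℂ}

lemma lev_pvec (h : IsRoots L lm) (i j : Fin 3) :
    lev (L i) (pvec (L j)) = if i = j then 3 * L i ^ 2 - 1 else 0 := by
  have h1 := h.sum
  have h2 := h.pair
  fin_cases i <;> fin_cases j <;> simp [lev, pvec]
  · ring
  · linear_combination (L 0 + L 1) * h1 - h2
  · linear_combination (L 0 + L 2) * h1 - h2
  · linear_combination (L 0 + L 1) * h1 - h2
  · ring
  · linear_combination (L 1 + L 2) * h1 - h2
  · linear_combination (L 0 + L 2) * h1 - h2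
  · linear_combination (L 1 + L 2) * h1 - h2
  · ring

lemma coord_pvec (h : IsRoots L lm) (hd : 4 - 27 * lm ^ 2 ≠ 0) (i j : Fin 3) :
    coord (L i) (pvec (L j)) = if i = j then 1 else 0 := by
  rw [coord, h.lev_pvec]
  split_ifs
  · exact div_self (h.three_sq_ne_zero hd i)
  · simp

lemma sum_coord (h : IsRoots L lm) (hd : 4 - 27 * lm ^ 2 ≠ 0) (w : ℂ³) :
    ∑ i, coord (L i) w • pvec (L i) = w := by
  have p0 := h.three_sq_ne_zero hd 0
  have p1 := h.three_sq_ne_zero hd 1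
  have p2 := h.three_sq_ne_zero hd 2
  rw [h.three_sq_zero] at p0
  rw [h.three_sq_one] at p1
  rw [h.three_sq_two] at p2
  have a01 : L 0 - L 1 ≠ 0 := left_ne_zero_of_mul p0
  have a02 : L 0 - L 2 ≠ 0 := right_ne_zero_of_mul p0
  have a12 : L 1 - L 2 ≠ 0 := right_ne_zero_of_mul p1
  have e1 : L 1 - L 0 = -(L 0 - L 1) := by ring
  have e2 : L 2 - L 0 = -(L 0 - L 2) := by ring
  have e3 : L 2 - L 1 = -(L 1 - L 2) := by ring
  have key : ∀ x0 x1 x2 a b c : ℂ, a ≠ 0 → b ≠ 0 → c ≠ 0 →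
      x0 / (a * b) + x1 / (-a * c) + x2 / (-b * -c) = (x0 * c - x1 * b + x2 * a) / (a * b * c) := by
    intro x0 x1 x2 a b c ha hb hc
    field_simp
    ring
  rw [sum_univ_three]
  simp only [coord]
  rw [h.three_sq_zero, h.three_sq_one, h.three_sq_two, e1, e2, e3]
  funext i
  have hv := mul_ne_zero (mul_ne_zero a01 a02) a12
  simp only [Pi.add_apply, Pi.smul_apply, smul_eq_mul, div_mul_eq_mul_div]
  rw [key _ _ _ _ _ _ a01 a02 a12, div_eq_iff hv]
  have hs := h.sum
  have hp := h.pair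
  cases i using fin3 <;> simp [pvec, lev]
  · ring
  · linear_combination w 0 * ((L 0 - L 1) * (L 0 - L 2) * (L 1 - L 2)) * hs
  · linear_combination w 0 * ((L 0 - L 1) * (L 0 - L 2) * (L 1 - L 2)) *
      ((L 0 + L 1 + L 2) * hs - hp) + w 1 * ((L 0 - L 1) * (L 0 - L 2) * (L 1 - L 2)) * hs

end IsRoots

lemma P_mulVec (k : ℂ) (w : ℂ³) : P k *ᵥ w = ∑ i, w i • pvec (l i k) := by
  funext i
  cases i using fin3 <;> simp [P, pvec, mulVec, dotProduct, sum_univ_three] <;> ring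

lemma P_inv_mulVec (hk : NonSpecial k) (w : ℂ³) : (P k)⁻¹ *ᵥ w = fun i => coord (l i k) w := by
  have hr := isRoots_l hk.1
  have hd := disc_ne_zero hk
  have h1 : (Matrix.of fun i j => coord (l i k) (Pi.single j 1)) * P k = 1 := by
    ext i j
    have h2 : coord (l i k) (pvec (l j k)) = if i = j then 1 else 0 := hr.coord_pvec hd i j
    rw [one_apply, ← h2]
    cases j using fin3 <;>
    simp [P, mul_apply, sum_univ_three, coord, lev, pvec] <;> ring
  rw [Matrix.inv_eq_left_inv h1]
  funext i
  simp [mulVec, dotProduct, sum_univ_three, coord, lev]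
  ring

lemma isUnit_det_P (hk : NonSpecial k) : IsUnit (P k).det := by
  have hd := disc_ne_zero hk
  rw [← (isRoots_l hk.1).disc] at hd
  rw [isUnit_iff_ne_zero]
  have : (P k).det = -((l 0 k - l 1 k) * (l 0 k - l 2 k) * (l 1 k - l 2 k)) := by
    simp [P, det_fin_three]; ring
  rw [this]
  exact neg_ne_zero.2 fun h => hd (by rw [h]; simp)

lemma P_mulVec_coord (hk : NonSpecial k) (w : ℂ³) : P k *ᵥ (fun i => coord (l i k) w) = w := by
  rw [← P_inv_mulVec hk, mulVec_mulVec, mul_nonsing_inv _ (isUnit_det_P hk), one_mulVec]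

lemma coord_P_mulVec (hk : NonSpecial k) (v : ℂ³) (i : Fin 3) : coord (l i k) (P k *ᵥ v) = v i := by
  have : (P k)⁻¹ *ᵥ (P k *ᵥ v) = v := by
    rw [mulVec_mulVec, nonsing_inv_mul _ (isUnit_det_P hk), one_mulVec]
  rw [P_inv_mulVec hk] at this
  exact congrFun this i

lemma conj_apply (hk : NonSpecial k) (N Φ : Mat3) (i j : Fin 3) :
    ((P k)⁻¹ * N * P k * Φ) i j = coord (l i k) (N *ᵥ (P k *ᵥ fun r => Φ r j)) := by
  have : ((P k)⁻¹ * N * P k * Φ) i j = ((P k)⁻¹ *ᵥ (N *ᵥ (P k *ᵥ fun r => Φ r j))) i := by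
    simp only [mulVec_mulVec, ← Matrix.mul_assoc]
    rfl
  rw [this, P_inv_mulVec hk]

/-! ### Linear systems of size three -/

lemma le_sum_three {c : Fin 3 → ℝ} (h : ∀ i, 0 ≤ c i) (i : Fin 3) : c i ≤ ∑ i, c i :=
  single_le_sum (fun i _ => h i) (Finset.mem_univ i)

lemma le_sum_sum {c : Fin 3 → Fin 3 → ℝ} (h : ∀ i j, 0 ≤ c i j) (i j : Fin 3) :
    c i j ≤ ∑ i, ∑ j, c i j :=
  (le_sum_three (h i) j).trans (le_sum_three (fun i => sum_nonneg fun j _ => h i j) i)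

lemma norm_mulVec_le {M : Mat3} {c : ℝ} (hM : ∀ i j, ‖M i j‖ ≤ c) (v : ℂ³) : ‖M *ᵥ v‖ ≤ 3 * c * ‖v‖ := by
  have hc : 0 ≤ c := (norm_nonneg _).trans (hM 0 0)
  refine (pi_norm_le_iff_of_nonneg (by positivity)).2 fun i => ?_
  calc ‖(M *ᵥ v) i‖ ≤ ∑ j, ‖M i j * v j‖ := by
        rw [mulVec, dotProduct]; exact norm_sum_le _ _
    _ ≤ ∑ _j : Fin 3, c * ‖v‖ := by
        refine sum_le_sum fun j _ => ?_
        rw [norm_mul]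
        exact mul_le_mul (hM i j) (norm_le_pi_norm v j) (norm_nonneg _) hc
    _ = 3 * c * ‖v‖ := by simp; ring

lemma exists_matrix_ode {M : ℝ → Mat3} (hM : ∀ i j, Continuous fun s => M s i j)
    {g g' : ℝ → ℂ³} (hg : ∀ s, HasDerivAt g (g' s) s) :
    ∃ v : ℝ → ℂ³, v 0 = g 0 ∧ ∀ s, HasDerivAt v (M s *ᵥ v s + g' s) s := by
  let φ : Mat3 →ₗ[ℝ] (ℂ³) →L[ℝ] (ℂ³) :=
    { toFun := fun A => LinearMap.toContinuousLinearMap (A.mulVecLin.restrictScalars ℝ)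
      map_add' := fun A B => by ext1 v; exact add_mulVec A B v
      map_smul' := fun c A => by ext1 v; exact smul_mulVec c A v }
  exact exists_linear_ode (M := fun s => φ (M s))
    (φ.continuous_of_finiteDimensional.comp (continuous_matrix hM)) hg

/-- The fundamental matrix of `v' = M v`, normalized at `0`. -/
def fund (M : ℝ → Mat3) (s : ℝ) : Mat3 :=
  open Classical in
  if hM : ∀ i j, Continuous fun s => M s i j then
    Matrix.of fun i j => (exists_matrix_ode hM fun s => hasDerivAt_const s (Pi.single j 1)).choose s i
  else 1

section

variable {M : ℝ → Mat3} (hM : ∀ i j, Continuous fun s => M s i j)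

include hM

lemma fund_zero : fund M 0 = 1 := by
  ext i j
  simp only [fund, hM, implies_true, dif_pos, of_apply]
  rw [(exists_matrix_ode hM fun s => hasDerivAt_const s (Pi.single j 1)).choose_spec.1]
  simp [one_apply, Pi.single_apply]

lemma hasDerivAt_fund_mulVec (c : ℂ³) (s : ℝ) :
    HasDerivAt (fun s => fund M s *ᵥ c) (M s *ᵥ (fund M s *ᵥ c)) s := by
  have e : ∀ s, fund M s *ᵥ c = ∑ j, c j •
      (exists_matrix_ode hM fun s => hasDerivAt_const s (Pi.single j 1)).choose s := fun s => by
    funext i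
    simp [fund, hM, mulVec, dotProduct, sum_univ_three, mul_comm]
  simp only [e, Matrix.mulVec_sum, mulVec_smul]
  exact HasDerivAt.fun_sum fun j _ => (((exists_matrix_ode hM fun s => hasDerivAt_const s
    (Pi.single j 1)).choose_spec.2 s).const_smul (c j)).congr_deriv (by rw [add_zero])

omit hM in
lemma exists_entry_bound {X : ℝ} (hM : ∀ i j, ContinuousOn (fun s => M s i j) (Icc 0 X)) :
    ∃ c, 0 ≤ c ∧ ∀ x ∈ Icc 0 X, ∀ i j, ‖M x i j‖ ≤ c := by
  choose c hc using fun i j => isCompact_Icc.exists_bound_of_continuousOn (hM i j)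
  exact ⟨∑ i, ∑ j, |c i j|, by positivity, fun x hx i j => (hc i j x hx).trans
    ((le_abs_self _).trans (le_sum_sum (fun _ _ => abs_nonneg _) i j))⟩

lemma eq_fund_mulVec {w : ℝ → ℂ³} {X : ℝ}
    (hw : ∀ x ∈ Icc 0 X, HasDerivWithinAt w (M x *ᵥ w x) (Icc 0 X) x) (hx : x ∈ Icc 0 X) :
    w x = fund M x *ᵥ w 0 := by
  obtain ⟨c, hc0, hc⟩ := exists_entry_bound fun i j => (hM i j).continuousOn (s := Icc 0 X)
  have h := norm_le_of_norm_deriv_le (v := fun x => w x - fund M x *ᵥ w 0)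
    (v' := fun x => M x *ᵥ w x - M x *ᵥ (fund M x *ᵥ w 0)) (K := 3 * c) (ε := 0) (X := X)
    (by positivity) le_rfl
    (fun x hx => (hw x hx).sub (hasDerivAt_fund_mulVec hM (w 0) x).hasDerivWithinAt)
    (fun x hx => by
      rw [← mulVec_sub, add_zero]
      exact norm_mulVec_le (hc x hx) _) x hx
  rw [fund_zero hM, one_mulVec, sub_self, norm_zero, add_zero, zero_mul] at h
  exact sub_eq_zero.1 (norm_le_zero_iff.1 h)

lemma hasDerivAt_fund_apply (i j : Fin 3) (s : ℝ) :
    HasDerivAt (fun s => fund M s i j) ((M s * fund M s) i j) s := by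
  have h := (hasDerivAt_pi.1 (hasDerivAt_fund_mulVec hM (Pi.single j 1) s)) i
  have e : ∀ N : Mat3, (N *ᵥ Pi.single j 1) i = N i j := fun N => by simp
  rw [mulVec_mulVec, e] at h
  simpa only [e] using h

lemma det_fund (htr : ∀ s, M s 0 0 + M s 1 1 + M s 2 2 = 0) (s : ℝ) : (fund M s).det = 1 := by
  have hd : ∀ s, HasDerivAt (fun s => (fund M s).det) 0 s := by
    intro s
    have e := fun i j => hasDerivAt_fund_apply hM i j s
    simp only [det_fin_three]
    have h := ((((((e 0 0).mul (e 1 1)).mul (e 2 2)).sub (((e 0 0).mul (e 1 2)).mul (e 2 1))).sub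
      (((e 0 1).mul (e 1 0)).mul (e 2 2))).add (((e 0 1).mul (e 1 2)).mul (e 2 0))).add
      (((e 0 2).mul (e 1 0)).mul (e 2 1)) |>.sub (((e 0 2).mul (e 1 1)).mul (e 2 0))
    refine h.congr_deriv ?_
    have h3 : (M s 0 0 + M s 1 1 + M s 2 2) * (fund M s).det = 0 := by rw [htr]; simp
    rw [det_fin_three] at h3
    simp only [mul_apply, sum_univ_three, Pi.mul_apply]
    rw [← h3]
    ring
  rw [is_const_of_deriv_eq_zero (fun s => (hd s).differentiableAt) (fun s => (hd s).deriv) s 0,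
    fund_zero hM, Matrix.det_one]

end

lemma hasDeriv_ode_param {𝕜 : Type*} [NontriviallyNormedField 𝕜] [NormedAlgebra 𝕜 ℂ]
    [SMulCommClass ℝ 𝕜 ℂ] {X K : ℝ} (hX : 0 ≤ X) (hK : 0 ≤ K) {s : Set 𝕜} {p₀ : 𝕜} (hp₀ : p₀ ∈ s)
    {U : 𝕜 → ℝ → Mat3} {U' : ℝ → Mat3} {ψ : 𝕜 → ℝ → ℂ³} {χ : ℝ → ℂ³}
    (hU : ∀ i j, ContinuousOn (fun x => U p₀ x i j) (Icc 0 X))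
    (hU' : ∀ i j, ContinuousOn (fun x => U' x i j) (Icc 0 X))
    (hψ : ∀ p ∈ s, ∀ x ∈ Icc 0 X, HasDerivWithinAt (ψ p) (U p x *ᵥ ψ p x) (Icc 0 X) x)
    (hχ : ∀ x ∈ Icc 0 X, HasDerivWithinAt χ (U p₀ x *ᵥ χ x + U' x *ᵥ ψ p₀ x) (Icc 0 X) x)
    (hrem : ∀ᶠ p in 𝓝[s] p₀, ∀ x ∈ Icc 0 X, ∀ i j,
      ‖U p x i j - U p₀ x i j - (p - p₀) • U' x i j‖ ≤ K * ‖p - p₀‖ ^ 2)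
    (h0 : HasDerivWithinAt (fun p => ψ p 0) (χ 0) s p₀) :
    HasDerivWithinAt (fun p => ψ p X) (χ X) s p₀ := by
  obtain ⟨c, hc0, hc⟩ := exists_entry_bound hU
  obtain ⟨d, hd0, hd⟩ := exists_entry_bound hU'
  obtain ⟨B, hB⟩ := isCompact_Icc.exists_bound_of_continuousOn fun x hx =>
    (hψ p₀ hp₀ x hx).continuousWithinAt.prodMk (hχ x hx).continuousWithinAt
  simp only [norm_prod_le_iff] at hB
  have hB0 : 0 ≤ B := (norm_nonneg _).trans (hB 0 ⟨le_rfl, hX⟩).1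
  rw [hasDerivWithinAt_iff_isLittleO] at h0 ⊢
  refine (Asymptotics.IsBigO.of_bound (Real.exp ((3 * (K + d + c) + 1) * X)) ?_).trans_isLittleO
    (h0.norm_left.add (((Asymptotics.isLittleO_pow_sub_sub p₀ one_lt_two).mono
      nhdsWithin_le_nhds).const_mul_left (3 * (2 * K + d) * B)))
  filter_upwards [hrem, self_mem_nhdsWithin,
    mem_nhdsWithin_of_mem_nhds (Metric.closedBall_mem_nhds p₀ one_pos)] with p hp hps h1
  rw [Metric.mem_closedBall, dist_eq_norm] at h1
  set h := ‖p - p₀‖ with hh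
  have h0 : 0 ≤ h := norm_nonneg _
  have h2 : h ^ 2 ≤ h := by nlinarith
  have hr : ∀ y ∈ Icc 0 X, ∀ i j, ‖(U p y - U p₀ y) i j‖ ≤ (K + d) * h := fun y hy i j => by
    have h3 := norm_add_le (U p y i j - U p₀ y i j - (p - p₀) • U' y i j) ((p - p₀) • U' y i j)
    rw [sub_add_cancel, norm_smul] at h3
    have := mul_le_mul_of_nonneg_left h2 hK
    have := mul_le_mul_of_nonneg_left (hd y hy i j) h0
    exact h3.trans (by linarith [hp y hy i j])
  rw [norm_of_nonneg (by positivity), mul_comm]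
  refine norm_le_of_norm_deriv_le (v := fun y => ψ p y - ψ p₀ y - (p - p₀) • χ y) (by positivity)
    (by positivity) (fun y hy => ((hψ p hps y hy).sub (hψ p₀ hp₀ y hy)).sub
      ((hχ y hy).const_smul (p - p₀))) (fun y hy => ?_) X ⟨hX, le_rfl⟩
  set e := ψ p y - ψ p₀ y - (p - p₀) • χ y with he
  have h7 : U p y *ᵥ ψ p y - U p₀ y *ᵥ ψ p₀ y - (p - p₀) • (U p₀ y *ᵥ χ y + U' y *ᵥ ψ p₀ y) =
      (U p y - U p₀ y) *ᵥ e + U p₀ y *ᵥ e + (U p y - U p₀ y - (p - p₀) • U' y) *ᵥ ψ p₀ y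
        + (p - p₀) • ((U p y - U p₀ y) *ᵥ χ y) := by
    simp only [he, mulVec_sub, Matrix.sub_mulVec, mulVec_smul, smul_mulVec, smul_add, smul_sub]
    abel
  rw [h7]
  refine ((norm_add_le _ _).trans (add_le_add_left norm_add₃_le _)).trans ?_
  rw [norm_smul]
  have h8 := norm_mulVec_le (hr y hy) e
  have h9 := mul_le_mul_of_nonneg_left h1 (by positivity : 0 ≤ (K + d) * ‖e‖)
  have h10 := mul_le_mul_of_nonneg_left ((norm_mulVec_le (hr y hy) (χ y)).trans
    (mul_le_mul_of_nonneg_left (hB y hy).2 (by positivity))) h0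
  have h11 := (norm_mulVec_le (M := U p y - U p₀ y - (p - p₀) • U' y) (hp y hy) (ψ p₀ y)).trans
    (mul_le_mul_of_nonneg_left (hB y hy).1 (by positivity))
  linarith [norm_mulVec_le (hc y hy) e]

lemma exists_taylor_bound {φ : ℂ → ℂ} {p₀ : ℂ} (hφ : AnalyticAt ℂ φ p₀) : ∃ K, 0 ≤ K ∧
    ∀ᶠ p in 𝓝 p₀, ‖φ p - φ p₀ - (p - p₀) * deriv φ p₀‖ ≤ K * ‖p - p₀‖ ^ 2 := by
  obtain ⟨f, hf⟩ := hφ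
  obtain ⟨K, hK, hb⟩ := (hf.isBigO_sub_partialSum_pow 2).exists_nonneg
  refine ⟨K, hK, ?_⟩
  have ht : Tendsto (fun p => p - p₀) (𝓝 p₀) (𝓝 0) := by
    simpa using (continuous_sub_right p₀).tendsto p₀
  filter_upwards [ht.eventually hb.bound] with p hp
  rw [norm_pow, norm_norm] at hp
  refine le_trans (le_of_eq ?_) hp
  have e0 : f 0 (fun _ => p - p₀) = φ p₀ := by rw [← hf.coeff_zero (fun _ => 0)]; congr!
  rw [FormalMultilinearSeries.partialSum, Finset.sum_range_succ, Finset.sum_range_one, e0,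
    hf.hasDerivAt.deriv, add_sub_cancel, sub_sub]
  congr 3
  simp

lemma diffAt_fund_param {ι : Type*} [Fintype ι] {M : ℂ → ℝ → Mat3} {A : ℝ → Mat3}
    {B : ι → ℝ → Mat3} {φ : ι → ℂ → ℂ} {p₀ : ℂ} {X : ℝ} (hX : 0 ≤ X)
    (hM : ∀ p s, M p s = A s + ∑ r, φ r p • B r s) (hA : ∀ i j, Continuous fun s => A s i j)
    (hB : ∀ r i j, Continuous fun s => B r s i j) (hφ : ∀ r, AnalyticAt ℂ (φ r) p₀) (c : ℂ³) :
    DifferentiableAt ℂ (fun p => fund (M p) X *ᵥ c) p₀ := by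
  have happ : ∀ p s i j, M p s i j = A s i j + ∑ r, φ r p * B r s i j := fun p s i j => by
    simp [hM, Matrix.sum_apply]
  have hMc : ∀ p i j, Continuous fun s => M p s i j := fun p i j => by
    simp only [happ]
    exact (hA i j).add (continuous_finsetSum _ fun r _ => (hB r i j).const_mul _)
  have hψ := fun p => hasDerivAt_fund_mulVec (hMc p) c
  set M' : ℝ → Mat3 := fun s => ∑ r, deriv (φ r) p₀ • B r s with hM'
  have happ' : ∀ s i j, M' s i j = ∑ r, deriv (φ r) p₀ * B r s i j := fun s i j => by
    simp [hM', Matrix.sum_apply]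
  have hM'c : ∀ i j, Continuous fun s => M' s i j := fun i j => by
    simp only [happ']
    exact continuous_finsetSum _ fun r _ => (hB r i j).const_mul _
  have hf : Continuous fun s => M' s *ᵥ (fund (M p₀) s *ᵥ c) := (continuous_matrix hM'c).matrix_mulVec
      (continuous_iff_continuousAt.2 fun s => (hψ p₀ s).continuousAt)
  obtain ⟨χ, hχ0, hχ⟩ := exists_matrix_ode (hMc p₀) fun s =>
    intervalIntegral.integral_hasDerivAt_right (hf.intervalIntegrable 0 s)
      (hf.stronglyMeasurableAtFilter _ _) hf.continuousAt
  choose K hK hb using fun r => exists_taylor_bound (hφ r)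
  choose b hb0 hbB using fun r => exists_entry_bound fun i j => (hB r i j).continuousOn (s := Icc 0 X)
  refine (hasDerivWithinAt_univ.1 (hasDeriv_ode_param (𝕜 := ℂ) (K := ∑ r, K r * b r)
    (U' := M') hX (sum_nonneg fun r _ => mul_nonneg (hK r) (hb0 r)) (mem_univ p₀)
    (fun i j => (hMc p₀ i j).continuousOn) (fun i j => (hM'c i j).continuousOn)
    (fun p _ x _ => (hψ p x).hasDerivWithinAt) (fun x _ => (hχ x).hasDerivWithinAt) ?_ ?_)
    ).differentiableAt
  · rw [nhdsWithin_univ]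
    filter_upwards [eventually_all.2 hb] with p hp s hs i j
    rw [happ, happ, happ', add_sub_add_left_eq_sub, ← sum_sub_distrib, smul_eq_mul,
      mul_sum, ← sum_sub_distrib, sum_mul]
    refine norm_sum_le_of_le _ fun r _ => ?_
    have := mul_le_mul (hp r) (hbB r s hs i j) (norm_nonneg _) (by have := hK r; positivity)
    rw [← norm_mul] at this
    exact (congrArg norm (by ring)).trans_le (this.trans (le_of_eq (by ring)))
  · simp only [fund_zero (hMc _), one_mulVec, hχ0, intervalIntegral.integral_same]
    exact hasDerivWithinAt_const _ _ _

/-! ### The Lax pair in companion form -/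

/-- The matrix of the `x`-part of the Lax pair. -/
def Umat (u : 𝓕) (lm : ℂ) (x t : ℝ) : Mat3 :=
  !![0, 1, 0; 0, 0, 1; lm * ((mom u x t : ℂ) + 1), 1, 0]

/-- The matrix of the `t`-part of the Lax pair. -/
def Wmat (u : 𝓕) (lm : ℂ) (x t : ℝ) : Mat3 :=
  !![-(2 / (3 * lm)) + (dx u 1 x t : ℂ), -(u x t : ℂ), 1 / lm;
    1 + (u x t : ℂ), 1 / (3 * lm), -(u x t : ℂ);
    (dx u 1 x t : ℂ) - lm * u x t * ((mom u x t : ℂ) + 1), 1, 1 / (3 * lm) - (dx u 1 x t : ℂ)]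

/-- The `x`-propagator at time `t`. -/
def propX (u : 𝓕) (t : ℝ) (lm : ℂ) (x : ℝ) : Mat3 :=
  fund (fun x => Umat u lm (max x 0) t) x

/-- The `t`-propagator at `x = 0`. -/
def propT (u : 𝓕) (T : ℝ) (lm : ℂ) (t : ℝ) : Mat3 :=
  fund (fun t => Wmat u lm 0 (max 0 (min t T))) t

/-- The solution of the Lax pair which is the identity at `(0, 0)`. -/
def Psi (u : 𝓕) (T : ℝ) (lm : ℂ) (x t : ℝ) : Mat3 := propX u t lm x * propT u T lm t

section

lemma RapidDecay.continuous_clamp_x {f : 𝓕} (hf : RapidDecay T f) (ht : t ∈ Icc 0 T) : Continuous fun x => f (max x 0) t :=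
  (hf.contOn_x ht).comp_continuous (by fun_prop) fun x => le_max_right x 0

lemma clamp_mem (t : ℝ) : max 0 (min t T) ∈ Icc 0 T :=
  ⟨le_max_left _ _, max_le hT.out.le (min_le_right _ _)⟩

lemma RapidDecay.continuous_clamp_t {f : 𝓕} (hf : RapidDecay T f) (hx : 0 ≤ x) : Continuous fun t => f x (max 0 (min t T)) :=
  (hf.contOn_t hx).comp_continuous (by fun_prop) clamp_mem

lemma clamp_eq (ht : t ∈ Icc 0 T) : max 0 (min t T) = t := by
  rw [min_eq_left ht.2, max_eq_right ht.1]

include hu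

lemma continuous_Umat (lm : ℂ) (ht : t ∈ Icc 0 T) (i j : Fin 3) :
    Continuous fun x => Umat u lm (max x 0) t i j := by
  have h := (rapid_mom hu).continuous_clamp_x ht
  fin_cases i <;> fin_cases j <;> simp [Umat] <;> fun_prop

lemma continuous_Wmat (lm : ℂ) (i j : Fin 3) :
    Continuous fun t => Wmat u lm 0 (max 0 (min t T)) i j := by
  have h := (rapid_mom hu).continuous_clamp_t le_rfl
  have h0 := hu.rapidDecay.continuous_clamp_t le_rfl
  have h1 := (rapid_dx hu 1).1.continuous_clamp_t le_rfl
  have h0c := continuous_ofReal.comp h0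
  fin_cases i <;> fin_cases j <;> simp [Wmat] <;> fun_prop

lemma propX_zero (lm : ℂ) (ht : t ∈ Icc 0 T) : propX u t lm 0 = 1 := fund_zero (continuous_Umat hu lm ht)

lemma propT_zero (lm : ℂ) : propT u T lm 0 = 1 := fund_zero (continuous_Wmat hu lm)

lemma det_propX (lm : ℂ) (ht : t ∈ Icc 0 T) (x : ℝ) : (propX u t lm x).det = 1 :=
  det_fund (continuous_Umat hu lm ht) (fun s => by simp [Umat]) x

lemma det_propT (lm : ℂ) (t : ℝ) : (propT u T lm t).det = 1 := by
  refine det_fund (continuous_Wmat hu lm) (fun s => ?_) t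
  rcases eq_or_ne lm 0 with rfl | h
  · simp [Wmat]
  · simp [Wmat]; field_simp; ring

lemma det_Psi (lm : ℂ) (ht : t ∈ Icc 0 T) (x : ℝ) : (Psi u T lm x t).det = 1 := by
  rw [Psi, det_mul, det_propX hu lm ht, det_propT hu, one_mul]

lemma Psi_zero_zero (lm : ℂ) : Psi u T lm 0 0 = 1 := by
  rw [Psi, propX_zero hu lm ⟨le_rfl, hT.out.le⟩, propT_zero hu, one_mul]

lemma Psi_zero_x (lm : ℂ) (ht : t ∈ Icc 0 T) : Psi u T lm 0 t = propT u T lm t := by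
  rw [Psi, propX_zero hu lm ht, one_mul]

lemma Psi_zero_t (lm : ℂ) (x : ℝ) : Psi u T lm x 0 = propX u 0 lm x := by
  rw [Psi, propT_zero hu, mul_one]

lemma hasDeriv_propX (lm : ℂ) (hx : 0 ≤ x) (ht : t ∈ Icc 0 T)
    (c : ℂ³) : HasDerivWithinAt (fun x => propX u t lm x *ᵥ c)
      (Umat u lm x t *ᵥ (propX u t lm x *ᵥ c)) (Ici 0) x := by
  have h := (hasDerivAt_fund_mulVec (continuous_Umat hu lm ht) c x).hasDerivWithinAt (s := Ici 0)
  rwa [max_eq_left hx] at h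

lemma hasDeriv_propT (lm : ℂ) (ht : t ∈ Icc 0 T)
    (c : ℂ³) : HasDerivWithinAt (fun t => propT u T lm t *ᵥ c)
      (Wmat u lm 0 t *ᵥ (propT u T lm t *ᵥ c)) (Icc 0 T) t := by
  have h := (hasDerivAt_fund_mulVec (continuous_Wmat hu lm) c t).hasDerivWithinAt (s := Icc 0 T)
  rwa [clamp_eq ht] at h

lemma eq_propX_mulVec {lm : ℂ} {X t : ℝ} (ht : t ∈ Icc 0 T) {w : ℝ → ℂ³}
    (hw : ∀ x ∈ Icc 0 X, HasDerivWithinAt w (Umat u lm x t *ᵥ w x) (Icc 0 X) x)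
    (hx : x ∈ Icc 0 X) : w x = propX u t lm x *ᵥ w 0 :=
  eq_fund_mulVec (continuous_Umat hu lm ht) (fun x hx => by rw [max_eq_left hx.1]; exact hw x hx) hx

lemma eq_propT_mulVec {lm : ℂ} {X : ℝ} (hX : X ≤ T) {w : ℝ → ℂ³}
    (hw : ∀ t ∈ Icc 0 X, HasDerivWithinAt w (Wmat u lm 0 t *ᵥ w t) (Icc 0 X) t)
    (ht : t ∈ Icc 0 X) : w t = propT u T lm t *ᵥ w 0 :=
  eq_fund_mulVec (continuous_Wmat hu lm)
    (fun x hx => by rw [clamp_eq ⟨hx.1, hx.2.trans hX⟩]; exact hw x hx) ht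

lemma hasDeriv_Psi_x (lm : ℂ) (hx : 0 ≤ x) (ht : t ∈ Icc 0 T)
    (c : ℂ³) : HasDerivWithinAt (fun x => Psi u T lm x t *ᵥ c)
      (Umat u lm x t *ᵥ (Psi u T lm x t *ᵥ c)) (Ici 0) x := by
  simp only [Psi, ← mulVec_mulVec]
  exact hasDeriv_propX hu lm hx ht _

lemma eq_Psi_mulVec {lm : ℂ} (hx : 0 ≤ x) (ht : t ∈ Icc 0 T) {w : ℝ → ℝ → ℂ³}
    (hwx : ∀ x' ∈ Icc 0 x, HasDerivWithinAt (fun s => w s t) (Umat u lm x' t *ᵥ w x' t) (Icc 0 x) x')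
    (hwt : ∀ t' ∈ Icc 0 t, HasDerivWithinAt (w 0) (Wmat u lm 0 t' *ᵥ w 0 t') (Icc 0 t) t') :
    w x t = Psi u T lm x t *ᵥ w 0 0 := by
  rw [Psi, ← mulVec_mulVec, ← eq_propT_mulVec hu ht.2 hwt ⟨ht.1, le_rfl⟩]
  exact eq_propX_mulVec hu ht hwx ⟨hx, le_rfl⟩

omit hu in
lemma exists_taylor_t {f : 𝓕} (hf : RapidDecay T f) : ∃ K, 0 ≤ K ∧
    ∀ x t t₀, 0 ≤ x → t ∈ Icc 0 T → t₀ ∈ Icc 0 T →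
      |f x t - f x t₀ - (t - t₀) * pdt T f x t₀| ≤ K * |t - t₀| ^ 2 := by
  obtain ⟨K, hK, hb⟩ := (((hf.pdt).pdt)).bound 0
  simp only [pow_zero, div_one] at hb
  refine ⟨K, hK, fun x t t₀ hx ht ht₀ => ?_⟩
  have hsub : uIcc t₀ t ⊆ Icc 0 T := uIcc_subset_Icc ht₀ ht
  have := (convex_uIcc t₀ t).norm_image_sub_le_of_norm_hasDerivWithin_le
    (f := fun s => f x s - s * pdt T f x t₀) (f' := fun s => pdt T f x s - 1 * pdt T f x t₀)
    (C := K * |t - t₀|) (fun s hs => ((hf.hasDeriv_t hx (hsub hs)).mono hsub).sub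
      ((hasDerivWithinAt_id s _).mul_const _))
    (fun s hs => by
      rw [one_mul]
      refine ((convex_uIcc t₀ t).norm_image_sub_le_of_norm_hasDerivWithin_le
        (fun s hs => ((hf.pdt).hasDeriv_t hx (hsub hs)).mono hsub)
        (fun s hs => hb x s hx (hsub hs)) left_mem_uIcc hs).trans ?_
      gcongr
      exact abs_sub_left_of_mem_uIcc hs) left_mem_uIcc right_mem_uIcc
  rw [sq, ← mul_assoc]
  exact (congrArg norm (by ring)).trans_le this

lemma hasDeriv_Psi_t {lm : ℂ} (hlm : lm ≠ 0) (hx : 0 ≤ x) (ht : t ∈ Icc 0 T)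
    (c : ℂ³) : HasDerivWithinAt (fun t => Psi u T lm x t *ᵥ c)
      (Wmat u lm x t *ᵥ (Psi u T lm x t *ᵥ c)) (Icc 0 T) t := by
  have hm := rapid_mom hu
  obtain ⟨K, hK, htay⟩ := exists_taylor_t hm
  have hsub : Icc 0 x ⊆ Ici 0 := Icc_subset_Ici_self
  have hcm := continuous_ofReal.comp_continuousOn ((hm.contOn_x ht).mono hsub)
  have hcd := continuous_ofReal.comp_continuousOn (((hm.pdt).contOn_x ht).mono hsub)
  refine hasDeriv_ode_param (𝕜 := ℝ) (K := ‖lm‖ * K) hx (by positivity) ht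
    (U := fun p x => Umat u lm x p) (U' := fun x => !![0, 0, 0; 0, 0, 0; lm * pdt T (mom u) x t, 0, 0])
    (ψ := fun p x => Psi u T lm x p *ᵥ c) (χ := fun x => Wmat u lm x t *ᵥ (Psi u T lm x t *ᵥ c))
    (fun i j => ?_) (fun i j => ?_)
    (fun p hp y hy => (hasDeriv_Psi_x hu lm hy.1 hp c).mono hsub) ?_ ?_ ?_
  · fin_cases i <;> fin_cases j <;> simp [Umat] <;>
      first | exact continuousOn_const | exact continuousOn_const.mul (hcm.add continuousOn_const)
  · fin_cases i <;> fin_cases j <;> simp <;>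
      first | exact continuousOn_const | exact continuousOn_const.mul hcd
  · intro y hy
    have e := hasDerivWithinAt_pi.1 ((hasDeriv_Psi_x hu lm hy.1 ht c).mono hsub)
    have d0 := ((hasDeriv_u_x hu hy.1 ht).mono hsub).ofReal_comp
    have d1 := ((hasDeriv_dx hu 1 hy.1 ht).mono hsub).ofReal_comp
    have dm := ((hm.hasDeriv_x hy.1 ht).mono hsub).ofReal_comp
    have hpt := pdt_mom hu hy.1 ht
    have hpx := pdx_mom hu hy.1 ht
    have hm : dx u 2 y t = u y t - mom u y t := by rw [mom]; ring
    obtain ⟨ψ, hψ⟩ : ∃ ψ : ℝ → ℂ³, ∀ y, Psi u T lm y t *ᵥ c = ψ y := ⟨_, fun _ => rfl⟩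
    simp only [hψ] at e ⊢
    have e0 := e 0
    have e1 := e 1
    have e2 := e 2
    rw [hasDerivWithinAt_pi]
    intro i
    cases i using fin3
    on_goal 1 => have h := (((e0.const_mul (-(2 / (3 * lm)))).add (d1.mul e0)).sub (d0.mul e1)).add
                   (e2.const_mul (1 / lm))
    on_goal 2 => have h := ((e0.add (d0.mul e0)).add (e1.const_mul (1 / (3 * lm)))).sub (d0.mul e2)
    on_goal 3 => have h := ((d1.mul e0).sub (((d0.const_mul lm).mul (dm.add_const 1)).mul e0)).add
                   (e1.add ((e2.const_mul (1 / (3 * lm))).sub (d1.mul e2)))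
    all_goals
      refine (h.congr (fun s _ => ?_) ?_).congr_deriv ?_
      iterate 2 (simp [Wmat, dotProduct, sum_univ_three]; ring)
      simp [Wmat, Umat, dotProduct, sum_univ_three, hm, hpt, hpx]
      field_simp
      ring
  · filter_upwards [self_mem_nhdsWithin] with p hp y hy i j
    have h0 := mul_le_mul_of_nonneg_left (htay y p t hy.1 hp ht) (norm_nonneg lm)
    rw [← norm_eq_abs, ← norm_real, ← norm_mul, ← mul_assoc] at h0
    have h1 := (norm_nonneg _).trans h0
    cases i using fin3 <;> cases j using fin3 <;> first
      | simpa [Umat] using h1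
      | exact (congrArg norm (by simp [Umat]; ring)).trans_le h0
  · exact ((hasDeriv_propT hu lm ht c).congr (fun s hs => by
      rw [Psi_zero_x hu lm hs]) (by rw [Psi_zero_x hu lm ht])).congr_deriv
      (by rw [Psi_zero_x hu lm ht])

lemma diff_propX (hx : 0 ≤ x) (ht : t ∈ Icc 0 T) (c : ℂ³) :
    Differentiable ℂ fun lm => propX u t lm x *ᵥ c := by
  intro p₀
  have h := (rapid_mom hu).continuous_clamp_x ht
  refine diffAt_fund_param (ι := Fin 1) (M := fun lm x => Umat u lm (max x 0) t)
    (A := fun x => !![0, 1, 0; 0, 0, 1; 0, 1, 0]) (φ := fun _ => id)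
    (B := fun _ x => !![0, 0, 0; 0, 0, 0; (mom u (max x 0) t : ℂ) + 1, 0, 0]) hx (fun p s => ?_)
    (fun i j => continuous_const) (fun r i j => ?_) (fun _ => analyticAt_id) c
  · simp [Umat]
  · fin_cases i <;> fin_cases j <;> simp <;> fun_prop

lemma diffAt_propT (ht : t ∈ Icc 0 T) (c : ℂ³) {lm : ℂ}
    (hlm : lm ≠ 0) : DifferentiableAt ℂ (fun lm => propT u T lm t *ᵥ c) lm := by
  have h := (rapid_mom hu).continuous_clamp_t le_rfl
  have h1 := (rapid_dx hu 1).1.continuous_clamp_t le_rfl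
  have h0 := continuous_ofReal.comp (hu.rapidDecay.continuous_clamp_t le_rfl)
  refine diffAt_fund_param (ι := Fin 2)
    (M := fun lm t => Wmat u lm 0 (max 0 (min t T))) (A := fun t => Wmat u 0 0 (max 0 (min t T)))
    (φ := ![id, fun p => p⁻¹])
    (B := fun r t => ![!![0, 0, 0; 0, 0, 0;
      -(u 0 (max 0 (min t T)) * ((mom u 0 (max 0 (min t T)) : ℂ) + 1)), 0, 0],
      !![-(2 / 3), 0, 1; 0, 1 / 3, 0; 0, 0, 1 / 3]] r) ht.1 (fun p s => ?_)
    (continuous_Wmat hu 0) (fun r i j => ?_) (fun r => ?_) c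
  · ext i j
    fin_cases i <;> fin_cases j <;>
      simp [Wmat, Fin.sum_univ_two] <;> ring
  · fin_cases r <;> fin_cases i <;> fin_cases j <;> simp <;>
      fun_prop
  · fin_cases r
    · exact analyticAt_id
    · exact analyticAt_inv hlm

lemma diffAt_Psi (hx : 0 ≤ x) (ht : t ∈ Icc 0 T) (i j : Fin 3) {lm : ℂ}
    (hlm : lm ≠ 0) : DifferentiableAt ℂ (fun lm => Psi u T lm x t i j) lm := by
  have hA : ∀ r, DifferentiableAt ℂ (fun lm => propX u t lm x i r) lm := fun r => by
    have := differentiableAt_pi.1 ((diff_propX hu hx ht (Pi.single r 1)) lm) i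
    simpa using this
  have hB : ∀ r, DifferentiableAt ℂ (fun lm => propT u T lm t r j) lm := fun r => by
    have := differentiableAt_pi.1 (diffAt_propT hu ht (Pi.single j 1) hlm) r
    simpa using this
  simp only [Psi, mul_apply]
  exact DifferentiableAt.fun_sum fun r _ => (hA r).mul (hB r)

end

/-- The pairing between solutions at `lm` and at `-lm` which is constant in `x`. -/
def rowR (w : ℂ³) : ℂ³ := ![w 2 - w 0, -w 1, w 0]

section

include hu

lemma hasDerivAt_propX_clamp (lm : ℂ) (ht : t ∈ Icc 0 T) (c : ℂ³) (x : ℝ) :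
    HasDerivAt (fun x => (propX u t lm x *ᵥ c) 0) ((propX u t lm x *ᵥ c) 1) x ∧
    HasDerivAt (fun x => (propX u t lm x *ᵥ c) 1) ((propX u t lm x *ᵥ c) 2) x ∧
    HasDerivAt (fun x => (propX u t lm x *ᵥ c) 2)
      (lm * (mom u (max x 0) t + 1) * (propX u t lm x *ᵥ c) 0 + (propX u t lm x *ᵥ c) 1) x := by
  have h := hasDerivAt_pi.1 (hasDerivAt_fund_mulVec (continuous_Umat hu lm ht) c x)
  refine ⟨(h 0).congr_deriv ?_, (h 1).congr_deriv ?_, (h 2).congr_deriv ?_⟩ <;>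
    rw [propX] <;> generalize fund _ x *ᵥ c = v <;>
    simp [Umat, mulVec, dotProduct, sum_univ_three]

lemma rowR_propX_dot (lm : ℂ) (ht : t ∈ Icc 0 T) (v w : ℂ³) (x : ℝ) :
    rowR (propX u t (-lm) x *ᵥ w) ⬝ᵥ (propX u t lm x *ᵥ v) = rowR w ⬝ᵥ v := by
  have hd : ∀ x, HasDerivAt (fun x => rowR (propX u t (-lm) x *ᵥ w) ⬝ᵥ (propX u t lm x *ᵥ v)) 0 x := by
    intro x
    obtain ⟨a0, a1, a2⟩ := hasDerivAt_propX_clamp hu lm ht v x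
    obtain ⟨b0, b1, b2⟩ := hasDerivAt_propX_clamp hu (-lm) ht w x
    have h := (((b2.sub b0).mul a0).add (b1.neg.mul a1)).add (b0.mul a2)
    simp only [rowR, dotProduct, sum_univ_three, cons_val, cons_val_zero, cons_val_one]
    refine h.congr_deriv ?_
    simp only [Pi.sub_apply, Pi.neg_apply]
    ring
  rw [is_const_of_deriv_eq_zero (fun s => (hd s).differentiableAt) (fun s => (hd s).deriv) x 0,
    propX_zero hu _ ht, propX_zero hu _ ht, one_mulVec, one_mulVec]

lemma propX_cross (lm : ℂ) (hx : 0 ≤ x) (ht : t ∈ Icc 0 T) (v w : ℂ³) :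
    propX u t lm x *ᵥ (crossProduct (rowR v) (rowR w)) =
      crossProduct (rowR (propX u t (-lm) x *ᵥ v)) (rowR (propX u t (-lm) x *ᵥ w)) := by
  have h := eq_propX_mulVec hu (lm := lm) (X := x) ht
    (w := fun x => crossProduct (rowR (propX u t (-lm) x *ᵥ v)) (rowR (propX u t (-lm) x *ᵥ w)))
    (fun y hy => ?_) (x := x) ⟨hx, le_rfl⟩
  · rw [h, propX_zero hu _ ht, one_mulVec, one_mulVec]
  · obtain ⟨a0, a1, a2⟩ := hasDerivAt_propX_clamp hu (-lm) ht v y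
    obtain ⟨b0, b1, b2⟩ := hasDerivAt_propX_clamp hu (-lm) ht w y
    rw [max_eq_left hy.1] at a2 b2
    refine HasDerivAt.hasDerivWithinAt (hasDerivAt_pi.2 fun i => ?_)
    cases i using fin3
    on_goal 1 => have h := (a1.neg.mul b0).sub (a0.mul b1.neg)
    on_goal 2 => have h := (a0.mul (b2.sub b0)).sub ((a2.sub a0).mul b0)
    on_goal 3 => have h := ((a2.sub a0).mul b1.neg).sub (a1.neg.mul (b2.sub b0))
    all_goals
      simp only [cross_apply, rowR, cons_val, cons_val_zero, cons_val_one]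
      refine h.congr_deriv ?_
      simp [Umat, mulVec, dotProduct, sum_univ_three]
      ring

end

/-! ### Jost solutions: weighted energy estimates -/

/-- The matrix of the system satisfied by the derivatives of a normalized solution. -/
def gmat (f : ℝ → ℝ) (lm μ₁ μ₂ : ℂ) (x : ℝ) : Mat3 := !![0, 1, 0; 0, μ₁, 1; lm * f x, 0, μ₂]

/-- The entries of `v` are bounded by `ρ` with weights `1`, `(1+x)^w`, `(1+x)^{2w}`. -/
def Wt (w : ℕ) (x ρ : ℝ) (v : ℂ³) : Prop :=
  ‖v 0‖ ≤ ρ ∧ ‖v 1‖ ≤ ρ / (1 + x) ^ w ∧ ‖v 2‖ ≤ ρ / (1 + x) ^ (2 * w)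

lemma Wt.norm_le {w : ℕ} {x ρ : ℝ} {v : ℂ³} (h : Wt w x ρ v) (hx : 0 ≤ x) : ‖v‖ ≤ ρ := by
  have hρ := (norm_nonneg _).trans h.1
  have h1 : ∀ n, 1 ≤ (1 + x) ^ n := fun n => one_le_pow₀ (by linarith)
  refine (pi_norm_le_iff_of_nonneg hρ).2 fun i => ?_
  cases i using fin3
  exacts [h.1, h.2.1.trans (div_le_self hρ (h1 _)), h.2.2.trans (div_le_self hρ (h1 _))]

lemma hasDerivAt_weight (n : ℕ) (hx : 0 ≤ x) {v : ℝ → ℂ} {v' : ℂ} (hv : HasDerivAt v v' x) :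
    HasDerivAt (fun x => ((1 + x : ℝ) : ℂ) ^ n * v x)
      (((n / (1 + x) : ℝ) : ℂ) * (((1 + x : ℝ) : ℂ) ^ n * v x) + ((1 + x : ℝ) : ℂ) ^ n * v') x := by
  have hne : (1 + x : ℂ) ≠ 0 := by exact_mod_cast (by positivity : (1 + x : ℝ) ≠ 0)
  refine (((((hasDerivAt_id x).const_add 1).ofReal_comp).pow n).mul hv).congr_deriv ?_
  rcases n with _ | n
  · simp
  · simp [pow_succ]
    field_simp

lemma weighted_energy {w : ℕ} (hw : 2 ≤ w) {X H ρ : ℝ} (hH : 0 ≤ H) {f : ℝ → ℝ} {lm μ₁ μ₂ : ℂ}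
    (hμ₁ : 0 ≤ μ₁.re) (hμ₂ : 0 ≤ μ₂.re) {r v : ℝ → ℂ³}
    (hv : ∀ x, HasDerivAt v (gmat f lm μ₁ μ₂ x *ᵥ v x + r x) x) (hr : ∀ x, r x 0 = 0)
    (hh : ∀ x, 0 ≤ x → ‖lm * f x‖ ≤ H / (1 + x) ^ (2 * w + 2))
    (hr' : ∀ x, 0 ≤ x → x ≤ X → ‖r x 1‖ ≤ ρ / (1 + x) ^ (w + 2) ∧ ‖r x 2‖ ≤ ρ / (1 + x) ^ (2 * w + 2))
    (hX : Wt w X ρ (v X)) {a : ℝ} (ha : 0 ≤ a) (haX : a ≤ X) :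
    Wt w a (ρ * (2 * Real.exp (11 * (H + 1)))) (v a) := by
  have hρ : 0 ≤ ρ := (norm_nonneg _).trans hX.1
  have hX0 := ha.trans haX
  have hW : ∀ (n : ℕ) (x : ℝ), 0 ≤ x → ∀ c : ℂ, ‖((1 + x : ℝ) : ℂ) ^ n * c‖ = (1 + x) ^ n * ‖c‖ :=
    fun n x hx c => by rw [norm_mul, norm_pow, norm_real, norm_of_nonneg (by linarith)]
  have key := energy_backward_decay (a := a) (b := X) ha haX (K := H + 1) (ε := ρ)
    (v := fun i x => ![v x 0, ((1 + x : ℝ) : ℂ) ^ w * v x 1, ((1 + x : ℝ) : ℂ) ^ (2 * w) * v x 2] i)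
    (Λ := fun i x => ![0, μ₁ + (w / (1 + x) : ℝ), μ₂ + ((2 * w : ℕ) / (1 + x) : ℝ)] i)
    (r := fun i x => ![v x 1, ((1 + x : ℝ) : ℂ) ^ w * (v x 2 + r x 1),
      ((1 + x : ℝ) : ℂ) ^ (2 * w) * (lm * f x * v x 0 + r x 2)] i) (by positivity) ?_ ?_ ?_
  · simp only [sum_univ_three, cons_val_zero, cons_val_one, cons_val, hW _ a ha, hW _ X hX0] at key
    obtain ⟨h0, h1, h2⟩ := hX
    rw [le_div_iff₀' (by positivity)] at h1 h2
    rw [Wt, le_div_iff₀' (by positivity), le_div_iff₀' (by positivity)]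
    have he : 1 ≤ Real.exp (11 * (H + 1)) := Real.one_le_exp (by positivity)
    have hS : ‖v X 0‖ ^ 2 + ((1 + X) ^ w * ‖v X 1‖) ^ 2 + ((1 + X) ^ (2 * w) * ‖v X 2‖) ^ 2 ≤
        ρ ^ 2 + ρ ^ 2 + ρ ^ 2 := by gcongr
    have := mul_le_mul_of_nonneg_right hS (exp_pos (11 * (H + 1))).le
    have := mul_nonneg (mul_nonneg (sq_nonneg ρ) (by linarith : 0 ≤ Real.exp (11 * (H + 1))))
      (sub_nonneg.2 he)
    refine ⟨?_, ?_, ?_⟩ <;> refine abs_le_of_sq_le_sq' ?_ (by positivity) |>.2 <;>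
      linarith [sq_nonneg ‖v a 0‖, sq_nonneg ((1 + a) ^ w * ‖v a 1‖), sq_nonneg ρ,
        sq_nonneg ((1 + a) ^ (2 * w) * ‖v a 2‖)]
  · intro i x hx
    have hx0 : 0 ≤ x := ha.trans hx.1
    have hd := hasDerivAt_pi.1 (hv x)
    cases i using fin3
    · exact ((hd 0).congr_deriv (by simp [gmat, dotProduct, sum_univ_three, hr])).hasDerivWithinAt
    · exact ((hasDerivAt_weight w hx0 (hd 1)).congr_deriv (by simp [gmat, dotProduct, sum_univ_three]; ring)).hasDerivWithinAt
    · exact ((hasDerivAt_weight (2 * w) hx0 (hd 2)).congr_deriv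
        (by simp [gmat, dotProduct, sum_univ_three]; ring)).hasDerivWithinAt
  · intro i x hx
    have hx0 : 0 ≤ x := ha.trans hx.1
    have hle : (1 + x) ^ 2 ≤ (1 + x) ^ w := pow_le_pow_right₀ (by linarith) hw
    have hc := hh x hx0
    obtain ⟨hc₁, hc₂⟩ := hr' x hx0 hx.2
    rw [le_div_iff₀ (by positivity), pow_add] at hc hc₁ hc₂
    have n0 := norm_nonneg (v x 0)
    have n1 : 0 ≤ (1 + x) ^ w * ‖v x 1‖ := by positivity
    have n2 : 0 ≤ (1 + x) ^ (2 * w) * ‖v x 2‖ := by positivity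
    have hs := mul_nonneg hH (by positivity :
      0 ≤ ‖v x 0‖ + (1 + x) ^ w * ‖v x 1‖ + (1 + x) ^ (2 * w) * ‖v x 2‖ + ρ)
    rw [div_mul_eq_mul_div, le_div_iff₀ (by positivity)]
    cases i using fin3 <;>
      simp only [sum_univ_three, cons_val_zero, cons_val_one, cons_val, hW _ x hx0]
    · linarith [mul_le_mul_of_nonneg_left hle (norm_nonneg (v x 1))]
    · have := mul_le_mul_of_nonneg_left hle (by positivity : 0 ≤ (1 + x) ^ w * ‖v x 2‖)
      have := mul_le_mul_of_nonneg_left (norm_add_le (v x 2) (r x 1))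
        (by positivity : 0 ≤ (1 + x) ^ w * (1 + x) ^ 2)
      rw [two_mul w, pow_add] at *
      linarith
    · have := mul_le_mul_of_nonneg_right hc n0
      have := mul_le_mul_of_nonneg_left (norm_add_le (lm * f x * v x 0) (r x 2))
        (by positivity : 0 ≤ (1 + x) ^ (2 * w) * (1 + x) ^ 2)
      rw [norm_mul] at this
      linarith [mul_nonneg hH n1, mul_nonneg hH n2, mul_nonneg hH hρ]
  · intro i x hx
    have hre : ∀ n : ℕ, 0 ≤ n / (1 + x) := fun n => div_nonneg n.cast_nonneg (by linarith [hx.1])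
    cases i using fin3
    · simp
    · simpa only [cons_val, add_re, ofReal_re] using add_nonneg hμ₁ (hre w)
    · simpa only [cons_val, add_re, ofReal_re] using add_nonneg hμ₂ (hre (2 * w))

lemma norm_sub_le_of_deriv_decay {n : ℕ} {v v' : ℝ → ℂ} {a b c : ℝ} (ha : 0 ≤ a) (hab : a ≤ b)
    (hc : 0 ≤ c) (hv : ∀ x ∈ Icc a b, HasDerivWithinAt v (v' x) (Icc a b) x)
    (hb : ∀ x ∈ Icc a b, ‖v' x‖ ≤ c / (1 + x) ^ (n + 2)) :
    ‖v b - v a‖ ≤ c / (1 + a) ^ (n + 1) := by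
  have hd := fun x (hx : a ≤ x) =>
    (hasDerivAt_neg_div_one_add (c / (1 + a) ^ n) (ha.trans hx)).const_add (c / (1 + a) ^ (n + 1))
  refine (image_norm_le_of_norm_deriv_right_le_deriv_boundary' (f := fun x => v x - v a) (f' := v')
    (fun x hx => (hv x hx).continuousWithinAt.sub continuousWithinAt_const)
    (fun x hx => ((hv x ⟨hx.1, hx.2.le⟩).sub_const _).mono_of_mem_nhdsWithin
      (Icc_mem_nhdsGE_of_mem hx)) (le_of_eq ?_)
    (fun x hx => (hd x hx.1).continuousAt.continuousWithinAt)
    (fun x hx => (hd x hx.1).hasDerivWithinAt) (fun x hx => ?_) (right_mem_Icc.2 hab)).trans ?_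
  · rw [sub_self, norm_zero]; field_simp; ring
  · refine (hb x ⟨hx.1, hx.2.le⟩).trans ?_
    rw [div_div, pow_add]
    have : (1 + a) ^ n ≤ (1 + x) ^ n := by gcongr; exact hx.1
    have := ha.trans hx.1
    gcongr
  · have := ha.trans hab
    have : 0 ≤ c / (1 + a) ^ n / (1 + b) := by positivity
    rw [neg_div]
    linarith

/-! ### The normalized system -/

/-- The solution of the normalized system which equals `(1, 0, 0)` at `X`. -/
def gsol (f : ℝ → ℝ) (lm μ₁ μ₂ : ℂ) (X x : ℝ) : ℂ³ :=
  fund (fun s => -gmat f lm μ₁ μ₂ (X - s)) (X - x) *ᵥ ![1, 0, 0]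

section

variable {f : ℝ → ℝ} (hf : Continuous f)

include hf

lemma continuous_gmat (lm μ₁ μ₂ : ℂ) (X : ℝ) (i j : Fin 3) :
    Continuous fun s => (-gmat f lm μ₁ μ₂ (X - s)) i j := by
  fin_cases i <;> fin_cases j <;> simp [gmat] <;> fun_prop

lemma gsol_self (lm μ₁ μ₂ : ℂ) (X : ℝ) : gsol f lm μ₁ μ₂ X X = ![1, 0, 0] := by
  rw [gsol, sub_self, fund_zero (continuous_gmat hf _ _ _ _), one_mulVec]

lemma hasDerivAt_gsol (lm μ₁ μ₂ : ℂ) (X x : ℝ) :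
    HasDerivAt (gsol f lm μ₁ μ₂ X) (gmat f lm μ₁ μ₂ x *ᵥ gsol f lm μ₁ μ₂ X x) x :=
  ((hasDerivAt_fund_mulVec (continuous_gmat hf lm μ₁ μ₂ X) ![1, 0, 0] (X - x)).scomp x
    ((hasDerivAt_id x).const_sub X)).congr_deriv (by simp [gsol, Matrix.neg_mulVec])

lemma diffAt_gsol_param {lm μ₁ μ₂ : ℂ → ℂ} {k₀ : ℂ} (h₀ : AnalyticAt ℂ lm k₀)
    (h₁ : AnalyticAt ℂ μ₁ k₀) (h₂ : AnalyticAt ℂ μ₂ k₀) {X : ℝ} (hX : 0 ≤ X) :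
    DifferentiableAt ℂ (fun k => gsol f (lm k) (μ₁ k) (μ₂ k) X 0) k₀ := by
  refine (?_ : DifferentiableAt ℂ (fun k => fund (fun s => -gmat f (lm k) (μ₁ k) (μ₂ k) (X - s))
    (X - 0) *ᵥ ![1, 0, 0]) k₀)
  refine diffAt_fund_param (A := fun s => !![0, -1, 0; 0, 0, -1; 0, 0, 0])
    (B := fun r s => ![!![0, 0, 0; 0, 0, 0; -(f (X - s) : ℂ), 0, 0],
      !![0, 0, 0; 0, -1, 0; 0, 0, 0], !![0, 0, 0; 0, 0, 0; 0, 0, -1]] r)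
    (φ := ![lm, μ₁, μ₂]) (by simpa) (fun p s => ?_) (fun i j => continuous_const) (fun r i j => ?_)
    (fun r => ?_) _
  · ext i j
    fin_cases i <;> fin_cases j <;>
      simp [gmat, sum_univ_three]
  · cases r using fin3 <;> fin_cases i <;> fin_cases j <;> simp <;>
      fun_prop
  · cases r using fin3
    exacts [h₀, h₁, h₂]

end

lemma div_one_add_pow_le {c x : ℝ} (hc : 0 ≤ c) (hx : 0 ≤ x) {n m : ℕ} (h : n ≤ m) :
    c / (1 + x) ^ m ≤ c / (1 + x) ^ n := by
  have : (1 + x) ^ n ≤ (1 + x) ^ m := pow_le_pow_right₀ (by linarith) h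
  have : 0 < 1 + x := by linarith
  gcongr

section

variable {f : ℝ → ℝ} (hf : Continuous f) {H B : ℝ} (hH : 0 ≤ H) (hB : 0 ≤ B)
  (hfb : ∀ x, 0 ≤ x → |f x| ≤ H / (1 + x) ^ 14)

include hfb hH hB in
lemma norm_mul_decay {lm : ℂ} (hlm : ‖lm‖ ≤ B) (hx : 0 ≤ x) {n : ℕ} (hn : n ≤ 14) :
    ‖lm * (f x : ℂ)‖ ≤ B * H / (1 + x) ^ n := by
  rw [norm_mul, norm_real, norm_eq_abs]
  calc ‖lm‖ * |f x| ≤ B * (H / (1 + x) ^ 14) := by gcongr; exact hfb x hx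
    _ = B * H / (1 + x) ^ 14 := by ring
    _ ≤ _ := div_one_add_pow_le (by positivity) hx hn

/-- The growth constant of the weighted energy. -/
def growth (B H : ℝ) : ℝ := 2 * Real.exp (11 * (B * H + 1))

lemma Wt.improve {w : ℕ} (hw : 1 ≤ w) {v : ℝ → ℂ³} {X Y C : ℝ} (hX : 0 ≤ X) (hY : X ≤ Y)
    (hd : ∀ y, HasDerivAt (fun y => v y 0) (v y 1) y)
    (h : ∀ y, X ≤ y → y ≤ Y → ‖v y 1‖ ≤ C / (1 + y) ^ (w + 2) ∧ ‖v y 2‖ ≤ C / (1 + y) ^ (2 * (w + 2)))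
    (h0 : v Y 0 = 0) : Wt w X (C / (1 + X) ^ 2) (v X) := by
  have hC : 0 ≤ C := by
    have := (norm_nonneg _).trans (h X le_rfl hY).1
    rwa [le_div_iff₀ (by positivity), zero_mul] at this
  have b0 := norm_sub_le_of_deriv_decay hX hY hC (fun y _ => (hd y).hasDerivWithinAt)
    fun y hy => (h y hy.1 hy.2).1
  rw [h0, zero_sub, norm_neg] at b0
  obtain ⟨b1, b2⟩ := h X le_rfl hY
  refine ⟨b0.trans (div_one_add_pow_le hC hX (by lia)), ?_, ?_⟩ <;> rw [div_div, ← pow_add]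
  exacts [by rwa [add_comm 2], b2.trans (div_one_add_pow_le hC hX (by lia))]

variable {lm μ₁ μ₂ lm' μ₁' μ₂' : ℂ} {δ : ℝ} (hlm : ‖lm‖ ≤ B) (h₁ : 0 ≤ μ₁.re) (h₂ : 0 ≤ μ₂.re)

include hf hH hB hfb hlm h₁ h₂

lemma gsol_bound {x X : ℝ} (hx : 0 ≤ x) (hX : x ≤ X) : Wt 6 x (growth B H) (gsol f lm μ₁ μ₂ X x) := by
  rw [← one_mul (growth B H)]
  refine weighted_energy (by norm_num) (mul_nonneg hB hH) h₁ h₂ (r := 0)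
    (fun y => by simpa using hasDerivAt_gsol hf lm μ₁ μ₂ X y) (fun _ => rfl)
    (fun y hy => norm_mul_decay hH hB hfb hlm hy (by norm_num)) (fun y hy _ => ?_) ?_ hx hX
  · simpa using ⟨by positivity, by positivity⟩
  · have := hx.trans hX
    simpa [gsol_self hf, Wt] using ⟨by positivity, by positivity⟩

lemma gsol_near {x X : ℝ} (hx : 0 ≤ x) (hX : x ≤ X) :
    Wt 4 x (growth B H / (1 + x) ^ 2) (gsol f lm μ₁ μ₂ X x - ![1, 0, 0]) :=
  Wt.improve (by norm_num) hx hX (v := fun x => gsol f lm μ₁ μ₂ X x - ![1, 0, 0])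
    (fun y => ((hasDerivAt_pi.1 (hasDerivAt_gsol hf lm μ₁ μ₂ X y) 0).sub_const 1).congr_deriv
      (by simp [gmat, dotProduct, sum_univ_three]))
    (fun y hy hyX => by simpa using (gsol_bound hf hH hB hfb hlm h₁ h₂ (hx.trans hy) hyX).2)
    (by simp [gsol_self hf])

lemma gsol_sub {x X Y : ℝ} (hx : 0 ≤ x) (hX : x ≤ X) (hY : X ≤ Y) :
    Wt 4 x (growth B H / (1 + X) ^ 2 * growth B H) (gsol f lm μ₁ μ₂ Y x - gsol f lm μ₁ μ₂ X x) := by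
  have h := gsol_near hf hH hB hfb hlm h₁ h₂ (hx.trans hX) hY
  have h0 := (norm_nonneg _).trans h.1
  refine weighted_energy (v := fun x => gsol f lm μ₁ μ₂ Y x - gsol f lm μ₁ μ₂ X x) (r := 0)
    (by norm_num) (mul_nonneg hB hH) h₁ h₂ (fun y => ((hasDerivAt_gsol hf lm μ₁ μ₂ Y y).sub
      (hasDerivAt_gsol hf lm μ₁ μ₂ X y)).congr_deriv (by simp [mulVec_sub])) (fun _ => rfl)
    (fun y hy => norm_mul_decay hH hB hfb hlm hy (by norm_num)) (fun y hy _ => ?_) ?_ hx hX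
  · simpa using ⟨by positivity, by positivity⟩
  · simpa only [gsol_self hf] using h

variable (h₁' : 0 ≤ μ₁'.re) (h₂' : 0 ≤ μ₂'.re) (d₀ : ‖lm - lm'‖ ≤ δ) (d₁ : ‖μ₁ - μ₁'‖ ≤ δ)
  (d₂ : ‖μ₂ - μ₂'‖ ≤ δ)

include d₀ d₁ d₂

omit hf in
lemma gsys_forced {w : ℕ} (hw : 2 ≤ w) (hw' : w ≤ 6) {X ρ : ℝ} {g v : ℝ → ℂ³}
    (hv : ∀ x, HasDerivAt v (gmat f lm μ₁ μ₂ x *ᵥ v x +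
      (gmat f lm μ₁ μ₂ x - gmat f lm' μ₁' μ₂' x) *ᵥ g x) x)
    (hg : ∀ y, 0 ≤ y → y ≤ X → Wt (w + 2) y ρ (g y)) (hX : Wt w X (δ * ρ * (1 + H)) (v X)) (hx : 0 ≤ x) (hxX : x ≤ X) : Wt w x (δ * ρ * (1 + H) * growth B H) (v x) := by
  have hδ : 0 ≤ δ := (norm_nonneg _).trans d₀
  refine weighted_energy hw (mul_nonneg hB hH) h₁ h₂ hv (fun y => by simp [gmat, dotProduct, sum_univ_three])
    (fun y hy => norm_mul_decay hH hB hfb hlm hy (by lia)) (fun y hy hyX => ?_) hX hx hxX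
  obtain ⟨b0, b1, b2⟩ := hg y hy hyX
  have hρ := (norm_nonneg _).trans b0
  have e1 : ((gmat f lm μ₁ μ₂ y - gmat f lm' μ₁' μ₂' y) *ᵥ g y) 1 = (μ₁ - μ₁') * g y 1 := by
    simp [gmat, dotProduct, sum_univ_three]
  have e2 : ((gmat f lm μ₁ μ₂ y - gmat f lm' μ₁' μ₂' y) *ᵥ g y) 2 =
      (lm - lm') * f y * g y 0 + (μ₂ - μ₂') * g y 2 := by
    simp [gmat, dotProduct, sum_univ_three, sub_mul]
  have hF := norm_mul_decay hH hδ hfb d₀ hy (show 2 * w + 2 ≤ 14 by lia)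
  rw [e1, e2, norm_mul]
  constructor
  · calc _ ≤ δ * (ρ / (1 + y) ^ (w + 2)) := by gcongr
      _ ≤ δ * (ρ / (1 + y) ^ (w + 2)) * (1 + H) := le_mul_of_one_le_right (by positivity) (by linarith)
      _ = _ := by ring
  · refine (norm_add_le _ _).trans ?_
    rw [norm_mul, norm_mul (μ₂ - μ₂')]
    calc _ ≤ δ * H / (1 + y) ^ (2 * w + 2) * ρ + δ * (ρ / (1 + y) ^ (2 * w + 2)) := by
          gcongr
          exact b2.trans (div_one_add_pow_le hρ hy (by lia))
      _ = _ := by ring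

omit hH hB hfb hlm h₁ h₂ d₀ d₁ d₂ in
lemma hasDerivAt_gsol_sub (X x : ℝ) : HasDerivAt (fun x => gsol f lm μ₁ μ₂ X x - gsol f lm' μ₁' μ₂' X x)
      (gmat f lm μ₁ μ₂ x *ᵥ (gsol f lm μ₁ μ₂ X x - gsol f lm' μ₁' μ₂' X x) +
        (gmat f lm μ₁ μ₂ x - gmat f lm' μ₁' μ₂' x) *ᵥ gsol f lm' μ₁' μ₂' X x) x :=
  ((hasDerivAt_gsol hf lm μ₁ μ₂ X x).sub (hasDerivAt_gsol hf lm' μ₁' μ₂' X x)).congr_deriv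
    (by rw [mulVec_sub, Matrix.sub_mulVec]; abel)

variable (hlm' : ‖lm'‖ ≤ B)

include hlm' h₁' h₂'

lemma gsol_param {x X : ℝ} (hx : 0 ≤ x) (hX : x ≤ X) : Wt 4 x (δ * growth B H * (1 + H) * growth B H)
      (gsol f lm μ₁ μ₂ X x - gsol f lm' μ₁' μ₂' X x) := by
  have hδ : 0 ≤ δ := (norm_nonneg _).trans d₀
  have hg : 0 ≤ growth B H := by rw [growth]; positivity
  refine gsys_forced hH hB hfb hlm h₁ h₂ d₀ d₁ d₂ (by norm_num) (by norm_num)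
    (v := fun x => gsol f lm μ₁ μ₂ X x - gsol f lm' μ₁' μ₂' X x) (hasDerivAt_gsol_sub hf X)
    (fun y hy => gsol_bound hf hH hB hfb hlm' h₁' h₂' hy) ?_ hx hX
  have := hx.trans hX
  simp only [gsol_self hf, sub_self, Wt, Pi.zero_apply, norm_zero]
  exact ⟨by positivity, by positivity, by positivity⟩

lemma gsol_param_sub {X Y : ℝ} (hX : 0 ≤ X) (hY : X ≤ Y) :
    ‖(gsol f lm μ₁ μ₂ Y 0 - gsol f lm' μ₁' μ₂' Y 0) - (gsol f lm μ₁ μ₂ X 0 - gsol f lm' μ₁' μ₂' X 0)‖ ≤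
      δ * (growth B H / (1 + X) ^ 2 * growth B H) * (1 + H) * growth B H := by
  refine (gsys_forced hH hB hfb hlm h₁ h₂ d₀ d₁ d₂ le_rfl (by norm_num) (v := fun x =>
    (gsol f lm μ₁ μ₂ Y x - gsol f lm' μ₁' μ₂' Y x) - (gsol f lm μ₁ μ₂ X x - gsol f lm' μ₁' μ₂' X x))
    (fun y => ((hasDerivAt_gsol_sub hf Y y).sub (hasDerivAt_gsol_sub hf X y)).congr_deriv
      (by simp only [mulVec_sub]; abel))
    (fun y hy hyX => gsol_sub hf hH hB hfb hlm' h₁' h₂' hy hyX hY) ?_ le_rfl hX).norm_le le_rfl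
  have h := Wt.improve (w := 2) (by norm_num) hX hY
    (v := fun y => gsol f lm μ₁ μ₂ Y y - gsol f lm' μ₁' μ₂' Y y)
    (fun y => (hasDerivAt_pi.1 (hasDerivAt_gsol_sub hf Y y) 0).congr_deriv (by simp [gmat, dotProduct, sum_univ_three]))
    (fun y hy hyX => (gsol_param hf hH hB hfb hlm h₁ h₂ h₁' h₂' d₀ d₁ d₂ hlm' (hX.trans hy) hyX).2)
    (by simp [gsol_self hf])
  simp only [gsol_self hf, sub_self, sub_zero]
  convert h using 1
  ring

end

/-- The limit at `0` of the normalized solutions as the normalization point goes to infinity. -/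
def glim (f : ℝ → ℝ) (lm μ₁ μ₂ : ℂ) : ℂ³ :=
  limUnder atTop fun n : ℕ => gsol f lm μ₁ μ₂ n 0

lemma tendsto_div_one_add_sq (C : ℝ) : Tendsto (fun n : ℕ => C / (1 + (n : ℝ)) ^ 2) atTop (𝓝 0) := by
  have h1 : Tendsto (fun n : ℕ => (1 + (n : ℝ)) ^ 2) atTop atTop :=
    (tendsto_pow_atTop (by norm_num)).comp (tendsto_atTop_add_const_left _ _ tendsto_natCast_atTop_atTop)
  exact h1.const_div_atTop C

section

variable {f : ℝ → ℝ} (hf : Continuous f) {H : ℝ} (hH : 0 ≤ H)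
  (hfb : ∀ x, 0 ≤ x → |f x| ≤ H / (1 + x) ^ 14)

include hf hH hfb

lemma tendsto_glim {lm μ₁ μ₂ : ℂ} (h₁ : 0 ≤ μ₁.re) (h₂ : 0 ≤ μ₂.re) :
    Tendsto (fun n : ℕ => gsol f lm μ₁ μ₂ n 0) atTop (𝓝 (glim f lm μ₁ μ₂)) := by
  refine tendsto_nhds_limUnder (cauchySeq_tendsto_of_complete (cauchySeq_of_le_tendsto_0'
    (fun n : ℕ => growth ‖lm‖ H ^ 2 / (1 + (n : ℝ)) ^ 2) (fun n m hnm => ?_)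
    (tendsto_div_one_add_sq _)))
  rw [dist_eq_norm, norm_sub_rev, sq, ← div_mul_eq_mul_div]
  exact (gsol_sub hf hH (norm_nonneg lm) hfb le_rfl h₁ h₂ le_rfl (Nat.cast_nonneg n)
    (Nat.cast_le.2 hnm)).norm_le le_rfl

omit hf hH hfb in
lemma diffWithin_of_approx {E : Type*} [NormedAddCommGroup E] [NormedSpace ℂ E]
    [CompleteSpace E] {F : ℂ → E} {Fn : ℕ → ℂ → E} {s : Set ℂ} {k₀ : ℂ} {ε : ℕ → ℝ}
    (hd : ∀ n, DifferentiableAt ℂ (Fn n) k₀) (hε : Tendsto ε atTop (𝓝 0))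
    (h : ∀ n, ∀ᶠ k in 𝓝[s] k₀, ‖(F k - F k₀) - (Fn n k - Fn n k₀)‖ ≤ ε n * ‖k - k₀‖) :
    DifferentiableWithinAt ℂ F s k₀ := by
  suffices hL : ∃ L, Tendsto (slope F k₀) (𝓝[s \ {k₀}] k₀) (𝓝 L) by
    obtain ⟨L, hL⟩ := hL
    exact (hasDerivWithinAt_iff_tendsto_slope.2 hL).differentiableWithinAt
  rcases eq_or_neBot (𝓝[s \ {k₀}] k₀) with hbot | hne
  · exact ⟨0, by rw [hbot]; exact tendsto_bot⟩
  rw [← cauchy_map_iff_exists_tendsto]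
  rw [Metric.cauchy_iff]
  refine ⟨inferInstance, fun η hη => ?_⟩
  obtain ⟨n, hn⟩ := (hε.eventually (gt_mem_nhds (show 0 < η / 4 by linarith))).exists
  have hs : Tendsto (slope (Fn n) k₀) (𝓝[s \ {k₀}] k₀) (𝓝 (deriv (Fn n) k₀)) :=
    hasDerivWithinAt_iff_tendsto_slope.1 (hd n).hasDerivAt.hasDerivWithinAt
  have h1 := hs.eventually (Metric.ball_mem_nhds _ (show 0 < η / 4 by linarith))
  have h2 : ∀ᶠ k in 𝓝[s \ {k₀}] k₀, dist (slope F k₀ k) (slope (Fn n) k₀ k) < η / 4 := by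
    filter_upwards [(h n).filter_mono (nhdsWithin_mono _ sdiff_subset), self_mem_nhdsWithin]
      with k hk hks
    have hpos : 0 < ‖k - k₀‖ := norm_pos_iff.2 (sub_ne_zero.2 hks.2)
    rw [dist_eq_norm, slope_def_module, slope_def_module, ← smul_sub, norm_smul, norm_inv]
    refine lt_of_le_of_lt ?_ hn
    rw [inv_mul_le_iff₀ hpos, mul_comm]
    exact hk
  refine ⟨_, image_mem_map (h1.and h2), ?_⟩
  rintro _ ⟨k, ⟨hk1, hk2⟩, rfl⟩ _ ⟨k', ⟨hk1', hk2'⟩, rfl⟩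
  have t1 := dist_triangle (slope F k₀ k) (slope (Fn n) k₀ k) (deriv (Fn n) k₀)
  have t2 := dist_triangle (slope F k₀ k') (slope (Fn n) k₀ k') (deriv (Fn n) k₀)
  have t3 := dist_triangle_right (slope F k₀ k) (slope F k₀ k') (deriv (Fn n) k₀)
  linarith

lemma diffWithin_glim {lm μ₁ μ₂ : ℂ → ℂ} {k₀ : ℂ} {s : Set ℂ} (hk₀ : k₀ ∈ s)
    (a₀ : AnalyticAt ℂ lm k₀) (a₁ : AnalyticAt ℂ μ₁ k₀) (a₂ : AnalyticAt ℂ μ₂ k₀)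
    (h₁ : ∀ k ∈ s, 0 ≤ (μ₁ k).re) (h₂ : ∀ k ∈ s, 0 ≤ (μ₂ k).re) :
    DifferentiableWithinAt ℂ (fun k => glim f (lm k) (μ₁ k) (μ₂ k)) s k₀ := by
  set B := ‖lm k₀‖ + 1 with hBdef
  have hB : 0 ≤ B := by positivity
  have hbound : ∀ᶠ k in 𝓝 k₀, ‖lm k‖ ≤ B := by
    filter_upwards [a₀.continuousAt.norm.eventually (gt_mem_nhds (lt_add_one ‖lm k₀‖))] with k hk
    exact hk.le
  obtain ⟨c₀, hc₀, l₀⟩ := a₀.differentiableAt.isBigO_sub.exists_nonneg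
  obtain ⟨c₁, hc₁, l₁⟩ := a₁.differentiableAt.isBigO_sub.exists_nonneg
  obtain ⟨c₂, hc₂, l₂⟩ := a₂.differentiableAt.isBigO_sub.exists_nonneg
  set c := c₀ + c₁ + c₂ with hc
  refine diffWithin_of_approx (Fn := fun n k => gsol f (lm k) (μ₁ k) (μ₂ k) n 0)
    (ε := fun n => c * (growth B H ^ 3 * (1 + H)) / (1 + (n : ℝ)) ^ 2)
    (fun n => diffAt_gsol_param hf a₀ a₁ a₂ (Nat.cast_nonneg n))
    (tendsto_div_one_add_sq _) fun n => ?_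
  filter_upwards [hbound.filter_mono nhdsWithin_le_nhds, l₀.bound.filter_mono nhdsWithin_le_nhds,
    l₁.bound.filter_mono nhdsWithin_le_nhds, l₂.bound.filter_mono nhdsWithin_le_nhds, self_mem_nhdsWithin]
    with k hkB hk₀' hk₁ hk₂ hks
  have t1 := tendsto_glim hf hH hfb (lm := lm k) (h₁ k hks) (h₂ k hks)
  have t0 := tendsto_glim hf hH hfb (lm := lm k₀) (h₁ k₀ hk₀) (h₂ k₀ hk₀)
  have t := ((t1.sub t0).sub_const (gsol f (lm k) (μ₁ k) (μ₂ k) n 0 -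
    gsol f (lm k₀) (μ₁ k₀) (μ₂ k₀) n 0)).norm
  refine le_of_tendsto t ?_
  filter_upwards [eventually_ge_atTop n] with m hm
  have hn := norm_nonneg (k - k₀)
  have := gsol_param_sub hf hH hB hfb (δ := c * ‖k - k₀‖) hkB (h₁ k hks) (h₂ k hks) (h₁ k₀ hk₀)
    (h₂ k₀ hk₀)
    (hk₀'.trans (by gcongr; linarith)) (hk₁.trans (by gcongr; linarith))
    (hk₂.trans (by gcongr; linarith)) (by rw [hBdef]; linarith) (Nat.cast_nonneg n) (Nat.cast_le.2 hm)
  refine this.trans (le_of_eq ?_)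
  ring

end

/-! ### Jost solutions -/

/-- Passage from the normalized system to the companion system. -/
def unnorm (s μ : ℂ) : Mat3 := !![1, 0, 0; s, 1, 0; s ^ 2, 2 * s + μ, 1]

/-- The value at `x = 0`, `t = 0` of the solution of the `x`-part of the Lax pair which is asymptotic
to `e^{l_a x} (1, l_a, l_a²)` as `x → ∞`. -/
def jost (u : 𝓕) (a : Fin 3) (k : ℂ) : ℂ³ :=
  unnorm (l a k) (l (a + 1) k - l a k) *ᵥ
    glim (fun x => mom u (max x 0) 0) (lam k) (l (a + 1) k - l a k) (l (a + 2) k - l a k)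

/-- The set where `l_a` has the smallest real part. -/
def minRegion (a : Fin 3) : Set ℂ := {k | k ≠ 0 ∧ ∀ j, (l a k).re ≤ (l j k).re}

lemma analyticAt_l (j : Fin 3) (hk : k ≠ 0) : AnalyticAt ℂ (l j) k := by
  have h := rot_ne_zero j hk
  unfold l rot at *
  fun_prop (disch := assumption)

lemma analyticAt_lam (hk : k ≠ 0) : AnalyticAt ℂ lam k := by
  have h : k ^ 3 ≠ 0 := pow_ne_zero 3 hk
  unfold lam
  fun_prop (disch := assumption)

lemma tendsto_dot_zero {F G : ℝ → ℂ³} {M : ℝ} (hF : ∀ x, 0 ≤ x → ‖F x‖ ≤ M)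
    (hG : Tendsto G atTop (𝓝 0)) : Tendsto (fun x => F x ⬝ᵥ G x) atTop (𝓝 0) := by
  have hb : ∀ v w : ℂ³, ‖v ⬝ᵥ w‖ ≤ 3 * ‖v‖ * ‖w‖ := fun v w => by
    refine (norm_sum_le_of_le _ fun i _ => norm_mul_le_of_le (norm_le_pi_norm v i)
      (norm_le_pi_norm w i)).trans (le_of_eq ?_)
    simp [mul_assoc]
  have h0 : Tendsto (fun x => 3 * M * ‖G x‖) atTop (𝓝 0) := by
    simpa using hG.norm.const_mul (3 * M)
  refine squeeze_zero_norm' ?_ h0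
  filter_upwards [eventually_ge_atTop 0] with x hx
  exact (hb _ _).trans (by gcongr; exact hF x hx)

lemma rowR_smul (c : ℂ) (w : ℂ³) : rowR (c • w) = c • rowR w := by
  funext i
  cases i using fin3 <;> simp [rowR]
  ring

lemma continuous_rowR : Continuous rowR := continuous_pi fun i => by
  cases i using fin3 <;> simp [rowR] <;> fun_prop

lemma eq_zero_of_rowR {w : ℂ³} (h : rowR w = 0) : w = 0 := funext fun i => by
  have h0 := congrFun h 0
  have h1 := congrFun h 1
  have h2 : w 0 = 0 := congrFun h 2
  simp only [rowR, cons_val_zero, cons_val_one, h2, sub_zero, Pi.zero_apply, neg_eq_zero] at h0 h1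
  cases i using fin3 <;> assumption

lemma norm_rowR_le (w : ℂ³) : ‖rowR w‖ ≤ 2 * ‖w‖ := by
  refine (pi_norm_le_iff_of_nonneg (by positivity)).2 fun i => ?_
  have h := fun i => norm_le_pi_norm w i
  have hn := norm_nonneg w
  cases i using fin3
  · exact (norm_sub_le _ _).trans (by linarith [h 2, h 0])
  · change ‖-w 1‖ ≤ _
    rw [norm_neg]; linarith [h 1]
  · exact (h 0).trans (by linarith)

lemma rowR_surjective (b : ℂ³) : ∃ w, rowR w = b := ⟨![b 2, -b 1, b 0 + b 2], by
    funext i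
    cases i using fin3 <;> simp [rowR]⟩

lemma norm_exp_mul_ofReal (s : ℂ) (x : ℝ) : ‖exp (s * x)‖ = Real.exp (s.re * x) := by
  rw [norm_exp]; simp

section

include hu

omit hu in
lemma zero_mem_Icc : (0 : ℝ) ∈ Icc 0 T := ⟨le_rfl, hT.out.le⟩

lemma exists_mom_bound (N : ℕ) : ∃ H, 0 ≤ H ∧ ∀ x, 0 ≤ x → |mom u (max x 0) 0| ≤ H / (1 + x) ^ N := by
  obtain ⟨H, hH, hb⟩ := (rapid_mom hu).bound N
  refine ⟨H, hH, fun x hx => ?_⟩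
  rw [max_eq_left hx]
  exact hb x 0 hx zero_mem_Icc

lemma diffWithin_jost {a : Fin 3} (hk : k ∈ minRegion a) :
    DifferentiableWithinAt ℂ (jost u a) (minRegion a) k := by
  obtain ⟨H, hH, hb⟩ := exists_mom_bound hu 14
  have la := analyticAt_l a hk.1
  have lb := analyticAt_l (a + 1) hk.1
  have lc := analyticAt_l (a + 2) hk.1
  have hg := diffWithin_glim ((rapid_mom hu).continuous_clamp_x zero_mem_Icc) hH hb hk
    (analyticAt_lam hk.1) (lb.sub la) (lc.sub la)
    (fun k hk => by simpa using hk.2 (a + 1)) (fun k hk => by simpa using hk.2 (a + 2))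
  have g := differentiableWithinAt_pi.1 hg
  have da := la.differentiableAt.differentiableWithinAt (s := minRegion a)
  have db := lb.differentiableAt.differentiableWithinAt (s := minRegion a)
  refine differentiableWithinAt_pi.2 fun i => ?_
  cases i using fin3 <;> simp only [jost, unnorm, mulVec, dotProduct, sum_univ_three] <;>
    simp only [of_apply, cons_val] <;> fun_prop

omit hu in
lemma isRoots_shift (hk : k ≠ 0) (a : Fin 3) : IsRoots ![l a k, l (a + 1) k, l (a + 2) k] (lam k) := by
  have h := (isRoots_l hk).comp (σ := fun j => a + j) (add_right_injective a)
  exact ⟨by simpa using h.sum, by simpa using h.pair, by simpa using h.prod⟩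

lemma tendsto_jost {a : Fin 3} (hk : k ∈ minRegion a) :
    Tendsto (fun x : ℝ => exp (-l a k * x) • (propX u 0 (lam k) x *ᵥ jost u a k)) atTop
      (𝓝 (pvec (l a k))) := by
  obtain ⟨H, hH, hb⟩ := exists_mom_bound hu 14
  have hf := (rapid_mom hu).continuous_clamp_x zero_mem_Icc
  have hr := isRoots_shift hk.1 a
  have hs := hr.sum
  have hp := hr.pair
  have hc := hr.cubic 0
  simp only [cons_val_zero, cons_val_one, cons_val] at hs hp hc
  have h₁ : 0 ≤ (l (a + 1) k - l a k).re := by simpa using hk.2 (a + 1)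
  have h₂ : 0 ≤ (l (a + 2) k - l a k).re := by simpa using hk.2 (a + 2)
  have hnear := fun x X => gsol_near hf hH (norm_nonneg _) hb (le_refl ‖lam k‖) h₁ h₂ (x := x) (X := X)
  have htl := tendsto_glim hf hH hb (lm := lam k) h₁ h₂
  have hsys := hasDerivAt_gsol hf (lam k) (l (a + 1) k - l a k) (l (a + 2) k - l a k)
  rw [jost]
  set f := fun x => mom u (max x 0) 0 with hfdef
  generalize hμ₁ : l (a + 1) k - l a k = μ₁ at *
  generalize hμ₂ : l (a + 2) k - l a k = μ₂ at *
  rw [sub_eq_iff_eq_add'] at hμ₁ hμ₂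
  rw [hμ₁, hμ₂] at hs hp
  generalize l a k = s at *
  have hprop : ∀ (n : ℕ) (x : ℝ), 0 ≤ x →
      propX u 0 (lam k) x *ᵥ (unnorm s μ₁ *ᵥ gsol f (lam k) μ₁ μ₂ n 0) =
        exp (s * x) • (unnorm s μ₁ *ᵥ gsol f (lam k) μ₁ μ₂ n x) := by
    intro n x hx
    have hw := eq_propX_mulVec hu (lm := lam k) (X := x) zero_mem_Icc
      (w := fun x => exp (s * x) • (unnorm s μ₁ *ᵥ gsol f (lam k) μ₁ μ₂ n x))
      (fun y hy => ?_) (x := x) ⟨hx, le_rfl⟩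
    · simpa using hw.symm
    · have hE := ((hasDerivAt_id y).ofReal_comp.const_mul s).cexp
      have hd := hasDerivAt_pi.1 (hsys n y)
      have efy : f y = mom u y 0 := by rw [hfdef]; simp only [max_eq_left hy.1]
      refine HasDerivAt.hasDerivWithinAt (hasDerivAt_pi.2 fun i => ?_)
      refine (hE.mul (HasDerivAt.fun_sum fun j (_ : j ∈ Finset.univ) =>
        (hd j).const_mul (unnorm s μ₁ i j))).congr_deriv ?_
      generalize gsol f (lam k) μ₁ μ₂ n y = g
      cases i using fin3 <;> simp [Umat, unnorm, gmat, dotProduct, sum_univ_three, efy]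
      iterate 2 ring
      linear_combination exp (s * y) * (g 0 * hc + g 1 * (-hp + (2 * s + μ₁) * hs) + g 2 * hs)
  set A := unnorm s μ₁
  set c := ∑ i, ∑ j, ‖A i j‖
  have hc : ∀ i j, ‖A i j‖ ≤ c := le_sum_sum fun _ _ => norm_nonneg _
  have hA : ∀ B : Mat3, Continuous fun w : ℂ³ => B *ᵥ w := fun B =>
    continuous_const.matrix_mulVec continuous_id
  have h0 : Tendsto (fun x : ℝ => 3 * c * (growth ‖lam k‖ H / (1 + x) ^ 2)) atTop (𝓝 0) := by
    simpa using ((tendsto_pow_atTop two_ne_zero).comp (tendsto_atTop_add_const_left _ _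
      tendsto_id)).const_div_atTop (growth ‖lam k‖ H) |>.const_mul (3 * c)
  rw [tendsto_iff_norm_sub_tendsto_zero]
  refine squeeze_zero' (Eventually.of_forall fun _ => norm_nonneg _) ?_ h0
  filter_upwards [eventually_ge_atTop 0] with x hx
  refine le_of_tendsto ((((((hA _).tendsto _).comp (((hA _).tendsto _).comp
    htl)).const_smul _).sub_const _).norm) ?_
  filter_upwards [eventually_ge_atTop ⌈x⌉₊] with n hn
  have e : pvec s = A *ᵥ ![1, 0, 0] := by
    funext i
    cases i using fin3 <;> simp [A, pvec, unnorm]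
  rw [Function.comp_apply, Function.comp_apply, hprop n x hx, smul_smul, ← exp_add, neg_mul,
    neg_add_cancel, exp_zero, one_smul, e, ← mulVec_sub]
  exact (norm_mulVec_le hc _).trans (mul_le_mul_of_nonneg_left ((hnear x n hx
    ((Nat.le_ceil x).trans (Nat.cast_le.2 hn))).norm_le hx) (by positivity))

lemma hasDeriv_coord (hk : NonSpecial k) (s : ℂ) (c : ℂ³) (i : Fin 3) (hx : 0 ≤ x) :
    HasDerivWithinAt (fun x : ℝ => coord (l i k) (propX u 0 (lam k) x *ᵥ c) * exp (-s * x))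
      ((l i k - s) * (coord (l i k) (propX u 0 (lam k) x *ᵥ c) * exp (-s * x))
        + lam k * mom u x 0 / χ[l i k] *
          ∑ j, coord (l j k) (propX u 0 (lam k) x *ᵥ c) * exp (-s * x)) (Ici 0) x := by
  obtain ⟨a0, a1, a2⟩ := hasDerivAt_propX_clamp hu (lam k) zero_mem_Icc c x
  rw [max_eq_left hx] at a2
  have hE : HasDerivAt (fun y : ℝ => exp (-s * y)) (exp (-s * x) * -s) x := by
    simpa using ((hasDerivAt_id x).ofReal_comp.const_mul (-s)).cexp
  have hc := (isRoots_l hk.1).cubic i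
  have hsum : ∑ j, coord (l j k) (propX u 0 (lam k) x *ᵥ c) = (propX u 0 (lam k) x *ᵥ c) 0 := by
    have := congrFun ((isRoots_l hk.1).sum_coord (disc_ne_zero hk) (propX u 0 (lam k) x *ᵥ c)) 0
    simpa [pvec] using this
  rw [← sum_mul, hsum]
  have h := (((((a0.const_mul (l i k ^ 2 - 1)).add (a1.const_mul (l i k))).add a2).div_const
    χ[l i k]).mul hE).hasDerivWithinAt (s := Ici 0)
  refine h.congr_deriv ?_
  simp only [coord, lev, Pi.add_apply]
  generalize propX u 0 (lam k) x *ᵥ c = v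
  linear_combination (exp := 1) (-v 0 * exp (-s * x) / χ[l i k]) * hc

lemma exists_coef_bound (k : ℂ) : ∃ K, 0 ≤ K ∧ ∀ i (y : ℝ), 0 ≤ y →
    ∀ v : Fin 3 → ℝ → ℂ, ‖lam k * mom u y 0 / χ[l i k] * ∑ j, v j y‖ ≤
      K / (1 + y) ^ 2 * ‖∑ j, v j y‖ := by
  obtain ⟨H, hH, hmb⟩ := exists_mom_bound hu 2
  refine ⟨∑ i, ‖lam k / χ[l i k]‖ * H, by positivity, fun i y hy v => ?_⟩
  have hm := hmb y hy
  rw [max_eq_left hy] at hm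
  rw [norm_mul, mul_div_right_comm, norm_mul, norm_real, norm_eq_abs]
  gcongr
  calc _ ≤ ‖lam k / χ[l i k]‖ * (H / (1 + y) ^ 2) := by gcongr
    _ = ‖lam k / χ[l i k]‖ * H / (1 + y) ^ 2 := by ring
    _ ≤ _ := by
      gcongr
      exact le_sum_three (c := fun i => ‖lam k / χ[l i k]‖ * H) (fun _ => by positivity) i

lemma exists_forward_bound (hk : NonSpecial k) {b : Fin 3} (hb : ∀ j, (l j k).re ≤ (l b k).re) (c : ℂ³) :
    ∃ M, ∀ x : ℝ, 0 ≤ x → ‖exp (-l b k * x) • (propX u 0 (lam k) x *ᵥ c)‖ ≤ M := by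
  obtain ⟨K, hK0, hK⟩ := exists_coef_bound hu k
  set v : Fin 3 → ℝ → ℂ := fun i x =>
    coord (l i k) (propX u 0 (lam k) x *ᵥ c) * exp (-l b k * x) with hv
  set E := (∑ i, ‖v i 0‖ ^ 2 + 0 ^ 2) * Real.exp (11 * K) with hE
  refine ⟨∑ i, sqrt E * ‖pvec (l i k)‖, fun x hx => ?_⟩
  rw [← (isRoots_l hk.1).sum_coord (disc_ne_zero hk) (propX u 0 (lam k) x *ᵥ c), Finset.smul_sum]
  refine (norm_sum_le _ _).trans (sum_le_sum fun i _ => ?_)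
  rw [smul_smul, norm_smul, mul_comm (exp _)]
  gcongr
  refine Real.le_sqrt_of_sq_le (le_trans ?_ (energy_forward_decay (v := v) (ε := 0) le_rfl hx hK0
    (fun i y hy => (hasDeriv_coord hu hk (l b k) c i hy.1).mono (fun z hz => hz.1))
    (hΛ := fun i y hy => by simpa using hb i)
    (fun i y hy => (hK i y hy.1 v).trans (by rw [add_zero]; gcongr; exact norm_sum_le _ _))))
  rw [zero_pow two_ne_zero, add_zero]
  exact le_sum_three (c := fun i => ‖v i x‖ ^ 2) (fun _ => by positivity) i

lemma eq_zero_of_bounded (hk : NonSpecial k) {a : Fin 3}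
    (ha : ∀ j, (l a k).re ≤ (l j k).re) {c : ℂ³} {M : ℝ}
    (hM : ∀ x : ℝ, 0 ≤ x → ‖exp (-l a k * x) • (propX u 0 (lam k) x *ᵥ c)‖ ≤ M)
    (hlim : ∀ i, Tendsto (fun x : ℝ => lev (l i k) (propX u 0 (lam k) x *ᵥ c) *
      exp (-l i k * x)) atTop (𝓝 0)) : c = 0 := by
  obtain ⟨K, hK0, hK⟩ := exists_coef_bound hu k
  have hM0 : 0 ≤ M := (norm_nonneg _).trans (hM 0 le_rfl)
  set v : Fin 3 → ℝ → ℂ := fun i x =>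
    coord (l i k) (propX u 0 (lam k) x *ᵥ c) * exp (-l a k * x) with hv
  have hsumb : ∀ x : ℝ, 0 ≤ x → ‖∑ j, v j x‖ ≤ M := by
    intro x hx
    have := congrFun ((isRoots_l hk.1).sum_coord (disc_ne_zero hk) (propX u 0 (lam k) x *ᵥ c)) 0
    rw [hv, ← sum_mul, mul_comm, show ∑ j, coord (l j k) (propX u 0 (lam k) x *ᵥ c) =
      (propX u 0 (lam k) x *ᵥ c) 0 by simpa [pvec] using this]
    exact (norm_le_pi_norm (exp (-l a k * x) • (propX u 0 (lam k) x *ᵥ c)) 0).trans (hM x hx)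
  have hdecay : ∀ i (x : ℝ), 0 ≤ x → ‖v i x‖ ≤ K * M / (1 + x) ^ (0 + 1) := by
    intro i x hx
    set g : ℝ → ℂ := fun y => coord (l i k) (propX u 0 (lam k) y *ᵥ c) *
      exp (-l i k * y) * exp ((l i k - l a k) * x) with hg
    have hg0 : Tendsto g atTop (𝓝 0) := by
      have := ((hlim i).div_const χ[l i k]).mul_const (exp ((l i k - l a k) * x))
      rw [zero_div, zero_mul] at this
      exact this.congr fun y => by simp only [hg, coord]; ring
    have hgx : g x = v i x := by
      simp only [hg, hv]
      rw [mul_assoc, ← exp_add]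
      congr 2; ring
    rw [← hgx, ← norm_neg, ← zero_sub]
    refine le_of_tendsto (hg0.sub_const (g x)).norm ?_
    filter_upwards [eventually_ge_atTop x] with X hX
    refine norm_sub_le_of_deriv_decay (v' := fun y => lam k * mom u y 0 / χ[l i k] *
      (∑ j, v j y) * exp ((l i k - l a k) * (x - y : ℝ))) hx hX (by positivity) (fun y hy => ?_)
      fun y hy => ?_
    · refine (((hasDeriv_coord hu hk (l i k) c i (hx.trans hy.1)).mono
        (fun z hz => hx.trans hz.1 : Icc x X ⊆ Ici 0)).mul_const
        (exp ((l i k - l a k) * x))).congr_deriv ?_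
      rw [sub_self, zero_mul, zero_add, hv]
      simp only [← sum_mul]
      have e : exp (-l i k * y) * exp ((l i k - l a k) * x) =
          exp (-l a k * y) * exp ((l i k - l a k) * (x - y : ℝ)) := by
        rw [← exp_add, ← exp_add]; congr 1; push_cast; ring
      linear_combination (lam k * mom u y 0 / χ[l i k] *
        (∑ j, coord (l j k) (propX u 0 (lam k) y *ᵥ c))) * e
    · have hy0 := hx.trans hy.1
      have h1 : 0 ≤ (l i k - l a k).re := by simpa using ha i
      have hexp : ‖exp ((l i k - l a k) * (x - y : ℝ))‖ ≤ 1 := by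
        rw [norm_exp_mul_ofReal, exp_le_one_iff]
        nlinarith [hy.1]
      rw [norm_mul]
      calc _ ≤ K / (1 + y) ^ 2 * M * 1 := by
            gcongr
            exact (hK i y hy0 v).trans (by gcongr; exact hsumb y hy0)
        _ = _ := by ring
  have hvi : ∀ i, v i 0 = 0 := by
    intro i
    have h0 : Tendsto (fun X : ℝ => 3 * (K * M / (1 + X)) ^ 2 * Real.exp (11 * K)) atTop (𝓝 0) := by
      simpa using ((((tendsto_atTop_add_const_left _ (1 : ℝ) tendsto_id).const_div_atTop
        (K * M)).pow 2).const_mul 3).mul_const (Real.exp (11 * K))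
    refine norm_eq_zero.1 (pow_eq_zero_iff two_ne_zero |>.1 (le_antisymm (ge_of_tendsto h0 ?_)
      (sq_nonneg _)))
    filter_upwards [eventually_ge_atTop 0] with X hX
    have h := energy_backward_decay (v := v) (ε := 0) le_rfl hX hK0
      (fun i y hy => (hasDeriv_coord hu hk (l a k) c i hy.1).mono (fun z hz => hz.1))
      (hΛ := fun i y hy => by simpa using ha i)
      (fun i y hy => (hK i y hy.1 v).trans (by rw [add_zero]; gcongr; exact norm_sum_le _ _))
    rw [zero_pow two_ne_zero, add_zero, add_zero] at h
    refine (le_sum_three (c := fun i => ‖v i 0‖ ^ 2) (fun _ => by positivity) i).trans (h.trans ?_)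
    gcongr
    rw [sum_univ_three]
    have := fun i => pow_le_pow_left₀ (norm_nonneg (v i X)) (hdecay i X hX) 2
    simp only [zero_add, pow_one] at this
    linarith [this 0, this 1, this 2]
  rw [← (isRoots_l hk.1).sum_coord (disc_ne_zero hk) c]
  refine Finset.sum_eq_zero fun i _ => ?_
  have := hvi i
  simp only [hv, propX_zero hu _ zero_mem_Icc, one_mulVec, ofReal_zero,
    mul_zero, exp_zero, mul_one] at this
  rw [this, zero_smul]

end

/-! ### Vectors in `ℂ³` -/

lemma dot_three (v w : ℂ³) : v ⬝ᵥ w = v 0 * w 0 + v 1 * w 1 + v 2 * w 2 := by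
  simp [dotProduct, sum_univ_three]

lemma cross_cross_left (x y z : ℂ³) :
    crossProduct (crossProduct x y) z = (x ⬝ᵥ z) • y - (y ⬝ᵥ z) • x := by
  funext i
  cases i using fin3 <;> simp [cross_apply, dot_three] <;> ring

lemma cross_cross_right (x y z : ℂ³) :
    crossProduct x (crossProduct y z) = (x ⬝ᵥ z) • y - (x ⬝ᵥ y) • z := by
  funext i
  cases i using fin3 <;> simp [cross_apply, dot_three] <;> ring

lemma dot_cross_rotate (x y z : ℂ³) : x ⬝ᵥ crossProduct y z = y ⬝ᵥ crossProduct z x := by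
  rw [dot_three, dot_three]
  simp only [cross_apply, cons_val_zero, cons_val_one, cons_val]
  ring

lemma exists_eq_cross {e C : ℂ³} (he : e ≠ 0) (h : e ⬝ᵥ C = 0) : ∃ w, C = crossProduct w e := by
  obtain ⟨i, hi⟩ := Function.ne_iff.1 he
  refine ⟨crossProduct (Pi.single i (e i)⁻¹) C, ?_⟩
  rw [cross_cross_left]
  have : Pi.single i (e i)⁻¹ ⬝ᵥ e = 1 := by
    rw [single_dotProduct]; exact inv_mul_cancel₀ hi
  rw [this, dotProduct_comm, h]
  simp

lemma norm_cross_le (v w : ℂ³) : ‖crossProduct v w‖ ≤ 2 * ‖v‖ * ‖w‖ := by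
  have hb : ∀ i j, ‖v i * w j‖ ≤ ‖v‖ * ‖w‖ := fun i j => by
    rw [norm_mul]
    exact mul_le_mul (norm_le_pi_norm v i) (norm_le_pi_norm w j) (norm_nonneg _) (norm_nonneg _)
  refine (pi_norm_le_iff_of_nonneg (by positivity)).2 fun i => ?_
  cases i using fin3 <;>
    simp only [cross_apply, cons_val_zero, cons_val_one, cons_val] <;>
    refine (norm_sub_le _ _).trans ?_ <;>
    linarith [hb 1 2, hb 2 1, hb 2 0, hb 0 2, hb 0 1, hb 1 0]

lemma lev_eq_dot (s : ℂ) (w : ℂ³) : lev s w = ![s ^ 2 - 1, s, 1] ⬝ᵥ w := by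
  rw [dot_three]
  simp [lev]

lemma rowR_pvec (s : ℂ) : rowR (pvec (-s)) = ![s ^ 2 - 1, s, 1] := by
  funext i
  cases i using fin3 <;> simp [rowR, pvec]

lemma IsRoots.cross_lev {L : ℂ³} {lm : ℂ} (h : IsRoots L lm) :
    crossProduct ![L 2 ^ 2 - 1, L 2, 1] ![L 1 ^ 2 - 1, L 1, 1] = (L 2 - L 1) • pvec (L 0) := by
  have hs := h.sum
  have hp := h.pair
  funext i
  cases i using fin3 <;> simp [cross_apply, pvec]
  · linear_combination (L 1 - L 2) * hs
  · linear_combination (L 2 - L 1) * (hp - L 0 * hs)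

lemma IsRoots.cross_lev' {L : ℂ³} {lm : ℂ} (h : IsRoots L lm) :
    crossProduct ![L 0 ^ 2 - 1, L 0, 1] ![L 1 ^ 2 - 1, L 1, 1] = (L 0 - L 1) • pvec (L 2) :=
  (h.comp (σ := ![2, 1, 0]) (by decide)).cross_lev

/-! ### The column problems -/

/-- `σ` lists the indices in weakly increasing order of `Re l_j` at the nonspecial point `k`. -/
structure OrdAt (k : ℂ) (σ : Fin 3 → Fin 3) : Prop where
  ns : NonSpecial k
  inj : Function.Injective σ
  le01 : (l (σ 0) k).re ≤ (l (σ 1) k).re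
  le12 : (l (σ 1) k).re ≤ (l (σ 2) k).re

lemma NonSpecial.neg (hk : NonSpecial k) : NonSpecial (-k) := by
  have : (-k) ^ 6 = k ^ 6 := by ring
  exact ⟨neg_ne_zero.2 hk.1, by rw [this]; exact hk.2.1, by rw [this]; exact hk.2.2⟩

namespace OrdAt

variable {σ : Fin 3 → Fin 3} (h : OrdAt k σ)

include h

lemma roots : IsRoots (fun p => l (σ p) k) (lam k) := (isRoots_l h.ns.1).comp h.inj

lemma mono (hpr : p ≤ r) : (l (σ p) k).re ≤ (l (σ r) k).re := by
  cases p using fin3 <;> cases r using fin3 <;>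
    first | exact le_rfl | exact h.le01 | exact h.le12 | exact h.le01.trans h.le12 |
      exact absurd hpr (by decide)

lemma min (j : Fin 3) : (l (σ 0) k).re ≤ (l j k).re := by
  obtain ⟨p, rfl⟩ := (Finite.injective_iff_surjective.1 h.inj) j
  exact h.mono (Fin.zero_le p)

lemma max (j : Fin 3) : (l j k).re ≤ (l (σ 2) k).re := by
  obtain ⟨p, rfl⟩ := (Finite.injective_iff_surjective.1 h.inj) j
  exact h.mono (Fin.le_last p)

lemma mem_minRegion : k ∈ minRegion (σ 0) := ⟨h.ns.1, h.min⟩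

lemma neg_mem_minRegion : -k ∈ minRegion (σ 2) :=
  ⟨neg_ne_zero.2 h.ns.1, fun j => by rw [l_neg, l_neg]; simpa using h.max j⟩

lemma pi_ne_zero (p : Fin 3) : 3 * l (σ p) k ^ 2 - 1 ≠ 0 :=
  (isRoots_l h.ns.1).three_sq_ne_zero (disc_ne_zero h.ns) (σ p)

lemma sub_ne_zero (hpr : p ≠ r := by decide) : l (σ p) k - l (σ r) k ≠ 0 :=
  _root_.sub_ne_zero.2 fun e => hpr (h.inj (l_injective h.ns e))

lemma sum : l (σ 0) k + l (σ 1) k + l (σ 2) k = 0 := h.roots.sum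

end OrdAt

/-- The row whose pairing with a vector gives the coefficient of the fastest growing exponential. -/
def topRow (u : 𝓕) (σ : Fin 3 → Fin 3) (k : ℂ) : ℂ³ := rowR (jost u (σ 2) (-k))

/-- The conditions which determine a column of the eigenfunctions: boundedness and normalization at
infinity (`d` is the limit of the diagonal component), and orthogonality to the rows `b p`, `p < r`. -/
structure IsCol (u : 𝓕) (k : ℂ) (σ : Fin 3 → Fin 3) (b : Fin 3 → ℂ³) (r : Fin 3)
    (d : ℂ) (C : ℂ³) : Prop where
  bdd : ∃ M, ∀ x : ℝ, 0 ≤ x → ‖exp (-l (σ r) k * x) • (propX u 0 (lam k) x *ᵥ C)‖ ≤ M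
  lim : ∀ p, r < p → Tendsto (fun x : ℝ => lev (l (σ p) k) (propX u 0 (lam k) x *ᵥ C) *
    exp (-l (σ p) k * x)) atTop (𝓝 0)
  diag : Tendsto (fun x : ℝ => lev (l (σ r) k) (propX u 0 (lam k) x *ᵥ C) *
    exp (-l (σ r) k * x)) atTop (𝓝 d)
  start : ∀ p, p < r → b p ⬝ᵥ C = 0

section

variable {σ : Fin 3 → Fin 3} {b : Fin 3 → ℂ³} {r : Fin 3} {d d' : ℂ}
  {C C' : ℂ³} (h : IsCol u k σ b r d C)

include h

lemma IsCol.add (h' : IsCol u k σ b r d' C') : IsCol u k σ b r (d + d') (C + C') := by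
  obtain ⟨M, hM⟩ := h.bdd
  obtain ⟨M', hM'⟩ := h'.bdd
  refine ⟨⟨M + M', fun x hx => ?_⟩, fun p hp => ?_, ?_, fun p hp => ?_⟩
  · rw [mulVec_add, smul_add]
    exact norm_add_le_of_le (hM x hx) (hM' x hx)
  · simpa [mulVec_add, lev_add, add_mul] using (h.lim p hp).add (h'.lim p hp)
  · simpa [mulVec_add, lev_add, add_mul] using h.diag.add h'.diag
  · rw [dotProduct_add, h.start p hp, h'.start p hp, add_zero]

lemma IsCol.smul (c : ℂ) : IsCol u k σ b r (c * d) (c • C) := by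
  obtain ⟨M, hM⟩ := h.bdd
  refine ⟨⟨‖c‖ * M, fun x hx => ?_⟩, fun p hp => ?_, ?_, fun p hp => ?_⟩
  · rw [mulVec_smul, smul_comm, norm_smul]
    exact mul_le_mul_of_nonneg_left (hM x hx) (norm_nonneg c)
  · simpa [mulVec_smul, lev_smul, mul_assoc] using (h.lim p hp).const_mul c
  · simpa [mulVec_smul, lev_smul, mul_assoc] using h.diag.const_mul c
  · rw [dotProduct_smul, h.start p hp, smul_zero]

end

lemma norm_exp_smul_le {a b : ℂ} (h : a.re ≤ b.re) (hx : 0 ≤ x) (v : ℂ³) :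
    ‖exp (-b * x) • v‖ ≤ ‖exp (-a * x) • v‖ := by
  rw [norm_smul, norm_smul, norm_exp_mul_ofReal, norm_exp_mul_ofReal, neg_re, neg_re]
  gcongr

lemma pvec_ne_zero (s : ℂ) : pvec s ≠ 0 := fun h => by
  have := congrFun h 0
  simp [pvec] at this

section

variable {σ : Fin 3 → Fin 3} (h : OrdAt k σ)

include hu h

lemma jost_ne_zero : jost u (σ 0) k ≠ 0 := fun h0 => by
  have := tendsto_jost hu h.mem_minRegion
  simp only [h0, mulVec_zero, smul_zero] at this
  exact pvec_ne_zero _ (tendsto_nhds_unique this tendsto_const_nhds)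

omit hu in
lemma OrdAt.rev : OrdAt (-k) fun p => σ (2 - p) := ⟨h.ns.neg, h.inj.comp sub_right_injective, by
    rw [l_neg, l_neg]; simpa using h.le12, by
    rw [l_neg, l_neg]; simpa using h.le01⟩

lemma tendsto_topRow : Tendsto (fun x : ℝ => exp (l (σ 2) k * x) •
      rowR (propX u 0 (-lam k) x *ᵥ jost u (σ 2) (-k))) atTop
      (𝓝 ![l (σ 2) k ^ 2 - 1, l (σ 2) k, 1]) := by
  have := (continuous_rowR.tendsto _).comp (tendsto_jost hu h.neg_mem_minRegion)
  simpa only [l_neg, neg_neg, lam_neg, rowR_pvec, comp_def, rowR_smul] using this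

lemma topRow_ne_zero : topRow u σ k ≠ 0 := fun h0 =>
  jost_ne_zero hu h.rev (eq_zero_of_rowR h0)

lemma forward_bound (C : ℂ³) :
    ∃ M, ∀ x : ℝ, 0 ≤ x → ‖exp (-l (σ 2) k * x) • (propX u 0 (lam k) x *ᵥ C)‖ ≤ M :=
  exists_forward_bound hu h.ns h.max C

lemma tendsto_top (C : ℂ³) : Tendsto (fun x : ℝ => lev (l (σ 2) k) (propX u 0 (lam k) x *ᵥ C) *
      exp (-l (σ 2) k * x)) atTop (𝓝 (topRow u σ k ⬝ᵥ C)) := by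
  obtain ⟨M, hM⟩ := forward_bound hu h C
  have ht := (tendsto_topRow hu h).sub_const ![l (σ 2) k ^ 2 - 1, l (σ 2) k, 1]
  rw [sub_self] at ht
  have h0 := (tendsto_dot_zero hM ht).const_sub (topRow u σ k ⬝ᵥ C)
  rw [sub_zero] at h0
  refine h0.congr fun x => ?_
  have hp := rowR_propX_dot hu (lam k) zero_mem_Icc C (jost u (σ 2) (-k)) x
  rw [topRow, ← hp, dotProduct_sub, dotProduct_comm _ (_ • rowR _), smul_dotProduct,
    dotProduct_smul, smul_smul, ← exp_add]
  rw [neg_mul, add_neg_cancel, exp_zero, one_smul, sub_sub_cancel, lev_eq_dot, dotProduct_comm, dotProduct_smul,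
    smul_eq_mul, mul_comm]

lemma tendsto_lev_jost (i : Fin 3) :
    Tendsto (fun x : ℝ => lev (l i k) (propX u 0 (lam k) x *ᵥ jost u (σ 0) k) *
      exp (-l i k * x)) atTop (𝓝 (if i = σ 0 then 3 * l i k ^ 2 - 1 else 0)) := by
  have hc : Continuous (lev (l i k)) := by unfold lev; fun_prop
  have h1 := (hc.tendsto _).comp (tendsto_jost hu h.mem_minRegion)
  rw [(isRoots_l h.ns.1).lev_pvec i (σ 0)] at h1
  have e : ∀ x : ℝ, lev (l i k) (propX u 0 (lam k) x *ᵥ jost u (σ 0) k) * exp (-l i k * x) =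
      (lev (l i k) ∘ fun x : ℝ => exp (-l (σ 0) k * x) •
        (propX u 0 (lam k) x *ᵥ jost u (σ 0) k)) x * exp ((l (σ 0) k - l i k) * x) := fun x => by
    rw [Function.comp_apply, lev_smul, mul_right_comm, ← exp_add, mul_comm]
    ring_nf
  simp only [e]
  by_cases hi : i = σ 0
  · simpa [hi, comp_def] using h1
  · rw [if_neg hi] at h1 ⊢
    refine h1.zero_mul_isBoundedUnder_le (isBoundedUnder_of_eventually_le (a := 1) ?_)
    filter_upwards [eventually_ge_atTop 0] with x hx
    rw [Function.comp_apply, norm_exp_mul_ofReal, sub_re]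
    exact exp_le_one_iff.2 (by nlinarith [h.min i])

lemma topRow_jost : topRow u σ k ⬝ᵥ jost u (σ 0) k = 0 := by
  have h2 := tendsto_lev_jost hu h (σ 2)
  rw [if_neg (fun e => absurd (h.inj e) (by decide))] at h2
  exact tendsto_nhds_unique (tendsto_top hu h _) h2

lemma isCol_jost (b : Fin 3 → ℂ³) : IsCol u k σ b 0 (3 * l (σ 0) k ^ 2 - 1) (jost u (σ 0) k) := by
  refine ⟨?_, fun p hp => ?_, ?_, fun p hp => absurd hp (by simp)⟩
  · obtain ⟨X, hX⟩ := (Metric.tendsto_atTop.1 (tendsto_jost hu h.mem_minRegion)) 1 one_pos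
    obtain ⟨M, hM⟩ := (isCompact_Icc (a := 0) (b := max X 0)).exists_bound_of_continuousOn
      (f := fun x : ℝ => exp (-l (σ 0) k * x) • (propX u 0 (lam k) x *ᵥ jost u (σ 0) k))
      fun x hx => ContinuousWithinAt.smul (f := fun x : ℝ => exp (-l (σ 0) k * x)) (by fun_prop)
        ((hasDeriv_propX hu (lam k) hx.1 zero_mem_Icc _).continuousWithinAt.mono Icc_subset_Ici_self)
    refine ⟨max M (‖pvec (l (σ 0) k)‖ + 1), fun x hx => ?_⟩
    rcases le_total x (max X 0) with hx' | hx'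
    · exact (hM x ⟨hx, hx'⟩).trans (le_max_left _ _)
    · have := hX x ((le_max_left _ _).trans hx')
      rw [dist_eq_norm] at this
      exact ((norm_le_norm_add_norm_sub' _ _).trans (add_le_add_right this.le _)).trans
        (le_max_right _ _)
  · have h2 := tendsto_lev_jost hu h (σ p)
    rwa [if_neg (fun e => hp.ne' (h.inj e))] at h2
  · have h2 := tendsto_lev_jost hu h (σ 0)
    rwa [if_pos rfl] at h2

lemma isCol_zero_iff {b : Fin 3 → ℂ³} {d : ℂ} :
    IsCol u k σ b 0 d C ↔ C = (d / (3 * l (σ 0) k ^ 2 - 1)) • jost u (σ 0) k := by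
  have hπ := h.pi_ne_zero 0
  have hj := (isCol_jost hu h b).smul (d / (3 * l (σ 0) k ^ 2 - 1))
  rw [div_mul_cancel₀ _ hπ] at hj
  constructor
  · intro hC
    have hd := hC.add (hj.smul (-1))
    rw [neg_one_mul, add_neg_cancel] at hd
    obtain ⟨M, hM⟩ := hd.bdd
    have hz := eq_zero_of_bounded hu h.ns h.min hM (fun i => by
      obtain ⟨p, rfl⟩ := (Finite.injective_iff_surjective.1 h.inj) i
      rcases (Fin.zero_le p).eq_or_lt with rfl | hp
      · exact hd.diag
      · exact hd.lim p hp)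
    rw [neg_one_smul, ← sub_eq_add_neg] at hz
    exact _root_.sub_eq_zero.1 hz
  · rintro rfl
    exact hj

lemma cross_topRow_bound_and_limit (b : ℂ³) : (∃ M, ∀ x : ℝ, 0 ≤ x → ‖exp (-l (σ 1) k * x) •
      (propX u 0 (lam k) x *ᵥ crossProduct b (topRow u σ k))‖ ≤ M) ∧
    Tendsto (fun x : ℝ => lev (l (σ 1) k) (propX u 0 (lam k) x *ᵥ crossProduct b (topRow u σ k)) *
      exp (-l (σ 1) k * x)) atTop
      (𝓝 ((l (σ 2) k - l (σ 1) k) * (b ⬝ᵥ jost u (σ 0) k))) := by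
  obtain ⟨w, rfl⟩ := rowR_surjective b
  obtain ⟨M, hM⟩ := forward_bound hu h.rev w
  obtain ⟨N, hN⟩ := (isCol_jost hu h.rev 0).bdd
  simp only [l_neg, neg_neg, lam_neg, sub_zero, sub_self] at hM hN
  set y : ℝ → ℂ³ := fun x => exp (l (σ 0) k * x) • rowR (propX u 0 (-lam k) x *ᵥ w) with hy
  set e : ℝ → ℂ³ := fun x => exp (l (σ 2) k * x) •
    rowR (propX u 0 (-lam k) x *ᵥ jost u (σ 2) (-k)) with he
  have hyb : ∀ x : ℝ, 0 ≤ x → ‖y x‖ ≤ 2 * M := fun x hx => by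
    simp only [hy, ← rowR_smul]
    exact (norm_rowR_le _).trans (by linarith [hM x hx])
  have heb : ∀ x : ℝ, 0 ≤ x → ‖e x‖ ≤ 2 * N := fun x hx => by
    simp only [he, ← rowR_smul]
    exact (norm_rowR_le _).trans (by linarith [hN x hx])
  have hprop : ∀ x : ℝ, 0 ≤ x → exp (-l (σ 1) k * x) •
      (propX u 0 (lam k) x *ᵥ crossProduct (rowR w) (topRow u σ k)) =
      crossProduct (y x) (e x) := fun x hx => by
    rw [topRow, propX_cross hu (lam k) hx zero_mem_Icc, hy, he]
    simp only [LinearMap.map_smul, LinearMap.smul_apply, smul_smul, ← exp_add]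
    congr 2
    linear_combination (-(x : ℂ)) * h.sum
  refine ⟨⟨2 * (2 * M) * (2 * N), fun x hx => ?_⟩, ?_⟩
  · rw [hprop x hx]
    have := hyb x hx
    have := heb x hx
    exact (norm_cross_le _ _).trans (by gcongr; linarith [norm_nonneg (y x)])
  · set ρ₁ : ℂ³ := ![l (σ 1) k ^ 2 - 1, l (σ 1) k, 1] with hρ₁
    set ρ₂ : ℂ³ := ![l (σ 2) k ^ 2 - 1, l (σ 2) k, 1] with hρ₂
    have hcr : crossProduct ρ₂ ρ₁ = (l (σ 2) k - l (σ 1) k) • pvec (l (σ 0) k) := h.roots.cross_lev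
    have t1 : Tendsto (fun x => crossProduct (e x - ρ₂) ρ₁) atTop (𝓝 0) := by
      have ht := (tendsto_topRow hu h).sub_const ρ₂
      rw [sub_self] at ht
      have := (ht.norm.const_mul 2).mul_const ‖ρ₁‖
      rw [norm_zero, mul_zero, zero_mul] at this
      exact squeeze_zero_norm (fun x => norm_cross_le _ _) this
    have t2 := (tendsto_jost hu h.mem_minRegion).sub_const (pvec (l (σ 0) k))
    rw [sub_self] at t2
    have d1 := tendsto_dot_zero hyb t1
    have d2 := tendsto_dot_zero hyb t2
    have d := (d1.sub (d2.const_mul (l (σ 2) k - l (σ 1) k))).add_const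
      ((l (σ 2) k - l (σ 1) k) * (rowR w ⬝ᵥ jost u (σ 0) k))
    rw [mul_zero, sub_zero, zero_add] at d
    refine d.congr' ?_
    filter_upwards [eventually_ge_atTop 0] with x hx
    have hp := rowR_propX_dot hu (lam k) zero_mem_Icc (jost u (σ 0) k) w x
    have hyx : y x ⬝ᵥ (exp (-l (σ 0) k * x) • (propX u 0 (lam k) x *ᵥ jost u (σ 0) k)) =
        rowR w ⬝ᵥ jost u (σ 0) k := by
      rw [← hp, hy]
      simp only [smul_dotProduct, dotProduct_smul, smul_smul, ← exp_add, neg_mul, neg_add_cancel,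
        exp_zero, one_smul]
    rw [mul_comm _ (exp _), ← lev_smul, hprop x hx, lev_eq_dot,
      dot_cross_rotate _ (y x), dotProduct_sub, hyx, LinearMap.map_sub, LinearMap.sub_apply, dotProduct_sub, hcr,
      dotProduct_smul, smul_eq_mul]
    ring

lemma isCol_one_iff {b : Fin 3 → ℂ³} (hΔ : b 0 ⬝ᵥ jost u (σ 0) k ≠ 0) {d : ℂ} :
    IsCol u k σ b 1 d C ↔ C = (d / ((l (σ 2) k - l (σ 1) k) * (b 0 ⬝ᵥ jost u (σ 0) k))) •
      crossProduct (b 0) (topRow u σ k) := by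
  have h21 : l (σ 2) k - l (σ 1) k ≠ 0 := h.sub_ne_zero (by decide)
  constructor
  · intro hC
    have h0 : topRow u σ k ⬝ᵥ C = 0 := tendsto_nhds_unique (tendsto_top hu h C) (hC.lim 2 (by decide))
    obtain ⟨w, rfl⟩ := exists_eq_cross (topRow_ne_zero hu h) h0
    have hd := tendsto_nhds_unique hC.diag (cross_topRow_bound_and_limit hu h w).2
    have hb := hC.start 0 (by decide)
    have e1 := cross_cross_right (jost u (σ 0) k) w (topRow u σ k)
    rw [dotProduct_comm _ (topRow u σ k), topRow_jost hu h, zero_smul, zero_sub] at e1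
    have e2 := cross_cross_right (b 0) (jost u (σ 0) k) (crossProduct w (topRow u σ k))
    rw [hb, zero_smul, zero_sub, e1, LinearMap.map_neg, LinearMap.map_smul, neg_inj] at e2
    rw [hd, mul_div_mul_left _ _ h21, dotProduct_comm w, div_eq_inv_mul, mul_smul, e2, smul_smul,
      inv_mul_cancel₀ hΔ, one_smul]
  · rintro rfl
    have hb : IsCol u k σ b 1 ((l (σ 2) k - l (σ 1) k) * (b 0 ⬝ᵥ jost u (σ 0) k))
        (crossProduct (b 0) (topRow u σ k)) := by
      refine ⟨(cross_topRow_bound_and_limit hu h (b 0)).1, fun p hp => ?_,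
        (cross_topRow_bound_and_limit hu h (b 0)).2, fun p hp => ?_⟩
      · obtain rfl : p = 2 := by lia
        have := tendsto_top hu h (crossProduct (b 0) (topRow u σ k))
        rwa [dot_cross_self] at this
      · obtain rfl : p = 0 := by lia
        exact dot_self_cross _ _
    simpa only [div_mul_cancel₀ _ (mul_ne_zero h21 hΔ)] using
      hb.smul (d / ((l (σ 2) k - l (σ 1) k) * (b 0 ⬝ᵥ jost u (σ 0) k)))

lemma isCol_one_add_jost {b : Fin 3 → ℂ³} (hΔ : b 0 ⬝ᵥ jost u (σ 0) k = 0) :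
    IsCol u k σ b 1 0 (jost u (σ 0) k) := by
  have hj := isCol_jost hu h b
  obtain ⟨M, hM⟩ := hj.bdd
  refine ⟨⟨M, fun x hx => le_trans ?_ (hM x hx)⟩, fun p hp => ?_, ?_, fun p hp => ?_⟩
  · exact norm_exp_smul_le h.le01 hx _
  · exact hj.lim p (lt_of_le_of_lt (by decide) hp)
  · exact hj.lim 1 (by decide)
  · obtain rfl : p = 0 := by lia
    exact hΔ

lemma isCol_two {b : Fin 3 → ℂ³} {d : ℂ} :
    IsCol u k σ b 2 d C ↔ topRow u σ k ⬝ᵥ C = d ∧ b 0 ⬝ᵥ C = 0 ∧ b 1 ⬝ᵥ C = 0 := by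
  refine ⟨fun hC => ⟨tendsto_nhds_unique (tendsto_top hu h C) hC.diag, hC.start 0 (by decide),
    hC.start 1 (by decide)⟩, ?_⟩
  · rintro ⟨h2, h0, h1⟩
    refine ⟨forward_bound hu h C, fun p hp => ?_, ?_, fun p hp => ?_⟩
    · lia
    · rw [← h2]; exact tendsto_top hu h C
    · cases p using fin3
      · exact h0
      · exact h1
      · exact absurd hp (by decide)

lemma isCol_two_iff {b : Fin 3 → ℂ³} (hΔ : topRow u σ k ⬝ᵥ crossProduct (b 0) (b 1) ≠ 0) {d : ℂ} :
    IsCol u k σ b 2 d C ↔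
      C = (d / (topRow u σ k ⬝ᵥ crossProduct (b 0) (b 1))) • crossProduct (b 0) (b 1) := by
  rw [isCol_two hu h]
  constructor
  · rintro ⟨h2, h0, h1⟩
    have e1 := cross_cross_right C (b 0) (b 1)
    rw [dotProduct_comm, h1, dotProduct_comm C, h0, zero_smul, zero_smul, sub_zero] at e1
    have e2 := cross_cross_right (topRow u σ k) C (crossProduct (b 0) (b 1))
    rw [e1, LinearMap.map_zero, h2] at e2
    rw [div_eq_inv_mul, mul_smul, ← _root_.sub_eq_zero.1 e2.symm, smul_smul, inv_mul_cancel₀ hΔ, one_smul]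
  · rintro rfl
    refine ⟨?_, ?_, ?_⟩
    · rw [dotProduct_smul, smul_eq_mul, div_mul_cancel₀ _ hΔ]
    · rw [dotProduct_smul, dot_self_cross, smul_zero]
    · rw [dotProduct_smul, dot_cross_self, smul_zero]

lemma exists_isCol_two_zero {b : Fin 3 → ℂ³}
    (hΔ : topRow u σ k ⬝ᵥ crossProduct (b 0) (b 1) = 0) : ∃ v ≠ 0, IsCol u k σ b 2 0 v := by
  rw [triple_product_eq_det] at hΔ
  obtain ⟨v, hv, h0⟩ := Matrix.exists_mulVec_eq_zero_iff.2 hΔ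
  exact ⟨v, hv, (isCol_two hu h).2 ⟨congrFun h0 0, congrFun h0 1, congrFun h0 2⟩⟩

end

/-! ### Contour integrals of exact forms -/

lemma contourIntegral_const_mul (T : ℝ) (c : Contour) (x t : ℝ) (e : ℂ) (a b : ℝ → ℝ → ℂ) :
    contourIntegral T c x t (fun x' t' => e * a x' t') (fun x' t' => e * b x' t') =
      e * contourIntegral T c x t a b := by
  cases c <;> simp only [contourIntegral, intervalIntegral.integral_const_mul, integral_const_mul] <;>
    ring

lemma integral_eq_sub_of_hasDeriv {a b : ℝ} (hab : a ≤ b) {f f' : ℝ → ℂ}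
    (hf' : ContinuousOn f' (Icc a b))
    (hf : ∀ s ∈ Icc a b, HasDerivWithinAt f (f' s) (Icc a b) s) : ∫ s in a..b, f' s = f b - f a :=
  intervalIntegral.integral_eq_sub_of_hasDerivAt_of_le hab (fun s hs => (hf s hs).continuousWithinAt)
    (fun s hs => (hf s (Ioo_subset_Icc_self hs)).hasDerivAt (Icc_mem_nhds hs.1 hs.2))
    (hf'.intervalIntegrable_of_Icc hab)

lemma integrableOn_of_decay {g : ℝ → ℂ} {C : ℝ} (hg : ContinuousOn g (Ici 0))
    (hb : ∀ s, 0 ≤ s → ‖g s‖ ≤ C / (1 + s) ^ 2) : IntegrableOn g (Ioi 0) := by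
  have h0 : IntegrableOn (fun s : ℝ => C / (1 + s) ^ 2) (Ioi 0) := by
    refine integrableOn_Ioi_deriv_of_nonneg' (g := fun s => -C / (1 + s)) (l := 0)
      (fun s hs => hasDerivAt_neg_div_one_add C hs) (fun s hs => ?_) ?_
    · exact (norm_nonneg _).trans (hb s (le_of_lt hs))
    · exact (tendsto_atTop_add_const_left _ _ tendsto_id).const_div_atTop _
  refine Integrable.mono' h0 ((hg.mono Ioi_subset_Ici_self).aestronglyMeasurable measurableSet_Ioi) ?_
  filter_upwards [ae_restrict_mem measurableSet_Ioi] with s hs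
  exact hb s (le_of_lt hs)

lemma tendsto_of_contourIntegral_three {T x t : ℝ} {f a b : ℝ → ℝ → ℂ} (hx : 0 ≤ x)
    (ha : ContinuousOn (fun s => a s t) (Ici 0))
    (hf : ∀ s, 0 ≤ s → HasDerivWithinAt (fun s => f s t) (a s t) (Ici 0) s) {C : ℝ}
    (hb : ∀ s, 0 ≤ s → ‖a s t‖ ≤ C / (1 + s) ^ 2) :
    Tendsto (fun s => f s t) atTop (𝓝 (f x t - contourIntegral T γ₃ x t a b)) := by
  have hi := (integrableOn_of_decay ha hb).mono_set (Ioi_subset_Ioi hx)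
  have h1 := (intervalIntegral_tendsto_integral_Ioi x hi tendsto_id).const_add (f x t)
  rw [contourIntegral, sub_neg_eq_add]
  refine h1.congr' ?_
  filter_upwards [eventually_ge_atTop x] with X hX
  have hs : Icc x X ⊆ Ici 0 := fun y hy => hx.trans hy.1
  have := integral_eq_sub_of_hasDeriv hX (ha.mono hs) fun s h => (hf s (hs h)).mono hs
  rw [id, this]; ring

/-! ### Diagonalization -/

/-- The companion matrix of `s³ - s - lm`. -/
def U0 (lm : ℂ) : Mat3 := !![0, 1, 0; 0, 0, 1; lm, 1, 0]

/-- The matrix of the `t`-part of the Lax pair with vanishing potential. -/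
def W0 (lm : ℂ) : Mat3 := !![-(2 / (3 * lm)), 0, 1 / lm; 1, 1 / (3 * lm), 0; 0, 1, 1 / (3 * lm)]

lemma coord_U0 {s lm : ℂ} (h : s ^ 3 - s = lm) (w : ℂ³) : coord s (U0 lm *ᵥ w) = s * coord s w := by
  simp only [coord]
  rw [← mul_div_assoc]
  congr 1
  simp [lev, U0, mulVec, dotProduct, sum_univ_three]
  linear_combination (-w 0) * h

lemma coord_W0 {s lm : ℂ} (h : s ^ 3 - s = lm) (hlm : lm ≠ 0) (w : ℂ³) :
    coord s (W0 lm *ᵥ w) = (s ^ 2 - 2 / 3) / lm * coord s w := by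
  simp only [coord]
  rw [← mul_div_assoc]
  congr 1
  simp [lev, W0, mulVec, dotProduct, sum_univ_three]
  field_simp
  linear_combination (-(3 * s * w 0) - 3 * w 1) * h

lemma norm_coord_le (s : ℂ) : ∃ c, 0 ≤ c ∧ ∀ w : ℂ³, ‖coord s w‖ ≤ c * ‖w‖ := by
  refine ⟨(‖s ^ 2 - 1‖ + ‖s‖ + 1) / ‖3 * s ^ 2 - 1‖, by positivity, fun w => ?_⟩
  rw [coord, norm_div, div_mul_eq_mul_div]
  gcongr
  rw [lev]
  refine norm_add₃_le.trans ?_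
  rw [norm_mul, norm_mul, add_mul, add_mul, one_mul]
  gcongr <;> exact norm_le_pi_norm w _

lemma hasDeriv_coord_comp {χ : ℝ → ℂ³} {χ' : ℂ³} {S : Set ℝ} (h : HasDerivWithinAt χ χ' S x) (s : ℂ) :
    HasDerivWithinAt (fun y => coord s (χ y)) (coord s χ') S x := by
  have e := hasDerivWithinAt_pi.1 h
  exact ((((e 0).const_mul (s ^ 2 - 1)).add ((e 1).const_mul s)).add (e 2)).div_const χ[s]

section

variable (hk : NonSpecial k) {S : Set ℝ} {α β : ℂ} {N : Mat3} {θ : ℝ → ℂ} {j : Fin 3}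

include hk

lemma hasDeriv_diag {χ : ℝ → ℂ³}
    (hχ : HasDerivWithinAt χ ((α • U0 (lam k) + β • W0 (lam k) + N) *ᵥ χ x) S x)
    (hθ : HasDerivWithinAt θ (α * l j k + β * z j k) S x) (i : Fin 3) :
    HasDerivWithinAt (fun y => coord (l i k) (χ y) * exp (-θ y))
      (α * ((l i k - l j k) * (coord (l i k) (χ x) * exp (-θ x)))
        + β * ((z i k - z j k) * (coord (l i k) (χ x) * exp (-θ x)))
        + coord (l i k) (N *ᵥ χ x) * exp (-θ x)) S x := by
  have h := (hasDeriv_coord_comp hχ (l i k)).mul hθ.neg.cexp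
  refine h.congr_deriv ?_
  have hc := (isRoots_l hk.1).cubic i
  rw [add_mulVec, add_mulVec, coord_add, coord_add, smul_mulVec,
    smul_mulVec, coord_smul, coord_smul, coord_U0 hc, coord_W0 hc (lam_ne_zero hk),
    ← z_eq i hk.1]
  simp only [Pi.neg_apply]
  ring

lemma hasDeriv_undiag {v : ℝ → ℂ³}
    (hv : ∀ i, HasDerivWithinAt (fun y => v y i) (α * ((l i k - l j k) * v x i)
        + β * ((z i k - z j k) * v x i) + coord (l i k) (N *ᵥ (P k *ᵥ v x))) S x)
    (hθ : HasDerivWithinAt θ (α * l j k + β * z j k) S x) :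
    HasDerivWithinAt (fun y => exp (θ y) • (P k *ᵥ v y))
      ((α • U0 (lam k) + β • W0 (lam k) + N) *ᵥ (exp (θ x) • (P k *ᵥ v x))) S x := by
  have hr := isRoots_l hk.1
  have hd := disc_ne_zero hk
  have hE := hθ.cexp
  have hP : HasDerivWithinAt (fun y => P k *ᵥ v y) (∑ i, (α * ((l i k - l j k) * v x i)
        + β * ((z i k - z j k) * v x i) + coord (l i k) (N *ᵥ (P k *ᵥ v x))) • pvec (l i k)) S x := by
    simp only [P_mulVec]
    exact HasDerivWithinAt.fun_sum fun i _ => by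
      have := (hv i).smul_const (pvec (l i k))
      simpa only [P_mulVec] using this
  refine (hE.smul hP).congr_deriv ?_
  have e1 : U0 (lam k) *ᵥ (P k *ᵥ v x) = ∑ i, (l i k * v x i) • pvec (l i k) := by
    rw [← hr.sum_coord hd (U0 (lam k) *ᵥ (P k *ᵥ v x))]
    refine sum_congr rfl fun i _ => ?_
    rw [coord_U0 (hr.cubic i), coord_P_mulVec hk]
  have e2 : W0 (lam k) *ᵥ (P k *ᵥ v x) = ∑ i, (z i k * v x i) • pvec (l i k) := by
    rw [← hr.sum_coord hd (W0 (lam k) *ᵥ (P k *ᵥ v x))]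
    refine sum_congr rfl fun i _ => ?_
    rw [coord_W0 (hr.cubic i) (lam_ne_zero hk), coord_P_mulVec hk, ← z_eq i hk.1]
  have e3 : N *ᵥ (P k *ᵥ v x) = ∑ i, coord (l i k) (N *ᵥ (P k *ᵥ v x)) • pvec (l i k) :=
    (hr.sum_coord hd _).symm
  rw [mulVec_smul, add_mulVec, add_mulVec, smul_mulVec, smul_mulVec, e1, e2]
  generalize N *ᵥ (P k *ᵥ v x) = w at e3 ⊢
  conv_rhs => rw [e3]
  rw [P_mulVec]
  simp only [sum_univ_three]
  module

end

/-! ### The perturbation matrices -/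

/-- The potential part of the `x`-part of the first Lax pair. -/
def N1 (u : 𝓕) (lm : ℂ) (x t : ℝ) : Mat3 :=
  !![0, 0, 0; 0, 0, 0; lm * ((q u x t : ℂ) ^ 3 - 1), 0, 0]

/-- The potential part of the `t`-part of the first Lax pair. -/
def N2 (u : 𝓕) (lm : ℂ) (x t : ℝ) : Mat3 :=
  !![(dx u 1 x t : ℂ), -(u x t : ℂ), 0; (u x t : ℂ), 0, -(u x t : ℂ);
    (dx u 1 x t : ℂ) - lm * u x t * (q u x t : ℂ) ^ 3, 0, -(dx u 1 x t : ℂ)]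

/-- The potential part of the `x`-part of the second Lax pair. -/
def tN1 (u : 𝓕) (x t : ℝ) : Mat3 :=
  !![(qx u x t : ℂ) / q u x t, 0, 0; 0, 0, 0;
    0, 1 / (q u x t : ℂ) - q u x t, -((qx u x t : ℂ) / q u x t)]

/-- The potential part of the `t`-part of the second Lax pair. -/
def tN2 (u : 𝓕) (lm : ℂ) (x t : ℝ) : Mat3 :=
  !![-((u x t : ℂ) * qx u x t / q u x t), 0, 0; ((u x t : ℂ) + 1) / q u x t - 1, 0, 0;
      (dx u 1 x t : ℂ) / (q u x t : ℂ) ^ 2, 1 / (q u x t : ℂ) - 1 + u x t * q u x t,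
        (u x t : ℂ) * qx u x t / q u x t]
    + (((q u x t : ℂ) ^ 2 - 1) / lm) • !![0, 0, 1; 0, 0, 0; 0, 0, 0]

section

include hu

lemma Umat_eq (lm : ℂ) (hx : 0 ≤ x) (ht : t ∈ Icc 0 T) :
    Umat u lm x t = (1 : ℂ) • U0 lm + (0 : ℂ) • W0 lm + N1 u lm x t := by
  have hq : (q u x t : ℂ) ^ 3 = mom u x t + 1 := by exact_mod_cast q_cube hu hx ht
  ext i j
  fin_cases i <;> fin_cases j <;> simp [Umat, U0, N1, hq]
  ring

lemma Wmat_eq (lm : ℂ) (hx : 0 ≤ x) (ht : t ∈ Icc 0 T) :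
    Wmat u lm x t = (0 : ℂ) • U0 lm + (1 : ℂ) • W0 lm + N2 u lm x t := by
  have hq : (q u x t : ℂ) ^ 3 = mom u x t + 1 := by exact_mod_cast q_cube hu hx ht
  ext i j
  fin_cases i <;> fin_cases j <;> simp [Wmat, W0, N2, hq]
  ring

end

/-! ### Gauge frames

Both Lax pairs arise from the system with the matrices `Umat`, `Wmat` by a diagonal gauge
transformation and a phase. -/

/-- `diag(r, 1, 1/r)`. -/
def dgm (r : ℝ) : Mat3 := !![(r : ℂ), 0, 0; 0, 1, 0; 0, 0, (r : ℂ)⁻¹]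

/-- `diag(c, 0, -c)`. -/
def hmat (c : ℝ) : Mat3 := !![(c : ℂ), 0, 0; 0, 0, 0; 0, 0, -(c : ℂ)]

lemma dgm_mulVec (r : ℝ) (w : ℂ³) : dgm r *ᵥ w = ![r * w 0, w 1, (r : ℂ)⁻¹ * w 2] := by
  funext i
  cases i using fin3 <;> simp [dgm, mulVec, dotProduct, sum_univ_three]

lemma dgm_inv_mul {r : ℝ} (hr : r ≠ 0) : dgm r⁻¹ * dgm r = 1 := by
  have hr' : (r : ℂ) ≠ 0 := by exact_mod_cast hr
  ext i j
  fin_cases i <;> fin_cases j <;> simp [dgm, hr']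

lemma dgm_mul_inv {r : ℝ} (hr : r ≠ 0) : dgm r * dgm r⁻¹ = 1 := by
  simpa using dgm_inv_mul (inv_ne_zero hr)

lemma dgm_one : dgm 1 = 1 := by
  ext i j
  fin_cases i <;> fin_cases j <;> simp [dgm]

lemma hasDeriv_dgm_mulVec {r : ℝ → ℝ} {r' : ℝ} {w : ℝ → ℂ³} {w' : ℂ³}
    {S : Set ℝ} (hr : HasDerivWithinAt r r' S x) (h0 : r x ≠ 0)
    (hw : HasDerivWithinAt w w' S x) :
    HasDerivWithinAt (fun s => dgm (r s) *ᵥ w s)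
      (hmat (r' / r x) *ᵥ (dgm (r x) *ᵥ w x) + dgm (r x) *ᵥ w') S x := by
  have h0' : (r x : ℂ) ≠ 0 := by exact_mod_cast h0
  have hc := hr.ofReal_comp
  have e := hasDerivWithinAt_pi.1 hw
  refine hasDerivWithinAt_pi.2 fun i => ?_
  cases i using fin3
  · simp only [dgm_mulVec, cons_val_zero]
    refine (hc.mul (e 0)).congr_deriv ?_
    simp [hmat]
    field_simp
  · simp only [dgm_mulVec, cons_val_one]
    refine (e 1).congr_deriv ?_
    simp [hmat]
  · simp only [dgm_mulVec, cons_val]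
    refine ((hc.inv h0').mul (e 2)).congr_deriv ?_
    simp [hmat]
    field_simp

lemma hasDeriv_gauge {r : ℝ → ℝ} {r' : ℝ} {ψ : ℝ → ℂ³} {A B : Mat3}
    {S : Set ℝ} (hr : HasDerivWithinAt r r' S x) (h0 : r x ≠ 0)
    (hAB : hmat (r' / r x) + dgm (r x) * A * dgm (r x)⁻¹ = B)
    (hψ : HasDerivWithinAt ψ (A *ᵥ ψ x) S x) :
    HasDerivWithinAt (fun s => dgm (r s) *ᵥ ψ s) (B *ᵥ (dgm (r x) *ᵥ ψ x)) S x := by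
  refine (hasDeriv_dgm_mulVec hr h0 hψ).congr_deriv ?_
  rw [← hAB, add_mulVec]
  simp only [mulVec_mulVec, Matrix.mul_assoc, dgm_inv_mul h0, mul_one]

lemma hasDeriv_ungauge {r : ℝ → ℝ} {r' : ℝ} {χ : ℝ → ℂ³} {A B : Mat3}
    {S : Set ℝ} (hr : HasDerivWithinAt r r' S x) (h0 : r x ≠ 0)
    (hAB : hmat (r' / r x) + dgm (r x) * A * dgm (r x)⁻¹ = B)
    (hχ : HasDerivWithinAt χ (B *ᵥ χ x) S x) :
    HasDerivWithinAt (fun s => dgm (r s)⁻¹ *ᵥ χ s) (A *ᵥ (dgm (r x)⁻¹ *ᵥ χ x)) S x := by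
  have e : -r' / r x ^ 2 / (r x)⁻¹ = -(r' / r x) := by field_simp
  have hc : hmat (-(r' / r x)) * dgm (r x)⁻¹ = -(dgm (r x)⁻¹ * hmat (r' / r x)) := by
    ext i j
    fin_cases i <;> fin_cases j <;> simp [dgm, hmat] <;> ring
  refine (hasDeriv_dgm_mulVec (hr.inv h0) (inv_ne_zero h0) hχ).congr_deriv ?_
  simp only [Pi.inv_apply]
  rw [e, ← hAB, mulVec_mulVec, hc, add_mulVec, mulVec_add, Matrix.neg_mulVec,
    mulVec_mulVec, neg_add_cancel_left]
  simp only [mulVec_mulVec, ← Matrix.mul_assoc, dgm_inv_mul h0, one_mul]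

/-- A gauge function `ρ` with its derivatives, a phase `Y` with its `t`-derivative `b`, the potential
parts `N`, `M` of the transformed system, the time domain, and the limit of `Y - x`. -/
structure Frame where
  ρ : ℝ → ℝ → ℝ
  ρx : ℝ → ℝ → ℝ
  ρt : ℝ → ℝ → ℝ
  Y : ℝ → ℝ → ℝ
  b : ℝ → ℝ → ℝ
  N : ℂ → ℝ → ℝ → Mat3
  M : ℂ → ℝ → ℝ → Mat3
  τ : Set ℝ
  c : ℝ

/-- The frame transforms the system with the matrices `Umat`, `Wmat`. -/
structure Frame.Good (F : Frame) (u : 𝓕) (T : ℝ) : Prop where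
  τ_sub : F.τ ⊆ Icc 0 T
  zero_mem : 0 ∈ F.τ
  Icc_sub : ∀ t ∈ F.τ, Icc 0 t ⊆ F.τ
  ρ_pos : ∀ x t, 0 ≤ x → t ∈ Icc 0 T → 0 < F.ρ x t
  ρ_bd : ∃ C, ∀ x t, 0 ≤ x → t ∈ Icc 0 T → F.ρ x t ≤ C ∧ (F.ρ x t)⁻¹ ≤ C
  ρ_lim : Tendsto (fun x => F.ρ x 0) atTop (𝓝 1)
  dρx : ∀ x t, 0 ≤ x → t ∈ Icc 0 T → HasDerivWithinAt (fun s => F.ρ s t) (F.ρx x t) (Ici 0) x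
  dρt : ∀ x t, 0 ≤ x → t ∈ Icc 0 T → HasDerivWithinAt (fun s => F.ρ x s) (F.ρt x t) (Icc 0 T) t
  dYx : ∀ x t, 0 ≤ x → t ∈ Icc 0 T → HasDerivWithinAt (fun s => F.Y s t) (F.ρ x t) (Ici 0) x
  dYt : ∀ x t, 0 ≤ x → t ∈ Icc 0 T → HasDerivWithinAt (fun s => F.Y x s) (F.b x t) (Icc 0 T) t
  Y_zero : F.Y 0 0 = 0
  Y_bd : ∃ C, ∀ x t, 0 ≤ x → t ∈ Icc 0 T → |F.Y x t - x| ≤ C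
  Y_lim : Tendsto (fun x => F.Y x 0 - x) atTop (𝓝 F.c)
  eqx : ∀ lm x t, 0 ≤ x → t ∈ Icc 0 T → hmat (F.ρx x t / F.ρ x t) + dgm (F.ρ x t) *
    Umat u lm x t * dgm (F.ρ x t)⁻¹ = (F.ρ x t : ℂ) • U0 lm + (0 : ℂ) • W0 lm + F.N lm x t
  eqt : ∀ lm x t, lm ≠ 0 → 0 ≤ x → t ∈ Icc 0 T → hmat (F.ρt x t / F.ρ x t) + dgm (F.ρ x t) *
    Wmat u lm x t * dgm (F.ρ x t)⁻¹ = (F.b x t : ℂ) • U0 lm + (1 : ℂ) • W0 lm + F.M lm x t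
  contN : ∀ lm t, t ∈ Icc 0 T → ∀ i j, ContinuousOn (fun x => F.N lm x t i j) (Ici 0)
  contM : ∀ lm i j, ContinuousOn (fun t => F.M lm 0 t i j) (Icc 0 T)
  decN : ∀ lm, ∃ C, ∀ x t, 0 ≤ x → t ∈ Icc 0 T → ∀ i j, ‖F.N lm x t i j‖ ≤ C / (1 + x) ^ 2
  decM : ∀ lm, ∃ C, ∀ x t, 0 ≤ x → t ∈ Icc 0 T → ∀ i j, ‖F.M lm x t i j‖ ≤ C / (1 + x) ^ 2

lemma norm_dgm_mulVec_le {r C : ℝ} (h0 : 0 < r) (h1 : r ≤ C) (h2 : r⁻¹ ≤ C) (w : ℂ³) :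
    ‖dgm r *ᵥ w‖ ≤ max C 1 * ‖w‖ := by
  refine (pi_norm_le_iff_of_nonneg (by positivity)).2 fun i => ?_
  rw [dgm_mulVec]
  have hw := norm_le_pi_norm w
  cases i using fin3
  · simp only [cons_val_zero, norm_mul, norm_real, norm_eq_abs, abs_of_pos h0]
    exact mul_le_mul (h1.trans (le_max_left _ _)) (hw 0) (norm_nonneg _) (by positivity)
  · simp only [cons_val_one]
    exact (hw 1).trans (le_mul_of_one_le_left (norm_nonneg _) (le_max_right _ _))
  · simp only [cons_val, norm_mul, norm_inv, norm_real, norm_eq_abs, abs_of_pos h0]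
    exact mul_le_mul (h2.trans (le_max_left _ _)) (hw 2) (norm_nonneg _) (by positivity)

/-- The phase `l_j Y + z_j t`. -/
def Frame.phase (F : Frame) (k : ℂ) (j : Fin 3) (x t : ℝ) : ℂ := l j k * F.Y x t + z j k * t

/-- The column with index `j` of the eigenfunction generated by the vector `C`. -/
def Frame.col (F : Frame) (u : 𝓕) (T : ℝ) (k : ℂ) (j : Fin 3) (C : ℂ³) (x t : ℝ) :
    ℂ³ := fun i =>
  coord (l i k) (dgm (F.ρ x t) *ᵥ (Psi u T (lam k) x t *ᵥ C)) * exp (-F.phase k j x t)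

/-- The time at which the contour `γ_{ij}` starts on the boundary `x = 0`. -/
def startTime (T : ℝ) (n : Fin 18) (i j : Fin 3) : ℝ :=
  match contour n i j with
  | γ₁ => T
  | _ => 0

/-- The row expressing the initial condition of the entry `(n#p, n#r)`. -/
def Frame.row (F : Frame) (u : 𝓕) (T : ℝ) (n : Fin 18) (k : ℂ) (r p : Fin 3) : ℂ³ :=
  ![l n#p k ^ 2 - 1, l n#p k, 1] ᵥ* (dgm (F.ρ 0 (startTime T n n#p n#r)) *
      Psi u T (lam k) 0 (startTime T n n#p n#r))

lemma Frame.P_col (hk : NonSpecial k) (F : Frame) (u : 𝓕) (T : ℝ) (j : Fin 3)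
    (C : ℂ³) (x t : ℝ) : P k *ᵥ F.col u T k j C x t =
      exp (-F.phase k j x t) • (dgm (F.ρ x t) *ᵥ (Psi u T (lam k) x t *ᵥ C)) := by
  have : F.col u T k j C x t = fun i => coord (l i k) (exp (-F.phase k j x t) •
      (dgm (F.ρ x t) *ᵥ (Psi u T (lam k) x t *ᵥ C))) := by
    funext i; rw [coord_smul, mul_comm]; rfl
  rw [this, P_mulVec_coord hk]

lemma lOrd_injective (n : Fin 18) : Function.Injective (lOrd n) := by
  revert n; decide

lemma before_lOrd : Before (lOrd n) n#p n#r ↔ p < r :=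
  ⟨fun ⟨_, _, h, e1, e2⟩ => by rwa [← lOrd_injective n e1, ← lOrd_injective n e2],
    fun h => ⟨p, r, h, rfl, rfl⟩⟩

lemma contour_of_le (h : r ≤ p) : contour n n#p n#r = γ₃ := by
  rw [contour, if_neg]
  rw [before_lOrd]; exact not_lt.2 h

lemma contour_of_lt (h : p < r) : contour n n#p n#r = γ₂ ∨ contour n n#p n#r = γ₁ := by
  rw [contour, if_pos (before_lOrd.2 h)]
  split_ifs <;> simp

/-- The `x`-part of the Lax pair for the column with index `j`. -/
def Frame.LaxX (F : Frame) (k : ℂ) (j : Fin 3) (v : ℝ → ℝ → ℂ³) : Prop :=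
  ∀ x t, 0 ≤ x → t ∈ F.τ → ∀ i, HasDerivWithinAt (fun s => v s t i)
    (F.ρ x t * ((l i k - l j k) * v x t i) + 0 * ((z i k - z j k) * v x t i)
      + coord (l i k) (F.N (lam k) x t *ᵥ (P k *ᵥ v x t))) (Ici 0) x

/-- The `t`-part of the Lax pair for the column with index `j`. -/
def Frame.LaxT (F : Frame) (k : ℂ) (j : Fin 3) (v : ℝ → ℝ → ℂ³) : Prop :=
  ∀ x t, 0 ≤ x → t ∈ F.τ → ∀ i, HasDerivWithinAt (fun s => v x s i)
    (F.b x t * ((l i k - l j k) * v x t i) + 1 * ((z i k - z j k) * v x t i)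
      + coord (l i k) (F.M (lam k) x t *ᵥ (P k *ᵥ v x t))) F.τ t

/-- The column equations: the two differential equations, boundedness and the integral equations. -/
structure Frame.IsSolCol (F : Frame) (T : ℝ) (n : Fin 18) (k : ℂ) (j : Fin 3)
    (v : ℝ → ℝ → ℂ³) : Prop where
  lax_x : F.LaxX k j v
  lax_t : F.LaxT k j v
  bounded : ∀ t ∈ F.τ, ∃ C : ℝ, ∀ x, 0 ≤ x → ∀ i, ‖v x t i‖ ≤ C
  integral_eq : ∀ x t, 0 ≤ x → t ∈ F.τ → ∀ i,
    v x t i = (if i = j then 1 else 0) + contourIntegral T (contour n i j) x t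
      (fun x' t' => exp ((l i k - l j k) * ((F.Y x t - F.Y x' t' : ℝ) : ℂ)
        + (z i k - z j k) * ((t - t' : ℝ) : ℂ)) * coord (l i k) (F.N (lam k) x' t' *ᵥ (P k *ᵥ v x' t')))
      (fun x' t' => exp ((l i k - l j k) * ((F.Y x t - F.Y x' t' : ℝ) : ℂ)
        + (z i k - z j k) * ((t - t' : ℝ) : ℂ)) * coord (l i k) (F.M (lam k) x' t' *ᵥ (P k *ᵥ v x' t')))

section

variable {F : Frame} (hF : F.Good u T) 

lemma Frame.Good.hasDeriv_phase_x (hF : F.Good u T) (j : Fin 3) (hx : 0 ≤ x)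
    (ht : t ∈ Icc 0 T) : HasDerivWithinAt (fun s => F.phase k j s t)
      (F.ρ x t * l j k + 0 * z j k) (Ici 0) x :=
  (((hF.dYx x t hx ht).ofReal_comp.const_mul (l j k)).add_const _).congr_deriv (by ring)

lemma Frame.Good.hasDeriv_phase_t (hF : F.Good u T) (j : Fin 3) (hx : 0 ≤ x)
    (ht : t ∈ Icc 0 T) : HasDerivWithinAt (fun s => F.phase k j x s)
      (F.b x t * l j k + 1 * z j k) (Icc 0 T) t :=
  (((hF.dYt x t hx ht).ofReal_comp.const_mul (l j k)).add
    ((hasDerivWithinAt_id t (Icc 0 T)).ofReal_comp.const_mul (z j k))).congr_deriv (by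
      push_cast; ring)

lemma Frame.Good.exists_phase_bound (hF : F.Good u T) (k : ℂ) (i : Fin 3) :
    ∃ a, ∀ x t, 0 ≤ x → t ∈ Icc 0 T → |(F.phase k i x t - l i k * x).re| ≤ a := by
  obtain ⟨c, hc⟩ := hF.Y_bd
  refine ⟨‖l i k‖ * c + ‖z i k‖ * T, fun x t hx ht => (abs_re_le_norm _).trans ?_⟩
  rw [show F.phase k i x t - l i k * x = l i k * ((F.Y x t - x : ℝ) : ℂ) + z i k * t by
    rw [Frame.phase]; push_cast; ring]
  refine norm_add_le_of_le ?_ ?_ <;> rw [norm_mul, norm_real, norm_eq_abs]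
  · gcongr; exact hc x t hx ht
  · rw [abs_of_nonneg ht.1]; gcongr; exact ht.2

/-- The exact one-form integrated in the integral equations: its `dx`-component. -/
def Frame.formX (F : Frame) (k : ℂ) (i j : Fin 3) (v : ℝ → ℝ → ℂ³) (x t : ℝ) : ℂ :=
  exp (F.phase k j x t - F.phase k i x t) * coord (l i k) (F.N (lam k) x t *ᵥ (P k *ᵥ v x t))

/-- The exact one-form integrated in the integral equations: its `dt`-component. -/
def Frame.formT (F : Frame) (k : ℂ) (i j : Fin 3) (v : ℝ → ℝ → ℂ³) (x t : ℝ) : ℂ :=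
  exp (F.phase k j x t - F.phase k i x t) * coord (l i k) (F.M (lam k) x t *ᵥ (P k *ᵥ v x t))

/-- The potential of the exact one-form integrated in the integral equations. -/
def Frame.pot (F : Frame) (k : ℂ) (i j : Fin 3) (v : ℝ → ℝ → ℂ³) (x t : ℝ) : ℂ :=
  exp (F.phase k j x t - F.phase k i x t) * v x t i

include hF

lemma hasDeriv_pot_x {j : Fin 3} {v : ℝ → ℝ → ℂ³} (hv : F.LaxX k j v) (hx : 0 ≤ x) (ht : t ∈ F.τ) (i : Fin 3) :
    HasDerivWithinAt (fun s => F.pot k i j v s t) (F.formX k i j v x t) (Ici 0) x := by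
  refine (((hF.hasDeriv_phase_x (k := k) j hx (hF.τ_sub ht)).sub
    (hF.hasDeriv_phase_x i hx (hF.τ_sub ht))).cexp.mul (hv x t hx ht i)).congr_deriv ?_
  simp only [Pi.sub_apply, Frame.formX]
  ring

lemma hasDeriv_pot_t {j : Fin 3} {v : ℝ → ℝ → ℂ³} (hv : F.LaxT k j v) (hx : 0 ≤ x) (ht : t ∈ F.τ) (i : Fin 3) :
    HasDerivWithinAt (F.pot k i j v x) (F.formT k i j v x t) F.τ t := by
  refine ((((hF.hasDeriv_phase_t (k := k) j hx (hF.τ_sub ht)).sub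
    (hF.hasDeriv_phase_t i hx (hF.τ_sub ht))).mono hF.τ_sub).cexp.mul (hv x t hx ht i)).congr_deriv ?_
  simp only [Pi.sub_apply, Frame.formT]
  ring

end

section

include hu

lemma exists_Wmat_bound (lm : ℂ) :
    ∃ K, 0 ≤ K ∧ ∀ x t, 0 ≤ x → t ∈ Icc 0 T → ∀ i j, ‖Wmat u lm x t i j‖ ≤ K := by
  obtain ⟨A, hA, ha⟩ := hu.rapidDecay.bound 0
  obtain ⟨B, hB, hb⟩ := (rapid_dx hu 1).1.bound 0
  obtain ⟨D, hD, hd⟩ := (rapid_mom hu).bound 0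
  simp only [pow_zero, div_one] at ha hb hd
  refine ⟨‖2 / (3 * lm)‖ + ‖1 / lm‖ + ‖1 / (3 * lm)‖ + 1 + A + B + ‖lm‖ * A * (D + 1),
    by positivity, fun x t hx ht i j => ?_⟩
  have a1 : ‖(u x t : ℂ)‖ ≤ A := by simpa using ha x t hx ht
  have b1 : ‖(dx u 1 x t : ℂ)‖ ≤ B := by simpa using hb x t hx ht
  have d1 : ‖(mom u x t : ℂ)‖ ≤ D := by simpa using hd x t hx ht
  have p1 := norm_nonneg (2 / (3 * lm))
  have p2 := norm_nonneg (1 / lm)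
  have p3 := norm_nonneg (1 / (3 * lm))
  have p4 : 0 ≤ ‖lm‖ * A * (D + 1) := by positivity
  have e1 : ‖lm * (u x t : ℂ) * ((mom u x t : ℂ) + 1)‖ ≤ ‖lm‖ * A * (D + 1) := by
    rw [norm_mul, norm_mul]
    gcongr
    exact (norm_add_le _ _).trans (by simpa using d1)
  cases i using fin3 <;> cases j using fin3 <;>
    simp only [Wmat, of_apply, cons_val_zero, cons_val_one, cons_val]
  all_goals
    first | refine (norm_add_le _ _).trans ?_ | refine (norm_sub_le _ _).trans ?_ | skip
    try simp only [norm_neg, norm_one]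
    linarith

variable {F : Frame} (hF : F.Good u T) (hk : NonSpecial k)

include hF hk

lemma hasDeriv_col_x (j : Fin 3) (C : ℂ³) (hx : 0 ≤ x) (ht : t ∈ Icc 0 T)
    (i : Fin 3) : HasDerivWithinAt (fun s => F.col u T k j C s t i)
      (F.ρ x t * ((l i k - l j k) * F.col u T k j C x t i)
        + 0 * ((z i k - z j k) * F.col u T k j C x t i)
        + coord (l i k) (F.N (lam k) x t *ᵥ (P k *ᵥ F.col u T k j C x t))) (Ici 0) x := by
  refine (hasDeriv_diag hk (hasDeriv_gauge (hF.dρx x t hx ht)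
    (hF.ρ_pos x t hx ht).ne' (hF.eqx (lam k) x t hx ht) (hasDeriv_Psi_x hu (lam k) hx ht C))
    (hF.hasDeriv_phase_x (k := k) j hx ht) i).congr_deriv ?_
  rw [F.P_col hk, mulVec_smul, coord_smul, mul_comm (exp _)]
  rfl

lemma hasDeriv_col_t (j : Fin 3) (C : ℂ³) (hx : 0 ≤ x) (ht : t ∈ Icc 0 T)
    (i : Fin 3) : HasDerivWithinAt (fun s => F.col u T k j C x s i)
      (F.b x t * ((l i k - l j k) * F.col u T k j C x t i)
        + 1 * ((z i k - z j k) * F.col u T k j C x t i)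
        + coord (l i k) (F.M (lam k) x t *ᵥ (P k *ᵥ F.col u T k j C x t))) (Icc 0 T) t := by
  refine (hasDeriv_diag hk (hasDeriv_gauge (hF.dρt x t hx ht)
    (hF.ρ_pos x t hx ht).ne' (hF.eqt (lam k) x t (lam_ne_zero hk) hx ht)
    (hasDeriv_Psi_t hu (lam_ne_zero hk) hx ht C))
    (hF.hasDeriv_phase_t (k := k) j hx ht) i).congr_deriv ?_
  rw [F.P_col hk, mulVec_smul, coord_smul, mul_comm (exp _)]
  rfl

omit hu hF hk in
lemma exp_mul_col (i j : Fin 3) (C : ℂ³) (x t : ℝ) :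
    exp (F.phase k j x t - F.phase k i x t) * F.col u T k j C x t i =
      coord (l i k) (dgm (F.ρ x t) *ᵥ (Psi u T (lam k) x t *ᵥ C)) * exp (-F.phase k i x t) := by
  rw [Frame.col, mul_comm, mul_assoc, ← exp_add]
  congr 2; ring

omit hk in
lemma exists_gauged_bound (hlm : lam k ≠ 0) {s : ℂ} {M : ℝ}
    (hM : ∀ x : ℝ, 0 ≤ x → ‖exp (-s * x) • (propX u 0 (lam k) x *ᵥ C)‖ ≤ M) (i : Fin 3)
    (hi : s.re ≤ (l i k).re) : ∃ B, ∀ x t, 0 ≤ x → t ∈ Icc 0 T →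
      ‖exp (-F.phase k i x t) • (dgm (F.ρ x t) *ᵥ (Psi u T (lam k) x t *ᵥ C))‖ ≤ B := by
  obtain ⟨K, hK, hW⟩ := exists_Wmat_bound hu (lam k)
  obtain ⟨a, ha⟩ := hF.exists_phase_bound k i
  obtain ⟨R, hR⟩ := hF.ρ_bd
  have hM0 : 0 ≤ M := (norm_nonneg _).trans (hM 0 le_rfl)
  refine ⟨Real.exp a * (max R 1 * (M * Real.exp ((3 * K + 1) * T))), fun x t hx ht => ?_⟩
  have hg : ‖Psi u T (lam k) x t *ᵥ C‖ ≤ ‖propX u 0 (lam k) x *ᵥ C‖ * Real.exp ((3 * K + 1) * T) := by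
    have := norm_le_of_norm_deriv_le (v := fun t => Psi u T (lam k) x t *ᵥ C) (X := T)
      (K := 3 * K) (ε := 0) (by positivity) le_rfl
      (fun t ht => hasDeriv_Psi_t hu hlm hx ht C)
      (fun t ht => by rw [add_zero]; exact norm_mulVec_le (hW x t hx ht) _) t ht
    rwa [Psi_zero_t hu, add_zero] at this
  have h1 := hM x hx
  rw [norm_smul, norm_exp_mul_ofReal, neg_re] at h1
  have h2 := norm_dgm_mulVec_le (hF.ρ_pos x t hx ht) (hR x t hx ht).1 (hR x t hx ht).2
    (Psi u T (lam k) x t *ᵥ C)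
  have e1 : ‖exp (-F.phase k i x t)‖ ≤ Real.exp a * Real.exp (-s.re * x) := by
    rw [norm_exp, ← Real.exp_add]
    have := (abs_le.1 (ha x t hx ht)).1
    rw [sub_re, re_mul_ofReal] at this
    exact exp_le_exp.2 (by rw [neg_re]; nlinarith)
  rw [norm_smul]
  calc _ ≤ Real.exp a * Real.exp (-s.re * x) *
        (max R 1 * (‖propX u 0 (lam k) x *ᵥ C‖ * Real.exp ((3 * K + 1) * T))) := by
        gcongr
        exact h2.trans (by gcongr)
    _ = Real.exp a * (max R 1 *
        ((Real.exp (-s.re * x) * ‖propX u 0 (lam k) x *ᵥ C‖) * Real.exp ((3 * K + 1) * T))) := by ring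
    _ ≤ _ := by gcongr

omit hu hk in
lemma tendsto_lev_gauge {s : ℂ} {w : ℝ → ℂ³} {M : ℝ} (hM : ∀ x, 0 ≤ x → ‖w x‖ ≤ M) :
    Tendsto (fun x => lev s (dgm (F.ρ x 0) *ᵥ w x) - lev s (w x)) atTop (𝓝 0) := by
  have h1 := hF.ρ_lim.sub_const 1
  have h2 := (hF.ρ_lim.inv₀ one_ne_zero).sub_const 1
  rw [sub_self] at h1
  rw [inv_one, sub_self] at h2
  have h : Tendsto (fun x => ![(s ^ 2 - 1) * ((F.ρ x 0 - 1 : ℝ) : ℂ), 0, (((F.ρ x 0)⁻¹ - 1 : ℝ) : ℂ)])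
      atTop (𝓝 (0 : ℂ³)) := by
    refine tendsto_pi_nhds.2 fun i => ?_
    have c1 := (continuous_ofReal.tendsto 0).comp h1
    have c2 := (continuous_ofReal.tendsto 0).comp h2
    cases i using fin3
    · simpa using c1.const_mul (s ^ 2 - 1)
    · simp
    · rw [ofReal_zero] at c2
      exact c2.congr fun x => by simp
  refine (tendsto_dot_zero hM h).congr fun x => ?_
  rw [dot_three, dgm_mulVec]
  simp only [lev, cons_val_zero, cons_val_one, cons_val]
  push_cast
  ring

lemma tendsto_gauged_zero_iff {M : ℝ} {i : Fin 3}
    (hM : ∀ x : ℝ, 0 ≤ x → ‖exp (-l i k * x) • (propX u 0 (lam k) x *ᵥ C)‖ ≤ M) {d : ℂ} :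
    Tendsto (fun x => coord (l i k) (dgm (F.ρ x 0) *ᵥ (Psi u T (lam k) x 0 *ᵥ C)) *
      exp (-F.phase k i x 0)) atTop (𝓝 d) ↔
    Tendsto (fun x : ℝ => lev (l i k) (propX u 0 (lam k) x *ᵥ C) * exp (-l i k * x)) atTop
      (𝓝 (d * (χ[l i k] * exp (l i k * F.c)))) := by
  have hπ := (isRoots_l hk.1).three_sq_ne_zero (disc_ne_zero hk) i
  have a1 := tendsto_lev_gauge hF (s := l i k) hM
  have a2 : ∀ s : ℂ, Tendsto (fun x => exp (s * ((F.Y x 0 - x : ℝ) : ℂ))) atTop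
      (𝓝 (exp (s * F.c))) := fun s =>
    (Continuous.tendsto (by fun_prop : Continuous fun y : ℝ => exp (s * y)) _).comp hF.Y_lim
  have e : ∀ x, coord (l i k) (dgm (F.ρ x 0) *ᵥ (Psi u T (lam k) x 0 *ᵥ C)) *
      exp (-F.phase k i x 0) * (χ[l i k] * exp (l i k * ((F.Y x 0 - x : ℝ) : ℂ))) =
      lev (l i k) (dgm (F.ρ x 0) *ᵥ (exp (-l i k * x) • (propX u 0 (lam k) x *ᵥ C))) := fun x => by
    rw [show exp (-l i k * x) = exp (-F.phase k i x 0) * exp (l i k * ((F.Y x 0 - x : ℝ) : ℂ)) by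
        rw [← exp_add, Frame.phase]; congr 1; push_cast; ring,
      Psi_zero_t hu, mulVec_smul, lev_smul, coord]
    field_simp
  constructor <;> intro h
  · have := (h.mul ((a2 (l i k)).const_mul χ[l i k])).sub a1
    rw [sub_zero] at this
    exact this.congr fun x => by rw [e, lev_smul]; ring
  · have := (a1.add h).mul ((a2 (-l i k)).const_mul χ[l i k]⁻¹)
    rw [zero_add, show d * (χ[l i k] * exp (l i k * F.c)) * (χ[l i k]⁻¹ * exp (-l i k * F.c)) = d by
        rw [neg_mul, Complex.exp_neg]; field_simp [exp_ne_zero]] at this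
    refine this.congr fun x => ?_
    rw [lev_smul, mul_comm (exp _), sub_add_cancel, ← e, neg_mul _ ((F.Y x 0 - x : ℝ) : ℂ)]
    field_simp
    rw [mul_assoc, ← exp_add, add_neg_cancel, exp_zero, mul_one]

lemma tendsto_gauged {s : ℂ} {M : ℝ}
    (hM : ∀ x : ℝ, 0 ≤ x → ‖exp (-s * x) • (propX u 0 (lam k) x *ᵥ C)‖ ≤ M) {i : Fin 3}
    (hi : s.re ≤ (l i k).re) {d : ℂ} (hd : Tendsto (fun x : ℝ =>
      lev (l i k) (propX u 0 (lam k) x *ᵥ C) * exp (-l i k * x)) atTop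
      (𝓝 (d * (χ[l i k] * exp (l i k * F.c))))) (ht : t ∈ Icc 0 T) :
    Tendsto (fun x => coord (l i k) (dgm (F.ρ x t) *ᵥ (Psi u T (lam k) x t *ᵥ C)) *
      exp (-F.phase k i x t)) atTop (𝓝 d) := by
  obtain ⟨B, hB⟩ := exists_gauged_bound hu hF (lam_ne_zero hk) hM i hi
  obtain ⟨D, hD⟩ := hF.decM (lam k)
  obtain ⟨c, hc0, hc⟩ := norm_coord_le (l i k)
  set f : ℝ → ℝ → ℂ := fun x t => coord (l i k) (dgm (F.ρ x t) *ᵥ (Psi u T (lam k) x t *ᵥ C)) *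
      exp (-F.phase k i x t)
  have h0 := (tendsto_gauged_zero_iff hu hF hk fun x hx =>
    (norm_exp_smul_le hi hx _).trans (hM x hx)).2 hd
  have hd0 : Tendsto (fun x => f x t - f x 0) atTop (𝓝 0) := by
    have hz : Tendsto (fun x : ℝ => c * (3 * (D / (1 + x) ^ 2) * B) * T) atTop (𝓝 0) := by
      have : Tendsto (fun x : ℝ => D / (1 + x) ^ 2) atTop (𝓝 0) := ((tendsto_pow_atTop two_ne_zero).comp
          (tendsto_atTop_add_const_left _ 1 tendsto_id)).const_div_atTop D
      simpa using ((this.const_mul 3).mul_const B).const_mul c |>.mul_const T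
    refine squeeze_zero_norm' ?_ hz
    filter_upwards [eventually_ge_atTop 0] with x hx
    have hder : ∀ s ∈ Icc 0 T, HasDerivWithinAt (f x)
        (coord (l i k) (F.M (lam k) x s *ᵥ (exp (-F.phase k i x s) •
          (dgm (F.ρ x s) *ᵥ (Psi u T (lam k) x s *ᵥ C))))) (Icc 0 T) s := fun s hs =>
      (hasDeriv_col_t hu hF hk i C hx hs i).congr_deriv (by rw [F.P_col hk]; ring)
    have hbd : ∀ s ∈ Ico 0 T, ‖coord (l i k) (F.M (lam k) x s *ᵥ (exp (-F.phase k i x s) •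
          (dgm (F.ρ x s) *ᵥ (Psi u T (lam k) x s *ᵥ C))))‖ ≤ c * (3 * (D / (1 + x) ^ 2) * B) := fun s hs => by
      have hs' := Ico_subset_Icc_self hs
      have := (norm_nonneg _).trans (hD x s hx hs' 0 0)
      exact (hc _).trans (mul_le_mul_of_nonneg_left ((norm_mulVec_le (hD x s hx hs') _).trans
        (mul_le_mul_of_nonneg_left (hB x s hx hs') (by linarith))) hc0)
    have := norm_image_sub_le_of_norm_deriv_le_segment' hder hbd t ht
    rw [sub_zero] at this
    exact this.trans (mul_le_mul_of_nonneg_left ht.2 ((norm_nonneg _).trans (hbd 0 ⟨le_rfl, hT.out⟩)))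
  have := h0.add hd0
  rw [add_zero] at this
  exact this.congr fun x => add_sub_cancel (f x 0) _

end

lemma contOn_mulVec {A : ℝ → Mat3} {w : ℝ → ℂ³} {S : Set ℝ}
    (hA : ∀ i j, ContinuousOn (fun s => A s i j) S) (hw : ContinuousOn w S) :
    ContinuousOn (fun s => A s *ᵥ w s) S := by
  refine continuousOn_pi.2 fun i => ?_
  simp only [mulVec, dotProduct]
  exact continuousOn_finsetSum _ fun j _ => (hA i j).mul (continuousOn_pi.1 hw j)

lemma exists_norm_mulVec_le (A : Mat3) : ∃ c, 0 ≤ c ∧ ∀ v : ℂ³, ‖A *ᵥ v‖ ≤ c * ‖v‖ :=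
  ⟨_, norm_nonneg _, (LinearMap.toContinuousLinearMap A.mulVecLin).le_opNorm⟩

lemma continuous_coord (s : ℂ) : Continuous (coord s) := by
  unfold coord lev; fun_prop

section

variable {F : Frame} (hF : F.Good u T) {j : Fin 3}
  {v : ℝ → ℝ → ℂ³}

lemma Frame.contourIntegral_eq (F : Frame) (c : Contour) (i j : Fin 3) (v : ℝ → ℝ → ℂ³) (x t : ℝ) :
    contourIntegral T c x t (fun x' t' => exp ((l i k - l j k) * ((F.Y x t - F.Y x' t' : ℝ) : ℂ)
        + (z i k - z j k) * ((t - t' : ℝ) : ℂ)) * coord (l i k) (F.N (lam k) x' t' *ᵥ (P k *ᵥ v x' t')))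
      (fun x' t' => exp ((l i k - l j k) * ((F.Y x t - F.Y x' t' : ℝ) : ℂ)
        + (z i k - z j k) * ((t - t' : ℝ) : ℂ)) * coord (l i k) (F.M (lam k) x' t' *ᵥ (P k *ᵥ v x' t')))
      = exp (F.phase k i x t - F.phase k j x t) *
        contourIntegral T c x t (F.formX k i j v) (F.formT k i j v) := by
  rw [← contourIntegral_const_mul]
  have e : ∀ x' t', exp ((l i k - l j k) * ((F.Y x t - F.Y x' t' : ℝ) : ℂ)
        + (z i k - z j k) * ((t - t' : ℝ) : ℂ)) = exp (F.phase k i x t - F.phase k j x t) *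
      exp (F.phase k j x' t' - F.phase k i x' t') := fun x' t' => by
    rw [← exp_add]
    congr 1
    simp only [Frame.phase]
    push_cast
    ring
  congr 1 <;> funext x' t' <;> rw [e, mul_assoc] <;> rfl

lemma Frame.exp_mul_pot (F : Frame) (i j : Fin 3) (v : ℝ → ℝ → ℂ³) (x t : ℝ) :
    exp (F.phase k i x t - F.phase k j x t) * F.pot k i j v x t = v x t i := by
  rw [Frame.pot, ← mul_assoc, ← exp_add]
  simp

include hF

lemma contOn_formX (ht : t ∈ Icc 0 T) (i : Fin 3) (hv : ContinuousOn (fun s => v s t) (Ici 0)) :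
    ContinuousOn (fun s => F.formX k i j v s t) (Ici 0) := by
  have h1 : ContinuousOn (fun s => F.phase k j s t - F.phase k i s t) (Ici 0) := fun x hx =>
    ((hF.hasDeriv_phase_x j hx ht).sub (hF.hasDeriv_phase_x i hx ht)).continuousWithinAt
  refine h1.cexp.mul ((continuous_coord _).comp_continuousOn ?_)
  exact contOn_mulVec (hF.contN _ t ht) (contOn_mulVec (fun _ _ => continuousOn_const) hv)

lemma contOn_formT {S : Set ℝ} (hS : S ⊆ Icc 0 T) (i : Fin 3)
    (hv : ContinuousOn (v 0) S) : ContinuousOn (F.formT k i j v 0) S := by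
  have h1 : ContinuousOn (fun s => F.phase k j 0 s - F.phase k i 0 s) (Icc 0 T) := fun x hx =>
    ((hF.hasDeriv_phase_t j le_rfl hx).sub (hF.hasDeriv_phase_t i le_rfl hx)).continuousWithinAt
  refine (h1.mono hS).cexp.mul ((continuous_coord _).comp_continuousOn ?_)
  exact contOn_mulVec (fun i j => (hF.contM _ i j).mono hS)
    (contOn_mulVec (fun _ _ => continuousOn_const) hv)

lemma formX_decay (ht : t ∈ Icc 0 T) {i : Fin 3} (hij : (l j k).re ≤ (l i k).re) {C : ℝ}
    (hv : ∀ x, 0 ≤ x → ∀ i, ‖v x t i‖ ≤ C) :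
    ∃ D, ∀ x, 0 ≤ x → ‖F.formX k i j v x t‖ ≤ D / (1 + x) ^ 2 := by
  obtain ⟨D, hD⟩ := hF.decN (lam k)
  obtain ⟨c, hc0, hc⟩ := norm_coord_le (l i k)
  obtain ⟨a, ha⟩ := hF.exists_phase_bound k i
  obtain ⟨b, hb⟩ := hF.exists_phase_bound k j
  obtain ⟨p, hp0, hp⟩ := exists_norm_mulVec_le (P k)
  have hC0 : 0 ≤ C := (norm_nonneg _).trans (hv 0 le_rfl 0)
  refine ⟨Real.exp (a + b) * (c * (3 * D * (p * C))), fun x hx => ?_⟩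
  have hDx : 0 ≤ D / (1 + x) ^ 2 := (norm_nonneg _).trans (hD x t hx ht 0 0)
  have h1 : ‖exp (F.phase k j x t - F.phase k i x t)‖ ≤ Real.exp (a + b) := by
    have ha := (abs_le.1 (ha x t hx ht)).1
    have hb := (abs_le.1 (hb x t hx ht)).2
    simp only [norm_exp, sub_re, re_mul_ofReal, exp_le_exp] at *
    linarith [mul_le_mul_of_nonneg_right hij hx]
  have h2 : ‖P k *ᵥ v x t‖ ≤ p * C :=
    (hp _).trans (mul_le_mul_of_nonneg_left ((pi_norm_le_iff_of_nonneg hC0).2 (hv x hx)) hp0)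
  rw [Frame.formX, norm_mul]
  calc _ ≤ Real.exp (a + b) * (c * (3 * (D / (1 + x) ^ 2) * (p * C))) := by
        gcongr
        refine (hc _).trans (mul_le_mul_of_nonneg_left ?_ hc0)
        exact (norm_mulVec_le (hD x t hx ht) _).trans (by gcongr)
    _ = _ := by ring

variable (hx' : F.LaxX k j v)

include hx'

omit hF in
lemma Frame.LaxX.continuousOn (ht : t ∈ F.τ) : ContinuousOn (fun s => v s t) (Ici 0) :=
  fun x hx => continuousWithinAt_pi.2 fun i => (hx' x t hx ht i).continuousWithinAt

lemma contourIntegral_form (ht' : F.LaxT k j v) (hx : 0 ≤ x) (ht : t ∈ F.τ) (hp : p < r) (hγ : contour n n#p n#r = γ₁ → F.τ = Icc 0 T) (i : Fin 3) :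
    contourIntegral T (contour n n#p n#r) x t (F.formX k i j v) (F.formT k i j v) =
      F.pot k i j v x t - F.pot k i j v 0 (startTime T n n#p n#r) := by
  have htT := hF.τ_sub ht
  have hvt : ContinuousOn (v 0) F.τ := fun s hs =>
    continuousWithinAt_pi.2 fun i => (ht' 0 s le_rfl hs i).continuousWithinAt
  have hA := integral_eq_sub_of_hasDeriv hx ((contOn_formX hF htT i
    (hx'.continuousOn ht)).mono Icc_subset_Ici_self) fun s hs =>
      (hasDeriv_pot_x hF hx' hs.1 ht i).mono Icc_subset_Ici_self
  have hB : ∀ a b, a ≤ b → Icc a b ⊆ F.τ → ∫ s in a..b, F.formT k i j v 0 s =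
      F.pot k i j v 0 b - F.pot k i j v 0 a := fun a b hab hs =>
    integral_eq_sub_of_hasDeriv hab (contOn_formT hF (hs.trans hF.τ_sub) i (hvt.mono hs))
      fun s h => (hasDeriv_pot_t hF ht' le_rfl (hs h) i).mono hs
  rcases contour_of_lt (n := n) hp with e | e <;> rw [startTime, e] <;> simp only [contourIntegral]
  · rw [hA, hB 0 t htT.1 (hF.Icc_sub t ht)]; ring
  · rw [hA, intervalIntegral.integral_symm, hB t T htT.2 (by
      rw [hγ e]; exact Icc_subset_Icc_left htT.1)]
    ring

lemma tendsto_pot (hx : 0 ≤ x) (ht : t ∈ F.τ) {i : Fin 3}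
    (hij : (l j k).re ≤ (l i k).re) (hb : ∃ C, ∀ x, 0 ≤ x → ∀ i, ‖v x t i‖ ≤ C) :
    Tendsto (fun s => F.pot k i j v s t) atTop (𝓝 (F.pot k i j v x t -
      contourIntegral T γ₃ x t (F.formX k i j v) (F.formT k i j v))) := by
  obtain ⟨C, hC⟩ := hb
  obtain ⟨D, hD⟩ := formX_decay hF (hF.τ_sub ht) hij hC
  exact tendsto_of_contourIntegral_three hx (contOn_formX hF (hF.τ_sub ht) i
    (hx'.continuousOn ht)) (fun s hs => hasDeriv_pot_x hF hx' hs ht i) hD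

end

lemma Frame.row_dot (F : Frame) (C : ℂ³) : F.row u T n k r p ⬝ᵥ C =
    lev (l n#p k) (dgm (F.ρ 0 (startTime T n n#p n#r)) *ᵥ
      (Psi u T (lam k) 0 (startTime T n n#p n#r) *ᵥ C)) := by
  rw [Frame.row, ← Matrix.dotProduct_mulVec, mulVec_mulVec, lev_eq_dot]

lemma Frame.row_dot_eq_zero_iff (F : Frame) (h : OrdAt k (lOrd n)) (r p : Fin 3) (C : ℂ³) (j : Fin 3) :
    F.row u T n k r p ⬝ᵥ C = 0 ↔ F.pot k n#p j (F.col u T k j C) 0 (startTime T n n#p n#r) = 0 := by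
  rw [Frame.row_dot, Frame.pot, exp_mul_col, coord]
  simp [h.pi_ne_zero p]

section

variable {F : Frame} (hF : F.Good u T) (h : OrdAt k (lOrd n)) {r : Fin 3}

include hu hF h

lemma IsCol.col_bound {d : ℂ} {b : Fin 3 → ℂ³} (hC : IsCol u k (lOrd n) b r d C) :
    ∃ B, 0 ≤ B ∧ ∀ x t, 0 ≤ x → t ∈ Icc 0 T → ∀ i, ‖F.col u T k n#r C x t i‖ ≤ B := by
  obtain ⟨M, hM⟩ := hC.bdd
  obtain ⟨B, hB⟩ := exists_gauged_bound hu hF (lam_ne_zero h.ns) hM n#r le_rfl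
  choose c hc0 hc using fun i => norm_coord_le (l i k)
  have hB0 : 0 ≤ B := (norm_nonneg _).trans (hB 0 0 le_rfl zero_mem_Icc)
  refine ⟨∑ i, c i * B, sum_nonneg fun i _ => mul_nonneg (hc0 i) hB0, fun x t hx ht i => ?_⟩
  refine le_trans ?_ (le_sum_three (fun i => mul_nonneg (hc0 i) hB0) i)
  have := (hc i _).trans (mul_le_mul_of_nonneg_left (hB x t hx ht) (hc0 i))
  rwa [coord_smul, mul_comm] at this

lemma IsCol.tendsto_pot {d : ℂ} {b : Fin 3 → ℂ³} (hC : IsCol u k (lOrd n) b r (d * (χ[l n#r k] *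
      exp (l n#r k * F.c))) C) {p : Fin 3} (hp : r ≤ p) (ht : t ∈ Icc 0 T) :
    Tendsto (fun x => F.pot k n#p n#r (F.col u T k n#r C) x t) atTop (𝓝 (if p = r then d else 0)) := by
  obtain ⟨M, hM⟩ := hC.bdd
  simp only [Frame.pot, exp_mul_col]
  have hre := h.mono hp
  rcases hp.eq_or_lt with rfl | hp
  · simpa using tendsto_gauged hu hF h.ns hM hre hC.diag ht
  · rw [if_neg hp.ne']
    exact tendsto_gauged hu hF h.ns hM hre (by simpa using hC.lim p hp) ht

variable (hγ : ∀ p < r, contour n n#p n#r = γ₁ → F.τ = Icc 0 T)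

include hγ

lemma isSolCol_of_isCol (hC : IsCol u k (lOrd n) (F.row u T n k r) r
      (χ[l n#r k] * exp (l n#r k * F.c)) C) :
    F.IsSolCol T n k n#r (F.col u T k n#r C) := by
  obtain ⟨B, hB0, hB⟩ := IsCol.col_bound hu hF h hC
  have hx' := fun x t (hx : 0 ≤ x) (ht : t ∈ F.τ) (i : Fin 3) =>
    hasDeriv_col_x hu hF h.ns n#r C hx (hF.τ_sub ht) i
  have ht' := fun x t (hx : 0 ≤ x) (ht : t ∈ F.τ) (i : Fin 3) =>
    (hasDeriv_col_t hu hF h.ns n#r C hx (hF.τ_sub ht) i).mono hF.τ_sub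
  refine ⟨hx', ht', fun t ht => ⟨B, fun x hx i => hB x t hx (hF.τ_sub ht) i⟩, fun x t hx ht i => ?_⟩
  rw [Frame.contourIntegral_eq]
  obtain ⟨p, rfl⟩ := (Finite.injective_iff_surjective.1 h.inj) i
  rcases lt_or_ge p r with hp | hp
  · have hs := (F.row_dot_eq_zero_iff h r p C n#r).1 (hC.start p hp)
    rw [if_neg (fun e => hp.ne (h.inj e)), zero_add]
    rw [contourIntegral_form hF hx' ht' hx ht hp (hγ p hp), hs, sub_zero, Frame.exp_mul_pot]
  · rw [contour_of_le hp]
    have h1 := tendsto_pot hF hx' hx ht (h.mono hp) ⟨B, fun x hx i => hB x t hx (hF.τ_sub ht) i⟩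
    have h2 := IsCol.tendsto_pot (d := 1) hu hF h (by simpa using hC) hp (hF.τ_sub ht)
    have h3 := sub_eq_iff_eq_add'.1 (tendsto_nhds_unique h1 h2)
    rw [← F.exp_mul_pot (k := k) n#p n#r (F.col u T k n#r C) x t, h3, mul_add, add_comm]
    by_cases e : p = r
    · subst e; simp
    · rw [if_neg e, if_neg (fun e' => e (h.inj e'))]; simp

lemma exists_isCol_of_isSolCol {v : ℝ → ℝ → ℂ³} (hv : F.IsSolCol T n k n#r v) :
    ∃ C, IsCol u k (lOrd n) (F.row u T n k r) r (χ[l n#r k] * exp (l n#r k * F.c)) C ∧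
      ∀ x t, 0 ≤ x → t ∈ F.τ → v x t = F.col u T k n#r C x t := by
  have hlm := lam_ne_zero h.ns
  set w : ℝ → ℝ → ℂ³ := fun x t => dgm (F.ρ x t)⁻¹ *ᵥ (exp (F.phase k n#r x t) • (P k *ᵥ v x t)) with hw
  have hwx : ∀ x t, 0 ≤ x → t ∈ F.τ → HasDerivWithinAt (fun s => w s t)
      (Umat u (lam k) x t *ᵥ w x t) (Ici 0) x := fun x t hx ht => by
    have htT := hF.τ_sub ht
    exact hasDeriv_ungauge (hF.dρx x t hx htT) (hF.ρ_pos x t hx htT).ne'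
      (hF.eqx (lam k) x t hx htT) (hasDeriv_undiag h.ns (hv.lax_x x t hx ht)
      (hF.hasDeriv_phase_x _ hx htT))
  have hwt : ∀ x t, 0 ≤ x → t ∈ F.τ → HasDerivWithinAt (w x)
      (Wmat u (lam k) x t *ᵥ w x t) F.τ t := fun x t hx ht => by
    have htT := hF.τ_sub ht
    exact hasDeriv_ungauge ((hF.dρt x t hx htT).mono hF.τ_sub) (hF.ρ_pos x t hx htT).ne'
      (hF.eqt (lam k) x t hlm hx htT) (hasDeriv_undiag h.ns (hv.lax_t x t hx ht)
      ((hF.hasDeriv_phase_t _ hx htT).mono hF.τ_sub))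
  have hψ : ∀ x t, 0 ≤ x → t ∈ F.τ → w x t = Psi u T (lam k) x t *ᵥ w 0 0 := fun x t hx ht =>
    eq_Psi_mulVec hu hx (hF.τ_sub ht) (fun s hs => (hwx s t hs.1 ht).mono fun y hy => hy.1)
      (fun s hs => (hwt 0 s le_rfl (hF.Icc_sub t ht hs)).mono (hF.Icc_sub t ht))
  have hvC : ∀ x t, 0 ≤ x → t ∈ F.τ → v x t = F.col u T k n#r (w 0 0) x t := by
    intro x t hx ht
    funext i
    rw [Frame.col, ← hψ x t hx ht]
    simp only [hw]
    rw [mulVec_mulVec, dgm_mul_inv (hF.ρ_pos x t hx (hF.τ_sub ht)).ne', one_mulVec,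
      coord_smul, coord_P_mulVec h.ns, mul_right_comm, ← exp_add]
    simp
  obtain ⟨B, hB⟩ := hv.bounded 0 hF.zero_mem
  have h0 := hF.τ_sub hF.zero_mem
  have hin := fun p => hv.integral_eq 0 0 le_rfl hF.zero_mem n#p
  simp only [Frame.contourIntegral_eq] at hin
  have hph : ∀ i, F.phase k i 0 0 = 0 := fun i => by simp [Frame.phase, hF.Y_zero]
  have hlim : ∀ p, r ≤ p → Tendsto (fun x => F.pot k n#p n#r v x 0) atTop
      (𝓝 (if p = r then 1 else 0)) := by
    intro p hp
    have h1 := tendsto_pot hF hv.lax_x le_rfl hF.zero_mem (h.mono hp) ⟨B, hB⟩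
    have h2 := hin p
    rw [contour_of_le hp, hph, hph, sub_zero, exp_zero, one_mul] at h2
    convert h1 using 2
    rw [Frame.pot, hph, hph, sub_zero, exp_zero, one_mul, h2, add_sub_cancel_right]
    simp [h.inj.eq_iff]
  obtain ⟨R, hR⟩ := hF.ρ_bd
  obtain ⟨p₀, hp0, hp₀⟩ := exists_norm_mulVec_le (P k)
  have hB0 : 0 ≤ B := (norm_nonneg _).trans (hB 0 le_rfl 0)
  obtain ⟨c, hc⟩ := hF.exists_phase_bound k n#r
  have hM : ∀ x : ℝ, 0 ≤ x → ‖exp (-l n#r k * x) • (propX u 0 (lam k) x *ᵥ w 0 0)‖ ≤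
      Real.exp c * (max R 1 * (p₀ * B)) := fun x hx => by
    rw [← Psi_zero_t hu, ← hψ x 0 hx hF.zero_mem, hw]
    simp only [mulVec_smul, smul_smul, ← exp_add]
    rw [norm_smul, norm_exp, neg_mul, neg_add_eq_sub]
    gcongr
    · exact (le_abs_self _).trans (hc x 0 hx h0)
    · refine (norm_dgm_mulVec_le (inv_pos.2 (hF.ρ_pos x 0 hx h0)) (hR x 0 hx h0).2
        (by rw [inv_inv]; exact (hR x 0 hx h0).1) _).trans ?_
      gcongr
      exact (hp₀ _).trans (by gcongr; exact (pi_norm_le_iff_of_nonneg hB0).2 (hB x hx))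
  have hlev := fun p (hp : r ≤ p) => (tendsto_gauged_zero_iff hu hF h.ns fun x hx =>
    (norm_exp_smul_le (h.mono hp) hx _).trans (hM x hx)).1 ((hlim p hp).congr' (by
      filter_upwards [eventually_ge_atTop 0] with x hx
      rw [Frame.pot, hvC x 0 hx hF.zero_mem, exp_mul_col]))
  refine ⟨w 0 0, ⟨⟨_, hM⟩, fun p hp => ?_, ?_, fun p hp => ?_⟩, hvC⟩
  · simpa [hp.ne'] using hlev p hp.le
  · simpa using hlev r le_rfl
  · rw [F.row_dot_eq_zero_iff h r p _ n#r]
    have h2 := hin p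
    rw [if_neg (fun e => hp.ne (h.inj e)), zero_add, contourIntegral_form hF hv.lax_x hv.lax_t le_rfl
      hF.zero_mem hp (hγ p hp), mul_sub, Frame.exp_mul_pot, hph, hph, sub_zero, exp_zero, one_mul,
      eq_comm, sub_eq_self] at h2
    have hs : startTime T n n#p n#r ∈ F.τ := by
      rcases contour_of_lt (n := n) hp with e | e <;> rw [startTime, e]
      · exact hF.zero_mem
      · rw [hγ p hp e]; exact ⟨hT.out.le, le_rfl⟩
    rw [Frame.pot, ← hvC 0 _ le_rfl hs]
    exact h2

end

/-- The frame of the first Lax pair. -/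
def frameL (u : 𝓕) (T : ℝ) : Frame where
  ρ _ _ := 1
  ρx _ _ := 0
  ρt _ _ := 0
  Y x _ := x
  b _ _ := 0
  N lm x t := N1 u lm x t
  M lm x t := N2 u lm x t
  τ := Icc 0 T
  c := 0

/-- The frame of the second Lax pair. -/
def frameR (u : 𝓕) (T : ℝ) : Frame where
  ρ := q u
  ρx := qx u
  ρt x t := -(dx u 1 x t * q u x t + u x t * qx u x t)
  Y := yFun u
  b x t := -(u x t * q u x t)
  N _ x t := tN1 u x t
  M lm x t := tN2 u lm x t
  τ := Ico 0 T
  c := ∫ x in Ioi 0, (q u x 0 - 1)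

section

include hu

lemma contOn_q_x (ht : t ∈ Icc 0 T) : ContinuousOn (fun s => q u s t) (Ici 0) :=
  fun _ hx => (hasDeriv_q_x hu hx ht).continuousWithinAt

lemma contOn_q_t (hx : 0 ≤ x) : ContinuousOn (fun s => q u x s) (Icc 0 T) :=
  fun _ ht => (hasDeriv_q_t hu hx ht).continuousWithinAt

lemma contOn_q : ContinuousOn (uncurry (q u)) (strip T) := by
  have h := (rapid_mom hu).continuousOn
  have : ∀ p ∈ strip T, uncurry (q u) p = (uncurry (mom u) p + 1) ^ (1 / 3 : ℝ) := fun p _ => rfl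
  exact ((h.add continuousOn_const).rpow_const fun p hp =>
    Or.inl (mom_add_one_pos hu hp.1 hp.2).ne').congr this

lemma integral_q_eq (hx : 0 ≤ x) (ht : t ∈ Icc 0 T) : (∫ s in 0..x, q u s t) - (∫ s in 0..x, q u s 0) =
      ∫ s in 0..t, (q u 0 s * u 0 s - q u x s * u x s) := by
  set f : ℝ → ℝ → ℝ := fun s r => pdt T (mom u) s r / (3 * q u s r ^ 2) with hf
  have hfc : ContinuousOn (uncurry f) (Icc 0 x ×ˢ Icc 0 t) := by
    have hsub : Icc 0 x ×ˢ Icc 0 t ⊆ strip T := fun p hp => ⟨hp.1.1, hp.2.1, hp.2.2.trans ht.2⟩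
    have h1 := ((rapid_mom hu).pdt.continuousOn).mono hsub
    have h2 := (contOn_q hu).mono hsub
    refine h1.div ((h2.pow 2).const_mul 3) fun p hp => ?_
    have := q_pos hu (hsub hp).1 (hsub hp).2
    exact (by positivity : 0 < 3 * q u p.1 p.2 ^ 2).ne'
  have e1 : ∀ s ∈ Icc 0 x, ∫ r in 0..t, f s r = q u s t - q u s 0 := fun s hs =>
    intervalIntegral.integral_eq_sub_of_hasDerivAt_of_le ht.1
      ((contOn_q_t hu hs.1).mono (Icc_subset_Icc_right ht.2))
      (fun r hr => (hasDeriv_q_t hu hs.1 ⟨hr.1.le, hr.2.le.trans ht.2⟩).hasDerivAt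
        (Icc_mem_nhds hr.1 (hr.2.trans_le ht.2)))
      (ContinuousOn.intervalIntegrable_of_Icc ht.1
        (hfc.comp (f := fun r => (s, r)) (by fun_prop) fun r hr => ⟨hs, hr⟩))
  have e2 : ∀ r ∈ Icc 0 t, ∫ s in 0..x, f s r = q u 0 r * u 0 r - q u x r * u x r := by
    intro r hr
    have hrT : r ∈ Icc 0 T := ⟨hr.1, hr.2.trans ht.2⟩
    have hd : ∀ s, 0 ≤ s → HasDerivWithinAt (fun s => -(q u s r * u s r)) (f s r) (Ici 0) s := by
      intro s hs
      refine ((hasDeriv_q_x hu hs hrT).mul (hasDeriv_u_x hu hs hrT)).neg.congr_deriv ?_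
      have := (uniqueDiffOn_Icc hT.out r hrT).eq_deriv _ (hasDeriv_q_t hu hs hrT)
        (hasDeriv_q_t' hu hs hrT)
      simp only [hf]
      rw [this, qx_eq hu hs hrT]
      ring
    rw [intervalIntegral.integral_eq_sub_of_hasDerivAt_of_le hx
      (fun s hs => (hd s hs.1).continuousWithinAt.mono fun y hy => hy.1)
      (fun s hs => (hd s hs.1.le).hasDerivAt (Ici_mem_nhds hs.1))
      (ContinuousOn.intervalIntegrable_of_Icc hx
        (hfc.comp (f := fun s => (s, r)) (by fun_prop) fun s hs => ⟨hs, hr⟩))]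
    ring
  have hi : ∀ t ∈ Icc 0 T, IntervalIntegrable (fun s => q u s t) volume 0 x := fun t ht =>
    ((contOn_q_x hu ht).mono fun y hy => hy.1).intervalIntegrable_of_Icc hx
  rw [← intervalIntegral.integral_sub (hi t ht) (hi 0 zero_mem_Icc)]
  have a1 : ∫ s in 0..x, (q u s t - q u s 0) = ∫ s in 0..x, ∫ r in 0..t, f s r :=
    intervalIntegral.integral_congr fun s hs => (e1 s (by rwa [uIcc_of_le hx] at hs)).symm
  have a2 : ∫ r in 0..t, (q u 0 r * u 0 r - q u x r * u x r) = ∫ r in 0..t, ∫ s in 0..x, f s r :=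
    intervalIntegral.integral_congr fun r hr => (e2 r (by rwa [uIcc_of_le ht.1] at hr)).symm
  rw [a1, a2]
  simp only [intervalIntegral.integral_of_le hx, intervalIntegral.integral_of_le ht.1]
  refine integral_integral_swap ?_
  rw [Measure.prod_restrict]
  exact (hfc.integrableOn_compact (isCompact_Icc.prod isCompact_Icc)).mono_set
    (prod_mono Ioc_subset_Icc_self Ioc_subset_Icc_self)

lemma contOn_qu (hx : 0 ≤ x) : ContinuousOn (fun s => q u x s * u x s) (Icc 0 T) :=
  (contOn_q_t hu hx).mul (hu.rapidDecay.contOn_t hx)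

lemma yFun_eq (hx : 0 ≤ x) (ht : t ∈ Icc 0 T) :
    yFun u x t = (∫ s in 0..x, q u s 0) - ∫ s in 0..t, q u x s * u x s := by
  have h := integral_q_eq hu hx ht
  have hi : ∀ x, 0 ≤ x → IntervalIntegrable (fun s => q u x s * u x s) volume 0 t := fun x hx =>
    ((contOn_qu hu hx).mono (Icc_subset_Icc_right ht.2)).intervalIntegrable_of_Icc ht.1
  rw [intervalIntegral.integral_sub (hi 0 le_rfl) (hi x hx)] at h
  rw [yFun]
  linarith

omit hu in
lemma hasDeriv_integral {f : ℝ → ℝ} {b : ℝ} (hf : ContinuousOn f (Icc 0 b)) (hx : x ∈ Icc 0 b) :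
    HasDerivWithinAt (fun y => ∫ s in 0..y, f s) (f x) (Icc 0 b) x := by
  have : Fact (x ∈ Icc 0 b) := ⟨hx⟩
  exact intervalIntegral.integral_hasDerivWithinAt_right
    ((hf.mono (Icc_subset_Icc_right hx.2)).intervalIntegrable_of_Icc hx.1)
    (hf.stronglyMeasurableAtFilter_nhdsWithin measurableSet_Icc x) (hf x hx)

lemma hasDeriv_yFun_x (hx : 0 ≤ x) (ht : t ∈ Icc 0 T) :
    HasDerivWithinAt (fun s => yFun u s t) (q u x t) (Ici 0) x := by
  have h := hasDeriv_integral (b := x + 1) ((contOn_q_x hu ht).mono fun y hy => hy.1)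
    (x := x) ⟨hx, by linarith⟩
  have hmem : Icc 0 (x + 1) ∈ 𝓝[Ici 0] x :=
    mem_of_superset (inter_mem_nhdsWithin (Ici 0) (Iio_mem_nhds (lt_add_one x)))
      fun y hy => ⟨hy.1, le_of_lt hy.2⟩
  have h2 := (h.mono_of_mem_nhdsWithin hmem).sub_const (∫ s in 0..t, q u 0 s * u 0 s)
  simpa only [yFun] using h2

lemma hasDeriv_yFun_t (hx : 0 ≤ x) (ht : t ∈ Icc 0 T) :
    HasDerivWithinAt (fun s => yFun u x s) (-(u x t * q u x t)) (Icc 0 T) t := by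
  have h := (hasDeriv_integral (contOn_qu hu hx) ht).const_sub (∫ s in 0..x, q u s 0)
  exact (h.congr (fun s hs => yFun_eq hu hx hs) (yFun_eq hu hx ht)).congr_deriv (by ring)

lemma exists_q_sub_one_bound (N : ℕ) :
    ∃ C, 0 ≤ C ∧ ∀ x t, 0 ≤ x → t ∈ Icc 0 T → |q u x t - 1| ≤ C / (1 + x) ^ N := by
  obtain ⟨C, hC, h⟩ := (rapid_mom hu).bound N
  exact ⟨C, hC, fun x t hx ht => (abs_q_sub_one_le hu hx ht).trans (h x t hx ht)⟩

lemma tendsto_integral_q : Tendsto (fun x => yFun u x 0 - x) atTop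
    (𝓝 (∫ x in Ioi 0, (q u x 0 - 1))) := by
  obtain ⟨C, hC, h⟩ := exists_q_sub_one_bound hu 2
  have h0 := zero_mem_Icc (T := T)
  have hc := contOn_q_x hu h0
  have hi : IntegrableOn (fun x => ((q u x 0 - 1 : ℝ) : ℂ)) (Ioi 0) := by
    refine integrableOn_of_decay (C := C) ?_ fun s hs => ?_
    · exact continuous_ofReal.comp_continuousOn (hc.sub continuousOn_const)
    · rw [norm_real]; exact h s 0 hs h0
  have hi' : IntegrableOn (fun x => q u x 0 - 1) (Ioi 0) := by
    simpa only [IntegrableOn, ofReal_re, RCLike.re_to_complex] using hi.re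
  refine (intervalIntegral_tendsto_integral_Ioi 0 hi' tendsto_id).congr' ?_
  filter_upwards [eventually_ge_atTop 0] with x hx
  rw [id, intervalIntegral.integral_sub ((hc.mono fun y hy => hy.1).intervalIntegrable_of_Icc hx)
    intervalIntegrable_const]
  simp [yFun]

lemma yFun_sub_bound : ∃ C, ∀ x t, 0 ≤ x → t ∈ Icc 0 T → |yFun u x t - x| ≤ C := by
  obtain ⟨C, hC, h⟩ := exists_q_sub_one_bound hu 2
  obtain ⟨c, D, hc, hD⟩ := q_bounds hu
  obtain ⟨A, hA, ha⟩ := hu.rapidDecay.bound 0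
  simp only [pow_zero, div_one] at ha
  have hD0 : 0 ≤ D := hc.le.trans ((hD 0 0 le_rfl zero_mem_Icc).1.trans (hD 0 0 le_rfl zero_mem_Icc).2)
  refine ⟨C + D * A * T, fun x t hx ht => ?_⟩
  have h1 : |yFun u x t - yFun u x 0| ≤ D * A * T := by
    have := norm_image_sub_le_of_norm_deriv_le_segment' (C := D * A)
      (fun s hs => hasDeriv_yFun_t hu hx hs) (fun s hs => by
        have hs' := Ico_subset_Icc_self hs
        have q0 := q_pos hu hx hs'
        rw [norm_neg, norm_mul, mul_comm, norm_of_nonneg q0.le]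
        exact mul_le_mul (hD x s hx hs').2 (ha x s hx hs') (norm_nonneg _) hD0) t ht
    rw [sub_zero] at this
    exact this.trans (mul_le_mul_of_nonneg_left ht.2 (by positivity))
  have h2 : |yFun u x 0 - x| ≤ C := by
    have hd : ∀ s ∈ Icc 0 x, HasDerivWithinAt (fun s => yFun u s 0 - s) (q u s 0 - 1) (Icc 0 x) s :=
      fun s hs => ((hasDeriv_yFun_x hu hs.1 zero_mem_Icc).mono
        (fun y hy => hy.1)).sub (hasDerivWithinAt_id s _)
    have hB : ∀ s, 0 ≤ s → HasDerivAt (fun y : ℝ => -C / (1 + y) + C) (C / (1 + s) ^ 2) s :=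
      fun s hs => (hasDerivAt_neg_div_one_add C hs).add_const C
    have hz : yFun u 0 0 = 0 := by simp [yFun]
    have := image_norm_le_of_norm_deriv_right_le_deriv_boundary' (a := 0) (b := x)
      (f := fun s => yFun u s 0 - s) (f' := fun s => q u s 0 - 1)
      (B := fun y => -C / (1 + y) + C) (B' := fun s => C / (1 + s) ^ 2)
      (fun s hs => (hd s hs).continuousWithinAt)
      (fun s hs => (hd s (Ico_subset_Icc_self hs)).mono_of_mem_nhdsWithin
        (mem_of_superset (Ico_mem_nhdsGE hs.2) fun y hy => ⟨hs.1.trans hy.1, hy.2.le⟩))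
      (by simp [hz]) (fun s hs => (hB s hs.1).continuousAt.continuousWithinAt)
      (fun s hs => (hB s hs.1).hasDerivWithinAt) (fun s hs => h s 0 hs.1 zero_mem_Icc)
      (right_mem_Icc.2 hx)
    refine this.trans ?_
    have : 0 ≤ C / (1 + x) := by positivity
    simp only [neg_div]
    linarith
  exact (abs_sub_le _ (yFun u x 0) _).trans (by linarith)

end

/-! ### Decaying and bounded coefficients -/

/-- `f` is bounded on the half-strip. -/
def Bdd (T : ℝ) (f : ℝ → ℝ → ℂ) : Prop := ∃ C, ∀ x t, 0 ≤ x → t ∈ Icc 0 T → ‖f x t‖ ≤ C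

/-- `f` decays quadratically on the half-strip. -/
def Dec (T : ℝ) (f : ℝ → ℝ → ℂ) : Prop :=
  ∃ C, 0 ≤ C ∧ ∀ x t, 0 ≤ x → t ∈ Icc 0 T → ‖f x t‖ ≤ C / (1 + x) ^ 2

section

variable {f g : ℝ → ℝ → ℂ}

lemma Bdd.const (T : ℝ) (c : ℂ) : Bdd T fun _ _ => c := ⟨‖c‖, fun _ _ _ _ => le_rfl⟩

lemma Bdd.bound (hf : Bdd T f) : ∃ C, 0 ≤ C ∧ ∀ x t, 0 ≤ x → t ∈ Icc 0 T → ‖f x t‖ ≤ C :=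
  hf.imp fun _ h => ⟨(norm_nonneg _).trans (h 0 0 le_rfl zero_mem_Icc), h⟩

lemma Bdd.add (hf : Bdd T f) (hg : Bdd T g) : Bdd T fun x t => f x t + g x t := by
  obtain ⟨A, hA⟩ := hf
  obtain ⟨B, hB⟩ := hg
  exact ⟨A + B, fun x t hx ht => (norm_add_le _ _).trans (add_le_add (hA x t hx ht) (hB x t hx ht))⟩

lemma Bdd.mul (hf : Bdd T f) (hg : Bdd T g) : Bdd T fun x t => f x t * g x t := by
  obtain ⟨A, hA⟩ := hf
  obtain ⟨B, hB⟩ := hg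
  refine ⟨A * B, fun x t hx ht => ?_⟩
  rw [norm_mul]
  exact mul_le_mul (hA x t hx ht) (hB x t hx ht) (norm_nonneg _) ((norm_nonneg _).trans (hA x t hx ht))

lemma Dec.zero (T : ℝ) : Dec T fun _ _ => 0 := ⟨0, le_rfl, fun _ _ _ _ => by simp⟩

lemma Dec.add (hf : Dec T f) (hg : Dec T g) : Dec T fun x t => f x t + g x t := by
  obtain ⟨A, hA0, hA⟩ := hf
  obtain ⟨B, hB0, hB⟩ := hg
  refine ⟨A + B, add_nonneg hA0 hB0, fun x t hx ht => ?_⟩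
  rw [add_div]
  exact (norm_add_le _ _).trans (add_le_add (hA x t hx ht) (hB x t hx ht))

lemma Dec.neg (hf : Dec T f) : Dec T fun x t => -f x t := by
  obtain ⟨A, hA0, hA⟩ := hf
  exact ⟨A, hA0, fun x t hx ht => by rw [norm_neg]; exact hA x t hx ht⟩

lemma Dec.mul (hf : Dec T f) (hg : Bdd T g) : Dec T fun x t => f x t * g x t := by
  obtain ⟨A, hA0, hA⟩ := hf
  obtain ⟨B, hB⟩ := hg
  refine ⟨A * |B|, by positivity, fun x t hx ht => ?_⟩
  rw [norm_mul, mul_div_right_comm]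
  exact mul_le_mul (hA x t hx ht) ((hB x t hx ht).trans (le_abs_self B)) (norm_nonneg _) (by positivity)

lemma Dec.bdd (hf : Dec T f) : Bdd T f := by
  obtain ⟨A, hA0, hA⟩ := hf
  refine ⟨A, fun x t hx ht => (hA x t hx ht).trans (div_le_self hA0 ?_)⟩
  exact one_le_pow₀ (by linarith)

lemma Dec.congr (hf : Dec T f) (h : ∀ x t, 0 ≤ x → t ∈ Icc 0 T → g x t = f x t) : Dec T g := by
  obtain ⟨A, hA0, hA⟩ := hf
  exact ⟨A, hA0, fun x t hx ht => by rw [h x t hx ht]; exact hA x t hx ht⟩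

lemma RapidDecay.dec {f : 𝓕} (hf : RapidDecay T f) : Dec T fun x t => (f x t : ℂ) := by
  obtain ⟨A, hA0, hA⟩ := hf.bound 2
  exact ⟨A, hA0, fun x t hx ht => by rw [norm_real]; exact hA x t hx ht⟩

lemma exists_dec_matrix {N : ℝ → ℝ → Mat3} (h : ∀ i j, Dec T fun x t => N x t i j) :
    ∃ C, ∀ x t, 0 ≤ x → t ∈ Icc 0 T → ∀ i j, ‖N x t i j‖ ≤ C / (1 + x) ^ 2 := by
  choose C hC0 hC using h
  refine ⟨∑ i, ∑ j, C i j, fun x t hx ht i j => (hC i j x t hx ht).trans ?_⟩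
  gcongr
  exact le_sum_sum hC0 i j

end

section

include hu

lemma bdd_q : Bdd T fun x t => (q u x t : ℂ) := by
  obtain ⟨c, C, hc, h⟩ := q_bounds hu
  refine ⟨C, fun x t hx ht => ?_⟩
  rw [norm_real, norm_of_nonneg (q_pos hu hx ht).le]
  exact (h x t hx ht).2

lemma bdd_q_inv : Bdd T fun x t => (q u x t : ℂ)⁻¹ := by
  obtain ⟨c, C, hc, h⟩ := q_bounds hu
  refine ⟨c⁻¹, fun x t hx ht => ?_⟩
  rw [norm_inv, norm_real, norm_of_nonneg (q_pos hu hx ht).le]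
  exact inv_anti₀ hc (h x t hx ht).1

lemma dec_q : Dec T fun x t => (q u x t : ℂ) - 1 := by
  obtain ⟨C, hC, h⟩ := exists_q_sub_one_bound hu 2
  refine ⟨C, hC, fun x t hx ht => ?_⟩
  have := h x t hx ht
  change ‖(q u x t : ℂ) - 1‖ ≤ _
  rwa [← ofReal_one, ← Complex.ofReal_sub, norm_real]

lemma q_cube' (hx : 0 ≤ x) (ht : t ∈ Icc 0 T) : (q u x t : ℂ) ^ 3 = mom u x t + 1 := by
  exact_mod_cast q_cube hu hx ht

lemma q_ne_zero (hx : 0 ≤ x) (ht : t ∈ Icc 0 T) : (q u x t : ℂ) ≠ 0 := by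
  exact_mod_cast (q_pos hu hx ht).ne'

lemma dec_qx : Dec T fun x t => (qx u x t : ℂ) := by
  have hq := bdd_q_inv hu
  refine (((rapid_mom hu).pdx.dec.mul (hq.mul hq)).mul (Bdd.const T (1 / 3))).congr fun x t hx ht => ?_
  rw [qx_eq hu hx ht]
  have := q_ne_zero hu hx ht
  push_cast
  field_simp

lemma contOn_qx_x (ht : t ∈ Icc 0 T) : ContinuousOn (fun s => qx u s t) (Ici 0) := by
  refine ContinuousOn.congr (ContinuousOn.div ((rapid_mom hu).pdx.contOn_x ht)
    (((contOn_q_x hu ht).pow 2).const_mul 3) fun s hs => ?_)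
    fun s hs => qx_eq hu hs ht
  have := q_pos hu hs ht
  exact (by positivity : 0 < 3 * q u s t ^ 2).ne'

lemma contOn_qx_t (hx : 0 ≤ x) : ContinuousOn (fun s => qx u x s) (Icc 0 T) := by
  refine ContinuousOn.congr (ContinuousOn.div ((rapid_mom hu).pdx.contOn_t hx)
    (((contOn_q_t hu hx).pow 2).const_mul 3) fun s hs => ?_)
    fun s hs => qx_eq hu hx hs
  have := q_pos hu hx hs
  exact (by positivity : 0 < 3 * q u x s ^ 2).ne'

omit hu in
lemma hmat_zero : hmat 0 = 0 := by
  ext i j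
  fin_cases i <;> fin_cases j <;> simp [hmat]

lemma frameL_good : (frameL u T).Good u T where
  τ_sub := subset_rfl
  zero_mem := zero_mem_Icc (T := T)
  Icc_sub _ ht := Icc_subset_Icc_right ht.2
  ρ_pos _ _ _ _ := one_pos
  ρ_bd := ⟨1, fun _ _ _ _ => ⟨le_rfl, by simp [frameL]⟩⟩
  ρ_lim := tendsto_const_nhds
  dρx _ _ _ _ := hasDerivWithinAt_const _ _ _
  dρt _ _ _ _ := hasDerivWithinAt_const _ _ _
  dYx x _ _ _ := hasDerivWithinAt_id x _
  dYt _ _ _ _ := hasDerivWithinAt_const _ _ _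
  Y_zero := rfl
  Y_bd := ⟨0, fun _ _ _ _ => by simp [frameL]⟩
  Y_lim := by simp [frameL]
  eqx lm x t hx ht := by
    simp only [frameL, inv_one, dgm_one, one_mul, mul_one, zero_div, hmat_zero, zero_add]
    rw [Umat_eq hu lm hx ht, ofReal_one]
  eqt lm x t _ hx ht := by
    simp only [frameL, inv_one, dgm_one, one_mul, mul_one, zero_div, hmat_zero, zero_add]
    rw [Wmat_eq hu lm hx ht, ofReal_zero]
  contN lm t ht i j := by
    have h := continuous_ofReal.comp_continuousOn (contOn_q_x hu ht)
    simp only [comp_def] at h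
    fin_cases i <;> fin_cases j <;> simp [frameL, N1] <;> fun_prop
  contM lm i j := by
    have h := continuous_ofReal.comp_continuousOn (contOn_q_t hu le_rfl)
    have h1 := continuous_ofReal.comp_continuousOn (hu.rapidDecay.contOn_t le_rfl)
    have h2 := continuous_ofReal.comp_continuousOn ((rapid_dx hu 1).1.contOn_t le_rfl)
    simp only [comp_def] at h h1 h2
    fin_cases i <;> fin_cases j <;> simp [frameL, N2] <;> fun_prop
  decN lm := by
    refine exists_dec_matrix fun i j => ?_
    have h := (rapid_mom hu).dec.mul (Bdd.const T lm)
    fin_cases i <;> fin_cases j <;> simp [frameL, N1, Dec.zero]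
    exact h.congr fun x t hx ht => by rw [q_cube' hu hx ht]; ring
  decM lm := by
    refine exists_dec_matrix fun i j => ?_
    have hU := hu.rapidDecay.dec
    have hX := (rapid_dx hu 1).1.dec
    have h := (rapid_mom hu).dec.mul (Bdd.const T lm)
    fin_cases i <;> fin_cases j <;> simp [frameL, N2, Dec.zero, hU, hX, hU.neg, hX.neg]
    refine (hX.add (hU.mul (((rapid_mom hu).dec.bdd.add (Bdd.const T 1)).mul
      (Bdd.const T (-lm))))).congr fun x t hx ht => ?_
    rw [q_cube' hu hx ht]; ring

lemma gaugeR_x (lm : ℂ) (hx : 0 ≤ x) (ht : t ∈ Icc 0 T) : hmat (qx u x t / q u x t) +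
    dgm (q u x t) * Umat u lm x t * dgm (q u x t)⁻¹ =
      (q u x t : ℂ) • U0 lm + (0 : ℂ) • W0 lm + tN1 u x t := by
  have hq := q_ne_zero hu hx ht
  have h3 := q_cube' hu hx ht
  ext i j
  fin_cases i <;> fin_cases j <;>
    simp [hmat, dgm, Umat, U0, tN1, ← h3]
  field_simp

lemma gaugeR_t {lm : ℂ} (hlm : lm ≠ 0) (hx : 0 ≤ x) (ht : t ∈ Icc 0 T) :
    hmat (-(dx u 1 x t * q u x t + u x t * qx u x t) / q u x t) +
    dgm (q u x t) * Wmat u lm x t * dgm (q u x t)⁻¹ =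
      ((-(u x t * q u x t) : ℝ) : ℂ) • U0 lm + (1 : ℂ) • W0 lm + tN2 u lm x t := by
  have hq := q_ne_zero hu hx ht
  have h3 := q_cube' hu hx ht
  ext i j
  fin_cases i <;> fin_cases j <;>
    simp [hmat, dgm, Wmat, U0, W0, tN2, ← h3] <;>
    field_simp <;> ring

lemma contOn_tN1 (ht : t ∈ Icc 0 T) (i j : Fin 3) : ContinuousOn (fun x => tN1 u x t i j) (Ici 0) := by
  have h := continuous_ofReal.comp_continuousOn (contOn_q_x hu ht)
  have h1 := continuous_ofReal.comp_continuousOn (contOn_qx_x hu ht)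
  have hq : ∀ s ∈ Ici (0 : ℝ), (q u s t : ℂ) ≠ 0 := fun s hs => q_ne_zero hu hs ht
  simp only [comp_def] at h h1
  have hi := h.inv₀ hq
  have hd := h1.div h hq
  fin_cases i <;> fin_cases j <;> simp [tN1] <;>
    first | exact continuousOn_const | exact hd | exact hd.neg | exact hi.sub h

lemma contOn_tN2 (lm : ℂ) (i j : Fin 3) : ContinuousOn (fun t => tN2 u lm 0 t i j) (Icc 0 T) := by
  have h := continuous_ofReal.comp_continuousOn (contOn_q_t hu le_rfl)
  have h1 := continuous_ofReal.comp_continuousOn (contOn_qx_t hu le_rfl)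
  have h2 := continuous_ofReal.comp_continuousOn (hu.rapidDecay.contOn_t le_rfl)
  have h3 := continuous_ofReal.comp_continuousOn ((rapid_dx hu 1).1.contOn_t le_rfl)
  have hq : ∀ s ∈ Icc 0 T, (q u 0 s : ℂ) ≠ 0 := fun s hs => q_ne_zero hu le_rfl hs
  simp only [comp_def] at h h1 h2 h3
  have hi := h.inv₀ hq
  have hd := (h2.mul h1).div h hq
  fin_cases i <;> fin_cases j <;> simp [tN2] <;> first
    | exact continuousOn_const
    | exact hd
    | exact hd.neg
    | exact ((h.pow 2).sub continuousOn_const).div_const _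
    | exact ((h2.add continuousOn_const).div h hq).sub continuousOn_const
    | exact h3.div (h.pow 2) fun s hs => pow_ne_zero 2 (hq s hs)
    | exact (hi.sub continuousOn_const).add (h2.mul h)

lemma dec_tN1 (i j : Fin 3) : Dec T fun x t => tN1 u x t i j := by
  have hi := bdd_q_inv hu
  have h1 := (dec_qx hu).mul hi
  have h2 := (dec_q hu).mul ((hi.add (Bdd.const T 1)).mul (Bdd.const T (-1)))
  fin_cases i <;> fin_cases j <;> simp [tN1, Dec.zero]
  · exact h1
  · refine h2.congr fun x t hx ht => ?_
    have := q_ne_zero hu hx ht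
    field_simp
    ring
  · exact h1.neg

lemma dec_tN2 (lm : ℂ) (i j : Fin 3) : Dec T fun x t => tN2 u lm x t i j := by
  have hi := bdd_q_inv hu
  have hq := bdd_q hu
  have hU := hu.rapidDecay.dec
  have h1 := (hU.mul (dec_qx hu).bdd).mul hi
  have h2 := (dec_q hu).mul hi
  fin_cases i <;> fin_cases j <;> simp [tN2, Dec.zero]
  · exact h1.neg
  · refine ((dec_q hu).mul ((hq.add (Bdd.const T 1)).mul (Bdd.const T (1 / lm)))).congr
      fun x t _ _ => by ring
  · refine ((hU.mul hi).add h2.neg).congr fun x t hx ht => ?_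
    have := q_ne_zero hu hx ht
    field_simp
    ring
  · exact ((rapid_dx hu 1).1.dec.mul (hi.mul hi)).congr fun x t hx ht => by ring
  · refine ((hU.mul hq).add h2.neg).congr fun x t hx ht => ?_
    have := q_ne_zero hu hx ht
    field_simp
    ring
  · exact h1

lemma frameR_good : (frameR u T).Good u T where
  τ_sub := Ico_subset_Icc_self
  zero_mem := ⟨le_rfl, hT.out⟩
  Icc_sub _ ht := fun _ hs => ⟨hs.1, hs.2.trans_lt ht.2⟩
  ρ_pos _ _ hx ht := q_pos hu hx ht
  ρ_bd := by
    obtain ⟨c, C, hc, h⟩ := q_bounds hu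
    refine ⟨max C c⁻¹, fun x t hx ht => ⟨(h x t hx ht).2.trans (le_max_left _ _), ?_⟩⟩
    exact (inv_anti₀ hc (h x t hx ht).1).trans (le_max_right _ _)
  ρ_lim := by
    obtain ⟨C, hC, h⟩ := exists_q_sub_one_bound hu 1
    rw [tendsto_iff_norm_sub_tendsto_zero]
    have hz : Tendsto (fun x : ℝ => C / (1 + x) ^ 1) atTop (𝓝 0) := by
      simp only [pow_one]
      exact (tendsto_atTop_add_const_left _ 1 tendsto_id).const_div_atTop C
    refine squeeze_zero' (Eventually.of_forall fun _ => norm_nonneg _) ?_ hz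
    filter_upwards [eventually_ge_atTop 0] with x hx
    exact h x 0 hx zero_mem_Icc
  dρx x t hx ht := by
    have := hasDeriv_q_x hu hx ht
    rwa [← qx_eq hu hx ht] at this
  dρt _ _ hx ht := hasDeriv_q_t' hu hx ht
  dYx _ _ hx ht := hasDeriv_yFun_x hu hx ht
  dYt _ _ hx ht := hasDeriv_yFun_t hu hx ht
  Y_zero := by simp [frameR, yFun]
  Y_bd := yFun_sub_bound hu
  Y_lim := tendsto_integral_q hu
  eqx lm x t hx ht := gaugeR_x hu lm hx ht
  eqt lm x t hlm hx ht := gaugeR_t hu hlm hx ht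
  contN lm t ht i j := contOn_tN1 hu ht i j
  contM lm i j := contOn_tN2 hu lm i j
  decN lm := exists_dec_matrix (dec_tN1 hu)
  decM lm := exists_dec_matrix (dec_tN2 hu lm)

end

/-- The position of the index `j` in the list `lOrd n`. -/
def rk (n : Fin 18) (j : Fin 3) : Fin 3 :=
  if n#0 = j then 0 else if n#1 = j then 1 else 2

lemma rk_lOrd (n : Fin 18) (p : Fin 3) : rk n n#p = p := by
  revert n p; decide

lemma lOrd_rk (n : Fin 18) (j : Fin 3) : lOrd n (rk n j) = j := by
  revert n j; decide

namespace Frame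

variable (F : Frame) (u : 𝓕) (T : ℝ) (n : Fin 18) (k : ℂ)

/-- The function whose zeros are the poles of the column with the intermediate exponent. -/
def dMid : ℂ := F.row u T n k 1 0 ⬝ᵥ jost u n#0 k

/-- The function whose zeros are the poles of the column with the largest exponent. -/
def dTop : ℂ := topRow u (lOrd n) k ⬝ᵥ crossProduct (F.row u T n k 2 0) (F.row u T n k 2 1)

/-- The vectors generating the columns of the eigenfunction, in the order `lOrd n`. -/
def cvec (r : Fin 3) : ℂ³ :=
  exp (l n#r k * F.c) •
  ![jost u n#0 k, (χ[l n#1 k] / ((l n#2 k - l n#1 k) * F.dMid u T n k)) •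
      crossProduct (F.row u T n k 1 0) (topRow u (lOrd n) k),
    (χ[l n#2 k] / F.dTop u T n k) • crossProduct (F.row u T n k 2 0) (F.row u T n k 2 1)] r

lemma cvec_zero : F.cvec u T n k 0 = exp (l n#0 k * F.c) • jost u n#0 k := rfl

lemma cvec_one : F.cvec u T n k 1 = exp (l n#1 k * F.c) •
    (χ[l n#1 k] / ((l n#2 k - l n#1 k) * F.dMid u T n k)) •
      crossProduct (F.row u T n k 1 0) (topRow u (lOrd n) k) := rfl

lemma cvec_two : F.cvec u T n k 2 = exp (l n#2 k * F.c) • (χ[l n#2 k] / F.dTop u T n k) •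
      crossProduct (F.row u T n k 2 0) (F.row u T n k 2 1) := rfl

/-- The matrix of the vectors generating the columns of the eigenfunction. -/
def cmat : Mat3 := Matrix.of fun i j => F.cvec u T n k (rk n j) i

/-- All columns of `Φ` solve the column equations. -/
def IsSol (Φ : ℝ → ℝ → Mat3) : Prop := ∀ j, F.IsSolCol T n k j fun x t i => Φ x t i j

/-- The column equations are uniquely solvable. -/
def USolv : Prop := (∃ Φ, F.IsSol T n k Φ) ∧ ∀ Φ Φ', F.IsSol T n k Φ → F.IsSol T n k Φ' →
  ∀ x t : ℝ, 0 ≤ x → t ∈ F.τ → Φ x t = Φ' x t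

end Frame

section

variable {F : Frame} (hF : F.Good u T) (h : OrdAt k (lOrd n))

include hu hF h

omit hF in
lemma isCol_iff_cvec (hM : F.dMid u T n k ≠ 0) (hD : F.dTop u T n k ≠ 0) (r : Fin 3)
    : IsCol u k (lOrd n) (F.row u T n k r) r (χ[l n#r k] * exp (l n#r k * F.c)) C ↔
      C = F.cvec u T n k r := by
  cases r using fin3
  · rw [isCol_zero_iff hu h, mul_div_cancel_left₀ _ (h.pi_ne_zero 0)]
    rfl
  · rw [isCol_one_iff hu h hM, Frame.cvec_one, smul_smul, mul_comm _ (exp _), mul_div_assoc]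
    rfl
  · rw [isCol_two_iff hu h hD, Frame.cvec_two, smul_smul, mul_comm _ (exp _), mul_div_assoc]
    rfl

omit hF in
lemma topRow_cvec (hM : F.dMid u T n k ≠ 0) (hD : F.dTop u T n k ≠ 0) (r : Fin 3) :
    topRow u (lOrd n) k ⬝ᵥ F.cvec u T n k r = if r = 2 then χ[l n#2 k] * exp (l n#2 k * F.c) else 0 := by
  have hc := (isCol_iff_cvec hu h hM hD r).2 rfl
  split_ifs with hr
  · subst hr
    exact tendsto_nhds_unique (tendsto_top hu h _) hc.diag
  · exact tendsto_nhds_unique (tendsto_top hu h _) (hc.lim 2 (by lia))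

lemma col_zero_zero (j : Fin 3) (C : ℂ³) : dgm (F.ρ 0 0)⁻¹ *ᵥ (P k *ᵥ F.col u T k j C 0 0) = C := by
  have h0 := hF.ρ_pos 0 0 le_rfl zero_mem_Icc
  rw [F.P_col h.ns, Psi_zero_zero hu, Frame.phase, hF.Y_zero]
  simp [mulVec_mulVec, dgm_inv_mul h0.ne']

variable (hγ : ∀ r, ∀ p < r, contour n n#p n#r = γ₁ → F.τ = Icc 0 T)

include hγ

lemma isSol_cvec (hM : F.dMid u T n k ≠ 0) (hD : F.dTop u T n k ≠ 0) :
    F.IsSol T n k fun x t => Matrix.of fun i j => F.col u T k j (F.cvec u T n k (rk n j)) x t i := by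
  intro j
  have := isSolCol_of_isCol hu hF h (hγ (rk n j)) ((isCol_iff_cvec hu h hM hD (rk n j)).2 rfl)
  rw [lOrd_rk] at this
  exact this

lemma isSol_eq (hM : F.dMid u T n k ≠ 0) (hD : F.dTop u T n k ≠ 0) {Φ : ℝ → ℝ → Mat3}
    (hΦ : F.IsSol T n k Φ) (hx : 0 ≤ x) (ht : t ∈ F.τ) (i j : Fin 3) :
    Φ x t i j = F.col u T k j (F.cvec u T n k (rk n j)) x t i := by
  have hj := hΦ (lOrd n (rk n j))
  obtain ⟨C, hC, hv⟩ := exists_isCol_of_isSolCol hu hF h (hγ (rk n j)) hj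
  rw [isCol_iff_cvec hu h hM hD] at hC
  have := congrFun (hv x t hx ht) i
  rw [hC, lOrd_rk] at this
  exact this

lemma uSolv_iff : F.USolv T n k ↔ F.dMid u T n k ≠ 0 ∧ F.dTop u T n k ≠ 0 := by
  constructor
  · rintro ⟨⟨Φ, hΦ⟩, huniq⟩
    have key : ∀ r v, v ≠ 0 → ¬ IsCol u k (lOrd n) (F.row u T n k r) r 0 v := by
      intro r v hv hcol
      obtain ⟨C, hC, hCv⟩ := exists_isCol_of_isSolCol hu hF h (hγ r) (hΦ n#r)
      have h2 := hC.add hcol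
      rw [add_zero] at h2
      have h3 := isSolCol_of_isCol hu hF h (hγ r) h2
      set Φ' : ℝ → ℝ → Mat3 := fun x t => Matrix.of fun i j =>
        if j = n#r then F.col u T k n#r (C + v) x t i else Φ x t i j with hΦ'
      have hs : F.IsSol T n k Φ' := by
        intro j
        by_cases e : j = n#r
        · subst e
          convert h3 using 3 with x t
          funext i; simp [hΦ']
        · convert hΦ j using 3 with x t
          funext i
          simp [hΦ', e]
      have he := huniq Φ Φ' hΦ hs 0 0 le_rfl hF.zero_mem
      have he2 : F.col u T k n#r C 0 0 = F.col u T k n#r (C + v) 0 0 := by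
        rw [← hCv 0 0 le_rfl hF.zero_mem]
        funext i
        have := congrFun (congrFun he i) n#r
        simpa [hΦ'] using this
      have e1 := col_zero_zero hu hF h n#r C
      rw [he2, col_zero_zero hu hF h] at e1
      exact hv (by simpa using e1)
    refine ⟨fun hM => ?_, fun hD => ?_⟩
    · exact key 1 _ (jost_ne_zero hu h) (isCol_one_add_jost hu h hM)
    · obtain ⟨v, hv, hcol⟩ := exists_isCol_two_zero hu h hD
      exact key 2 v hv hcol
  · rintro ⟨hM, hD⟩
    refine ⟨⟨_, isSol_cvec hu hF h hγ hM hD⟩, fun Φ Φ' hΦ hΦ' x t hx ht => ?_⟩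
    ext i j
    rw [isSol_eq hu hF h hγ hM hD hΦ hx ht, isSol_eq hu hF h hγ hM hD hΦ' hx ht]

omit hF hγ in
lemma det_cmat_ne_zero (hM : F.dMid u T n k ≠ 0) (hD : F.dTop u T n k ≠ 0) :
    (F.cmat u T n k).det ≠ 0 := by
  intro h0
  obtain ⟨w, hw, he⟩ := Matrix.exists_mulVec_eq_zero_iff.2 h0
  have hsum : ∑ p, w n#p • F.cvec u T n k p = 0 := by
    rw [← he]
    have hb : Function.Bijective (lOrd n) := (Finite.injective_iff_bijective.1 (lOrd_injective n))
    have := hb.sum_comp (fun j => w j • F.cvec u T n k (rk n j))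
    simp only [rk_lOrd] at this
    rw [this]
    funext i
    simp [Frame.cmat, mulVec, dotProduct, mul_comm]
  rw [sum_univ_three] at hsum
  have hc := fun r => (isCol_iff_cvec hu h hM hD r).2 rfl
  have e0 : ∀ r, exp (l n#r k * F.c) ≠ 0 := fun r => exp_ne_zero _
  have t := topRow_cvec hu h hM hD
  have b0 : F.row u T n k 1 0 ⬝ᵥ F.cvec u T n k 0 ≠ 0 := by
    rw [Frame.cvec, dotProduct_smul]
    exact mul_ne_zero (e0 0) hM
  have b1 : F.row u T n k 1 0 ⬝ᵥ F.cvec u T n k 1 = 0 := (hc 1).start 0 (by decide)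
  have w2 : w n#2 = 0 := by
    have := congrArg (fun v => topRow u (lOrd n) k ⬝ᵥ v) hsum
    simpa +decide [dotProduct_add, dotProduct_smul, t, h.pi_ne_zero 2] using this
  rw [w2, zero_smul, add_zero] at hsum
  have w0 : w n#0 = 0 := by
    have := congrArg (fun v => F.row u T n k 1 0 ⬝ᵥ v) hsum
    simp only [dotProduct_add, dotProduct_smul, b1, dotProduct_zero, mul_zero, add_zero,
      smul_eq_mul] at this
    exact (mul_eq_zero.1 this).resolve_right b0
  rw [w0, zero_smul, zero_add] at hsum
  have w1 : w n#1 = 0 := by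
    rcases smul_eq_zero.1 hsum with e | e
    · exact e
    · have hd := (hc 1).diag
      simp only [e, mulVec_zero, lev, Pi.zero_apply, mul_zero, add_zero, zero_mul] at hd
      exact absurd (tendsto_nhds_unique hd tendsto_const_nhds) (mul_ne_zero (h.pi_ne_zero 1) (e0 1))
  apply hw
  funext j
  rw [← lOrd_rk n j]
  generalize rk n j = p
  cases p using fin3 <;> assumption

end

/-! ### The two Lax pairs -/

lemma comm_diagonal_apply (a : ℂ³) (Φ : Mat3) (i j : Fin 3) :
    (diagonal a * Φ - Φ * diagonal a) i j = (a i - a j) * Φ i j := by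
  rw [Matrix.sub_apply, diagonal_mul, mul_diagonal]; ring

lemma Frame.IsSol.bounded {F : Frame} {Φ : ℝ → ℝ → Mat3} (h : F.IsSol T n k Φ) (ht : t ∈ F.τ) :
    ∃ C, ∀ x, 0 ≤ x → ∀ i j, ‖Φ x t i j‖ ≤ C := by
  choose C hC using fun j => (h j).bounded t ht
  exact ⟨∑ j, |C j|, fun x hx i j => (hC j x hx i).trans ((le_abs_self _).trans
    (le_sum_three (fun _ => abs_nonneg _) j))⟩

lemma laxL_t_apply (hk : NonSpecial k) (Φ : Mat3) (x t : ℝ) (i j : Fin 3) :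
    (calZ k * Φ - Φ * calZ k + V2 u x t k * Φ) i j =
      ((0 : ℝ) : ℂ) * ((l i k - l j k) * Φ i j) + 1 * ((z i k - z j k) * Φ i j)
      + coord (l i k) (N2 u (lam k) x t *ᵥ (P k *ᵥ fun r => Φ r j)) := by
  rw [Matrix.add_apply, calZ, comm_diagonal_apply, V2, conj_apply hk, N2]
  simp

lemma isPhi_iff (hk : NonSpecial k)
    {Φ : ℝ → ℝ → Mat3} : IsPhi u T n k Φ ↔ (frameL u T).IsSol T n k Φ := by
  have e1 : ∀ x t i j, (calL k * Φ x t - Φ x t * calL k + V1 u x t k * Φ x t) i j =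
      ((1 : ℝ) : ℂ) * ((l i k - l j k) * Φ x t i j) + 0 * ((z i k - z j k) * Φ x t i j)
      + coord (l i k) (N1 u (lam k) x t *ᵥ (P k *ᵥ fun r => Φ x t r j)) := fun x t i j => by
    rw [Matrix.add_apply, calL, comm_diagonal_apply, V1, conj_apply hk, N1]
    simp
  have e3 : ∀ x t i j, (V1 u x t k * Φ x t) i j =
      coord (l i k) (N1 u (lam k) x t *ᵥ (P k *ᵥ fun r => Φ x t r j)) := fun x t i j => by
    rw [V1, conj_apply hk, N1]
  have e4 : ∀ x t i j, (V2 u x t k * Φ x t) i j =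
      coord (l i k) (N2 u (lam k) x t *ᵥ (P k *ᵥ fun r => Φ x t r j)) := fun x t i j => by
    rw [V2, conj_apply hk, N2]
  refine ⟨fun h j => ⟨fun x t hx ht i => (h.lax_x x t hx ht.1 ht.2 i j).congr_deriv (e1 x t i j),
    fun x t hx ht i => (h.lax_t x t hx ht.1 ht.2 i j).congr_deriv (laxL_t_apply hk (Φ x t) x t i j),
    fun t ht => (h.bounded t ht.1 ht.2).imp fun C hC x hx i => hC x hx i j, fun x t hx ht i => ?_⟩,
    fun h => ⟨fun x t hx h0 h1 i j => ((h j).lax_x x t hx ⟨h0, h1⟩ i).congr_deriv (e1 x t i j).symm,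
    fun x t hx h0 h1 i j => ((h j).lax_t x t hx ⟨h0, h1⟩ i).congr_deriv (laxL_t_apply hk (Φ x t) x t i j).symm,
    fun t h0 h1 => h.bounded ⟨h0, h1⟩, fun x t hx h0 h1 i j => ?_⟩⟩
  · have := h.integral_eq x t hx ht.1 ht.2 i j
    simp only [e3, e4] at this
    exact this
  · simp only [e3, e4]
    exact (h j).integral_eq x t hx ⟨h0, h1⟩ i

lemma isTPhi_iff (hk : NonSpecial k)
    {Φ : ℝ → ℝ → Mat3} : IsTPhi u T n k Φ ↔ (frameR u T).IsSol T n k Φ := by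
  have e1 : ∀ x t i j, ((q u x t : ℂ) • (calL k * Φ x t - Φ x t * calL k) + tV1 u x t k * Φ x t) i j =
      (q u x t : ℂ) * ((l i k - l j k) * Φ x t i j) + 0 * ((z i k - z j k) * Φ x t i j)
      + coord (l i k) (tN1 u x t *ᵥ (P k *ᵥ fun r => Φ x t r j)) := fun x t i j => by
    rw [Matrix.add_apply, Matrix.smul_apply, calL, comm_diagonal_apply, tV1, conj_apply hk, tN1]
    simp
  have e2 : ∀ x t i j, (calZ k * Φ x t - Φ x t * calZ k
        - ((u x t : ℂ) * q u x t) • (calL k * Φ x t - Φ x t * calL k) + tV2 u x t k * Φ x t) i j =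
      ((-(u x t * q u x t) : ℝ) : ℂ) * ((l i k - l j k) * Φ x t i j)
      + 1 * ((z i k - z j k) * Φ x t i j)
      + coord (l i k) (tN2 u (lam k) x t *ᵥ (P k *ᵥ fun r => Φ x t r j)) := fun x t i j => by
    rw [Matrix.add_apply, Matrix.sub_apply, Matrix.smul_apply, calZ, calL, comm_diagonal_apply,
      comm_diagonal_apply, tV2, conj_apply hk, tN2, smul_eq_mul]
    push_cast
    ring
  have e3 : ∀ x t i j, (tV1 u x t k * Φ x t) i j =
      coord (l i k) (tN1 u x t *ᵥ (P k *ᵥ fun r => Φ x t r j)) := fun x t i j => by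
    rw [tV1, conj_apply hk, tN1]
  have e4 : ∀ x t i j, (tV2 u x t k * Φ x t) i j =
      coord (l i k) (tN2 u (lam k) x t *ᵥ (P k *ᵥ fun r => Φ x t r j)) := fun x t i j => by
    rw [tV2, conj_apply hk, tN2]
  refine ⟨fun h j => ⟨fun x t hx ht i => (h.lax_x x t hx ht.1 ht.2 i j).congr_deriv (e1 x t i j),
    fun x t hx ht i => (h.lax_t x t hx ht.1 ht.2 i j).congr_deriv (e2 x t i j),
    fun t ht => (h.bounded t ht.1 ht.2).imp fun C hC x hx i => hC x hx i j, fun x t hx ht i => ?_⟩,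
    fun h => ⟨fun x t hx h0 h1 i j => ((h j).lax_x x t hx ⟨h0, h1⟩ i).congr_deriv (e1 x t i j).symm,
    fun x t hx h0 h1 i j => ((h j).lax_t x t hx ⟨h0, h1⟩ i).congr_deriv (e2 x t i j).symm,
    fun t h0 h1 => h.bounded ⟨h0, h1⟩, fun x t hx h0 h1 i j => ?_⟩⟩
  · have := h.integral_eq x t hx ht.1 ht.2 i j
    simp only [e3, e4] at this
    exact this
  · simp only [e3, e4]
    exact (h j).integral_eq x t hx ⟨h0, h1⟩ i

/-! ### The functions `M`, `S`, `ν` -/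

/-- The frame belonging to an index. -/
def Idx.frame (u : 𝓕) (T : ℝ) : Idx → Frame
  | inl _ => frameL u T
  | inr _ => frameR u T

/-- The index of the set `D_n` belonging to an index. -/
def Idx.num : Idx → Fin 18
  | inl n => n
  | inr n => emb n

/-- The unique solvability of the problem belonging to an index. -/
def Idx.Solv (u : 𝓕) (T : ℝ) (n : Idx) (k : ℂ) : Prop :=
  (n.frame u T).dMid u T n.num k ≠ 0 ∧ (n.frame u T).dTop u T n.num k ≠ 0

/-- The matrix of the vectors generating the columns of the eigenfunction. -/
def Idx.cmat (u : 𝓕) (T : ℝ) (n : Idx) (k : ℂ) : Mat3 := (n.frame u T).cmat u T n.num k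

lemma zOrd_emb (n : Fin 6) : zOrd (emb n) = lOrd (emb n) := by
  revert n; decide

lemma contour_emb {n : Fin 6} (h : p < r) : contour (emb n) (emb n)#p (emb n)#r = γ₂ := by
  rw [contour, zOrd_emb, if_pos (before_lOrd.2 h), if_pos (before_lOrd.2 h)]

lemma Idx.contour_one (n : Idx) : ∀ r, ∀ p < r,
    contour n.num n.num#p n.num#r = γ₁ → (n.frame u T).τ = Icc 0 T := by
  intro r p hp h
  rcases n with n | n
  · rfl
  · rw [Idx.num, contour_emb hp] at h
    cases h

section

include hu

lemma Idx.frame_good (n : Idx) : (n.frame u T).Good u T := by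
  rcases n with n | n
  · exact frameL_good hu
  · exact frameR_good hu

lemma solvable_iff (h : OrdAt k (lOrd n)) : Solvable u T n k ↔ Idx.Solv u T (inl n) k := by
  rw [Idx.Solv, Idx.frame, Idx.num, ← uSolv_iff hu (frameL_good hu) h (Idx.contour_one (inl n))]
  simp [isPhi_iff h.ns, Solvable, Frame.USolv, frameL]

lemma tSolvable_iff {n : Fin 6} (h : OrdAt k (lOrd (emb n))) :
    TSolvable u T (emb n) k ↔ Idx.Solv u T (inr n) k := by
  rw [Idx.Solv, Idx.frame, Idx.num, ← uSolv_iff hu (frameR_good hu) h (Idx.contour_one (inr n))]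
  simp [isTPhi_iff h.ns, TSolvable, Frame.USolv, frameR]

lemma strictMonoOn_yFun (ht : t ∈ Icc 0 T) : StrictMonoOn (fun x => yFun u x t) (Ici 0) := by
  refine strictMonoOn_of_deriv_pos (convex_Ici 0)
    (fun x hx => (hasDeriv_yFun_x hu hx ht).continuousWithinAt) fun x hx => ?_
  rw [interior_Ici] at hx
  rw [((hasDeriv_yFun_x hu (le_of_lt hx) ht).hasDerivAt (Ici_mem_nhds hx)).deriv]
  exact q_pos hu (le_of_lt hx) ht

lemma xOf_yFun (hx : 0 ≤ x) (ht : t ∈ Icc 0 T) : xOf u (yFun u x t) t = x :=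
  (strictMonoOn_yFun hu ht).injOn.leftInvOn_invFunOn hx

lemma M_eq {n : Idx} (h : OrdAt k (lOrd n.num)) (hs : n.Solv u T k) (hx : 0 ≤ x) (ht : t ∈ Ico 0 T) : M u T n (yFun u x t) t k =
      (P k)⁻¹ * (Psi u T (lam k) x t * n.cmat u T k) * expLZ k (-yFun u x t) (-t) := by
  have ht' := Ico_subset_Icc_self ht
  have key : ∀ i j, ((P k)⁻¹ * (Psi u T (lam k) x t * n.cmat u T k) *
      expLZ k (-yFun u x t) (-t)) i j = coord (l i k) (Psi u T (lam k) x t *ᵥ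
        (n.frame u T).cvec u T n.num k (rk n.num j)) *
        exp (l j k * (-yFun u x t : ℝ) + z j k * (-t : ℝ)) := fun i j => by
    rw [expLZ, mul_diagonal]
    congr 1
    have := congrFun (P_inv_mulVec h.ns (Psi u T (lam k) x t *ᵥ
        (n.frame u T).cvec u T n.num k (rk n.num j))) i
    rw [← this]
    rfl
  have hsol := fun Φ => isSol_eq (Φ := Φ) (x := x) (t := t) hu (n.frame_good hu) h (n.contour_one) hs.1 hs.2
  ext i j
  rw [key]
  rcases n with n | n
  · have hΦ : IsPhi u T n k (Classical.epsilon (IsPhi u T n k)) :=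
      Classical.epsilon_spec ((solvable_iff hu h).2 hs).1
    simp only [M]
    rw [xOf_yFun hu hx ht', expLZ, mul_diagonal, Phi,
      hsol _ ((isPhi_iff h.ns).1 hΦ) hx ht' i j, Frame.col]
    simp only [Idx.frame, frameL, dgm_one, one_mulVec, Frame.phase]
    rw [mul_assoc, ← exp_add]
    congr 2
    push_cast
    ring
  · have hΦ : IsTPhi u T (emb n) k (Classical.epsilon (IsTPhi u T (emb n) k)) :=
      Classical.epsilon_spec ((tSolvable_iff hu h).2 hs).1
    simp only [M]
    rw [xOf_yFun hu hx ht', conj_apply h.ns]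
    have e : (fun r => TPhi u T (emb n) x t k r j) = (frameR u T).col u T k j
        ((frameR u T).cvec u T (emb n) k (rk (emb n) j)) x t :=
      funext fun r => hsol _ ((isTPhi_iff h.ns).1 hΦ) hx ht r j
    have hD : Dmat u x t = dgm (q u x t)⁻¹ := by
      ext a b
      fin_cases a <;> fin_cases b <;> simp [Dmat, dgm]
    rw [e, Frame.P_col h.ns, hD, mulVec_smul, coord_smul, mulVec_mulVec, mul_comm]
    simp only [Idx.frame, frameR, Frame.phase, Idx.num]
    rw [dgm_inv_mul (q_pos hu hx ht').ne', one_mulVec]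
    congr 2
    push_cast
    ring

lemma S_eq {n : Idx} (h : OrdAt k (lOrd n.num)) (hs : n.Solv u T k) :
    S u T n k = (P k)⁻¹ * n.cmat u T k := by
  have h0 : yFun u 0 0 = 0 := by simp [yFun]
  have := M_eq hu h hs le_rfl (t := 0) ⟨le_rfl, hT.out⟩
  rw [h0, Psi_zero_zero hu, one_mul] at this
  rw [S, this]
  simp [expLZ]

lemma nu_apply {n : Idx} (h : OrdAt k (lOrd n.num)) (hs : n.Solv u T k) (hx : 0 ≤ x) (ht : t ∈ Ico 0 T) (p : Fin 3) : nu u T n (yFun u x t) t k n.num#p =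
      (Psi u T (lam k) x t *ᵥ (n.frame u T).cvec u T n.num k p) 0 *
        exp (-(l n.num#p k * yFun u x t + z n.num#p k * t)) := by
  have hone : (![1, 1, 1] : ℂ³) ᵥ* (P k)⁻¹ = Pi.single 0 1 := by
    have h1 : (![1, 1, 1] : ℂ³) = Pi.single 0 1 ᵥ* P k := by
      funext i
      cases i using fin3 <;> simp [P]
    rw [h1, vecMul_vecMul, mul_nonsing_inv _ (isUnit_det_P h.ns), vecMul_one]
  rw [nu, M_eq hu h hs hx ht, ← vecMul_vecMul, ← vecMul_vecMul, hone, expLZ,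
    Matrix.vecMul_diagonal, Matrix.single_one_vecMul]
  congr 1
  · rw [Matrix.row_apply, Idx.cmat, Frame.cmat, mul_apply, mulVec, dotProduct]
    simp [rk_lOrd]
  · congr 1; push_cast; ring

omit hu in
lemma expLZ_mul_expLZ_neg (k : ℂ) (a b : ℝ) : expLZ k a b * expLZ k (-a) (-b) = 1 := by
  rw [expLZ, expLZ, Matrix.diagonal_mul_diagonal, ← Matrix.diagonal_one]
  congr 1
  funext j
  rw [← exp_add]
  have : l j k * a + z j k * b + (l j k * ((-a : ℝ) : ℂ) + z j k * ((-b : ℝ) : ℂ)) = 0 := by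
    push_cast; ring
  rw [this, exp_zero]

lemma jump_relation {m n : Idx} (hm : OrdAt k (lOrd m.num)) (hn : OrdAt k (lOrd n.num))
    (sm : m.Solv u T k) (sn : n.Solv u T k) (hx : 0 ≤ x) (ht : t ∈ Ico 0 T) :
    nu u T n (yFun u x t) t k = nu u T m (yFun u x t) t k ᵥ* J u T m n (yFun u x t) t k ∧
      J u T m n (yFun u x t) t k * J u T n m (yFun u x t) t k = 1 := by
  have hP := isUnit_det_P hm.ns
  have hcm : IsUnit (m.cmat u T k).det := isUnit_iff_ne_zero.2 (det_cmat_ne_zero hu hm sm.1 sm.2)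
  have hcn : IsUnit (n.cmat u T k).det := isUnit_iff_ne_zero.2 (det_cmat_ne_zero hu hn sn.1 sn.2)
  have hS : ∀ {a b : Idx}, OrdAt k (lOrd a.num) → OrdAt k (lOrd b.num) → a.Solv u T k →
      b.Solv u T k → (S u T a k)⁻¹ * S u T b k = (a.cmat u T k)⁻¹ * b.cmat u T k := by
    intro a b ha hb sa sb
    rw [S_eq hu ha sa, S_eq hu hb sb, Matrix.mul_inv_rev, Matrix.mul_assoc,
      Matrix.nonsing_inv_nonsing_inv _ hP, mul_nonsing_inv_cancel_left _ _ hP]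
  have hE := expLZ_mul_expLZ_neg k (-yFun u x t) (-t)
  rw [neg_neg, neg_neg] at hE
  constructor
  · rw [nu, nu, M_eq hu hn sn hx ht, M_eq hu hm sm hx ht, J, hS hm hn sm sn, vecMul_vecMul]
    congr 1
    simp only [Matrix.mul_assoc]
    rw [← Matrix.mul_assoc (expLZ k (-yFun u x t) (-t)), hE, Matrix.one_mul,
      mul_nonsing_inv_cancel_left _ _ hcm]
  · rw [J, J, hS hm hn sm sn, hS hn hm sn sm]
    simp only [Matrix.mul_assoc]
    rw [← Matrix.mul_assoc (expLZ k (-yFun u x t) (-t)), hE, Matrix.one_mul,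
      mul_nonsing_inv_cancel_left _ _ hcn, Matrix.nonsing_inv_mul_cancel_left _ _ hcm,
      expLZ_mul_expLZ_neg]

end

/-! ### Bounds near the special points -/

lemma norm_exp_sub_le {A v A' g : ℝ → ℂ} {G G' : ℝ → ℝ} {a b c : ℝ} (hab : a ≤ b)
    (hA : ∀ s ∈ Icc a b, HasDerivWithinAt A (A' s) (Icc a b) s)
    (hv : ∀ s ∈ Icc a b, HasDerivWithinAt v (A' s * v s + g s) (Icc a b) s)
    (hg : ∀ s ∈ Icc a b, ‖g s‖ ≤ G' s) (hG : ∀ s ∈ Icc a b, HasDerivAt G (G' s) s)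
    (hc : ∀ s ∈ Icc a b, (A c).re ≤ (A s).re) :
    ‖exp (A c - A b) * v b - exp (A c - A a) * v a‖ ≤ G b - G a := by
  have hd : ∀ s ∈ Icc a b, HasDerivWithinAt (fun s => exp (A c - A s) * v s -
      exp (A c - A a) * v a) (exp (A c - A s) * g s) (Icc a b) s := fun s hs =>
    ((((hA s hs).const_sub (A c)).cexp.mul (hv s hs)).sub_const _).congr_deriv (by ring)
  refine image_norm_le_of_norm_deriv_right_le_deriv_boundary' (a := a) (b := b)
    (f' := fun s => exp (A c - A s) * g s) (B := fun s => G s - G a) (B' := G')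
    (fun s hs => (hd s hs).continuousWithinAt) (fun s hs => ?_) (by simp)
    (fun s hs => ((hG s hs).sub_const _).continuousAt.continuousWithinAt)
    (fun s hs => ((hG s (Ico_subset_Icc_self hs)).sub_const _).hasDerivWithinAt)
    (fun s hs => ?_) (right_mem_Icc.2 hab)
  · exact (hd s (Ico_subset_Icc_self hs)).mono_of_mem_nhdsWithin
      (mem_of_superset (Icc_mem_nhdsGE hs.2) (Icc_subset_Icc_left hs.1))
  · have hs' := Ico_subset_Icc_self hs
    rw [norm_mul, norm_exp, sub_re]
    refine (mul_le_of_le_one_left (norm_nonneg _) ?_).trans (hg s hs')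
    exact exp_le_one_iff.2 (sub_nonpos.2 (hc s hs'))

lemma norm_le_of_transport {Λ : ℂ} {w g : ℝ → ℂ} {T c s : ℝ}
    (hw : ∀ t ∈ Icc 0 T, HasDerivWithinAt w (Λ * w t + g t) (Icc 0 T) t)
    (hg : ∀ t ∈ Icc 0 T, ‖g t‖ ≤ c) (hs : s = 0 ∧ Λ.re ≤ 0 ∨ s = T ∧ 0 ≤ Λ.re) (ht : t ∈ Icc 0 T) : ‖w t‖ ≤ ‖w s‖ + c * T := by
  have hc : 0 ≤ c := (norm_nonneg _).trans (hg t ht)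
  have hA : ∀ r, HasDerivAt (fun r : ℝ => Λ * r) Λ r := fun r =>
    ((hasDerivAt_id r).ofReal_comp.const_mul Λ).congr_deriv (by simp)
  have hG : ∀ r, HasDerivAt (fun r : ℝ => c * r) c r := fun r =>
    ((hasDerivAt_id r).const_mul c).congr_deriv (by simp)
  rcases hs with ⟨rfl, hs⟩ | ⟨rfl, hs⟩
  · have hsub : Icc 0 t ⊆ Icc 0 T := Icc_subset_Icc_right ht.2
    have := norm_exp_sub_le (c := t) ht.1 (fun r _ => (hA r).hasDerivWithinAt)
      (fun r hr => (hw r (hsub hr)).mono hsub) (fun r hr => hg r (hsub hr)) (fun r _ => hG r)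
      (fun r hr => by simpa using mul_le_mul_of_nonpos_left hr.2 hs)
    rw [sub_self, exp_zero, one_mul] at this
    have h2 : ‖exp (Λ * t - Λ * ((0 : ℝ) : ℂ)) * w 0‖ ≤ ‖w 0‖ := by
      rw [norm_mul, norm_exp]
      refine mul_le_of_le_one_left (norm_nonneg _) (exp_le_one_iff.2 ?_)
      simpa using mul_nonpos_of_nonpos_of_nonneg hs ht.1
    have h3 := norm_sub_norm_le (w t) (exp (Λ * t - Λ * ((0 : ℝ) : ℂ)) * w 0)
    have := mul_le_mul_of_nonneg_left ht.2 hc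
    linarith
  · have hsub : Icc t s ⊆ Icc 0 s := Icc_subset_Icc_left ht.1
    have := norm_exp_sub_le (c := t) ht.2 (fun r _ => (hA r).hasDerivWithinAt)
      (fun r hr => (hw r (hsub hr)).mono hsub) (fun r hr => hg r (hsub hr)) (fun r _ => hG r)
      (fun r hr => by simpa using mul_le_mul_of_nonneg_left hr.1 hs)
    rw [sub_self, exp_zero, one_mul] at this
    have h2 : ‖exp (Λ * t - Λ * s) * w s‖ ≤ ‖w s‖ := by
      rw [norm_mul, norm_exp]
      refine mul_le_of_le_one_left (norm_nonneg _) (exp_le_one_iff.2 ?_)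
      simpa using mul_le_mul_of_nonneg_left ht.2 hs
    have h3 := norm_sub_norm_le (w t) (exp (Λ * t - Λ * s) * w s)
    rw [norm_sub_rev] at h3
    have := mul_nonneg hc ht.1
    linarith

lemma norm_le_of_fast {Λ : ℂ} {y g g' r : ℝ → ℂ} {T A δ s : ℝ} (hΛ : Λ ≠ 0)
    (hy : ∀ t ∈ Icc 0 T, HasDerivWithinAt y (Λ * y t + g t + r t) (Icc 0 T) t)
    (hg : ∀ t ∈ Icc 0 T, HasDerivWithinAt g (g' t) (Icc 0 T) t) (hgA : ∀ t ∈ Icc 0 T, ‖g t‖ ≤ A)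
    (hgA' : ∀ t ∈ Icc 0 T, ‖g' t‖ ≤ A) (hr : ∀ t ∈ Icc 0 T, ‖r t‖ ≤ δ)
    (hs : s = 0 ∧ Λ.re ≤ 0 ∨ s = T ∧ 0 ≤ Λ.re) (h0 : y s = 0) (ht : t ∈ Icc 0 T) :
    ‖y t‖ ≤ δ * T + (2 + T) * A / ‖Λ‖ := by
  have hT₀ : (0 : ℝ) ≤ T := ht.1.trans ht.2
  have hsm : s ∈ Icc 0 T := by
    rcases hs with ⟨rfl, -⟩ | ⟨rfl, -⟩
    exacts [left_mem_Icc.2 hT₀, right_mem_Icc.2 hT₀]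
  have hq : ∀ t ∈ Icc 0 T, ‖g t / Λ‖ ≤ A / ‖Λ‖ := fun t ht => by
    rw [norm_div]; exact div_le_div_of_nonneg_right (hgA t ht) (norm_nonneg _)
  have hq' : ∀ t ∈ Icc 0 T, ‖g' t / Λ‖ ≤ A / ‖Λ‖ := fun t ht => by
    rw [norm_div]; exact div_le_div_of_nonneg_right (hgA' t ht) (norm_nonneg _)
  have := norm_le_of_transport (w := fun t => y t + g t / Λ) (g := fun t => g' t / Λ + r t)
    (c := A / ‖Λ‖ + δ) (fun t ht => ((hy t ht).add ((hg t ht).div_const Λ)).congr_deriv (by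
      field_simp; ring)) (fun t ht => (norm_add_le _ _).trans (add_le_add (hq' t ht) (hr t ht))) hs ht
  rw [h0, zero_add] at this
  have h1 := norm_sub_le (y t + g t / Λ) (g t / Λ)
  rw [add_sub_cancel_right] at h1
  have e : (2 + T) * A / ‖Λ‖ = 2 * (A / ‖Λ‖) + A / ‖Λ‖ * T := by ring
  have := hq t ht
  have := hq s hsm
  rw [e]
  linarith

lemma le_of_self_improving {ι : Type*} {f : ι → ℝ} {D : ℝ} (hf : BddAbove (range f))
    (h : ∀ B, (∀ i, f i ≤ B) → ∀ i, f i ≤ D + B / 2) (i : ι) : f i ≤ 2 * D := by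
  have hN := fun i => le_ciSup hf i
  have : Nonempty ι := ⟨i⟩
  have := ciSup_le (h _ hN)
  linarith [hN i]

section

variable {F : Frame} (hF : F.Good u T) (ht : t ∈ Icc 0 T)
  {i j : Fin 3} {w g : ℝ → ℂ} {c : ℝ} (hw : ∀ x, 0 ≤ x → HasDerivWithinAt w
    (F.ρ x t * ((l i k - l j k) * w x) + g x) (Ici 0) x)
  (hg : ∀ x, 0 ≤ x → ‖g x‖ ≤ c / (1 + x) ^ 2)

include hF ht

lemma monotoneOn_Y : MonotoneOn (fun x => F.Y x t) (Ici 0) := by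
  refine monotoneOn_of_deriv_nonneg (convex_Ici 0)
    (fun x hx => (hF.dYx x t hx ht).continuousWithinAt) (fun x hx => ?_) fun x hx => ?_
  all_goals
    rw [interior_Ici] at hx
    have := (hF.dYx x t (le_of_lt hx) ht).hasDerivAt (Ici_mem_nhds hx)
  · exact this.differentiableAt.differentiableWithinAt
  · rw [this.deriv]; exact (hF.ρ_pos x t (le_of_lt hx) ht).le

include hw hg

lemma norm_exp_sub_le_x {a b e : ℝ} (ha : 0 ≤ a) (hab : a ≤ b)
    (he : ∀ s ∈ Icc a b, (l i k - l j k).re * F.Y e t ≤ (l i k - l j k).re * F.Y s t) :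
    ‖exp ((l i k - l j k) * (F.Y e t - F.Y b t)) * w b -
      exp ((l i k - l j k) * (F.Y e t - F.Y a t)) * w a‖ ≤ c := by
  have hsub : Icc a b ⊆ Ici 0 := fun s hs => ha.trans hs.1
  have hc : 0 ≤ c := by simpa using (norm_nonneg _).trans (hg 0 le_rfl)
  have := norm_exp_sub_le (A := fun x => (l i k - l j k) * F.Y x t) (c := e) hab
    (fun s hs => ((hF.dYx s t (hsub hs) ht).ofReal_comp.const_mul (l i k - l j k)).mono hsub)
    (fun s hs => ((hw s (hsub hs)).mono hsub).congr_deriv (by ring)) (fun s hs => hg s (hsub hs))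
    (fun s hs => hasDerivAt_neg_div_one_add c (hsub hs)) (fun s hs => by simpa using he s hs)
  simp only [← mul_sub] at this
  refine this.trans ?_
  have h1 : c / (1 + a) ≤ c := div_le_self hc (by linarith)
  have h2 : 0 ≤ c / (1 + b) := div_nonneg hc (by linarith)
  rw [neg_div, neg_div]
  linarith

lemma norm_le_of_sweep (hij : (l i k).re ≤ (l j k).re) (hx : 0 ≤ x) : ‖w x‖ ≤ ‖w 0‖ + c := by
  have hr : (l i k - l j k).re ≤ 0 := by simpa using hij
  have hm := monotoneOn_Y hF ht
  have := norm_exp_sub_le_x hF ht hw hg (e := x) le_rfl hx fun s hs =>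
    mul_le_mul_of_nonpos_left (hm (mem_Ici.2 hs.1) hx hs.2) hr
  rw [sub_self, mul_zero, exp_zero, one_mul] at this
  have h2 : ‖exp ((l i k - l j k) * (F.Y x t - F.Y 0 t)) * w 0‖ ≤ ‖w 0‖ := by
    rw [norm_mul, ← Complex.ofReal_sub, norm_exp, re_mul_ofReal]
    refine mul_le_of_le_one_left (norm_nonneg _) (exp_le_one_iff.2 ?_)
    exact mul_nonpos_of_nonpos_of_nonneg hr (sub_nonneg.2 (hm self_mem_Ici hx hx))
  have := norm_sub_norm_le (w x) (exp ((l i k - l j k) * (F.Y x t - F.Y 0 t)) * w 0)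
  linarith

lemma norm_sub_le_of_sweep (hij : (l j k).re ≤ (l i k).re) {δ : ℂ} (hδ : Tendsto (fun x =>
    exp (F.phase k j x t - F.phase k i x t) * w x) atTop (𝓝 δ)) (hx : 0 ≤ x) :
    ‖w x - exp (F.phase k i x t - F.phase k j x t) * δ‖ ≤ c := by
  have hr : 0 ≤ (l i k - l j k).re := by simpa using hij
  have hm := monotoneOn_Y hF ht
  have h1 := ((hδ.const_mul (exp (F.phase k i x t - F.phase k j x t))).sub_const (w x)).norm
  rw [norm_sub_rev]
  refine le_of_tendsto h1 ((eventually_ge_atTop x).mono fun X hX => ?_)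
  have := norm_exp_sub_le_x hF ht hw hg (e := x) hx hX fun s hs =>
    mul_le_mul_of_nonneg_left (hm hx (hx.trans hs.1 : (0 : ℝ) ≤ s) hs.1) hr
  rw [sub_self, mul_zero, exp_zero, one_mul] at this
  have e : F.phase k i x t - F.phase k j x t + (F.phase k j X t - F.phase k i X t) =
      (l i k - l j k) * (F.Y x t - F.Y X t) := by
    simp only [Frame.phase]; ring
  rwa [← mul_assoc, ← exp_add, e]

end

/-! ### The points where `λ = 0` -/

/-- `Re z_j` is ordered at `k` as the contours of the index `n` require. -/
def ZOrdAt (k : ℂ) (n : Fin 18) : Prop := ∀ p r, p < r →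
  (contour n n#p n#r = γ₂ → (z n#p k).re ≤ (z n#r k).re) ∧
  (contour n n#p n#r = γ₁ → (z n#r k).re ≤ (z n#p k).re)

/-- `k` is close to a zero of `λ`. -/
structure NearK (k : ℂ) (n : Fin 18) (ε : ℝ) : Prop where
  ord : OrdAt k (lOrd n)
  zord : ZOrdAt k n
  near : ∀ p, ‖l n#p k - ![-1, 0, 1] p‖ ≤ ε
  lam : ‖lam k‖ ≤ ε
  small : ε ≤ 1 / 8

/-- The coefficient of the coupling of the coordinates with exponents `s` and `σ` in the `t`-part
of the first Lax pair, up to a multiple of `λ`. -/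
def coupling (s σ a b : ℂ) : ℂ := (s + σ) * ((σ - s) * a + (1 - s * σ) * b) / χ[σ]

/-- The limits at `λ = 0` of the exponents with the positions `p` and `p'` are of different type. -/
def mixed (p p' : Fin 3) : Bool := (p == 1) != (p' == 1)

lemma norm_sum_three_le {f : ℂ³} {c : ℝ} (h : ∀ i, ‖f i‖ ≤ c) : ‖∑ i, f i‖ ≤ 3 * c := by
  refine (norm_sum_le_of_le _ fun i _ => h i).trans (le_of_eq ?_)
  simp

lemma norm_coupling_le {s s' a b : ℂ} {A B C M : ℝ} (h1 : ‖s + s'‖ ≤ A) (h2 : ‖s' - s‖ ≤ B)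
    (h3 : ‖1 - s * s'‖ ≤ C) (ha : ‖a‖ ≤ M) (hb : ‖b‖ ≤ M) (hp : 1 / 2 ≤ ‖3 * s' ^ 2 - 1‖) :
    ‖coupling s s' a b‖ ≤ 2 * A * (B + C) * M := by
  have hA := (norm_nonneg _).trans h1
  have hB := (norm_nonneg _).trans h2
  have hC := (norm_nonneg _).trans h3
  have hM := (norm_nonneg _).trans ha
  rw [coupling, norm_div, norm_mul, div_le_iff₀ (by linarith)]
  have h4 : ‖(s' - s) * a + (1 - s * s') * b‖ ≤ B * M + C * M := by
    refine (norm_add_le _ _).trans ?_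
    rw [norm_mul, norm_mul]
    gcongr
  have := mul_le_mul h1 h4 (norm_nonneg _) hA
  have : 2 * A * (B + C) * M * (1 / 2) ≤ 2 * A * (B + C) * M * ‖3 * s' ^ 2 - 1‖ :=
    mul_le_mul_of_nonneg_left hp (by positivity)
  linarith

lemma coord_N2 (lm s : ℂ) (x t : ℝ) (v : ℂ³) :
    coord s (N2 u lm x t *ᵥ (P k *ᵥ v)) = ∑ p, (coupling (l n#p k) s (dx u 1 x t) (u x t)
      - lm * (u x t * (q u x t : ℂ) ^ 3) / χ[s]) * v n#p := by
  have hb : Function.Bijective (lOrd n) := Finite.injective_iff_bijective.1 (lOrd_injective n)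
  rw [hb.sum_comp (fun i => (coupling (l i k) s (dx u 1 x t) (u x t)
      - lm * (u x t * (q u x t : ℂ) ^ 3) / χ[s]) * v i), P_mulVec]
  simp only [coord, coupling, sum_univ_three, lev, N2, pvec, mulVec, dotProduct]
  simp
  ring

lemma coord_N1 (lm s : ℂ) (x t : ℝ) (v : ℂ³) : coord s (N1 u lm x t *ᵥ (P k *ᵥ v)) =
      lm * ((q u x t : ℂ) ^ 3 - 1) * (∑ i, v i) / χ[s] := by
  rw [P_mulVec]
  simp only [coord, sum_univ_three, lev, N1, pvec, mulVec, dotProduct]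
  simp

namespace NearK

variable {ε : ℝ} (h : NearK k n ε)

include h

lemma nonneg : 0 ≤ ε := (norm_nonneg _).trans h.lam

lemma norm_le (p : Fin 3) : ‖l n#p k‖ ≤ 9 / 8 := by
  have h1 := norm_le_norm_add_norm_sub' (l n#p k) (![-1, 0, 1] p)
  have h2 : ‖(![-1, 0, 1] p : ℂ)‖ ≤ 1 := by fin_cases p <;> simp
  linarith [h.near p, h.small]

lemma norm_le_one : ‖l n#1 k‖ ≤ ε := by simpa using h.near 1

lemma le_norm {p : Fin 3} (hp : p ≠ 1) : 7 / 8 ≤ ‖l n#p k‖ := by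
  have h1 := norm_le_norm_add_norm_sub' (![-1, 0, 1] p) (l n#p k)
  rw [norm_sub_rev] at h1
  have h2 : ‖(![-1, 0, 1] p : ℂ)‖ = 1 := by fin_cases p <;> simp at hp ⊢
  linarith [h.near p, h.small]

lemma pi_bound (p : Fin 3) : 1 / 2 ≤ ‖3 * l n#p k ^ 2 - 1‖ := by
  have h1 := norm_sub_norm_le (3 * l n#p k ^ 2) 1
  have h2 := norm_sub_norm_le 1 (3 * l n#p k ^ 2)
  rw [norm_sub_rev] at h2
  simp only [norm_mul, norm_pow, norm_one, Complex.norm_ofNat] at h1 h2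
  by_cases hp : p = 1
  · subst hp
    have := h.norm_le_one
    nlinarith [norm_nonneg (l n#1 k), h.small]
  · nlinarith [h.le_norm hp]

lemma add_bound : ‖l n#0 k + l n#2 k‖ ≤ 2 * ε := by
  have e : l n#0 k + l n#2 k = (l n#0 k - ![-1, 0, 1] 0) + (l n#2 k - ![-1, 0, 1] 2) := by simp
  rw [e]
  exact (norm_add_le _ _).trans (by linarith [h.near 0, h.near 2])

lemma coupling_le (p p' : Fin 3) {a b : ℂ} {M : ℝ} (ha : ‖a‖ ≤ M) (hb : ‖b‖ ≤ M) :
    ‖coupling (l n#p k) (l (n#p') k) a b‖ ≤ 40 * M := by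
  have hM := (norm_nonneg _).trans ha
  have h1 := h.norm_le p
  have h2 := h.norm_le p'
  have h3 : ‖1 - l n#p k * l (n#p') k‖ ≤ 3 := by
    refine (norm_sub_le _ _).trans ?_
    rw [norm_mul, norm_one]
    nlinarith [norm_nonneg (l n#p k), norm_nonneg (l (n#p') k)]
  refine (norm_coupling_le (A := 9 / 4) (B := 9 / 4) ((norm_add_le _ _).trans (by linarith))
    ((norm_sub_le _ _).trans (by linarith)) h3 ha hb (h.pi_bound p')).trans ?_
  linarith

lemma coupling_le_of_not_mixed {p p' : Fin 3} (hp : mixed p p' = false) {a b : ℂ} {M : ℝ}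
    (ha : ‖a‖ ≤ M) (hb : ‖b‖ ≤ M) :
    ‖coupling (l n#p k) (l (n#p') k) a b‖ ≤ 40 * ε * M := by
  have hM := (norm_nonneg _).trans ha
  have hε := h.nonneg
  have h1 := h.norm_le p
  have h2 := h.norm_le p'
  have h3 : ‖1 - l n#p k * l (n#p') k‖ ≤ 3 := by
    refine (norm_sub_le _ _).trans ?_
    rw [norm_mul, norm_one]
    nlinarith [norm_nonneg (l n#p k), norm_nonneg (l (n#p') k)]
  have hεM := mul_nonneg hε hM
  by_cases hpp : p = p'
  · subst hpp
    have hs : ‖l n#p k - l n#p k‖ ≤ 0 := by simp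
    by_cases h1' : p = 1
    · subst h1'
      have := h.norm_le_one
      refine (norm_coupling_le (A := 2 * ε) ((norm_add_le _ _).trans (by linarith)) hs h3 ha hb
        (h.pi_bound 1)).trans ?_
      linarith
    · have h4 : ‖1 - l n#p k * l n#p k‖ ≤ 3 * ε := by
        have e : 1 - l n#p k * l n#p k = -((l n#p k - ![-1, 0, 1] p) * (l n#p k + ![-1, 0, 1] p)) := by
          fin_cases p <;> simp at h1' ⊢ <;> ring
        have h5 : ‖l n#p k + ![-1, 0, 1] p‖ ≤ 3 := by
          refine (norm_add_le _ _).trans ?_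
          have : ‖(![-1, 0, 1] p : ℂ)‖ ≤ 1 := by fin_cases p <;> simp
          linarith
        rw [e, norm_neg, norm_mul, mul_comm]
        exact mul_le_mul h5 (h.near p) (norm_nonneg _) (by norm_num)
      refine (norm_coupling_le (A := 9 / 4) ((norm_add_le _ _).trans (by linarith)) hs h4 ha hb
        (h.pi_bound p)).trans ?_
      linarith
  · have h4 : ‖l n#p k + l (n#p') k‖ ≤ 2 * ε := by
      have := h.add_bound
      fin_cases p <;> fin_cases p' <;> simp [mixed] at hp hpp <;> first | exact this | (rw [add_comm]; exact this)
    refine (norm_coupling_le (B := 9 / 4) h4 ((norm_sub_le _ _).trans (by linarith)) h3 ha hb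
      (h.pi_bound p')).trans ?_
    linarith

lemma z_sub (hpr : p ≠ r) : z n#p k - z n#r k = (l n#r k - l n#p k) / (l n#p k * l n#r k) := by
  have hr := h.ord.roots
  have hl := lam_ne_zero h.ord.ns
  have e := hr.prod
  have hs := hr.sum
  have hne : ∀ p, l n#p k ≠ 0 := fun p h0 => hl (by
    rw [← e]; fin_cases p <;> simp_all)
  rw [z_eq _ h.ord.ns.1, z_eq _ h.ord.ns.1, ← sub_div, div_eq_div_iff hl
    (mul_ne_zero (hne p) (hne r)), ← e]
  beta_reduce at hs
  fin_cases p <;> fin_cases r <;> simp at hpr <;> simp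
  · linear_combination (l n#0 k - l n#1 k) * l n#0 k * l n#1 k * hs
  · linear_combination (l n#0 k - l n#2 k) * l n#0 k * l n#2 k * hs
  · linear_combination (l n#1 k - l n#0 k) * l n#0 k * l n#1 k * hs
  · linear_combination (l n#1 k - l n#2 k) * l n#1 k * l n#2 k * hs
  · linear_combination (l n#2 k - l n#0 k) * l n#0 k * l n#2 k * hs
  · linear_combination (l n#2 k - l n#1 k) * l n#1 k * l n#2 k * hs

lemma z_sub_ne_zero (hpr : p ≠ r) : z n#p k - z n#r k ≠ 0 := by
  rw [h.z_sub hpr]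
  have hl := lam_ne_zero h.ord.ns
  have e := h.ord.roots.prod
  have hne : ∀ p, l n#p k ≠ 0 := fun p h0 => hl (by
    rw [← e]; fin_cases p <;> simp_all)
  exact div_ne_zero (h.ord.sub_ne_zero hpr.symm) (mul_ne_zero (hne p) (hne r))

lemma z_sub_le (hpr : mixed p r = false) : ‖z n#p k - z n#r k‖ ≤ 6 := by
  by_cases e : p = r
  · subst e; simp
  have hp : p ≠ 1 := by rintro rfl; fin_cases r <;> simp [mixed] at hpr e
  have hr : r ≠ 1 := by rintro rfl; fin_cases p <;> simp [mixed] at hpr e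
  have h1 := h.le_norm hp
  have h2 := h.le_norm hr
  rw [h.z_sub e, norm_div, norm_mul, div_le_iff₀ (by positivity)]
  have := norm_sub_le (l n#r k) (l n#p k)
  nlinarith [h.norm_le p, h.norm_le r]

lemma inv_z_sub_le (hpr : mixed p r = true) : 1 / ‖z n#p k - z n#r k‖ ≤ 2 * ε := by
  have e : p ≠ r := by rintro rfl; fin_cases p <;> simp [mixed] at hpr
  have hε := h.small
  have h0 := h.norm_le_one
  have key : ‖l n#p k * l n#r k‖ ≤ 9 / 8 * ε ∧ 3 / 4 ≤ ‖l n#r k - l n#p k‖ := by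
    rw [norm_mul]
    by_cases hp : p = 1
    · subst hp
      refine ⟨?_, ?_⟩
      · rw [mul_comm]; exact mul_le_mul (h.norm_le r) h0 (norm_nonneg _) (by norm_num)
      · have := norm_sub_norm_le (l n#r k) (l n#1 k)
        linarith [h.le_norm (Ne.symm e)]
    · have hr : r = 1 := by fin_cases p <;> fin_cases r <;> simp [mixed] at hpr hp ⊢
      subst hr
      refine ⟨mul_le_mul (h.norm_le p) h0 (norm_nonneg _) (by norm_num), ?_⟩
      rw [norm_sub_rev]
      have := norm_sub_norm_le (l n#p k) (l n#1 k)
      linarith [h.le_norm hp]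
  rw [h.z_sub e, norm_div, one_div_div, div_le_iff₀ (by linarith)]
  nlinarith [h.nonneg]

end NearK

lemma mixed_trans : ∀ p' p r, mixed p' p = true → mixed p r = true → mixed p' r = false := by
  decide

/-- `M` bounds the coefficients of the first Lax pair and their `t`-derivatives. -/
structure LBound (u : 𝓕) (T M : ℝ) : Prop where
  one_le : 1 ≤ M
  u_le : ∀ t ∈ Icc 0 T, ‖(u 0 t : ℂ)‖ ≤ M
  ux_le : ∀ t ∈ Icc 0 T, ‖(dx u 1 0 t : ℂ)‖ ≤ M
  uq_le : ∀ t ∈ Icc 0 T, ‖(u 0 t : ℂ) * (q u 0 t : ℂ) ^ 3‖ ≤ M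
  ut_le : ∀ t ∈ Icc 0 T, ‖(pdt T u 0 t : ℂ)‖ ≤ M
  uxt_le : ∀ t ∈ Icc 0 T, ‖(pdt T (dx u 1) 0 t : ℂ)‖ ≤ M
  mom_le : ∀ x t, 0 ≤ x → t ∈ Icc 0 T → ‖(q u x t : ℂ) ^ 3 - 1‖ ≤ M / (1 + x) ^ 2

section

include hu

lemma exists_lBound : ∃ M, LBound u T M := by
  have hq := bdd_q hu
  obtain ⟨a, a0, ha⟩ := hu.rapidDecay.dec.bdd.bound
  obtain ⟨b, b0, hb⟩ := (rapid_dx hu 1).1.dec.bdd.bound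
  obtain ⟨c, c0, hc⟩ := (hu.rapidDecay.dec.mul (hq.mul (hq.mul hq))).bdd.bound
  obtain ⟨d, d0, hd⟩ := hu.rapidDecay.pdt.dec.bdd.bound
  obtain ⟨e, e0, he⟩ := (rapid_dx hu 1).1.pdt.dec.bdd.bound
  obtain ⟨f, hf0, hf⟩ := (rapid_mom hu).dec
  refine ⟨1 + a + b + c + d + e + f, by linarith, fun t ht => (ha 0 t le_rfl ht).trans (by linarith),
    fun t ht => (hb 0 t le_rfl ht).trans (by linarith), fun t ht => ?_,
    fun t ht => (hd 0 t le_rfl ht).trans (by linarith),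
    fun t ht => (he 0 t le_rfl ht).trans (by linarith), fun x t hx ht => ?_⟩
  · have e3 : (u 0 t : ℂ) * (q u 0 t : ℂ) ^ 3 = u 0 t * (q u 0 t * (q u 0 t * q u 0 t)) := by ring
    rw [e3]
    exact (hc 0 t le_rfl ht).trans (by linarith)
  · rw [q_cube' hu hx ht, add_sub_cancel_right]
    refine (hf x t hx ht).trans (div_le_div_of_nonneg_right (by linarith) (by positivity))

variable {M : ℝ} (hM : LBound u T M) {ε : ℝ} (h : NearK k n ε) {r : Fin 3}
  {d : ℂ} (hC : IsCol u k (lOrd n) ((frameL u T).row u T n k r) r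
    (d * (χ[l n#r k] * exp (l n#r k * (frameL u T).c))) C)
  {B : ℝ} (hB : ∀ x t, 0 ≤ x → t ∈ Icc 0 T → ∀ i, ‖(frameL u T).col u T k n#r C x t i‖ ≤ B)

local notation "𝓿" => Frame.col (frameL u T) u T k n#r C

/-- The coefficient of the coordinate with position `r` in the equation for that with position `p`. -/
local notation "κ[" r "," p "," t "]" => coupling (l n#r k) (l n#p k) (dx u 1 0 t) (u 0 t) - lam k * (u 0 t * (q u 0 t : ℂ) ^ 3) / χ[l n#p k]

include h

lemma hasDeriv_colL_t (p : Fin 3) (ht : t ∈ Icc 0 T) :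
    HasDerivWithinAt (fun s => 𝓿 0 s n#p) ((z n#p k - z n#r k) * 𝓿 0 t n#p +
      ∑ p', (κ[p', p, t]) * 𝓿 0 t (n#p')) (Icc 0 T) t := by
  refine (hasDeriv_col_t hu (frameL_good hu) h.ord.ns n#r C le_rfl ht n#p).congr_deriv ?_
  rw [← coord_N2]
  simp [frameL]

include hM hB

omit hu hM h in
lemma B_nonneg : 0 ≤ B := (norm_nonneg _).trans (hB 0 0 le_rfl zero_mem_Icc 0)

omit hu hB in
lemma norm_lam_term_le (p : Fin 3) (ht : t ∈ Icc 0 T) :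
    ‖lam k * (u 0 t * (q u 0 t : ℂ) ^ 3) / χ[l n#p k]‖ ≤ 2 * ε * M := by
  have hp := h.pi_bound p
  rw [norm_div, norm_mul, div_le_iff₀ (by linarith)]
  have h1 := mul_le_mul h.lam (hM.uq_le t ht) (norm_nonneg _) h.nonneg
  have h2 : 0 ≤ 2 * ε * M := by have := h.nonneg; have := hM.one_le; positivity
  nlinarith

omit hu in
lemma norm_deriv_colL_le {p : Fin 3} (hp : mixed p r = false) (ht : t ∈ Icc 0 T) :
    ‖(z n#p k - z n#r k) * 𝓿 0 t n#p + ∑ p', (κ[p', p, t]) * 𝓿 0 t (n#p')‖ ≤ 132 * M * B := by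
  have hB0 := B_nonneg hB
  have h1 := hM.one_le
  have hε := h.small
  refine (norm_add_le _ _).trans ?_
  have a1 : ‖(z n#p k - z n#r k) * 𝓿 0 t n#p‖ ≤ 6 * B := by
    rw [norm_mul]
    exact mul_le_mul (h.z_sub_le hp) (hB 0 t le_rfl ht _) (norm_nonneg _) (by norm_num)
  have a2 := norm_sum_three_le (c := 41 * M * B) (f := fun p' => (κ[p', p, t]) * 𝓿 0 t (n#p')) fun p' => by
    rw [norm_mul]
    refine mul_le_mul ((norm_sub_le _ _).trans ?_) (hB 0 t le_rfl ht _) (norm_nonneg _) (by positivity)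
    have := h.coupling_le p' p (hM.ux_le t ht) (hM.u_le t ht)
    have := norm_lam_term_le hM h p ht
    nlinarith
  nlinarith [mul_le_mul_of_nonneg_right h1 hB0]

include hC

omit hu hM hB in
lemma colL_start {p : Fin 3} (hp : p < r) : ∃ s, (s = 0 ∧ (z n#p k - z n#r k).re ≤ 0 ∨
      s = T ∧ 0 ≤ (z n#p k - z n#r k).re) ∧
    𝓿 0 s n#p = 0 := by
  refine ⟨startTime T n n#p n#r, ?_, ?_⟩
  · have hz := h.zord p r hp
    rcases contour_of_lt (n := n) hp with e | e
    · exact Or.inl ⟨by simp [startTime, e], by simpa using hz.1 e⟩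
    · exact Or.inr ⟨by simp [startTime, e], by simpa using hz.2 e⟩
  · have := ((frameL u T).row_dot_eq_zero_iff h.ord r p C n#r).1 (hC.start p hp)
    exact (mul_eq_zero.1 this).resolve_left (exp_ne_zero _)

lemma norm_colL_fast {p : Fin 3} (hp : p < r) (hpr : mixed p r = true) (ht : t ∈ Icc 0 T) :
    ‖𝓿 0 t n#p‖ ≤ 70000 * M ^ 2 * (1 + T) * ε * B := by
  have hB0 := B_nonneg hB
  have := hT.out
  have h1 := hM.one_le
  have hε := h.nonneg
  obtain ⟨s, hs, h0⟩ := colL_start h hC hp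
  set v := (frameL u T).col u T k n#r C with hv
  set V' : Fin 3 → ℝ → ℂ := fun p t => (z n#p k - z n#r k) * v 0 t n#p +
        ∑ p', (κ[p', p, t]) * v 0 t (n#p') with hV'
  have hd : ∀ p, ∀ t ∈ Icc 0 T, HasDerivWithinAt (fun s => v 0 s n#p) (V' p t) (Icc 0 T) t :=
    fun p t ht => hasDeriv_colL_t hu h p ht
  have hux : ∀ t ∈ Icc 0 T, HasDerivWithinAt (fun s => (dx u 1 0 s : ℂ)) (pdt T (dx u 1) 0 t)
    (Icc 0 T) t := fun t ht => ((rapid_dx hu 1).1.hasDeriv_t le_rfl ht).ofReal_comp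
  have hut : ∀ t ∈ Icc 0 T, HasDerivWithinAt (fun s => (u 0 s : ℂ)) (pdt T u 0 t)
    (Icc 0 T) t := fun t ht => (hu.rapidDecay.hasDeriv_t le_rfl ht).ofReal_comp
  set L : ℂ³ := fun p => l n#p k with hL
  have key := norm_le_of_fast (y := fun t => v 0 t n#p) (A := 15960 * M ^ 2 * B) (δ := 126 * ε * M * B)
    (g := fun t => ∑ p', if mixed p' p then coupling (L p') (L p) (dx u 1 0 t) (u 0 t) *
      v 0 t (n#p') else 0)
    (g' := fun t => ∑ p', if mixed p' p then coupling (L p') (L p) (pdt T (dx u 1) 0 t) (pdt T u 0 t) *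
      v 0 t (n#p') + coupling (L p') (L p) (dx u 1 0 t) (u 0 t) * V' p' t else 0)
    (r := fun t => ∑ p', ((if mixed p' p then 0 else coupling (L p') (L p) (dx u 1 0 t) (u 0 t)) -
      lam k * (u 0 t * (q u 0 t : ℂ) ^ 3) / χ[l n#p k]) * v 0 t (n#p'))
    (h.z_sub_ne_zero hp.ne) (fun t ht => (hd p t ht).congr_deriv ?_) (fun t ht => ?_)
    (fun t ht => ?_) (fun t ht => ?_) (fun t ht => ?_) hs h0 ht
  · refine key.trans ?_
    rw [div_eq_mul_one_div]
    have hi := h.inv_z_sub_le hpr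
    have h2 : (2 + T) * (15960 * M ^ 2 * B) * (1 / ‖z n#p k - z n#r k‖) ≤
        (2 + T) * (15960 * M ^ 2 * B) * (2 * ε) := mul_le_mul_of_nonneg_left hi (by positivity)
    have h3 : M * (ε * B * T) ≤ M ^ 2 * (ε * B * T) :=
      mul_le_mul_of_nonneg_right (by nlinarith) (by positivity)
    have h4 : 0 ≤ M ^ 2 * (ε * B) := by positivity
    have h5 : 0 ≤ M ^ 2 * (ε * B) * T := by positivity
    nlinarith
  · rw [hV', add_assoc, ← Finset.sum_add_distrib]
    refine congrArg (_ + ·) (sum_congr rfl fun p' _ => ?_)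
    split_ifs <;> ring
  · refine HasDerivWithinAt.fun_sum fun p' _ => ?_
    split_ifs
    · refine ((((hux t ht).const_mul (L p - L p')).add ((hut t ht).const_mul
        (1 - L p' * L p))).const_mul (L p' + L p)).div_const χ[L p] |>.mul
        (hd p' t ht) |>.congr_deriv ?_
      simp only [coupling]
      rfl
    · exact hasDerivWithinAt_const _ _ _
  · refine (norm_sum_three_le (c := 40 * M * B) fun p' => ?_).trans ?_
    · split_ifs
      · rw [norm_mul]
        exact mul_le_mul (h.coupling_le p' p (hM.ux_le t ht) (hM.u_le t ht)) (hB 0 t le_rfl ht _)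
          (norm_nonneg _) (by positivity)
      · rw [norm_zero]; positivity
    · nlinarith [mul_nonneg (sub_nonneg.2 h1) hB0, mul_nonneg (mul_nonneg (sub_nonneg.2 h1) hB0)
        (by linarith : 0 ≤ M)]
  · refine (norm_sum_three_le (c := 40 * M * B + 40 * M * (132 * M * B)) fun p' => ?_).trans ?_
    · split_ifs with e
      · have hp' := mixed_trans p' p r e hpr
        refine (norm_add_le _ _).trans (add_le_add ?_ ?_) <;> rw [norm_mul]
        · exact mul_le_mul (h.coupling_le p' p (hM.uxt_le t ht) (hM.ut_le t ht))
            (hB 0 t le_rfl ht _) (norm_nonneg _) (by positivity)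
        · exact mul_le_mul (h.coupling_le p' p (hM.ux_le t ht) (hM.u_le t ht))
            (norm_deriv_colL_le hM h hB hp' ht) (norm_nonneg _) (by positivity)
      · rw [norm_zero]; positivity
    · nlinarith [mul_nonneg (mul_nonneg (sub_nonneg.2 h1) hB0) (by linarith : 0 ≤ M)]
  · refine (norm_sum_three_le (c := 42 * ε * M * B) fun p' => ?_).trans (by linarith)
    rw [norm_mul]
    refine mul_le_mul ((norm_sub_le _ _).trans ?_) (hB 0 t le_rfl ht _) (norm_nonneg _) (by positivity)
    have h2 := norm_lam_term_le hM h p ht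
    split_ifs with e
    · rw [norm_zero]; nlinarith
    · have := h.coupling_le_of_not_mixed (Bool.eq_false_iff.2 e) (hM.ux_le t ht) (hM.u_le t ht)
      linarith

lemma norm_colL_slow (hr : r = 2) (ht : t ∈ Icc 0 T) : ‖𝓿 0 t n#0‖ ≤
      T * (90 + 40 * (70000 * M ^ 2 * (1 + T))) * M * ε * B := by
  have hB0 := B_nonneg hB
  have := hT.out
  have h1 := hM.one_le
  have hε := h.nonneg
  obtain ⟨s, hs, h0⟩ := colL_start h hC (show (0 : Fin 3) < r by rw [hr]; decide)
  have := norm_le_of_transport (fun t ht => hasDeriv_colL_t (C := C) hu h 0 ht)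
    (c := (90 + 40 * (70000 * M ^ 2 * (1 + T))) * M * ε * B) (fun t ht => ?_) hs ht
  · rw [h0, norm_zero, zero_add] at this
    linarith
  · rw [sum_univ_three]
    have hl := norm_lam_term_le hM h 0 ht
    have hb := fun p => hB 0 t le_rfl ht n#p
    have c0 := h.coupling_le_of_not_mixed (p := 0) (p' := 0) rfl (hM.ux_le t ht) (hM.u_le t ht)
    have c2 := h.coupling_le_of_not_mixed (p := 2) (p' := 0) rfl (hM.ux_le t ht) (hM.u_le t ht)
    have c1 := h.coupling_le 1 0 (hM.ux_le t ht) (hM.u_le t ht)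
    have hf := norm_colL_fast hu hM h hC hB (p := 1) (by rw [hr]; decide) (by rw [hr]; rfl) ht
    have f1 := mul_le_mul c1 hf (norm_nonneg _) (by positivity)
    have f0 := mul_le_mul ((norm_sub_le _ _).trans (add_le_add c0 hl)) (hb 0) (norm_nonneg _)
      (by positivity)
    have f2 := mul_le_mul ((norm_sub_le _ _).trans (add_le_add c2 hl)) (hb 2) (norm_nonneg _)
      (by positivity)
    have f3 := mul_le_mul hl (hb 1) (norm_nonneg _) (by positivity)
    rw [← norm_mul] at f0 f1 f2 f3
    rw [sub_mul (coupling (l n#1 k) _ _ _)]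
    refine norm_add₃_le.trans ((add_le_add_three f0 ((norm_sub_le _ _).trans
      (add_le_add f1 f3)) f2).trans (le_of_eq_of_le ?_ (?_ : (86 + 40 * (70000 * M ^ 2 * (1 + T))) * M * ε * B ≤ _)))
    · ring
    · gcongr; norm_num

end

include hu in
lemma exists_near_L :
    ∃ K, 0 ≤ K ∧ ∀ {k n ε}, NearK k n ε → ∀ {r d C}, IsCol u k (lOrd n) ((frameL u T).row u T n k r) r
      (d * (χ[l n#r k] * exp (l n#r k * (frameL u T).c))) C →
    ∀ B, (∀ x t, 0 ≤ x → t ∈ Icc 0 T → ∀ i, ‖(frameL u T).col u T k n#r C x t i‖ ≤ B) →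
    ∀ x t, 0 ≤ x → t ∈ Icc 0 T → ∀ p, ‖(frameL u T).col u T k n#r C x t n#p -
      (if p = r then d else 0)‖ ≤ K * ε * B := by
  obtain ⟨M, hM⟩ := exists_lBound hu
  have := hT.out
  have h1 := hM.one_le
  set K1 := 70000 * M ^ 2 * (1 + T) with hK1
  set K2 := T * (90 + 40 * K1) * M with hK2
  have hK10 : 0 ≤ K1 := by positivity
  have hK20 : 0 ≤ K2 := by positivity
  refine ⟨K1 + K2 + 6 * M, by positivity, fun {k n ε} h {r d C} hC B hB x t hx ht p => ?_⟩
  have hB0 := B_nonneg hB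
  have hε := h.nonneg
  have hF := frameL_good hu
  have hw : ∀ x, 0 ≤ x → HasDerivWithinAt (fun s => (frameL u T).col u T k n#r C s t n#p)
      ((frameL u T).ρ x t * ((l n#p k - l n#r k) *
        (frameL u T).col u T k n#r C x t n#p) + coord (l n#p k)
          (N1 u (lam k) x t *ᵥ (P k *ᵥ (frameL u T).col u T k n#r C x t))) (Ici 0) x :=
    fun x hx => (hasDeriv_col_x hu hF h.ord.ns n#r C hx ht n#p).congr_deriv
      (by rw [zero_mul, add_zero]; rfl)
  have hg : ∀ x, 0 ≤ x → ‖coord (l n#p k)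
      (N1 u (lam k) x t *ᵥ (P k *ᵥ (frameL u T).col u T k n#r C x t))‖ ≤
      6 * M * ε * B / (1 + x) ^ 2 := fun x hx => by
    have hp := h.pi_bound p
    rw [coord_N1, norm_div, norm_mul, norm_mul, div_le_iff₀ (by linarith)]
    have a1 := mul_le_mul (mul_le_mul h.lam (hM.mom_le x t hx ht) (norm_nonneg _) hε)
      (norm_sum_three_le (hB x t hx ht)) (norm_nonneg _) (by positivity)
    refine a1.trans ?_
    have a2 : 6 * M * ε * B / (1 + x) ^ 2 * (1 / 2) ≤ 6 * M * ε * B / (1 + x) ^ 2 *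
      ‖3 * l n#p k ^ 2 - 1‖ := mul_le_mul_of_nonneg_left hp (by positivity)
    refine le_trans (le_of_eq ?_) a2
    ring
  have e1 : 0 ≤ K1 * ε * B := by positivity
  have e2 : 0 ≤ K2 * ε * B := by positivity
  have e3 : 0 ≤ M * ε * B := by positivity
  rcases lt_or_ge p r with hp | hp
  · rw [if_neg hp.ne, sub_zero]
    refine (norm_le_of_sweep hF ht hw hg (h.ord.mono hp.le) hx).trans ?_
    have : ‖(frameL u T).col u T k n#r C 0 t n#p‖ ≤ K1 * ε * B + K2 * ε * B := by
      by_cases hpr : mixed p r = true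
      · exact (norm_colL_fast hu hM h hC hB hp hpr ht).trans (by linarith)
      · have : p = 0 ∧ r = 2 := by revert hp hpr; clear * -; revert p r; decide
        obtain ⟨rfl, e⟩ := this
        exact (norm_colL_slow hu hM h hC hB e ht).trans (by linarith)
    linarith
  · have hl := IsCol.tendsto_pot hu hF h.ord hC hp ht
    have := norm_sub_le_of_sweep hF ht hw hg (h.ord.mono hp) hl hx
    split_ifs at this ⊢ with e
    · subst e
      rw [sub_self, exp_zero, one_mul] at this
      linarith
    · rw [mul_zero] at this
      linarith

/-! ### The points `0` and `∞` -/

/-- The scale of the exponents `l_j` near `0` and `∞`. -/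
def scale (k : ℂ) : ℝ := ‖k‖ + ‖k‖⁻¹

/-- The lower shift matrix. -/
def shiftMat : Mat3 := !![0, 0, 0; 1, 0, 0; 0, 1, 0]

section

variable (hk : k ≠ 0) (hs : 4 ≤ scale k)

include hk

omit hk in
lemma norm_rot (j : Fin 3) : ‖rot j k‖ = ‖k‖ := by
  have e : (2 * π * I / 3 : ℂ) = ((2 * π / 3 : ℝ) : ℂ) * I := by
    push_cast; ring
  rw [rot, norm_mul, norm_pow, om, e, Complex.norm_exp_ofReal_mul_I, one_pow, one_mul]

omit hk in
lemma norm_l_le (j : Fin 3) : ‖l j k‖ ≤ scale k := by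
  rw [l, norm_mul, scale, ← norm_rot (k := k) j]
  refine (mul_le_of_le_one_left (norm_nonneg _) ?_).trans ((norm_add_le _ _).trans (by simp))
  rw [norm_div, norm_one, norm_real, norm_of_nonneg (Real.sqrt_nonneg _)]
  exact div_le_self zero_le_one (Real.one_le_sqrt.2 (by norm_num))

lemma scale_sq_le (j : Fin 3) : scale k ^ 2 - 4 ≤ 3 * ‖l j k‖ ^ 2 := by
  have hk' : ‖k‖ ≠ 0 := norm_ne_zero_iff.2 hk
  have h1 := abs_norm_sub_norm_le (rot j k) (-(1 / rot j k))
  rw [norm_neg, norm_div, norm_one, norm_rot, sub_neg_eq_add] at h1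
  have h2 : ‖l j k‖ ^ 2 * 3 = ‖rot j k + 1 / rot j k‖ ^ 2 := by
    rw [l, norm_mul, norm_div, norm_one, norm_real, norm_of_nonneg (Real.sqrt_nonneg _),
      mul_pow, div_pow, sq_sqrt (by norm_num)]
    ring
  rw [mul_comm, h2]
  refine le_trans (le_of_eq ?_) (pow_le_pow_left₀ (abs_nonneg _) h1 2)
  rw [sq_abs, scale]
  field_simp
  ring

include hs

lemma le_norm_l (j : Fin 3) : scale k / 3 ≤ ‖l j k‖ := by
  have := scale_sq_le hk j
  nlinarith [norm_nonneg (l j k)]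

lemma le_norm_pi (j : Fin 3) : scale k ^ 2 / 2 ≤ ‖3 * l j k ^ 2 - 1‖ := by
  have h1 := norm_sub_norm_le (3 * l j k ^ 2) 1
  simp only [norm_mul, norm_pow, norm_one, Complex.norm_ofNat] at h1
  nlinarith [scale_sq_le hk j]

lemma le_norm_lam : scale k ^ 3 / 27 ≤ ‖lam k‖ := by
  rw [← (isRoots_l hk).prod, norm_mul, norm_mul]
  have h := le_norm_l hk hs
  have h0 : 0 ≤ scale k / 3 := by linarith
  have := mul_le_mul (mul_le_mul (h 0) (h 1) h0 (norm_nonneg _)) (h 2) h0 (by positivity)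
  linarith

lemma norm_coord_le_scale {A : Mat3} {m B : ℝ} {v : ℂ³}
    (hA : ∀ a b : Fin 3, ‖A a b‖ * scale k ^ ((b : ℕ) + 1) ≤ m * scale k ^ (a : ℕ))
    (hv : ∀ i, ‖v i‖ ≤ B) (i : Fin 3) : ‖coord (l i k) (A *ᵥ (P k *ᵥ v))‖ ≤ 72 * m * B / scale k := by
  have hK : 0 < scale k := by linarith
  have hB := (norm_nonneg _).trans (hv 0)
  have hm : 0 ≤ m := by simpa using (mul_nonneg (norm_nonneg _) hK.le).trans (by simpa using hA 0 0)
  have hX : ∀ b, ‖(P k *ᵥ v) b‖ ≤ 3 * (scale k ^ (b : ℕ) * B) := fun b => by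
    rw [P_mulVec, Finset.sum_apply]
    refine norm_sum_three_le fun r => ?_
    have e : pvec (l r k) b = l r k ^ (b : ℕ) := by fin_cases b <;> simp [pvec]
    rw [Pi.smul_apply, smul_eq_mul, norm_mul, e, norm_pow, mul_comm]
    exact mul_le_mul (pow_le_pow_left₀ (norm_nonneg _) (norm_l_le r) _) (hv r) (norm_nonneg _)
      (by positivity)
  have hAX : ∀ a : Fin 3, ‖(A *ᵥ (P k *ᵥ v)) a‖ * scale k ≤ 9 * m * B * scale k ^ (a : ℕ) := fun a => by
    have : ‖(A *ᵥ (P k *ᵥ v)) a‖ ≤ 3 * (3 * B * (m * scale k ^ (a : ℕ) / scale k)) := by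
      refine norm_sum_three_le fun b => ?_
      rw [norm_mul]
      refine (mul_le_mul_of_nonneg_left (hX b) (norm_nonneg _)).trans ?_
      have h1 : ‖A a b‖ * scale k ^ (b : ℕ) ≤ m * scale k ^ (a : ℕ) / scale k := by
        rw [le_div_iff₀ hK, mul_assoc, ← pow_succ]; exact hA a b
      linarith [mul_le_mul_of_nonneg_left h1 hB]
    calc _ ≤ 3 * (3 * B * (m * scale k ^ (a : ℕ) / scale k)) * scale k := by gcongr
      _ = _ := by field_simp; ring
  have h0 := hAX 0
  have h1 := hAX 1
  have h2 := hAX 2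
  simp only [Fin.val_zero, pow_zero, Fin.val_one, pow_one, Fin.val_two, mul_one] at h0 h1 h2
  have hl := norm_l_le (k := k) i
  have hl2 : ‖l i k ^ 2 - 1‖ ≤ 2 * scale k ^ 2 := by
    refine (norm_sub_le _ _).trans ?_
    rw [norm_pow, norm_one]
    nlinarith [norm_nonneg (l i k)]
  have hmB := mul_nonneg hm hB
  rw [coord, norm_div, div_le_iff₀ (lt_of_lt_of_le (by positivity) (le_norm_pi hk hs i)), lev]
  refine le_trans ?_ (mul_le_mul_of_nonneg_left (le_norm_pi hk hs i) (by positivity))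
  have e : 72 * m * B / scale k * (scale k ^ 2 / 2) = 36 * (m * B * scale k) := by field_simp; ring
  rw [e]
  refine norm_add₃_le.trans ?_
  rw [norm_mul, norm_mul]
  have a0 : ‖l i k ^ 2 - 1‖ * ‖(A *ᵥ (P k *ᵥ v)) 0‖ ≤ 18 * (m * B * scale k) := by
    refine (mul_le_mul_of_nonneg_right hl2 (norm_nonneg _)).trans ?_
    nlinarith
  have a1 : ‖l i k‖ * ‖(A *ᵥ (P k *ᵥ v)) 1‖ ≤ 9 * (m * B * scale k) := by
    refine (mul_le_mul_of_nonneg_right hl (norm_nonneg _)).trans ?_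
    linarith
  have a2 : ‖(A *ᵥ (P k *ᵥ v)) 2‖ ≤ 9 * (m * B * scale k) := by
    refine le_of_mul_le_mul_right (h2.trans (le_of_eq ?_)) hK; ring
  linarith

lemma norm_coord_lower_le {a b c : ℂ} {m B : ℝ} {v : ℂ³} (ha : ‖a‖ ≤ m) (hb : ‖b‖ ≤ m)
    (hc : ‖c‖ ≤ m) (hv : ∀ i, ‖v i‖ ≤ B) (i : Fin 3) :
    ‖coord (l i k) (!![0, 0, 0; a, 0, 0; b, c, 0] *ᵥ (P k *ᵥ v))‖ ≤ 72 * m * B / scale k := by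
  have hm := (norm_nonneg _).trans ha
  refine norm_coord_le_scale hk hs (fun p r => ?_) hv i
  have hq : scale k ≤ scale k ^ 2 := by nlinarith
  fin_cases p <;> fin_cases r <;> simp <;> first | positivity | nlinarith

lemma norm_coord_upper_le {a b c d : ℂ} {m B : ℝ} {v : ℂ³} (ha : ‖a‖ ≤ m) (hb : ‖b‖ ≤ m)
    (hc : ‖c‖ ≤ m) (hd : ‖d‖ ≤ m) (hv : ∀ i, ‖v i‖ ≤ B) (i : Fin 3) :
    ‖coord (l i k) (((lam k)⁻¹ • !![0, a, b; d, 0, c; 0, 0, 0]) *ᵥ (P k *ᵥ v))‖ ≤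
      72 * (27 * m) * B / scale k := by
  have hm := (norm_nonneg _).trans ha
  have hK : 0 < scale k := by linarith
  have hl := le_norm_lam hk hs
  have hl0 : 0 < ‖lam k‖ := lt_of_lt_of_le (by positivity) hl
  have key : ∀ {w : ℂ}, ‖w‖ ≤ m → ‖lam k‖⁻¹ * ‖w‖ * scale k ^ 3 ≤ 27 * m := fun {w} hw => by
    rw [mul_assoc, inv_mul_le_iff₀ hl0]
    nlinarith [mul_le_mul_of_nonneg_right hw (pow_nonneg hK.le 3)]
  refine norm_coord_le_scale hk hs (fun p r => ?_) hv i
  fin_cases p <;> fin_cases r <;> simp <;> try positivity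
  · refine le_trans ?_ (key ha)
    gcongr <;> [linarith; norm_num]
  · simpa using key hb
  · refine le_trans ?_ ((key hd).trans (le_mul_of_one_le_right (by positivity) (by linarith)))
    calc _ = ‖lam k‖⁻¹ * ‖d‖ * scale k ^ 1 := by ring
      _ ≤ _ := by gcongr <;> [linarith; norm_num]
  · exact (key hc).trans (le_mul_of_one_le_right (by positivity) (by linarith))

end

lemma hasDeriv_shift (hk : NonSpecial k) {S : Set ℝ} {α β e' : ℂ}
    {N R : Mat3} {θ e : ℝ → ℂ} {j : Fin 3} {χ : ℝ → ℂ³}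
    (hχ : HasDerivWithinAt χ ((α • U0 (lam k) + β • W0 (lam k) + N) *ᵥ χ x) S x)
    (hθ : HasDerivWithinAt θ (α * l j k + β * z j k) S x) (he : HasDerivWithinAt e e' S x)
    (hR : e' • shiftMat + (1 + e x • shiftMat) * (α • U0 (lam k) + β • W0 (lam k) + N) =
      (α • U0 (lam k) + β • W0 (lam k)) * (1 + e x • shiftMat) + R) (i : Fin 3) :
    HasDerivWithinAt (fun y => coord (l i k) ((1 + e y • shiftMat) *ᵥ χ y) * exp (-θ y))
      (α * ((l i k - l j k) * (coord (l i k) ((1 + e x • shiftMat) *ᵥ χ x) * exp (-θ x)))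
        + β * ((z i k - z j k) * (coord (l i k) ((1 + e x • shiftMat) *ᵥ χ x) * exp (-θ x)))
        + coord (l i k) (R *ᵥ χ x) * exp (-θ x)) S x := by
  have h1 : HasDerivWithinAt (fun y => (1 + e y • shiftMat) *ᵥ χ y) ((e' • shiftMat +
      (1 + e x • shiftMat) * (α • U0 (lam k) + β • W0 (lam k) + N)) *ᵥ χ x) S x := by
    have h2 := hasDerivWithinAt_pi.1 hχ
    have h3 : HasDerivWithinAt (fun y => χ y + e y • ![0, χ y 0, χ y 1])
      ((α • U0 (lam k) + β • W0 (lam k) + N) *ᵥ χ x + (e x • ![0,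
        ((α • U0 (lam k) + β • W0 (lam k) + N) *ᵥ χ x) 0,
        ((α • U0 (lam k) + β • W0 (lam k) + N) *ᵥ χ x) 1] + e' • ![0, χ x 0, χ x 1])) S x := by
      refine hχ.add (he.smul (hasDerivWithinAt_pi.2 fun i => ?_))
      cases i using fin3
      exacts [hasDerivWithinAt_const _ _ _, h2 0, h2 1]
    have hsh : ∀ w : ℂ³, shiftMat *ᵥ w = ![0, w 0, w 1] := fun w => by
      funext i; cases i using fin3 <;>
        simp [shiftMat, mulVec, dotProduct, sum_univ_three]
    simp only [add_mulVec, one_mulVec, smul_mulVec, hsh, ← mulVec_mulVec] at h3 ⊢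
    exact h3.congr_deriv (by abel)
  rw [hR] at h1
  refine ((hasDeriv_coord_comp h1 (l i k)).mul hθ.neg.cexp).congr_deriv ?_
  have hc := (isRoots_l hk.1).cubic i
  rw [add_mulVec, ← mulVec_mulVec, add_mulVec, coord_add, coord_add,
    smul_mulVec, smul_mulVec, coord_smul, coord_smul, coord_U0 hc,
    coord_W0 hc (lam_ne_zero hk), ← z_eq i hk.1]
  simp only [Pi.neg_apply]
  ring

/-- `q_x / q²`. -/
def eFun (u : 𝓕) (T x t : ℝ) : ℂ := pdx T (mom u) x t * (q u x t : ℂ)⁻¹ ^ 4 * (1 / 3)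

/-- The derivative of `eFun` in a direction in which `pdx T (mom u)` and `mom u` have the derivatives
`f` and `g`. -/
def eFun' (u : 𝓕) (T : ℝ) (f g : 𝓕) (x t : ℝ) : ℂ :=
  (f x t * (q u x t : ℂ)⁻¹ ^ 4 -
    pdx T (mom u) x t * (4 * (q u x t : ℂ)⁻¹ ^ 7 * (g x t * (1 / 3)))) * (1 / 3)

lemma one_add_shift (e : ℂ) : 1 + e • shiftMat = !![1, 0, 0; e, 1, 0; 0, e, 1] := by
  ext i j
  fin_cases i <;> fin_cases j <;> simp [shiftMat]

section

include hu

lemma hasDeriv_eFun {c : ℝ → ℝ × ℝ} {f g : 𝓕} {S : Set ℝ} {s : ℝ}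
    (hx : 0 ≤ (c s).1) (ht : (c s).2 ∈ Icc 0 T)
    (h1 : HasDerivWithinAt (fun s => pdx T (mom u) (c s).1 (c s).2) (f (c s).1 (c s).2) S s)
    (h2 : HasDerivWithinAt (fun s => q u (c s).1 (c s).2)
      (g (c s).1 (c s).2 / (3 * q u (c s).1 (c s).2 ^ 2)) S s) :
    HasDerivWithinAt (fun s => eFun u T (c s).1 (c s).2) (eFun' u T f g (c s).1 (c s).2) S s := by
  have hq := q_ne_zero hu hx ht
  refine ((h1.ofReal_comp.mul ((h2.ofReal_comp.inv hq).pow 4)).mul_const (1 / 3)).congr_deriv ?_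
  simp only [eFun', Pi.inv_apply, Pi.pow_apply]
  push_cast
  field_simp
  ring

lemma eFun_mul_q (hx : 0 ≤ x) (ht : t ∈ Icc 0 T) :
    (qx u x t : ℂ) / q u x t = q u x t * eFun u T x t := by
  have hq := q_ne_zero hu hx ht
  rw [qx_eq hu hx ht, eFun]
  push_cast
  field_simp

lemma bdd_q_inv_pow (m : ℕ) : Bdd T fun x t => (q u x t : ℂ)⁻¹ ^ m := by
  induction m with
  | zero => simpa using Bdd.const T 1
  | succ m ih => simpa only [pow_succ] using ih.mul (bdd_q_inv hu)

lemma dec_eFun : Dec T (eFun u T) :=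
  (((rapid_mom hu).pdx.dec.mul (bdd_q_inv_pow hu 4)).mul (Bdd.const T (1 / 3)))

lemma dec_eFun' {f g : 𝓕} (hf : RapidDecay T f) (hg : RapidDecay T g) : Dec T (eFun' u T f g) := by
  have h := (hf.dec.mul (bdd_q_inv_pow hu 4)).add ((rapid_mom hu).pdx.dec.mul
    (((Bdd.const T 4).mul (bdd_q_inv_pow hu 7)).mul (hg.dec.bdd.mul (Bdd.const T (1 / 3))))).neg
  exact (h.mul (Bdd.const T (1 / 3))).congr fun x t _ _ => by rw [eFun', sub_eq_add_neg]

lemma shift_x (hx : 0 ≤ x) (ht : t ∈ Icc 0 T) (lm e' : ℂ) :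
    e' • shiftMat + (1 + eFun u T x t • shiftMat) *
      ((q u x t : ℂ) • U0 lm + (0 : ℂ) • W0 lm + tN1 u x t) =
    ((q u x t : ℂ) • U0 lm + (0 : ℂ) • W0 lm) * (1 + eFun u T x t • shiftMat) +
      !![0, 0, 0; e' + q u x t * eFun u T x t ^ 2, 0, 0;
        -(q u x t * eFun u T x t), e' + ((q u x t : ℂ)⁻¹ - q u x t), 0] := by
  have h := eFun_mul_q hu hx ht
  rw [tN1, h, one_add_shift]
  ext i j
  fin_cases i <;> fin_cases j <;> simp [shiftMat, U0] <;> ring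

lemma shift_t (ht : t ∈ Icc 0 T) {lm : ℂ} (hlm : lm ≠ 0) (e' : ℂ) :
    e' • shiftMat + (1 + eFun u T 0 t • shiftMat) *
      (((-(u 0 t * q u 0 t) : ℝ) : ℂ) • U0 lm + (1 : ℂ) • W0 lm + tN2 u lm 0 t) =
    (((-(u 0 t * q u 0 t) : ℝ) : ℂ) • U0 lm + (1 : ℂ) • W0 lm) * (1 + eFun u T 0 t • shiftMat) +
      (!![0, 0, 0; e' + ((u 0 t + 1) * (q u 0 t : ℂ)⁻¹ - 1) - u 0 t * q u 0 t * eFun u T 0 t ^ 2, 0, 0;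
        dx u 1 0 t * (q u 0 t : ℂ)⁻¹ ^ 2 + u 0 t * q u 0 t * eFun u T 0 t +
          eFun u T 0 t * ((u 0 t + 1) * (q u 0 t : ℂ)⁻¹ - 1),
        e' + ((q u 0 t : ℂ)⁻¹ - 1 + u 0 t * q u 0 t), 0] +
      lm⁻¹ • !![0, -eFun u T 0 t, (q u 0 t : ℂ) ^ 2 - 1;
        -eFun u T 0 t, 0, eFun u T 0 t + eFun u T 0 t * ((q u 0 t : ℂ) ^ 2 - 1); 0, 0, 0]) := by
  have hq := q_ne_zero hu le_rfl ht
  have h := eFun_mul_q hu le_rfl ht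
  have h' : (u 0 t : ℂ) * qx u 0 t / q u 0 t = u 0 t * (q u 0 t * eFun u T 0 t) := by
    rw [← h, mul_div_assoc]
  rw [tN2, h', one_add_shift]
  ext i j
  fin_cases i <;> fin_cases j <;>
    simp [shiftMat, U0, W0] <;> field_simp <;> ring

end

/-- `m` bounds the coefficients of the shifted second Lax pair. -/
structure RBound (u : 𝓕) (T m : ℝ) : Prop where
  e_le : ∀ x t, 0 ≤ x → t ∈ Icc 0 T → ‖eFun u T x t‖ ≤ m / (1 + x) ^ 2
  x_le : ∀ {k : ℂ}, NonSpecial k → 4 ≤ scale k → ∀ {v : ℂ³} {B : ℝ}, (∀ i, ‖v i‖ ≤ B) →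
    ∀ x t, 0 ≤ x → t ∈ Icc 0 T → ∀ i, ‖coord (l i k) (!![0, 0, 0;
      eFun' u T (pdx T (pdx T (mom u))) (pdx T (mom u)) x t + q u x t * eFun u T x t ^ 2, 0, 0;
      -(q u x t * eFun u T x t), eFun' u T (pdx T (pdx T (mom u))) (pdx T (mom u)) x t +
        ((q u x t : ℂ)⁻¹ - q u x t), 0] *ᵥ (P k *ᵥ v))‖ ≤ m * B / scale k / (1 + x) ^ 2
  t_le : ∀ {k : ℂ}, NonSpecial k → 4 ≤ scale k → ∀ {v : ℂ³} {B : ℝ}, (∀ i, ‖v i‖ ≤ B) →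
    ∀ t ∈ Icc 0 T, ∃ R : Mat3, eFun' u T (pdt T (pdx T (mom u))) (pdt T (mom u)) 0 t • shiftMat +
      (1 + eFun u T 0 t • shiftMat) *
      (((-(u 0 t * q u 0 t) : ℝ) : ℂ) • U0 (lam k) + (1 : ℂ) • W0 (lam k) + tN2 u (lam k) 0 t) =
      (((-(u 0 t * q u 0 t) : ℝ) : ℂ) • U0 (lam k) + (1 : ℂ) • W0 (lam k)) *
        (1 + eFun u T 0 t • shiftMat) + R ∧ ∀ i, ‖coord (l i k) (R *ᵥ (P k *ᵥ v))‖ ≤ m * B / scale k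

include hu in
lemma exists_rBound : ∃ m, 0 ≤ m ∧ RBound u T m := by
  have hm := rapid_mom hu
  have hE := dec_eFun hu
  have hX := dec_eFun' hu hm.pdx.pdx hm.pdx
  have hY := (dec_eFun' hu hm.pdx.pdt hm.pdt).bdd
  have hq := bdd_q hu
  have hi := bdd_q_inv hu
  have hU := hu.rapidDecay.dec.bdd
  have h1 := fun c => Bdd.const T c
  have g1 := hX.add (hE.mul (hE.bdd.mul hq))
  have g2 := hE.mul (hq.mul (h1 (-1)))
  have g3 := hX.add ((dec_q hu).mul ((hi.add (h1 1)).mul (h1 (-1))))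
  have hc := ((hU.add (h1 1)).mul hi).add (h1 (-1))
  have hUE := (hU.mul hq).mul hE.bdd
  have f1 := (hY.add hc).add ((hUE.mul hE.bdd).mul (h1 (-1)))
  have f2 := (((rapid_dx hu 1).1.dec.bdd.mul (bdd_q_inv_pow hu 2)).add hUE).add (hE.bdd.mul hc)
  have f3 := hY.add ((hi.add (h1 (-1))).add (hU.mul hq))
  have f4 := (hq.mul hq).add (h1 (-1))
  have f5 := hE.bdd.add (hE.bdd.mul f4)
  obtain ⟨a1, p1, g1⟩ := g1
  obtain ⟨a2, p2, g2⟩ := g2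
  obtain ⟨a3, p3, g3⟩ := g3
  obtain ⟨a4, p4, f0⟩ := hE
  obtain ⟨b1, q1, f1⟩ := f1.bound
  obtain ⟨b2, q2, f2⟩ := f2.bound
  obtain ⟨b3, q3, f3⟩ := f3.bound
  obtain ⟨b4, q4, f4⟩ := f4.bound
  obtain ⟨b5, q5, f5⟩ := f5.bound
  set m := a1 + a2 + a3 + a4 + b1 + b2 + b3 + b4 + b5
  have hm0 : 0 ≤ m := by positivity
  refine ⟨72 * (28 * m), by positivity, fun x t hx ht => ?_, fun {k} hk hs {v B} hv x t hx ht i => ?_,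
    fun {k} hk hs {v B} hv t ht => ⟨_, shift_t hu ht (lam_ne_zero hk) _, fun i => ?_⟩⟩
  · exact (f0 x t hx ht).trans (div_le_div_of_nonneg_right (by linarith) (by positivity))
  · have hd : ∀ {a}, a ≤ m → a / (1 + x) ^ 2 ≤ m / (1 + x) ^ 2 := fun h =>
      div_le_div_of_nonneg_right h (by positivity)
    have hB := (norm_nonneg _).trans (hv 0)
    have e3 : (q u x t : ℂ)⁻¹ - q u x t = (q u x t - 1) * (((q u x t : ℂ)⁻¹ + 1) * -1) := by
      have := q_ne_zero hu hx ht
      field_simp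
      ring
    refine (norm_coord_lower_le hk.1 hs (m := m / (1 + x) ^ 2) ?_ ?_ ?_ hv i).trans ?_
    · refine le_trans (le_of_eq ?_) ((g1 x t hx ht).trans (hd (by linarith)))
      congr 1; ring
    · refine le_trans (le_of_eq ?_) ((g2 x t hx ht).trans (hd (by linarith)))
      congr 1; ring
    · rw [e3]
      exact (g3 x t hx ht).trans (hd (by linarith))
    · have e : 72 * (m / (1 + x) ^ 2) * B / scale k = (72 * m) * B / scale k / (1 + x) ^ 2 := by ring
      rw [e]
      have : 0 < scale k := by linarith
      gcongr
      linarith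
  · have hB := (norm_nonneg _).trans (hv 0)
    rw [add_mulVec, coord_add]
    have e : 72 * (28 * m) * B / scale k = 72 * m * B / scale k + 72 * (27 * m) * B / scale k := by ring
    have hE' : ‖eFun u T 0 t‖ ≤ m := by
      have := f0 0 t le_rfl ht
      simp only [add_zero, one_pow, div_one] at this
      linarith
    rw [e]
    refine (norm_add_le _ _).trans (add_le_add (norm_coord_lower_le hk.1 hs ?_ ?_ ?_ hv i)
      (norm_coord_upper_le hk.1 hs ?_ ?_ ?_ ?_ hv i))
    · refine le_trans (le_of_eq ?_) ((f1 0 t le_rfl ht).trans (by linarith))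
      congr 1; ring
    · exact (f2 0 t le_rfl ht).trans (by linarith)
    · rw [sub_eq_add_neg]
      exact (f3 0 t le_rfl ht).trans (by linarith)
    · rwa [norm_neg]
    · rw [sq, sub_eq_add_neg]
      exact (f4 0 t le_rfl ht).trans (by linarith)
    · rw [sq, sub_eq_add_neg]
      exact (f5 0 t le_rfl ht).trans (by linarith)
    · rwa [norm_neg]

section

variable {m : ℝ}
  (hm : RBound u T m) (h : OrdAt k (lOrd n)) (hs : 4 ≤ scale k) {r : Fin 3}
  {B : ℝ} (hB : ∀ x t, 0 ≤ x → t ∈ Icc 0 T → ∀ i, ‖(frameR u T).col u T k n#r C x t i‖ ≤ B)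

/-- The coordinates of the shifted column of the second Lax pair. -/
def colS (u : 𝓕) (T : ℝ) (k : ℂ) (j : Fin 3) (C : ℂ³) (x t : ℝ) (i : Fin 3) : ℂ :=
  coord (l i k) ((1 + eFun u T x t • shiftMat) *ᵥ (dgm (q u x t) *ᵥ (Psi u T (lam k) x t *ᵥ C))) *
    exp (-(frameR u T).phase k j x t)

local notation "𝓿" => Frame.col (frameR u T) u T k n#r C

local notation "𝔀" => colS u T k n#r C

include h

lemma coord_mulVec_exp (A : Mat3) (i j : Fin 3) (C : ℂ³) (x t : ℝ) :
    coord (l i k) (A *ᵥ (dgm (q u x t) *ᵥ (Psi u T (lam k) x t *ᵥ C))) *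
      exp (-(frameR u T).phase k j x t) =
    coord (l i k) (A *ᵥ (P k *ᵥ (frameR u T).col u T k j C x t)) := by
  rw [Frame.P_col h.ns, mulVec_smul, coord_smul, mul_comm]
  rfl

include hm hs hB

lemma norm_colS_sub_le (hx : 0 ≤ x) (ht : t ∈ Icc 0 T) (i : Fin 3) : ‖𝔀 x t i - 𝓿 x t i‖ ≤
      72 * (m / (1 + x) ^ 2) * B / scale k := by
  have e : 𝔀 x t i - 𝓿 x t i = coord (l i k) (!![0, 0, 0; eFun u T x t, 0, 0; 0, eFun u T x t, 0] *ᵥ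
        (P k *ᵥ 𝓿 x t)) := by
    have e1 : eFun u T x t • shiftMat = !![0, 0, 0; eFun u T x t, 0, 0; 0, eFun u T x t, 0] := by
      rw [shiftMat]; ext i j
      fin_cases i <;> fin_cases j <;> simp
    rw [colS, coord_mulVec_exp h, e1, add_mulVec, one_mulVec, coord_add,
      coord_P_mulVec h.ns, add_sub_cancel_left]
  have he := hm.e_le x t hx ht
  rw [e]
  exact norm_coord_lower_le h.ns.1 hs he (by rw [norm_zero]; exact (norm_nonneg _).trans he) he
    (hB x t hx ht) i

include hu

lemma norm_colS_zero_le (hr : ∀ p, p < r → (z n#p k).re ≤ (z n#r k).re) {p : Fin 3}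
    (hp : p < r) (ht : t ∈ Icc 0 T) :
    ‖𝔀 0 t n#p‖ ≤ ‖𝔀 0 0 n#p‖ + m * B / scale k * T := by
  have hF := frameR_good hu
  have hm' := rapid_mom hu
  have hv := hB 0
  have hsub : Icc 0 t ⊆ Icc 0 T := Icc_subset_Icc_right ht.2
  have hmc : 0 ≤ m * B / scale k := by
    obtain ⟨R, -, hR⟩ := hm.t_le h.ns hs (hv 0 le_rfl zero_mem_Icc) 0 zero_mem_Icc
    exact (norm_nonneg _).trans (hR 0)
  set A : ℝ → ℂ := fun s => (frameR u T).phase k n#p 0 s - (frameR u T).phase k n#r 0 s with hA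
  have hAm : ∀ a ∈ Icc 0 T, ∀ b ∈ Icc 0 T, a ≤ b → (A b).re ≤ (A a).re := by
    intro a ha b hb hab
    have hY : MonotoneOn (fun s => yFun u 0 s) (Icc 0 T) := by
      refine monotoneOn_of_deriv_nonneg (convex_Icc 0 T)
        (fun s hs => (hF.dYt 0 s le_rfl hs).continuousWithinAt) (fun s hs => ?_) fun s hs => ?_
      all_goals
        rw [interior_Icc] at hs
        have := (hF.dYt 0 s le_rfl (Ioo_subset_Icc_self hs)).hasDerivAt (Icc_mem_nhds hs.1 hs.2)
      · exact this.differentiableAt.differentiableWithinAt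
      · have e : deriv (fun s => yFun u 0 s) s = -(u 0 s * q u 0 s) := this.deriv
        have := u_boundary_nonpos hu (Ioo_subset_Icc_self hs)
        have := q_pos hu le_rfl (Ioo_subset_Icc_self hs)
        rw [e]
        nlinarith
    have h1 : yFun u 0 a ≤ yFun u 0 b := hY ha hb hab
    have h2 := h.mono hp.le
    have h3 := hr p hp
    have e : ∀ s, (A s).re = ((l n#p k).re - (l n#r k).re) * yFun u 0 s +
        ((z n#p k).re - (z n#r k).re) * s := fun s => by
      simp [hA, Frame.phase, frameR]; ring
    rw [e, e]
    nlinarith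
  choose! R hR1 hR2 using fun s (hs' : s ∈ Icc 0 T) => hm.t_le h.ns hs (hv s le_rfl hs') s hs'
  have := norm_exp_sub_le (A := A) (v := fun s => 𝔀 0 s n#p)
    (A' := fun s => (((-(u 0 s * q u 0 s) : ℝ) : ℂ) * l n#p k + 1 * z n#p k) -
      (((-(u 0 s * q u 0 s) : ℝ) : ℂ) * l n#r k + 1 * z n#r k))
    (g := fun s => coord (l n#p k) (R s *ᵥ (P k *ᵥ 𝓿 0 s)))
    (G := fun s => m * B / scale k * s) (G' := fun _ => m * B / scale k) (c := t) ht.1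
    (fun s hs => (((hF.hasDeriv_phase_t (k := k) n#p le_rfl (hsub hs)).sub
      (hF.hasDeriv_phase_t (k := k) n#r le_rfl (hsub hs))).mono hsub))
    (fun s hs => ?_) (fun s hs => hR2 s (hsub hs) _)
    (fun s hs => ((hasDerivAt_id s).const_mul _).congr_deriv (mul_one _))
    (fun s hs => hAm s (hsub hs) t ht hs.2)
  · rw [sub_self, exp_zero, one_mul] at this
    have h2 : ‖exp (A t - A 0) * 𝔀 0 0 n#p‖ ≤ ‖𝔀 0 0 n#p‖ := by
      rw [norm_mul, norm_exp, sub_re]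
      exact mul_le_of_le_one_left (norm_nonneg _) (exp_le_one_iff.2
        (sub_nonpos.2 (hAm 0 zero_mem_Icc t ht ht.1)))
    have h3 := norm_sub_norm_le (𝔀 0 t n#p) (exp (A t - A 0) * 𝔀 0 0 n#p)
    have := mul_le_mul_of_nonneg_left ht.2 hmc
    linarith
  · have hs' := hsub hs
    have := hasDeriv_shift h.ns (hasDeriv_gauge (hF.dρt 0 s le_rfl hs')
      (hF.ρ_pos 0 s le_rfl hs').ne' (hF.eqt (lam k) 0 s (lam_ne_zero h.ns) le_rfl hs')
      (hasDeriv_Psi_t hu (lam_ne_zero h.ns) le_rfl hs' C))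
      (hF.hasDeriv_phase_t (k := k) n#r le_rfl hs')
      (hasDeriv_eFun hu (c := fun s => (0, s)) le_rfl hs'
        ((hm'.pdx).hasDeriv_t le_rfl hs') (hasDeriv_q_t hu le_rfl hs'))
      (hR1 s hs') n#p
    refine (this.mono hsub).congr_deriv ?_
    have e := coord_mulVec_exp (u := u) (T := T) h (R s) n#p n#r C 0 s
    rw [← e]
    simp only [colS, frameR]
    ring

lemma near_R_of_bound {d : ℂ} (hC : IsCol u k (lOrd n) ((frameR u T).row u T n k r) r
      (d * (χ[l n#r k] * exp (l n#r k * (frameR u T).c))) C)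
    (hr : ∀ p, p < r → contour n n#p n#r = γ₂ ∧
      (z n#p k).re ≤ (z n#r k).re) (hx : 0 ≤ x) (ht : t ∈ Icc 0 T)
    (p : Fin 3) : ‖𝓿 x t n#p - (if p = r then d else 0)‖ ≤ (145 + T) * m * B / scale k := by
  have hF := frameR_good hu
  have hm' := rapid_mom hu
  have hK : 0 < scale k := by linarith
  have hB0 : 0 ≤ B := (norm_nonneg _).trans (hB 0 0 le_rfl zero_mem_Icc 0)
  have hm0 : 0 ≤ m := by simpa using (norm_nonneg _).trans (hm.e_le 0 0 le_rfl zero_mem_Icc)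
  have hd : ∀ {x t}, 0 ≤ x → t ∈ Icc 0 T → ∀ i, ‖𝔀 x t i -
      𝓿 x t i‖ ≤ 72 * (m * B / scale k) := fun {x t} hx ht i => by
    refine (norm_colS_sub_le hm h hs hB hx ht i).trans ?_
    have : m / (1 + x) ^ 2 ≤ m := div_le_self hm0 (one_le_pow₀ (by linarith))
    rw [show 72 * (m * B / scale k) = 72 * m * B / scale k by ring]
    gcongr
  have hw : ∀ x, 0 ≤ x → HasDerivWithinAt (fun s => 𝔀 s t n#p)
      ((frameR u T).ρ x t * ((l n#p k - l n#r k) * 𝔀 x t n#p) + coord (l n#p k) (!![0, 0, 0;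
      eFun' u T (pdx T (pdx T (mom u))) (pdx T (mom u)) x t + q u x t * eFun u T x t ^ 2, 0, 0;
      -(q u x t * eFun u T x t), eFun' u T (pdx T (pdx T (mom u))) (pdx T (mom u)) x t +
        ((q u x t : ℂ)⁻¹ - q u x t), 0] *ᵥ (P k *ᵥ 𝓿 x t))) (Ici 0) x :=
    fun x hx => by
      have := hasDeriv_shift h.ns (hasDeriv_gauge (hF.dρx x t hx ht)
        (hF.ρ_pos x t hx ht).ne' (hF.eqx (lam k) x t hx ht)
        (hasDeriv_Psi_x hu (lam k) hx ht C))
        (hF.hasDeriv_phase_x (k := k) n#r hx ht)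
        (hasDeriv_eFun hu (c := fun s => (s, t)) hx ht
          ((hm'.pdx).hasDeriv_x hx ht) (hasDeriv_q_x hu hx ht))
        (shift_x hu hx ht _ _) n#p
      refine this.congr_deriv ?_
      rw [← coord_mulVec_exp h, zero_mul, add_zero]
      rfl
  have hg := fun x hx => hm.x_le h.ns hs (hB x t hx ht) x t hx ht n#p
  have h1 := hd hx ht n#p
  have e : (145 + T) * m * B / scale k = 145 * (m * B / scale k) + m * B / scale k * T := by ring
  have hmB : 0 ≤ m * B / scale k := by positivity
  have hmT : 0 ≤ m * B / scale k * T := by have := hT.out; positivity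
  rw [e]
  have key : ∀ δ, ‖𝔀 x t n#p - δ‖ ≤ 73 * (m * B / scale k) + m * B / scale k * T →
      ‖𝓿 x t n#p - δ‖ ≤ 145 * (m * B / scale k) + m * B / scale k * T := fun δ hδ => by
    have := norm_sub_le_norm_sub_add_norm_sub (𝓿 x t n#p) (𝔀 x t n#p) δ
    rw [norm_sub_rev (𝓿 x t n#p) (𝔀 x t n#p)] at this
    linarith
  refine key _ ?_
  rcases lt_or_ge p r with hp | hp
  · rw [if_neg hp.ne, sub_zero]
    have a1 := norm_le_of_sweep hF ht hw hg (h.mono hp.le) hx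
    have a2 := norm_colS_zero_le hu hm h hs hB (fun p hp => (hr p hp).2) hp ht
    have a3 : 𝓿 0 0 n#p = 0 := by
      have := ((frameR u T).row_dot_eq_zero_iff h r p C n#r).1 (hC.start p hp)
      rw [startTime, (hr p hp).1] at this
      exact (mul_eq_zero.1 this).resolve_left (exp_ne_zero _)
    have a4 := hd le_rfl zero_mem_Icc n#p
    rw [a3, sub_zero] at a4
    linarith
  · have hl := IsCol.tendsto_pot hu hF h hC hp ht
    have hl' : Tendsto (fun x => exp ((frameR u T).phase k n#r x t -
        (frameR u T).phase k n#p x t) * 𝔀 x t n#p) atTop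
        (𝓝 (if p = r then d else 0)) := by
      have h0 : Tendsto (fun x => exp ((frameR u T).phase k n#r x t -
        (frameR u T).phase k n#p x t) * (𝔀 x t n#p - 𝓿 x t n#p)) atTop
        (𝓝 0) := by
        have hb : Tendsto (fun x : ℝ => Real.exp (((frameR u T).phase k n#r 0 t -
            (frameR u T).phase k n#p 0 t).re) * (72 * (m / (1 + x) ^ 2) * B / scale k))
            atTop (𝓝 0) := by
          have h1 : Tendsto (fun x : ℝ => m / (1 + x) ^ 2) atTop (𝓝 0) :=
            tendsto_const_nhds.div_atTop ((tendsto_pow_atTop two_ne_zero).comp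
              (tendsto_atTop_add_const_left _ 1 tendsto_id))
          simpa using (((h1.const_mul 72).mul_const B).div_const (scale k)).const_mul _
        refine squeeze_zero_norm' ((eventually_ge_atTop 0).mono fun x hx => ?_) hb
        rw [norm_mul, norm_exp]
        refine mul_le_mul (exp_le_exp.2 ?_) (norm_colS_sub_le hm h hs hB hx ht _)
          (norm_nonneg _) (exp_pos _).le
        have hy := monotoneOn_Y hF ht self_mem_Ici hx hx
        have := h.mono hp
        simp only [Frame.phase, sub_re, add_re, re_mul_ofReal]
        beta_reduce at hy
        nlinarith
      have := hl.add h0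
      rw [add_zero] at this
      refine this.congr fun x => ?_
      simp only [Frame.pot]
      ring
    have := norm_sub_le_of_sweep hF ht hw hg (h.mono hp) hl' hx
    split_ifs at this ⊢ with e
    · subst e
      rw [sub_self, exp_zero, one_mul] at this
      linarith
    · rw [mul_zero] at this
      linarith

end

/-- The columns of the eigenfunctions at `k` are `η`-close to those of the identity, relative to
their size. -/
def Frame.NearId (F : Frame) (u : 𝓕) (T : ℝ) (n : Fin 18) (k : ℂ) (η : ℝ) : Prop :=
  ∀ r d C, IsCol u k (lOrd n) (F.row u T n k r) r (d * (χ[l n#r k] * exp (l n#r k * F.c))) C →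
    ∀ B, (∀ x t, 0 ≤ x → t ∈ Icc 0 T → ∀ i, ‖F.col u T k n#r C x t i‖ ≤ B) →
    ∀ x t, 0 ≤ x → t ∈ Icc 0 T → ∀ p, ‖F.col u T k n#r C x t n#p - (if p = r then d else 0)‖ ≤ η * B

section

include hu

lemma Frame.NearId.norm_sub_le {F : Frame} (hF : F.Good u T) (h : OrdAt k (lOrd n)) {η : ℝ} (hη : η ≤ 1 / 2) (hN : F.NearId u T n k η) {r : Fin 3}
    {d : ℂ} (hC : IsCol u k (lOrd n) (F.row u T n k r) r (d * (χ[l n#r k] * exp (l n#r k * F.c))) C)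
    (hx : 0 ≤ x) (ht : t ∈ Icc 0 T) (p : Fin 3) :
    ‖F.col u T k n#r C x t n#p - (if p = r then d else 0)‖ ≤ 2 * η * ‖d‖ := by
  obtain ⟨B, hB0, hB⟩ := IsCol.col_bound hu hF h hC
  have key := le_of_self_improving (ι := {q : ℝ × ℝ × Fin 3 // 0 ≤ q.1 ∧ q.2.1 ∈ Icc 0 T})
    (f := fun q => ‖F.col u T k n#r C q.1.1 q.1.2.1 q.1.2.2‖) (D := ‖d‖)
    ⟨B, by rintro _ ⟨⟨⟨x, t, i⟩, hx, ht⟩, rfl⟩; exact hB x t hx ht i⟩ ?_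
  · refine (hN r d C hC _ (fun x t hx ht i => key ⟨⟨x, t, i⟩, hx, ht⟩) x t hx ht p).trans (le_of_eq ?_)
    ring
  · rintro B' hB' ⟨⟨x, t, i⟩, hx, ht⟩
    have h1 := hN r d C hC B' (fun x t hx ht i => hB' ⟨⟨x, t, i⟩, hx, ht⟩) x t hx ht (rk n i)
    have hB0 := (norm_nonneg _).trans (hB' ⟨⟨x, t, i⟩, hx, ht⟩)
    rw [lOrd_rk] at h1
    have h2 := norm_le_norm_add_norm_sub' (F.col u T k n#r C x t i) (if rk n i = r then d else 0)
    have h3 : ‖(if rk n i = r then d else 0 : ℂ)‖ ≤ ‖d‖ := by split_ifs <;> simp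
    have : η * B' ≤ B' / 2 := by nlinarith
    simp only
    linarith

lemma Frame.NearId.solv {F : Frame} (hF : F.Good u T) (h : OrdAt k (lOrd n)) {η : ℝ} (hη : η ≤ 1 / 2) (hN : F.NearId u T n k η) :
    F.dMid u T n k ≠ 0 ∧ F.dTop u T n k ≠ 0 := by
  have key : ∀ r v, v ≠ 0 → ¬ IsCol u k (lOrd n) (F.row u T n k r) r 0 v := by
    intro r v hv hcol
    rw [← zero_mul (χ[l n#r k] * exp (l n#r k * F.c))] at hcol
    have := hN.norm_sub_le hu hF h hη hcol le_rfl zero_mem_Icc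
    have h0 : F.col u T k n#r v 0 0 = 0 := by
      funext i
      have h1 := this (rk n i)
      simp only [lOrd_rk, ite_self, sub_zero, norm_zero, mul_zero] at h1
      exact norm_le_zero_iff.1 h1
    have e := col_zero_zero hu hF h n#r v
    rw [h0, mulVec_zero, mulVec_zero] at e
    exact hv e.symm
  refine ⟨fun hM => key 1 _ (jost_ne_zero hu h) (isCol_one_add_jost hu h hM), fun hD => ?_⟩
  obtain ⟨v, hv, hcol⟩ := exists_isCol_two_zero hu h hD
  exact key 2 v hv hcol

lemma nu_eq_sum {n : Idx} (h : OrdAt k (lOrd n.num)) (hs : n.Solv u T k) (hx : 0 ≤ x) (ht : t ∈ Ico 0 T) (p : Fin 3) : nu u T n (yFun u x t) t k n.num#p =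
      ((n.frame u T).ρ x t : ℂ)⁻¹ * (∑ i, (n.frame u T).col u T k n.num#p
        ((n.frame u T).cvec u T n.num k p) x t i) *
        exp (l n.num#p k * ((n.frame u T).Y x t - yFun u x t)) := by
  have ht' := Ico_subset_Icc_self ht
  have hρ : ((n.frame u T).ρ x t : ℂ) ≠ 0 := by
    exact_mod_cast ((n.frame_good hu).ρ_pos x t hx ht').ne'
  have e := congrFun ((n.frame u T).P_col h.ns u T n.num#p ((n.frame u T).cvec u T n.num k p) x t) 0
  have e1 : ∀ w : ℂ³, (P k *ᵥ w) 0 = ∑ i, w i := fun w => by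
    simp [P, mulVec, dotProduct, sum_univ_three]
  rw [e1, dgm_mulVec] at e
  rw [nu_apply hu h hs hx ht, e, Pi.smul_apply, smul_eq_mul]
  simp only [cons_val_zero]
  have e2 : -(l n.num#p k * yFun u x t + z n.num#p k * t) = -(n.frame u T).phase k n.num#p x t +
        l n.num#p k * ((n.frame u T).Y x t - yFun u x t) := by
    rw [Frame.phase]; ring
  rw [e2, exp_add]
  field_simp

lemma tendsto_nu_of_nearId {n : Idx} {fl : Filter ℂ} {η : ℂ → ℝ}
    (hN : ∀ᶠ k in fl, OrdAt k (lOrd n.num) ∧ (n.frame u T).NearId u T n.num k (η k))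
    (hη : Tendsto η fl (𝓝 0)) :
    (∀ᶠ k in fl, n.Solv u T k) ∧ ∀ x t, 0 ≤ x → t ∈ Ico 0 T → ∀ p a,
      Tendsto (fun k => l n.num#p k * ((n.frame u T).Y x t - yFun u x t)) fl (𝓝 a) →
      Tendsto (fun k => nu u T n (yFun u x t) t k n.num#p) fl
        (𝓝 (((n.frame u T).ρ x t : ℂ)⁻¹ * exp a)) := by
  have hF := n.frame_good hu
  have hev : ∀ᶠ k in fl, η k ≤ 1 / 2 := (hη.eventually_lt_const (by norm_num)).mono fun _ => le_of_lt
  have hS : ∀ᶠ k in fl, n.Solv u T k := (hN.and hev).mono fun k hk =>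
    hk.1.2.solv hu hF hk.1.1 hk.2
  refine ⟨hS, fun x t hx ht p a ha => ?_⟩
  have hsum : Tendsto (fun k => ∑ i, (n.frame u T).col u T k n.num#p
        ((n.frame u T).cvec u T n.num k p) x t i) fl (𝓝 1) := by
    rw [tendsto_iff_norm_sub_tendsto_zero]
    have h0 : Tendsto (fun k => 3 * (2 * η k)) fl (𝓝 0) := by
      simpa using (hη.const_mul 2).const_mul 3
    refine squeeze_zero' (Eventually.of_forall fun _ => norm_nonneg _) ?_ h0
    filter_upwards [hN, hev, hS] with k hk hk' hs
    have hc := (isCol_iff_cvec hu hk.1 hs.1 hs.2 p).2 rfl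
    rw [← one_mul ((_ : ℂ) * exp _)] at hc
    have := fun r => hk.2.norm_sub_le hu hF hk.1 hk' hc hx (Ico_subset_Icc_self ht) r
    simp only [norm_one, mul_one] at this
    have hb : Function.Bijective (lOrd n.num) := Finite.injective_iff_bijective.1 (lOrd_injective n.num)
    rw [← hb.sum_comp]
    have e : (1 : ℂ) = ∑ r, if r = p then 1 else 0 := by simp
    rw [e, ← sum_sub_distrib]
    exact norm_sum_three_le this
  have := (tendsto_const_nhds (x := ((n.frame u T).ρ x t : ℂ)⁻¹)).mul hsum |>.mul ha.cexp
  rw [mul_one] at this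
  exact this.congr' ((hN.and hS).mono fun k hk => (nu_eq_sum hu hk.1.1 hk.2 hx ht p).symm)

end

/-! ### Dependence on the spectral parameter -/

/-- The points at which `λ` is finite and nonzero and `Re l_j` is ordered as in `lOrd n`. -/
def Reg (n : Fin 18) : Set ℂ := {k | k ≠ 0 ∧ lam k ≠ 0 ∧
  (l n#0 k).re ≤ (l n#1 k).re ∧ (l n#1 k).re ≤ (l n#2 k).re}

lemma exists_lOrd (n : Fin 18) (j : Fin 3) : j = n#0 ∨ j = n#1 ∨ j = n#2 := by
  revert n j; decide

lemma Reg.mem_minRegion (h : k ∈ Reg n) : k ∈ minRegion n#0 := by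
  refine ⟨h.1, fun j => ?_⟩
  obtain ⟨-, -, h1, h2⟩ := h
  rcases exists_lOrd n j with rfl|rfl|rfl
  exacts [le_rfl, h1, h1.trans h2]

lemma Reg.neg_mem_minRegion (h : k ∈ Reg n) : -k ∈ minRegion n#2 := by
  refine ⟨neg_ne_zero.2 h.1, fun j => ?_⟩
  obtain ⟨-, -, h1, h2⟩ := h
  simp only [l_neg, neg_re, neg_le_neg_iff]
  rcases exists_lOrd n j with rfl|rfl|rfl
  exacts [h1.trans h2, h2, le_rfl]

lemma DifferentiableWithinAt.cross {f g : ℂ → ℂ³} {s : Set ℂ} (hf : DifferentiableWithinAt ℂ f s k) (hg : DifferentiableWithinAt ℂ g s k) :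
    DifferentiableWithinAt ℂ (fun k => crossProduct (f k) (g k)) s k := by
  have f' := differentiableWithinAt_pi.1 hf
  have g' := differentiableWithinAt_pi.1 hg
  refine differentiableWithinAt_pi.2 fun i => ?_
  simp only [cross_apply]
  cases i using fin3
  exacts [((f' 1).mul (g' 2)).sub ((f' 2).mul (g' 1)), ((f' 2).mul (g' 0)).sub ((f' 0).mul (g' 2)),
    ((f' 0).mul (g' 1)).sub ((f' 1).mul (g' 0))]

lemma DifferentiableWithinAt.dotProduct {f g : ℂ → ℂ³} {s : Set ℂ} (hf : DifferentiableWithinAt ℂ f s k) (hg : DifferentiableWithinAt ℂ g s k) :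
    DifferentiableWithinAt ℂ (fun k => f k ⬝ᵥ g k) s k := by
  have f' := differentiableWithinAt_pi.1 hf
  have g' := differentiableWithinAt_pi.1 hg
  simp only [dot_three]
  exact (((f' 0).mul (g' 0)).add ((f' 1).mul (g' 1))).add ((f' 2).mul (g' 2))

lemma diffAt_l (j : Fin 3) (hk : k ≠ 0) : DifferentiableAt ℂ (l j) k :=
  (analyticAt_l j hk).differentiableAt

lemma diffAt_z (j : Fin 3) (hk : k ≠ 0) (hl : lam k ≠ 0) : DifferentiableAt ℂ (z j) k := by
  have h : DifferentiableAt ℂ (fun k => (l j k ^ 2 - 2 / 3) / lam k) k :=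
    (((diffAt_l j hk).pow 2).sub_const _).div (analyticAt_lam hk).differentiableAt hl
  exact h.congr_of_eventuallyEq ((eventually_ne_nhds hk).mono fun k hk => z_eq j hk)

section

variable (hk : k ∈ Reg n)


lemma startTime_mem (n : Fin 18) (i j : Fin 3) : startTime T n i j ∈ Icc 0 T := by
  rw [startTime]
  split
  exacts [⟨hT.out.le, le_rfl⟩, ⟨le_rfl, hT.out.le⟩]

include hu hk

lemma diff_jost : DifferentiableWithinAt ℂ (jost u n#0) (Reg n) k :=
  (diffWithin_jost hu (Reg.mem_minRegion hk)).mono fun _ h => Reg.mem_minRegion h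

lemma diff_topRow : DifferentiableWithinAt ℂ (topRow u (lOrd n)) (Reg n) k := by
  have h := differentiableWithinAt_pi.1 ((diffWithin_jost hu
    (Reg.neg_mem_minRegion hk)).comp k differentiable_neg.differentiableAt.differentiableWithinAt
    (fun _ h => Reg.neg_mem_minRegion h) : DifferentiableWithinAt ℂ _ (Reg n) k)
  refine differentiableWithinAt_pi.2 fun i => ?_
  cases i using fin3
  exacts [(h 2).sub (h 0), (h 1).neg, h 0]

lemma diff_Psi (hx : 0 ≤ x) (ht : t ∈ Icc 0 T) (i j : Fin 3) :
    DifferentiableAt ℂ (fun k => Psi u T (lam k) x t i j) k :=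
  (diffAt_Psi hu hx ht i j hk.2.1).comp k (analyticAt_lam hk.1).differentiableAt

lemma diff_row (F : Frame) (r p : Fin 3) :
    DifferentiableWithinAt ℂ (fun k => F.row u T n k r p) (Reg n) k := by
  have hl := diffAt_l n#p hk.1
  have hP := diff_Psi hu hk le_rfl (startTime_mem n n#p n#r)
  refine (differentiableAt_pi.2 fun i => ?_).differentiableWithinAt
  simp only [Frame.row, Matrix.vecMul, dotProduct, mul_apply, sum_univ_three, cons_val]
  fun_prop

lemma diff_dMid (F : Frame) : DifferentiableWithinAt ℂ (F.dMid u T n) (Reg n) k :=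
  DifferentiableWithinAt.dotProduct (diff_row hu hk F 1 0) (diff_jost hu hk)

lemma diff_dTop (F : Frame) : DifferentiableWithinAt ℂ (F.dTop u T n) (Reg n) k :=
  DifferentiableWithinAt.dotProduct (diff_topRow hu hk)
    (DifferentiableWithinAt.cross (diff_row hu hk F 2 0) (diff_row hu hk F 2 1))

lemma diff_cvec (hns : NonSpecial k) (F : Frame) (hM : F.dMid u T n k ≠ 0)
    (hD : F.dTop u T n k ≠ 0) (r : Fin 3) :
    DifferentiableWithinAt ℂ (fun k => F.cvec u T n k r) (Reg n) k := by
  have h : OrdAt k (lOrd n) := ⟨hns, lOrd_injective n, hk.2.2.1, hk.2.2.2⟩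
  have hl := fun p => (diffAt_l n#p hk.1).differentiableWithinAt (s := Reg n)
  have hM' := diff_dMid hu hk F
  have hD' := diff_dTop hu hk F
  have hpi := fun p => (((hl p).pow 2).const_mul 3).sub_const 1
  have ht := diff_topRow hu hk
  have hr := diff_row hu hk F
  refine ((hl r).mul_const _).cexp.smul ?_
  cases r using fin3
  · exact diff_jost hu hk
  · exact ((hpi 1).div (((hl 2).sub (hl 1)).mul hM') (mul_ne_zero (h.sub_ne_zero (by decide)) hM)).smul
      (DifferentiableWithinAt.cross (hr 1 0) ht)
  · exact ((hpi 2).div hD' hD).smul (DifferentiableWithinAt.cross (hr 2 0) (hr 2 1))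

end

/-! ### The spectral functions -/

lemma z_sum (hk : k ≠ 0) : z 0 k + z 1 k + z 2 k = 0 := by
  have h := isRoots_l hk
  have e : l 0 k ^ 2 + l 1 k ^ 2 + l 2 k ^ 2 = 2 := by
    linear_combination (l 0 k + l 1 k + l 2 k) * h.sum - 2 * h.pair
  rw [z_eq 0 hk, z_eq 1 hk, z_eq 2 hk, ← add_div, ← add_div]
  rw [show l 0 k ^ 2 - 2 / 3 + (l 1 k ^ 2 - 2 / 3) + (l 2 k ^ 2 - 2 / 3) = 0 by
    linear_combination e, zero_div]

section

include hu

lemma isUnit_det_Psi (ht : t ∈ Icc 0 T) : IsUnit (Psi u T (lam k) 0 t).det := by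
  rw [det_Psi hu _ ht]; exact isUnit_one

lemma sBdry_eq (hk : NonSpecial k) :
    SBdry u T k = (P k)⁻¹ * (Psi u T (lam k) 0 T)⁻¹ * P k * diagonal fun j =>
      exp (z j k * T) := by
  have hT' : T ∈ Icc 0 T := ⟨hT.out.le, le_rfl⟩
  have hF := frameL_good hu
  have hψ := isUnit_det_Psi hu (k := k) hT'
  set D : Fin 3 → ℂ³ := fun j => exp (z j k * T) • ((Psi u T (lam k) 0 T)⁻¹ *ᵥ pvec (l j k)) with hD
  have hex : IsBoundaryMu u T k fun t => Matrix.of fun i j => (frameL u T).col u T k j (D j) 0 t i := by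
    refine ⟨?_, fun t h0 h1 i j => ?_⟩
    · ext i j
      have e1 : Psi u T (lam k) 0 T *ᵥ D j = exp (z j k * T) • pvec (l j k) := by
        rw [hD, mulVec_smul, mulVec_mulVec, mul_nonsing_inv _ hψ, one_mulVec]
      have e2 : coord (l i k) (pvec (l j k)) = if i = j then 1 else 0 := by
        have := coord_P_mulVec hk (Pi.single j 1) i
        rwa [P_mulVec, Finset.sum_eq_single j (fun b _ hb => by simp [Pi.single_eq_of_ne hb])
          (by simp), Pi.single_eq_same, one_smul, Pi.single_apply] at this
      simp only [of_apply, Frame.col, frameL, dgm_one, one_mulVec, Frame.phase]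
      rw [e1, coord_smul, e2, mul_comm, ← mul_assoc, ← exp_add]
      simp [one_apply]
    · refine (hasDeriv_col_t hu hF hk j (D j) le_rfl ⟨h0, h1⟩ i).congr_deriv ?_
      rw [laxL_t_apply hk]
      rfl
  have hμ : IsBoundaryMu u T k (Classical.epsilon (IsBoundaryMu u T k)) :=
    Classical.epsilon_spec ⟨_, hex⟩
  rw [SBdry]
  set μ := Classical.epsilon (IsBoundaryMu u T k) with hμd
  have hP := isUnit_det_P hk
  have key : ∀ j, P k *ᵥ (fun i => μ 0 i j) = D j := fun j => by
    have hw := fun t ht => hasDeriv_undiag hk (v := fun t i => μ t i j) (x := t) (j := j)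
      (θ := fun t : ℝ => (frameL u T).phase k j 0 t) (N := N2 u (lam k) 0 t)
      (fun i => (hμ.2 t ht.1 ht.2 i j).congr_deriv (laxL_t_apply hk (μ t) 0 t i j))
      (hF.hasDeriv_phase_t (k := k) j le_rfl ht)
    have e := eq_propT_mulVec hu (lm := lam k) le_rfl (fun t ht => (hw t ht).congr_deriv (by
      have e0 := hF.eqt (lam k) 0 t (lam_ne_zero hk) le_rfl ht
      simp only [frameL, zero_div, inv_one, dgm_one, Matrix.one_mul, Matrix.mul_one] at e0
      rw [hmat_zero, zero_add] at e0
      rw [e0])) hT'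
    simp only [Frame.phase, frameL, ofReal_zero, mul_zero, zero_add, exp_zero, one_smul] at e
    rw [hD]
    simp only
    have e1 : P k *ᵥ (fun i => μ T i j) = pvec (l j k) := by
      rw [hμ.1, P_mulVec]
      simp [one_apply]
    rw [← mulVec_smul, ← e1, e, ← Psi_zero_x hu _ hT', mulVec_mulVec, nonsing_inv_mul _ hψ, one_mulVec]
  ext i j
  rw [mul_diagonal]
  have := congrFun (congrArg ((P k)⁻¹ *ᵥ ·) (key j)) i
  simp only [mulVec_mulVec, nonsing_inv_mul _ hP, one_mulVec] at this
  rw [this, hD, mulVec_smul, mulVec_mulVec, Pi.smul_apply, smul_eq_mul, mul_comm]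
  congr 1
  have hc : ∀ r, P k r j = pvec (l j k) r := fun r => by
    cases r using fin3 <;> cases j using fin3 <;> simp [P, pvec]
  rw [mul_apply, mulVec, dotProduct]
  simp only [hc]

lemma startMat_eq (hk : NonSpecial k) (n : Fin 18) (i j : Fin 3) : startMat u T n i j k =
    (P k)⁻¹ * (Psi u T (lam k) 0 (startTime T n i j))⁻¹ * P k * diagonal fun r =>
      exp (z r k * startTime T n i j) := by
  rw [startMat, startTime]
  have h0 : (1 : Mat3) = (P k)⁻¹ * (Psi u T (lam k) 0 0)⁻¹ * P k * diagonal fun r =>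
      exp (z r k * (0 : ℝ)) := by
    rw [Psi_zero_zero hu]
    simp [nonsing_inv_mul _ (isUnit_det_P hk)]
  cases contour n i j with
  | γ₁ => exact sBdry_eq hu hk
  | γ₂ => exact h0
  | γ₃ => exact h0

lemma det_startMat (hk : NonSpecial k) (n : Fin 18) (i j : Fin 3) : (startMat u T n i j k).det = 1 := by
  have hP := isUnit_det_P hk
  have h1 : ((P k)⁻¹).det * 1 * (P k).det = 1 := by
    rw [mul_one]
    rw [← det_mul, nonsing_inv_mul _ hP, Matrix.det_one]
  have h2 : ((Psi u T (lam k) 0 (startTime T n i j))⁻¹).det = 1 := by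
    rw [Matrix.det_nonsing_inv, det_Psi hu _ (startTime_mem n i j), Ring.inverse_one]
  rw [startMat_eq hu hk, det_mul, det_mul, det_mul, h2, Matrix.det_diagonal, Fin.prod_univ_three,
    ← exp_add, ← exp_add, ← add_mul, ← add_mul, z_sum hk.1]
  rw [h1, zero_mul, exp_zero, mul_one]

lemma startMat_inv_row (hk : NonSpecial k) (n : Fin 18) (p r : Fin 3) :
    (startMat u T n n#p n#r k)⁻¹ n#p = (exp (-(z n#p k * startTime T n n#p n#r)) /
        χ[l n#p k]) • ((frameL u T).row u T n k r p ᵥ* P k) := by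
  have hP := isUnit_det_P hk
  set s := startTime T n n#p n#r with hsd
  have hψ := isUnit_det_Psi hu (k := k) (startTime_mem n n#p n#r)
  have e : (startMat u T n n#p n#r k)⁻¹ = diagonal (fun r =>
      exp (-(z r k * s))) * (P k)⁻¹ * Psi u T (lam k) 0 s * P k := by
    refine Matrix.inv_eq_left_inv ?_
    rw [startMat_eq hu hk]
    simp only [Matrix.mul_assoc]
    rw [mul_nonsing_inv_cancel_left _ _ hP, mul_nonsing_inv_cancel_left _ _ hψ,
      Matrix.nonsing_inv_mul_cancel_left _ _ hP, Matrix.diagonal_mul_diagonal, ← Matrix.diagonal_one]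
    congr 1
    funext i
    rw [← exp_add, neg_add_cancel, exp_zero]
  have hrow : ∀ X : Mat3, ((P k)⁻¹ * X) n#p = χ[l n#p k]⁻¹ •
      (![l n#p k ^ 2 - 1, l n#p k, 1] ᵥ* X) := fun X => by
    funext j
    have := congrFun (P_inv_mulVec hk fun i => X i j) n#p
    rw [Pi.smul_apply, smul_eq_mul, inv_mul_eq_div]
    refine Eq.trans this ?_
    rw [coord, lev_eq_dot]
    rfl
  rw [e, Matrix.mul_assoc, Matrix.mul_assoc]
  funext j
  rw [diagonal_mul, ← Matrix.mul_assoc, Matrix.mul_assoc, hrow, Frame.row]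
  simp only [frameL, dgm_one, Matrix.one_mul, Pi.smul_apply, smul_eq_mul, vecMul_vecMul]
  ring

lemma norm_deltaMid (h : OrdAt k (lOrd n)) (hs : Idx.Solv u T (inl n) k) :
    ‖deltaMid u T n k‖ = ‖exp (-(z n#0 k * startTime T n n#0 n#1)) /
      χ[l n#0 k] * (frameL u T).dMid u T n k‖ := by
  set B := startMat u T n n#0 n#1 k with hB
  have hdet := det_startMat hu h.ns n n#0 n#1
  have hu' : IsUnit B.det := by rw [hB, hdet]; exact isUnit_one
  set w := B⁻¹ *ᵥ fun i => S u T (inl n) k i n#0 with hw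
  have e : (Matrix.of fun i : Fin 3 => ![S u T (inl n) k i n#0, B i n#1,
      B i n#2]) = B * Matrix.of fun i => ![w i, if i = n#1 then 1 else 0, if i = n#2 then 1 else 0] := by
    have hBw : B *ᵥ w = fun i => S u T (inl n) k i n#0 := by
      rw [hw, mulVec_mulVec, mul_nonsing_inv _ hu', one_mulVec]
    ext i j
    rw [mul_apply]
    fin_cases j
    · exact (congrFun hBw i).symm
    · simp
    · simp
  have hdet3 : ∀ a b c : Fin 3, a ≠ b → a ≠ c → b ≠ c → ‖(Matrix.of fun i : Fin 3 =>
      ![w i, if i = b then 1 else 0, if i = c then 1 else 0]).det‖ = ‖w a‖ := by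
    intro a b c
    fin_cases a <;> fin_cases b <;> fin_cases c <;> simp [det_fin_three]
  have hinj := lOrd_injective n
  rw [deltaMid, e, det_mul, hdet, one_mul, hdet3 n#0 _ _ (hinj.ne (by decide))
    (hinj.ne (by decide)) (hinj.ne (by decide))]
  congr 1
  have hS : (fun i => S u T (inl n) k i n#0) = (P k)⁻¹ *ᵥ jost u n#0 k := by
    rw [S_eq hu h hs]
    funext i
    rw [mul_apply, mulVec, dotProduct]
    simp only [Idx.cmat, Idx.frame, Idx.num, Frame.cmat, of_apply, rk_lOrd, Frame.cvec_zero, frameL]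
    simp
  rw [hw, hS, mulVec_mulVec]
  change (B⁻¹ * (P k)⁻¹) n#0 ⬝ᵥ jost u n#0 k = _
  have e2 : (B⁻¹ * (P k)⁻¹) n#0 = B⁻¹ n#0 ᵥ* (P k)⁻¹ := rfl
  rw [e2, startMat_inv_row hu h.ns n 0 1, smul_vecMul, vecMul_vecMul,
    mul_nonsing_inv _ (isUnit_det_P h.ns), vecMul_one, smul_dotProduct]
  rfl

lemma norm_deltaTop (h : OrdAt k (lOrd n)) (hs : Idx.Solv u T (inl n) k) :
    ‖deltaTop u T n k‖ * ‖(l n#0 k - l n#1 k) * (l n#0 k - l n#2 k) * (l n#1 k - l n#2 k)‖ =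
      ‖exp (-(z n#0 k * startTime T n n#0 n#2)) *
      exp (-(z n#1 k * startTime T n n#1 n#2)) *
      (frameL u T).dTop u T n k‖ := by
  have hP := isUnit_det_P h.ns
  have hc : IsUnit ((Idx.cmat u T (inl n) k)).det :=
    isUnit_iff_ne_zero.2 (det_cmat_ne_zero hu h hs.1 hs.2)
  have e0 : (S u T (inl n) k)⁻¹ n#2 = χ[l n#2 k]⁻¹ • (topRow u (lOrd n) k ᵥ* P k) := by
    have e1 : topRow u (lOrd n) k ᵥ* Idx.cmat u T (inl n) k = χ[l n#2 k] • Pi.single n#2 1 := by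
      funext j
      have := topRow_cvec hu h hs.1 hs.2 (rk n j)
      rw [Pi.smul_apply, Pi.single_apply, smul_eq_mul]
      refine Eq.trans this ?_
      have hj : rk n j = 2 ↔ j = n#2 := ⟨fun e => by rw [← lOrd_rk n j, e], fun e => by rw [e, rk_lOrd]⟩
      simp [hj, Idx.frame, frameL]
    have e2 : topRow u (lOrd n) k = χ[l n#2 k] • ((Idx.cmat u T (inl n) k)⁻¹ n#2) := by
      have := congrArg (· ᵥ* (Idx.cmat u T (inl n) k)⁻¹) e1
      simp only [vecMul_vecMul, mul_nonsing_inv _ hc, vecMul_one,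
        smul_vecMul, Matrix.single_one_vecMul] at this
      exact this
    rw [e2, smul_vecMul, smul_smul, inv_mul_cancel₀ (h.pi_ne_zero 2), one_smul,
      S_eq hu h hs, Matrix.mul_inv_rev, Matrix.nonsing_inv_nonsing_inv _ hP]
    rfl
  have e1 := startMat_inv_row hu h.ns n 0 2
  have e2 := startMat_inv_row hu h.ns n 1 2
  set a := χ[l n#2 k]⁻¹ with ha
  set b := exp (-(z n#0 k * startTime T n n#0 n#2)) with hb
  set c := exp (-(z n#1 k * startTime T n n#1 n#2)) with hcd
  have e3 : (Matrix.of ![(S u T (inl n) k)⁻¹ n#2, (startMat u T n n#0 n#2 k)⁻¹ n#0,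
      (startMat u T n n#1 n#2 k)⁻¹ n#1] : Mat3) =
      diagonal ![a, b / χ[l n#0 k], c / χ[l n#1 k]] *
      (Matrix.of ![topRow u (lOrd n) k, (frameL u T).row u T n k 2 0, (frameL u T).row u T n k 2 1]
        * P k) := by
    rw [e0, e1, e2]
    ext i j
    rw [diagonal_mul]
    fin_cases i <;> rfl
  have hdet : (P k).det ^ 2 = 4 - 27 * lam k ^ 2 := by
    rw [← (isRoots_l h.ns.1).disc]
    simp [P, det_fin_three]
    ring
  have hV : ‖(P k).det‖ = ‖(l n#0 k - l n#1 k) * (l n#0 k - l n#2 k) * (l n#1 k - l n#2 k)‖ := by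
    rw [← sq_eq_sq₀ (norm_nonneg _) (norm_nonneg _), ← norm_pow, ← norm_pow, hdet, h.roots.disc]
  have hne := fun p => h.pi_ne_zero p
  have hr := h.roots
  rw [← hV, deltaTop, e3, det_mul, det_mul, Matrix.det_diagonal, Fin.prod_univ_three, ← norm_mul]
  have e6 : (Matrix.of ![topRow u (lOrd n) k, (frameL u T).row u T n k 2 0,
      (frameL u T).row u T n k 2 1]).det = (frameL u T).dTop u T n k :=
    (triple_product_eq_det _ _ _).symm
  have e5 : (P k).det ^ 2 = -(χ[l n#0 k] * χ[l n#1 k] * χ[l n#2 k]) := by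
    rw [hdet, ← hr.disc, hr.three_sq_zero, hr.three_sq_one, hr.three_sq_two]
    ring
  rw [← norm_neg]
  congr 1
  have h0 := hne 0
  have h1 := hne 1
  have h2 := hne 2
  simp only [cons_val, ha, e6]
  rw [show ∀ w d α β γ : ℂ, -(α⁻¹ * (b / β) * (c / γ) * (w * d) * d) =
    b * c * w * (-d ^ 2 / (β * γ * α)) by intros; ring, e5, neg_neg, div_self (by positivity), mul_one]

end

/-! ### Limits at the sixth roots of unity -/

lemma exists_tendsto_div {f e : ℂ → ℂ} {g : ℂ → ℝ} {A B : Set ℂ} {κ e' : ℂ} {G : ℝ} (hAB : A ⊆ B)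
    (hκ : κ ∉ A) (hf : DifferentiableWithinAt ℂ f B κ) (he : HasDerivAt e e' κ)
    (hg : Tendsto g (𝓝[A] κ) (𝓝 G)) (hb : ∀ᶠ k in 𝓝[A] κ, ‖e k‖ ≤ g k * ‖f k‖)
    (h : e κ = 0 → e' ≠ 0) : ∃ a, Tendsto (fun k => e k / f k) (𝓝[A] κ) (𝓝 a) := by
  have hf' := (hf.mono hAB).hasDerivWithinAt
  have hec := he.continuousAt.continuousWithinAt (s := A)
  rcases (𝓝[A] κ).eq_or_neBot with hbot | hne
  · exact ⟨0, by rw [hbot]; exact tendsto_bot⟩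
  by_cases h0 : f κ = 0
  · by_cases h1 : e κ = 0
    · have sf := (hasDerivWithinAt_iff_tendsto_slope' hκ).1 hf'
      have se := (hasDerivWithinAt_iff_tendsto_slope' hκ).1 he.hasDerivWithinAt
      have hne' : ∀ᶠ k in 𝓝[A] κ, k - κ ≠ 0 :=
        eventually_mem_nhdsWithin.mono fun k hk => sub_ne_zero.2 fun e => hκ (e ▸ hk)
      have hle : ‖e'‖ ≤ G * ‖derivWithin f A κ‖ := by
        refine le_of_tendsto_of_tendsto se.norm (hg.mul sf.norm) ?_
        filter_upwards [hb, hne'] with k hk hk'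
        rw [slope_def_field, slope_def_field, h0, h1, sub_zero, sub_zero, norm_div, norm_div,
          ← mul_div_assoc]
        gcongr
      have hd : derivWithin f A κ ≠ 0 := fun hd => h h1 (by simpa [hd] using hle)
      refine ⟨_, (se.div sf hd).congr' ?_⟩
      filter_upwards [hne'] with k hk'
      rw [Pi.div_apply, slope_def_field, slope_def_field, h0, h1, sub_zero, sub_zero,
        div_div_div_cancel_right₀ hk']
    · have := le_of_tendsto_of_tendsto hec.norm (hg.mul hf'.continuousWithinAt.norm) hb
      simp only [h0, norm_zero, mul_zero] at this
      exact absurd (norm_le_zero_iff.1 this) h1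
  · exact ⟨_, hec.div hf'.continuousWithinAt h0⟩

lemma om_pow_succ_injective {i j : Fin 3} (h : om ^ ((i : ℕ) + 1) = om ^ ((j : ℕ) + 1)) : i = j := by
  rw [pow_succ, pow_succ] at h
  have hp := Complex.isPrimitiveRoot_exp 3 (by norm_num)
  have e : exp (2 * π * I / (3 : ℕ)) = om := by simp [om]
  rw [e] at hp
  exact Fin.ext (hp.pow_inj i.2 j.2 (mul_right_cancel₀ om_ne_zero h))

lemma exists_hasDerivAt_l_sub {i j : Fin 3} (hij : i ≠ j) {κ : ℂ} (hκ : κ ≠ 0) :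
    ∃ e', HasDerivAt (fun k => l i k - l j k) e' κ ∧ (l i κ - l j κ = 0 → e' ≠ 0) := by
  have hs : (sqrt 3 : ℂ) ≠ 0 := by simp
  have hd : ∀ j, HasDerivAt (l j) (1 / (sqrt 3 : ℂ) * (om ^ ((j : ℕ) + 1) * 1 +
      -(om ^ ((j : ℕ) + 1) * 1) / (om ^ ((j : ℕ) + 1) * κ) ^ 2)) κ := fun j => by
    have h1 := (hasDerivAt_id' κ).const_mul (om ^ ((j : ℕ) + 1))
    have h2 := h1.inv (rot_ne_zero j hκ)
    exact ((h1.add h2).const_mul _).congr_of_eventuallyEq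
      (Eventually.of_forall fun y => by simp [l, rot])
  refine ⟨_, (hd i).sub (hd j), fun h0 => ?_⟩
  have hab : om ^ ((i : ℕ) + 1) - om ^ ((j : ℕ) + 1) ≠ 0 :=
    sub_ne_zero.2 fun h => hij (om_pow_succ_injective h)
  have ha := rot_ne_zero i hκ
  have hb := rot_ne_zero j hκ
  simp only [l, rot] at h0 ha hb
  set a := om ^ ((i : ℕ) + 1)
  set b := om ^ ((j : ℕ) + 1)
  have ha0 := left_ne_zero_of_mul ha
  have hb0 := left_ne_zero_of_mul hb
  have h1 : (a - b) * (a * b * κ ^ 2 - 1) = 0 := by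
    field_simp at h0
    linear_combination h0
  have h2 : a * b * κ ^ 2 = 1 := sub_eq_zero.1 ((mul_eq_zero.1 h1).resolve_left hab)
  have e1 : ∀ c d : ℂ, c ≠ 0 → c * d * κ ^ 2 = 1 → -(c * 1) / (c * κ) ^ 2 = -d := fun c d hc h => by
    field_simp
    linear_combination h
  rw [e1 a b ha0 h2, e1 b a hb0 (by rw [← h2]; ring), ← mul_sub]
  refine mul_ne_zero (one_div_ne_zero hs) ?_
  rw [show a * 1 + -b - (b * 1 + -a) = 2 * (a - b) by ring]
  exact mul_ne_zero two_ne_zero hab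

lemma Reg.cases {κ : ℂ} (h : κ ∈ Reg n) (hκ : κ ^ 6 = 1) (hz : ZOrdAt κ n) :
    l n#0 κ ≠ l n#2 κ ∧ (l n#0 κ ≠ l n#1 κ ∨ l n#1 κ ≠ l n#2 κ ∧ ∀ p < 2, contour n n#p n#2 = γ₂) := by
  have hr := (isRoots_l h.1).comp (lOrd_injective n)
  have hsum := hr.sum
  have hpair := hr.pair
  have hprod := hr.prod
  have hd := hr.disc
  obtain ⟨h0, hl, h1, h2⟩ := h
  rw [disc_eq_zero h0 hκ] at hd
  simp only [ne_eq, OfNat.ofNat_ne_zero, not_false_eq_true, pow_eq_zero_iff, mul_eq_zero,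
    sub_eq_zero, or_assoc] at hd
  have z0 := z_eq n#0 h0
  have z1 := z_eq n#1 h0
  have z2 := z_eq n#2 h0
  set a := l n#0 κ
  set b := l n#1 κ
  set c := l n#2 κ
  have hne : a ≠ c := by
    intro e
    have hre := congrArg Complex.re hsum
    simp only [add_re, Complex.zero_re] at hre
    rw [← e] at h2 hre hsum hpair
    have har : a.re = 0 := by linarith
    have e3 : 3 * a ^ 2 = 1 := by linear_combination 2 * a * hsum - hpair
    have := congrArg Complex.re e3
    simp [pow_two, har] at this
    nlinarith [sq_nonneg a.im]
  refine ⟨hne, or_iff_not_imp_left.2 fun e => ?_⟩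
  push Not at e
  refine ⟨fun e' => hne (e.trans e'), fun p hp => ?_⟩
  have hc : c = -2 * a := by rw [← e] at hsum; linear_combination hsum
  have e3 : 3 * a ^ 2 = 1 := by rw [← e, hc] at hpair; linear_combination -hpair
  have ha0 : a ≠ 0 := by rintro h; simp [h] at e3
  have hlam : lam κ = -2 * a / 3 := by
    rw [← hprod, ← e, hc]
    linear_combination (-2 * a / 3) * e3
  have him : a.im = 0 ∧ a.re < 0 := by
    have hle : a.re ≤ c.re := h1.trans h2
    rw [hc] at hle
    simp at hle
    have i1 := congrArg Complex.re e3
    have i2 := congrArg Complex.im e3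
    simp [pow_two] at i1 i2
    have hre : a.re ≠ 0 := fun h => by rw [h] at i1; nlinarith [sq_nonneg a.im]
    exact ⟨by rcases mul_eq_zero.1 (show a.re * a.im = 0 by linarith) with h | h; exacts [absurd h hre, h],
      lt_of_le_of_ne (by linarith) hre⟩
  have hzz : ∀ w : ℂ, w = (a ^ 2 - 2 / 3) / lam κ → w.re < (z n#2 κ).re := by
    intro w hw
    have hdiff : z n#2 κ - w = -(9 / 2) * a := by
      rw [hw, z2, hc, hlam]
      field_simp
      ring
    have := congrArg Complex.re hdiff
    simp at this
    norm_num at this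
    linarith [him.2]
  have hlt : (z n#p κ).re < (z n#2 κ).re := by
    cases p using fin3
    · exact hzz _ z0
    · exact hzz _ (by rw [z1, ← e])
    · exact absurd hp (lt_irrefl _)
  cases hcn : contour n n#p n#2 with
  | γ₁ => exact absurd ((hz p 2 hp).2 hcn) (not_le.2 hlt)
  | γ₂ => rfl
  | γ₃ =>
    rw [contour, if_pos (before_lOrd.2 hp)] at hcn
    split_ifs at hcn

section

include hu

lemma exists_tendsto_cvec {A : Set ℂ} {κ : ℂ} (hA : ∀ k ∈ A, OrdAt k (lOrd n)) (hκ : κ ∈ Reg n)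
    (h6 : κ ^ 6 = 1) (hz : ZOrdAt κ n) {c : ℝ} (hc : 0 < c)
    (hev : ∀ᶠ k in 𝓝[A] κ, Idx.Solv u T (inl n) k ∧ c ≤ ‖deltaMid u T n k‖ ∧
      c ≤ ‖deltaTop u T n k‖) (r : Fin 3) :
    ∃ v, Tendsto (fun k => (frameL u T).cvec u T n k r) (𝓝[A] κ) (𝓝 v) := by
  set F := frameL u T
  have hAR : A ⊆ Reg n := fun k hk => ⟨(hA k hk).ns.1, lam_ne_zero (hA k hk).ns, (hA k hk).le01,
    (hA k hk).le12⟩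
  have hκA : κ ∉ A := fun h => (hA κ h).ns.2.2 h6
  have hA' : ∀ᶠ k in 𝓝[A] κ, OrdAt k (lOrd n) := eventually_mem_nhdsWithin.mono hA
  have hl : ∀ p, Tendsto (l p) (𝓝[A] κ) (𝓝 (l p κ)) := fun p =>
    (diffAt_l p hκ.1).continuousAt.continuousWithinAt
  have hex : ∀ p r : Fin 3, Tendsto (fun k => exp (-(z n#p k *
      startTime T n n#p n#r))) (𝓝[A] κ) (𝓝 (exp (-(z n#p κ *
      startTime T n n#p n#r)))) := fun p r =>
    (((diffAt_z _ hκ.1 hκ.2.1).continuousAt.continuousWithinAt (s := A)).tendsto.mul_const _).neg.cexp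
  have htop := diff_topRow hu hκ
  have hrow := diff_row hu hκ F
  have hcr : ∀ {f g : ℂ → ℂ³}, DifferentiableWithinAt ℂ f (Reg n) κ →
      DifferentiableWithinAt ℂ g (Reg n) κ → Tendsto (fun k => crossProduct (f k) (g k)) (𝓝[A] κ) _ :=
    fun hf hg => ((DifferentiableWithinAt.cross hf hg).mono hAR).continuousWithinAt
  obtain ⟨h02, hcase⟩ := Reg.cases hκ h6 hz
  have hd : ∀ {p r : Fin 3}, p ≠ r → ∃ e', HasDerivAt (fun k => l n#p k - l n#r k) e' κ ∧
      (l n#p κ - l n#r κ = 0 → e' ≠ 0) := fun hpr =>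
    exists_hasDerivAt_l_sub ((lOrd_injective n).ne hpr) hκ.1
  suffices h : ∃ v, Tendsto (fun k => ![jost u n#0 k,
    (χ[l n#1 k] / ((l n#2 k - l n#1 k) * F.dMid u T n k)) •
      crossProduct (F.row u T n k 1 0) (topRow u (lOrd n) k),
    (χ[l n#2 k] / F.dTop u T n k) •
      crossProduct (F.row u T n k 2 0) (F.row u T n k 2 1)] r) (𝓝[A] κ) (𝓝 v) by
    obtain ⟨v, hv⟩ := h
    exact ⟨_, ((hl n#r).mul_const _).cexp.smul hv⟩
  have htopB : ∀ᶠ k in 𝓝[A] κ, OrdAt k (lOrd n) ∧ c * ‖(l n#0 k - l n#1 k) * (l n#0 k - l n#2 k)‖ *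
      ‖l n#2 k - l n#1 k‖ ≤ ‖exp (-(z n#0 k * startTime T n n#0 n#2)) *
        exp (-(z n#1 k * startTime T n n#1 n#2))‖ * ‖F.dTop u T n k‖ := by
    filter_upwards [hev, hA'] with k hk ho
    have h2 := norm_deltaTop hu ho hk.1
    rw [norm_mul, norm_mul _ (F.dTop u T n k)] at h2
    rw [← h2, norm_sub_rev (l n#2 k), mul_assoc]
    exact ⟨ho, mul_le_mul_of_nonneg_right hk.2.2 (by positivity)⟩
  cases r using fin3
  · exact ⟨_, ((diff_jost hu hκ).mono hAR).continuousWithinAt⟩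
  · obtain ⟨e', he', hne⟩ := hd (p := 0) (r := 1) (by decide)
    obtain ⟨a, ha⟩ := exists_tendsto_div hAR hκA (diff_dMid hu hκ F) he'
      (((hex 0 1).norm.div ((((hl n#0).sub (hl n#2)).norm).const_mul c)
        (mul_ne_zero hc.ne' (norm_ne_zero_iff.2 (sub_ne_zero.2 h02))))) (by
      filter_upwards [hev, hA'] with k hk ho
      have h1 := hk.2.1
      rw [norm_deltaMid hu ho hk.1, ho.roots.three_sq_zero, norm_mul, norm_div, norm_mul] at h1
      have n01 := norm_pos_iff.2 (ho.sub_ne_zero (p := 0) (r := 1))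
      have n02 := norm_pos_iff.2 (ho.sub_ne_zero (p := 0) (r := 2))
      rw [Pi.div_apply, div_mul_eq_mul_div, le_div_iff₀ (by positivity)]
      rw [div_mul_eq_mul_div, le_div_iff₀ (by positivity)] at h1
      linarith) hne
    refine ⟨_, (ha.smul (hcr (hrow 1 0) htop)).congr' ?_⟩
    filter_upwards [hA'] with k ho
    have n21 := ho.sub_ne_zero (p := 2) (r := 1)
    simp only [cons_val]
    congr 1
    rw [ho.roots.three_sq_one, ← mul_div_mul_left _ (F.dMid u T n k) n21]
    congr 1
    ring
  · rcases hcase with h01 | ⟨h12, hγ⟩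
    · obtain ⟨e', he', hne⟩ := hd (p := 2) (r := 1) (by decide)
      obtain ⟨a, ha⟩ := exists_tendsto_div hAR hκA (diff_dTop hu hκ F) he'
        (((hex 0 2).mul (hex 1 2)).norm.div ((((hl n#0).sub (hl n#1)).mul
          ((hl n#0).sub (hl n#2))).norm.const_mul c)
        (mul_ne_zero hc.ne' (norm_ne_zero_iff.2 (mul_ne_zero (sub_ne_zero.2 h01)
          (sub_ne_zero.2 h02))))) (by
        filter_upwards [htopB] with k ⟨ho, h⟩
        have := norm_pos_iff.2 (mul_ne_zero (ho.sub_ne_zero (p := 0) (r := 1))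
          (ho.sub_ne_zero (p := 0) (r := 2)))
        rw [Pi.div_apply, div_mul_eq_mul_div, le_div_iff₀ (by positivity)]
        linarith) hne
      refine ⟨_, ((ha.mul ((hl n#2).sub (hl n#0))).smul (hcr (hrow 2 0) (hrow 2 1))).congr' ?_⟩
      filter_upwards [hA'] with k ho
      simp only [cons_val]
      congr 1
      rw [ho.roots.three_sq_two]
      ring
    · have hcross : ∀ k ∈ Reg n, crossProduct (F.row u T n k 2 0) (F.row u T n k 2 1) =
          (l n#0 k - l n#1 k) • pvec (l n#2 k) := fun k hk => by
        have hro : ∀ p < 2, F.row u T n k 2 p = ![l n#p k ^ 2 - 1, l n#p k, 1] := fun p hp => by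
            have hs : startTime T n n#p n#2 = 0 := by rw [startTime, hγ p hp]
            rw [Frame.row, hs, Psi_zero_zero hu]
            simp [F, frameL, dgm_one]
        rw [hro 0 (by decide), hro 1 (by decide)]
        exact ((isRoots_l hk.1).comp (lOrd_injective n)).cross_lev'
      have hpv : DifferentiableWithinAt ℂ (fun k => pvec (l n#2 k)) (Reg n) κ := by
        have h2 := (diffAt_l n#2 hκ.1).differentiableWithinAt (s := Reg n)
        refine differentiableWithinAt_pi.2 fun i => ?_
        cases i using fin3
        exacts [differentiableWithinAt_const _, h2, h2.pow 2]
      have hdt : ∀ k ∈ Reg n, F.dTop u T n k = (l n#0 k - l n#1 k) *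
          (topRow u (lOrd n) k ⬝ᵥ pvec (l n#2 k)) := fun k hk => by
        rw [Frame.dTop, hcross k hk, dotProduct_smul, smul_eq_mul]
      have hE : DifferentiableAt ℂ (fun k => (l n#2 k - l n#0 k) * (l n#2 k - l n#1 k)) κ :=
        ((diffAt_l _ hκ.1).sub (diffAt_l _ hκ.1)).mul ((diffAt_l _ hκ.1).sub (diffAt_l _ hκ.1))
      obtain ⟨a, ha⟩ := exists_tendsto_div hAR hκA
        (DifferentiableWithinAt.dotProduct htop hpv) hE.hasDerivAt
        (((hex 0 2).mul (hex 1 2)).norm.div_const c) (by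
        filter_upwards [htopB, eventually_mem_nhdsWithin] with k ⟨ho, h⟩ hkA
        rw [hdt k (hAR hkA), norm_mul, norm_mul (l n#0 k - l n#1 k)] at h
        rw [div_mul_eq_mul_div, le_div_iff₀ hc, norm_mul, norm_sub_rev _ (l n#0 k)]
        refine le_of_mul_le_mul_left ?_ (norm_pos_iff.2 (ho.sub_ne_zero (p := 0) (r := 1)))
        linarith) (fun h => absurd h (mul_ne_zero (sub_ne_zero.2 h02.symm) (sub_ne_zero.2 h12.symm)))
      refine ⟨_, (ha.smul (hpv.mono hAR).continuousWithinAt.tendsto).congr' ?_⟩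
      filter_upwards [hA', eventually_mem_nhdsWithin] with k ho hkA
      have n01 := ho.sub_ne_zero (p := 0) (r := 1)
      simp only [cons_val]
      rw [ho.roots.three_sq_two, hcross k (hAR hkA), hdt k (hAR hkA), smul_smul, div_mul_eq_mul_div,
        mul_comm _ (l n#0 k - l n#1 k), mul_div_mul_left _ _ n01]

lemma tendsto_nu_of_cvec {m : Idx} {A : Set ℂ} {κ : ℂ} (hA : ∀ k ∈ A, OrdAt k (lOrd m.num))
    (hκ : κ ∈ Reg m.num) (hev : ∀ᶠ k in 𝓝[A] κ, m.Solv u T k) {r : Fin 3}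
    {v : ℂ³} (hv : Tendsto (fun k => (m.frame u T).cvec u T m.num k r) (𝓝[A] κ) (𝓝 v))
    (hx : 0 ≤ x) (ht : t ∈ Ico 0 T) :
    Tendsto (fun k => nu u T m (yFun u x t) t k m.num#r) (𝓝[A] κ) (𝓝 ((Psi u T (lam κ) x t *ᵥ v) 0 *
        exp (-(l m.num#r κ * yFun u x t + z m.num#r κ * t)))) := by
  have hP := fun i j => (diff_Psi hu hκ hx
    (Ico_subset_Icc_self ht) i j).continuousAt.continuousWithinAt (s := A) |>.tendsto
  have hl := (diffAt_l m.num#r hκ.1).continuousAt.continuousWithinAt (s := A)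
  have hz := (diffAt_z m.num#r hκ.1 hκ.2.1).continuousAt.continuousWithinAt (s := A)
  have hm : Tendsto (fun k => (Psi u T (lam k) x t *ᵥ (m.frame u T).cvec u T m.num k r) 0)
      (𝓝[A] κ) (𝓝 ((Psi u T (lam κ) x t *ᵥ v) 0)) := by
    simp only [mulVec, dotProduct]
    exact tendsto_finsetSum _ fun i _ => (hP 0 i).mul (tendsto_pi_nhds.1 hv i)
  refine (hm.mul ((hl.tendsto.mul_const _).add (hz.tendsto.mul_const _)).neg.cexp).congr' ?_
  filter_upwards [hev, eventually_mem_nhdsWithin] with k hk hkA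
  exact (nu_apply hu (hA k hkA) hk hx ht r).symm

end

/-! ### The geometry of the sets `D_n` -/

/-- The cosine of the argument of `ω^j k`. -/
def cosr (j : Fin 3) (k : ℂ) : ℝ := (rot j k).re / ‖k‖

lemma l_re (j : Fin 3) (hk : k ≠ 0) : (l j k).re = scale k / sqrt 3 * cosr j k := by
  have h0 := norm_pos_iff.2 hk
  have h1 : normSq (rot j k) = ‖k‖ ^ 2 := by rw [normSq_eq_norm_sq, norm_rot]
  rw [l, cosr, scale, one_div, one_div, ← Complex.ofReal_inv, Complex.re_ofReal_mul, add_re, inv_re, h1]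
  field_simp

lemma normSq_l (j : Fin 3) (hk : k ≠ 0) :
    normSq (l j k) = ((‖k‖ - ‖k‖⁻¹) ^ 2 + 4 * cosr j k ^ 2) / 3 := by
  have h0 := norm_pos_iff.2 hk
  have h1 : normSq (rot j k) = ‖k‖ ^ 2 := by rw [normSq_eq_norm_sq, norm_rot]
  have h3 : sqrt 3 ^ 2 = 3 := sq_sqrt (by norm_num)
  rw [l, one_div, one_div, ← Complex.ofReal_inv, map_mul, Complex.normSq_ofReal, normSq_apply,
    add_re, Complex.add_im, inv_re, Complex.inv_im, h1, cosr]
  rw [normSq_apply] at h1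
  have e : (sqrt 3)⁻¹ * (sqrt 3)⁻¹ = 1 / 3 := by rw [← mul_inv, ← sq, h3, one_div]
  rw [e]
  field_simp
  linear_combination (‖k‖ ^ 2 - 1) ^ 2 * h1

lemma z_re_sub {i j : Fin 3} (hk : k ≠ 0) (hl : lam k ≠ 0) : ∃ a > 0,
    (z j k).re - (z i k).re = a * ((cosr j k - cosr i k) *
      ((‖k‖ - ‖k‖⁻¹) ^ 2 - 4 * cosr i k * cosr j k)) := by
  have hne : ∀ j, l j k ≠ 0 := fun j h => hl (by rw [← (isRoots_l hk).cubic j, h]; ring)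
  have e : ∀ j, (z j k).re = (l j k).re / normSq (l j k) + (1 / (3 * lam k)).re := fun j => by
    have : z j k = (l j k)⁻¹ + 1 / (3 * lam k) := by
      have h := hne j
      rw [z_eq j hk]
      field_simp
      linear_combination 3 * (isRoots_l hk).cubic j
    rw [this, add_re, inv_re]
  have hi := Complex.normSq_pos.2 (hne i)
  have hj := Complex.normSq_pos.2 (hne j)
  have hs : 0 < scale k := by rw [scale]; have := norm_pos_iff.2 hk; positivity
  rw [e, e, l_re _ hk, l_re _ hk]
  refine ⟨scale k / sqrt 3 / 3 / (normSq (l i k) * normSq (l j k)), by positivity, ?_⟩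
  rw [add_sub_add_right_eq_sub, div_sub_div _ _ hj.ne' hi.ne', normSq_l i hk, normSq_l j hk,
    div_mul_eq_mul_div, mul_comm (_ / 3 : ℝ) (_ / 3 : ℝ)]
  ring

lemma z_re_lt_iff {i j : Fin 3} (hk : k ≠ 0) (hl : lam k ≠ 0) (h : cosr i k < cosr j k) :
    ((z i k).re < (z j k).re ↔ 4 * cosr i k * cosr j k < (‖k‖ - ‖k‖⁻¹) ^ 2) ∧
    ((z j k).re < (z i k).re ↔ (‖k‖ - ‖k‖⁻¹) ^ 2 < 4 * cosr i k * cosr j k) := by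
  obtain ⟨a, ha, e⟩ := z_re_sub (i := i) (j := j) hk hl
  rw [← mul_assoc] at e
  have hb : 0 < a * (cosr j k - cosr i k) := mul_pos ha (sub_pos.2 h)
  constructor
  · rw [← sub_pos, e, mul_pos_iff_of_pos_left hb, sub_pos]
  · rw [← sub_pos, ← neg_sub, e, ← mul_neg, mul_pos_iff_of_pos_left hb, neg_sub, sub_pos]

lemma Dset.nonSpecial (hk : k ∈ Dset n) : NonSpecial k := by
  obtain ⟨h1, h2, h3, -⟩ := hk
  have h0 : k ≠ 0 := by rintro rfl; simp [l, rot] at h1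
  refine ⟨h0, fun h => ?_, fun h => ?_⟩
  · have e : k ^ 3 + 1 / k ^ 3 = 0 := by
      field_simp
      linear_combination h
    simp only [z, e] at h3
    simp at h3
  · have := ((isRoots_l h0).comp (lOrd_injective n)).disc
    rw [disc_eq_zero h0 h] at this
    simp only [ne_eq, OfNat.ofNat_ne_zero, not_false_eq_true, pow_eq_zero_iff, mul_eq_zero,
      sub_eq_zero, or_assoc] at this
    rcases this with e | e | e
    · exact h1.ne (by rw [e])
    · exact (h1.trans h2).ne (by rw [e])
    · exact h2.ne (by rw [e])

lemma Dset.ordAt (hk : k ∈ Dset n) : OrdAt k (lOrd n) :=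
  ⟨Dset.nonSpecial hk, lOrd_injective n, hk.1.le, hk.2.1.le⟩

lemma zOrd_cases (n : Fin 18) : (n.val < 6 ∧ zOrd n = lOrd n) ∨
    (¬ n.val < 6 ∧ zOrd n = ![n#1, n#0, n#2]) ∨
    (¬ n.val < 6 ∧ zOrd n 2 ≠ n#2 ∧ zOrd n = ![n#0, n#2, n#1]) := by
  revert n; decide

lemma Before.z_lt (hk : k ∈ Dset n) {i j : Fin 3} (h : Before (zOrd n) i j) :
    (z i k).re < (z j k).re := by
  obtain ⟨p, r, hpr, rfl, rfl⟩ := h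
  obtain ⟨-, -, h3, h4⟩ := hk
  cases p using fin3 <;> cases r using fin3 <;>
    first | exact absurd hpr (by decide) | assumption | exact h3.trans h4

lemma before_or (n : Fin 18) (p r : Fin 3) (h : p ≠ r) :
    Before (zOrd n) n#p n#r ∨ Before (zOrd n) n#r n#p := by
  unfold Before
  revert n p r; decide

lemma Dset.zOrdAt (hk : k ∈ Dset n) : ZOrdAt k n := by
  intro p r hpr
  rw [contour, if_pos (before_lOrd.2 hpr)]
  split_ifs with h
  · exact ⟨fun _ => (Before.z_lt hk h).le, fun h => by simp at h⟩
  · exact ⟨fun h => by simp at h, fun _ => (Before.z_lt hk ((before_or n p r hpr.ne).resolve_left h)).le⟩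

/-- The orientation of the permutation `lOrd n`. -/
def orient (n : Fin 18) : ℝ := if n#2 = n#1 + 1 then -1 else 1

lemma orient_sq (n : Fin 18) : orient n ^ 2 = 1 := by
  rw [orient]; split_ifs <;> norm_num

lemma rot_lOrd_re (n : Fin 18) (k : ℂ) : (rot n#0 k).re = -(rot n#1 k).re / 2 -
      sqrt 3 / 2 * (orient n * (rot n#1 k).im) ∧
    (rot n#2 k).re = -(rot n#1 k).re / 2 + sqrt 3 / 2 * (orient n * (rot n#1 k).im) := by
  have key : ∀ n : Fin 18, (n#2 = n#1 + 1 ∧ n#0 = n#1 + 2) ∨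
      (n#2 ≠ n#1 + 1 ∧ n#2 = n#1 + 2 ∧ n#0 = n#1 + 1) := by decide
  have hr : ∀ j, rot (j + 1) k = om * rot j k ∧ rot (j + 2) k = om ^ 2 * rot j k := fun j => by
    have h3 := om_pow_three
    cases j using fin3
    · exact ⟨by rw [rot_zero]; exact (rot_one k).trans (by ring), by
        rw [rot_zero]; exact (rot_two k).trans (by linear_combination -k * h3)⟩
    · exact ⟨by rw [rot_one]; exact (rot_two k).trans (by linear_combination -k * h3), by
        rw [rot_one]; exact (rot_zero k).trans (by linear_combination -om * k * h3)⟩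
    · exact ⟨by rw [rot_two]; exact rot_zero k, by rw [rot_two]; exact rot_one k⟩
  have h1 : ∀ w : ℂ, (om * w).re = -w.re / 2 - sqrt 3 / 2 * w.im := fun w => by
    rw [om_eq, Complex.mul_re]; ring
  have h2 : ∀ w : ℂ, (om ^ 2 * w).re = -w.re / 2 + sqrt 3 / 2 * w.im := fun w => by
    rw [show om ^ 2 = -1 - om by linear_combination om_sq_add, sub_mul, sub_re, h1]
    simp; ring
  rw [orient]
  rcases key n with ⟨a, b⟩ | ⟨a, b, c⟩
  · rw [if_pos a, a, b, (hr _).1, (hr _).2, h1, h2]; constructor <;> ring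
  · rw [if_neg a, b, c, (hr _).1, (hr _).2, h1, h2]; constructor <;> ring

/-- Polar coordinates adapted to `D_n`. -/
def par (n : Fin 18) (r α : ℝ) : ℂ :=
  om ^ (2 - (n#1 : ℕ)) * (r * (sin α + I * (orient n * cos α)))

lemma continuous_par (n : Fin 18) : Continuous fun p : ℝ × ℝ => par n p.1 p.2 := by
  unfold par; fun_prop

lemma om_pow_mul_pow (j : Fin 3) : om ^ ((j : ℕ) + 1) * om ^ (2 - (j : ℕ)) = 1 := by
  rw [← pow_add, show (j : ℕ) + 1 + (2 - (j : ℕ)) = 3 by omega, om_pow_three]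

lemma rot_par (n : Fin 18) (r α : ℝ) : rot n#1 (par n r α) = r * (sin α + I * (orient n * cos α)) := by
  rw [rot, par, ← mul_assoc, om_pow_mul_pow, one_mul]

lemma rot_par_re (n : Fin 18) (r α : ℝ) : (rot n#1 (par n r α)).re = r * sin α := by
  rw [rot_par, Complex.re_ofReal_mul]; simp [-Complex.ofReal_sin, -Complex.ofReal_cos]

lemma rot_par_im (n : Fin 18) (r α : ℝ) : (rot n#1 (par n r α)).im = r * (orient n * cos α) := by
  rw [rot_par, Complex.im_ofReal_mul]; simp [-Complex.ofReal_sin, -Complex.ofReal_cos]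

lemma norm_par (n : Fin 18) {r : ℝ} (hr : 0 ≤ r) (α : ℝ) : ‖par n r α‖ = r := by
  rw [← norm_rot n#1, ← sq_eq_sq₀ (norm_nonneg _) hr, ← normSq_eq_norm_sq,
    normSq_apply, rot_par_re, rot_par_im]
  linear_combination r ^ 2 * cos α ^ 2 * orient_sq n + r ^ 2 * Real.sin_sq_add_cos_sq α

lemma cosr_par (n : Fin 18) {r : ℝ} (hr : 0 < r) (α : ℝ) :
    cosr n#0 (par n r α) = -sin α / 2 - sqrt 3 / 2 * cos α ∧
    cosr n#1 (par n r α) = sin α ∧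
    cosr n#2 (par n r α) = -sin α / 2 + sqrt 3 / 2 * cos α := by
  obtain ⟨h1, h2⟩ := rot_lOrd_re n (par n r α)
  have ho := orient_sq n
  simp only [cosr, h1, h2, rot_par_re, rot_par_im, norm_par n hr.le]
  have hr0 := hr.ne'
  refine ⟨?_, ?_, ?_⟩
  · field_simp
    linear_combination -sqrt 3 * cos α * ho
  · field_simp
  · field_simp
    linear_combination sqrt 3 * cos α * ho

/-- The bound on `(‖k‖ - 1 / ‖k‖)²` at the angle `α`. -/
def barrier (α : ℝ) : ℝ := 4 * sin α * (-sin α / 2 + sqrt 3 / 2 * cos α)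

lemma barrier_eq (α : ℝ) : barrier α = 2 * sin (2 * α + π / 6) - 1 := by
  rw [barrier, Real.sin_add, sin_pi_div_six, Real.cos_pi_div_six, Real.sin_two_mul, Real.cos_two_mul]
  linear_combination -2 * Real.sin_sq_add_cos_sq α

/-- The range of the angle in the coordinates `par`. -/
abbrev sector : Set ℝ := Ioo (-(π / 6)) (π / 6)

lemma strictMonoOn_barrier : StrictMonoOn barrier sector := by
  intro α hα β hβ h
  have hp := pi_pos
  rw [barrier_eq, barrier_eq]
  have := Real.strictMonoOn_sin (a := 2 * α + π / 6) (b := 2 * β + π / 6)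
    ⟨by linarith [hα.1], by linarith [hα.2]⟩ ⟨by linarith [hβ.1], by linarith [hβ.2]⟩ (by linarith)
  linarith

lemma neg_mem_sector {α : ℝ} (h : α ∈ sector) : -α ∈ sector := ⟨by linarith [h.2], by linarith [h.1]⟩

lemma abs_mem_sector {α : ℝ} (h : α ∈ sector) : |α| ∈ sector := by
  rcases abs_choice α with e | e <;> rw [e]
  exacts [h, neg_mem_sector h]

lemma barrier_zero : barrier 0 = 0 := by simp [barrier]

/-- The conditions defining `D_n` in the coordinates `par`, with `s = (‖k‖ - 1 / ‖k‖)²`. -/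
def ParCond (n : Fin 18) (s α : ℝ) : Prop :=
  if n.val < 6 then barrier |α| < s
  else if zOrd n 2 = n#2 then s < barrier (-α) else s < barrier α

lemma par_mem_Dset_iff (n : Fin 18) {r α : ℝ} (hr : 0 < r) (hα : α ∈ sector) :
    par n r α ∈ Dset n ↔ ParCond n ((r - r⁻¹) ^ 2) α := by
  obtain ⟨c0, c1, c2⟩ := cosr_par n hr α
  have hN := norm_par n hr.le α
  set K := par n r α
  have hk : K ≠ 0 := norm_pos_iff.1 (by rwa [hN])
  have hp := pi_pos
  have hcos : cos (π / 6) < cos α := by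
    rw [← Real.cos_abs α]
    exact Real.cos_lt_cos_of_nonneg_of_le_pi (abs_nonneg _) (by linarith) (abs_lt.2 hα)
  have hs : ∀ β ∈ sector, sin β < 1 / 2 := fun β hβ => sin_pi_div_six ▸
    Real.sin_lt_sin_of_lt_of_le_pi_div_two (by linarith [hβ.1]) (by linarith) hβ.2
  have hs1 := hs α hα
  have hs2 := hs _ (neg_mem_sector hα)
  rw [sin_neg] at hs2
  rw [Real.cos_pi_div_six] at hcos
  have h3 : sqrt 3 ^ 2 = 3 := sq_sqrt (by norm_num)
  have h3p : 0 < sqrt 3 := by positivity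
  have hmul : 3 / 2 < sqrt 3 * cos α := by nlinarith
  have h01 : cosr n#0 K < cosr n#1 K := by rw [c0, c1]; linarith
  have h12 : cosr n#1 K < cosr n#2 K := by rw [c1, c2]; linarith
  have hneg : cosr n#0 K < 0 := by rw [c0]; linarith
  have hpos : 0 < cosr n#2 K := by rw [c2]; linarith
  have b1 : 4 * cosr n#1 K * cosr n#2 K = barrier α := by rw [c1, c2, barrier]
  have b0 : 4 * cosr n#0 K * cosr n#1 K = barrier (-α) := by
    rw [c0, c1, barrier, sin_neg, Real.cos_neg]; ring
  have b2 : 4 * cosr n#0 K * cosr n#2 K < (r - r⁻¹) ^ 2 := by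
    nlinarith [mul_neg_of_neg_of_pos hneg hpos, sq_nonneg (r - r⁻¹)]
  have hsc : 0 < scale K / sqrt 3 := by rw [scale, hN]; positivity
  have hl : ∀ {i j}, cosr i K < cosr j K → (l i K).re < (l j K).re := fun h => by
    rw [l_re _ hk, l_re _ hk]; exact mul_lt_mul_of_pos_left h hsc
  have key : lam K ≠ 0 → (K ∈ Dset n ↔ ParCond n ((r - r⁻¹) ^ 2) α) := fun h0 => by
    have z0 := z_re_lt_iff hk h0 h01
    have z1 := z_re_lt_iff hk h0 h12
    have z2 := (z_re_lt_iff hk h0 (h01.trans h12)).1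
    rw [hN] at z0 z1 z2
    rw [b0] at z0
    rw [b1] at z1
    refine (and_iff_right (hl h01)).trans ((and_iff_right (hl h12)).trans ?_)
    rw [ParCond]
    rcases zOrd_cases n with ⟨hn, e⟩ | ⟨hn, e⟩ | ⟨hn, hn', e⟩
    · rw [if_pos hn, e, z0.1, z1.1, abs, strictMonoOn_barrier.monotoneOn.map_sup hα
        (neg_mem_sector hα), sup_lt_iff, and_comm]
    · rw [if_neg hn, if_pos (by rw [e]; rfl), e]
      exact (and_iff_left (z2.2 b2)).trans z0.2
    · rw [if_neg hn, if_neg hn', e]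
      exact (and_iff_right (z2.2 b2)).trans z1.2
  refine ⟨fun h => (key (lam_ne_zero (Dset.nonSpecial h))).1 h, fun h => (key ?_).2 h⟩
  have hz : ∀ p, l n#p K ≠ 0 := fun p h0 => by
    have hn := normSq_l n#p hk
    rw [h0, map_zero, hN] at hn
    have a := sq_nonneg (r - r⁻¹)
    have b := sq_nonneg (cosr n#p K)
    have hc : cosr n#p K = 0 := pow_eq_zero_iff two_ne_zero |>.1 (by linarith)
    have hsin : sin α = 0 := by
      cases p using fin3
      exacts [absurd hc hneg.ne, c1 ▸ hc, absurd hc hpos.ne']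
    rw [ParCond, show (r - r⁻¹) ^ 2 = 0 by linarith] at h
    rcases abs_choice α with e | e <;> simp [barrier, hsin, e] at h
  rw [← ((isRoots_l hk).comp (lOrd_injective n)).prod]
  exact mul_ne_zero (mul_ne_zero (hz 0) (hz 1)) (hz 2)

lemma exists_par (h : k ∈ Dset n) : ∃ α ∈ sector, par n ‖k‖ α = k := by
  have hk := (Dset.nonSpecial h).1
  have hn := norm_pos_iff.2 hk
  obtain ⟨h1, h2, -⟩ := h
  have hsc : 0 < scale k / sqrt 3 := by rw [scale]; positivity
  rw [l_re _ hk, l_re _ hk, mul_lt_mul_iff_right₀ hsc, cosr, cosr, div_lt_div_iff_of_pos_right hn]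
    at h1 h2
  obtain ⟨e0, e2⟩ := rot_lOrd_re n k
  have hns : (rot n#1 k).re ^ 2 + (rot n#1 k).im ^ 2 = ‖k‖ ^ 2 := by
    rw [← norm_rot n#1, ← normSq_eq_norm_sq, normSq_apply]; ring
  have hrot : rot n#1 k = ⟨(rot n#1 k).re, (rot n#1 k).im⟩ := rfl
  have ho := orient_sq n
  have h3 : sqrt 3 ^ 2 = 3 := sq_sqrt (by norm_num)
  have h3p : 0 < sqrt 3 := by positivity
  set a := (rot n#1 k).re
  set b := (rot n#1 k).im
  set w := orient n * b with hw
  have hns' : a ^ 2 + w ^ 2 = ‖k‖ ^ 2 := by rw [hw]; linear_combination hns + b ^ 2 * ho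
  have hwp : 3 * |a| < sqrt 3 * w := by
    rcases abs_cases a with ⟨e, -⟩ | ⟨e, -⟩ <;> rw [e] <;> linarith
  have hw0 : 0 < w := by
    by_contra hc
    nlinarith [abs_nonneg a]
  have ha4 : 2 * |a| < ‖k‖ := by
    have : (3 * |a|) ^ 2 < (sqrt 3 * w) ^ 2 := by
      have := abs_nonneg a
      gcongr
    rw [mul_pow, mul_pow, h3, sq_abs] at this
    refine lt_of_pow_lt_pow_left₀ 2 hn.le ?_
    rw [mul_pow, sq_abs]
    linarith
  have hab := abs_lt.1 (show |a / ‖k‖| < 1 / 2 by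
    rw [abs_div, abs_of_pos hn, div_lt_iff₀ hn]; linarith)
  have hs6 := sin_pi_div_six
  have hp := pi_pos
  refine ⟨Real.arcsin (a / ‖k‖), ⟨?_, ?_⟩, ?_⟩
  · rw [Real.lt_arcsin_iff_sin_lt' ⟨by linarith, by linarith⟩, sin_neg, hs6]; exact hab.1
  · rw [Real.arcsin_lt_iff_lt_sin' ⟨by linarith, by linarith⟩, hs6]; exact hab.2
  · have hc : cos (Real.arcsin (a / ‖k‖)) = w / ‖k‖ := by
      rw [Real.cos_arcsin, Real.sqrt_eq_iff_mul_self_eq_of_pos (by positivity)]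
      field_simp
      linarith
    have hob : orient n * w = b := by rw [hw]; linear_combination b * ho
    have hn0 : (‖k‖ : ℂ) ≠ 0 := by exact_mod_cast hn.ne'
    have e1 : (‖k‖ : ℂ) * (((a / ‖k‖ : ℝ) : ℂ) + I * (orient n * ((w / ‖k‖ : ℝ) : ℂ))) = rot n#1 k := by
      rw [hrot, Complex.mk_eq_add_mul_I, ← hob]
      push_cast
      field_simp
    rw [par, hc, Real.sin_arcsin (by linarith [hab.1]) (by linarith [hab.2]), e1, rot, ← mul_assoc,
      mul_comm (om ^ (2 - _)), om_pow_mul_pow, one_mul]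

lemma sq_sub_inv_le {a b : ℝ} (ha : 0 < a) (hab : a ≤ b) (hb : b ≤ 1) :
    (b - b⁻¹) ^ 2 ≤ (a - a⁻¹) ^ 2 := by
  have h1 : b⁻¹ ≤ a⁻¹ := by gcongr
  have h2 : 1 ≤ b⁻¹ := (one_le_inv₀ (ha.trans_le hab)).2 hb
  nlinarith

lemma sq_sub_inv_le' {a b : ℝ} (hb : 1 ≤ b) (hab : b ≤ a) : (b - b⁻¹) ^ 2 ≤ (a - a⁻¹) ^ 2 := by
  have h0 : 0 < b := by linarith
  have := sq_sub_inv_le (inv_pos.2 (h0.trans_le hab)) (by gcongr : a⁻¹ ≤ b⁻¹) (inv_le_one_of_one_le₀ hb)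
  rw [inv_inv, inv_inv] at this
  linarith

lemma exists_path_inl {R : ℝ} (hR : 2 < R) (hk : k ∈ E R (inl n)) :
    ∃ U ⊆ E R (inl n), IsPreconnected U ∧ k ∈ U ∧ ∃ K ∈ closure U, K ^ 6 = -1 := by
  obtain ⟨hD, hr1, hr2⟩ := hk
  have hk0 := norm_pos_iff.2 (Dset.nonSpecial hD).1
  obtain ⟨α, hα, hpar⟩ := exists_par hD
  set r := ‖k‖
  rw [← hpar, par_mem_Dset_iff n hk0 hα] at hD
  have hR1 : 1 / R < 1 := by rw [div_lt_one (by linarith)]; linarith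
  set ρ : ℝ → ℝ := fun τ => (1 - τ) * r + τ * 1 with hρ
  set A : ℝ → ℝ := fun τ => (1 - τ) * α + τ * 0 with hA
  have h0I : (0 : ℝ) ∈ sector := by constructor <;> linarith [pi_pos]
  have hρm : ∀ τ ∈ Icc (0 : ℝ) 1, ρ τ ∈ Ioo (1 / R) R ∧ (ρ τ - (ρ τ)⁻¹) ^ 2 ≤ (r - r⁻¹) ^ 2 :=
    fun τ hτ => by
    refine ⟨convex_Ioo _ _ ⟨hr1, hr2⟩ ⟨hR1, by linarith⟩ (sub_nonneg.2 hτ.2) hτ.1 (by ring), ?_⟩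
    rcases le_total r 1 with h | h
    · exact sq_sub_inv_le hk0 (by simp only [hρ]; nlinarith [hτ.1]) (by simp only [hρ]; nlinarith [hτ.2])
    · exact sq_sub_inv_le' (by simp only [hρ]; nlinarith [hτ.2]) (by simp only [hρ]; nlinarith [hτ.1])
  have hAm : ∀ τ ∈ Icc (0 : ℝ) 1, A τ ∈ sector := fun τ hτ =>
    convex_Ioo _ _ hα h0I (sub_nonneg.2 hτ.2) hτ.1 (by ring)
  suffices h : ∃ f g : ℝ → ℝ × ℝ, Continuous f ∧ Continuous g ∧ f 0 = (r, α) ∧ f 1 = g 0 ∧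
      g 1 = (1, 0) ∧ (∀ τ ∈ Icc (0 : ℝ) 1, par n (f τ).1 (f τ).2 ∈ E R (inl n)) ∧
      ∀ τ ∈ Ico (0 : ℝ) 1, par n (g τ).1 (g τ).2 ∈ E R (inl n) by
    obtain ⟨f, g, hf, hg, f0, fg, g1, hfE, hgE⟩ := h
    have hf' := (continuous_par n).comp hf
    have hg' := (continuous_par n).comp hg
    refine ⟨(fun τ => par n (f τ).1 (f τ).2) '' Icc 0 1 ∪ (fun τ => par n (g τ).1 (g τ).2) '' Ico 0 1,
      union_subset (image_subset_iff.2 hfE) (image_subset_iff.2 hgE), ?_,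
      Or.inl ⟨0, by simp, by simp only [f0, hpar]⟩, par n 1 0, ?_, ?_⟩
    · refine IsPreconnected.union (par n (f 1).1 (f 1).2) ⟨1, by simp, rfl⟩ ⟨0, by simp, ?_⟩
        (isPreconnected_Icc.image _ hf'.continuousOn) (isPreconnected_Ico.image _ hg'.continuousOn)
      simp only [fg]
    · refine closure_mono subset_union_right (image_closure_subset_closure_image hg' ⟨1, ?_, ?_⟩)
      · rw [closure_Ico (by norm_num)]; simp
      · simp [g1]
    · rw [par, mul_pow, ← pow_mul, mul_comm _ 6, show 6 * (2 - (n#1 : ℕ)) =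
        3 * (2 * (2 - (n#1 : ℕ))) by ring, pow_mul, om_pow_three, one_pow]
      have ho : (orient n : ℂ) ^ 2 = 1 := by exact_mod_cast orient_sq n
      simp only [Real.sin_zero, Real.cos_zero, ofReal_zero, ofReal_one, zero_add,
        one_mul, mul_one, mul_pow]
      rw [show 6 = 2 * 3 by norm_num, pow_mul, pow_mul, Complex.I_sq, ho]
      norm_num
  have hE : ∀ a b, a ∈ Ioo (1 / R) R → b ∈ sector → ParCond n ((a - a⁻¹) ^ 2) b →
      par n a b ∈ E R (inl n) := fun a b h hb hc => by
    have h0 : 0 < a := (by positivity : 0 < 1 / R).trans h.1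
    exact ⟨(par_mem_Dset_iff n h0 hb).2 hc, by rw [mem_ofPred_eq, norm_par n h0.le]; exact h⟩
  have hρc : Continuous ρ := by simp only [hρ]; fun_prop
  have hAc : Continuous A := by simp only [hA]; fun_prop
  have hz := barrier_zero
  have mono := strictMonoOn_barrier.monotoneOn
  by_cases hn : n.val < 6
  · simp only [ParCond, if_pos hn] at hD hE
    have hs : 0 < (r - r⁻¹) ^ 2 := by
      linarith [mono h0I (abs_mem_sector hα) (abs_nonneg α)]
    refine ⟨fun τ => (r, A τ), fun τ => (ρ τ, 0), by fun_prop, by fun_prop, by simp [hA],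
      by simp [hρ, hA], by simp [hρ], fun τ hτ => hE _ _ ⟨hr1, hr2⟩ (hAm τ hτ) ?_, fun τ hτ => ?_⟩
    · refine (mono (abs_mem_sector (hAm τ hτ)) (abs_mem_sector hα) ?_).trans_lt hD
      simp only [hA, mul_zero, add_zero]
      rw [abs_mul, abs_of_nonneg (sub_nonneg.2 hτ.2)]
      nlinarith [abs_nonneg α, hτ.1]
    · obtain ⟨h1, -⟩ := hρm τ (Ico_subset_Icc_self hτ)
      refine hE _ _ h1 h0I ?_
      have h0 : 0 < ρ τ := (by positivity : 0 < 1 / R).trans h1.1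
      have hne : ρ τ - (ρ τ)⁻¹ ≠ 0 := by
        intro h
        have h' : ρ τ ^ 2 = 1 := by field_simp at h; linarith
        have h1' : ρ τ = 1 := by nlinarith
        have hr1 : (1 - τ) * (r - 1) = 0 := by simp only [hρ] at h1'; linarith
        rcases mul_eq_zero.1 hr1 with h | h
        · linarith [hτ.2]
        · rw [sub_eq_zero.1 h] at hs; norm_num at hs
      rw [abs_zero, hz]
      positivity
  · simp only [ParCond, if_neg hn] at hD hE
    refine ⟨fun τ => (ρ τ, α), fun τ => (1, A τ), by fun_prop, by fun_prop, by simp [hρ],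
      by simp [hρ, hA], by simp [hA], fun τ hτ => ?_, fun τ hτ => ?_⟩
    · refine hE _ _ (hρm τ hτ).1 hα ?_
      split_ifs at hD ⊢ <;> exact (hρm τ hτ).2.trans_lt hD
    · have hAτ := hAm τ (Ico_subset_Icc_self hτ)
      refine hE _ _ ⟨hR1, by linarith⟩ hAτ ?_
      have hpos : ∀ {b c}, b ∈ sector → c ∈ sector → c = (1 - τ) * b → 0 < barrier b →
          0 < barrier c := fun hb hc e h => by
        rw [← hz, strictMonoOn_barrier.lt_iff_lt h0I hb] at h
        rw [← hz, strictMonoOn_barrier.lt_iff_lt h0I hc, e]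
        exact mul_pos (sub_pos.2 hτ.2) h
      have h0 := sq_nonneg (r - r⁻¹)
      simp only [inv_one, sub_self, ne_eq, OfNat.ofNat_ne_zero, not_false_eq_true, zero_pow]
      split_ifs at hD ⊢
      exacts [hpos (neg_mem_sector hα) (neg_mem_sector hAτ) (by simp [hA]) (h0.trans_lt hD),
        hpos hα hAτ (by simp [hA]) (h0.trans_lt hD)]

lemma exists_path_inr {R : ℝ} (hR : 2 < R) {n : Fin 6} (hk : k ∈ E R (inr n)) :
    ∃ U ⊆ E R (inr n), IsPreconnected U ∧ k ∈ U ∧ ∀ m : ℝ, ∃ w ∈ U, m ≤ scale w := by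
  obtain ⟨hD, hr⟩ := hk
  have hk0 := norm_pos_iff.2 (Dset.nonSpecial hD).1
  obtain ⟨α, hα, hpar⟩ := exists_par hD
  have hR1 : 1 / R < 1 := by rw [div_lt_one (by linarith)]; linarith
  have hn : (emb n).val < 6 := n.2
  rw [mem_ofPred_eq] at hr
  set r := ‖k‖
  rw [← hpar, par_mem_Dset_iff _ hk0 hα] at hD
  simp only [ParCond, if_pos hn] at hD
  have hE : ∀ a, 0 < a → (a < 1 / R ∨ R < a) → (r - r⁻¹) ^ 2 ≤ (a - a⁻¹) ^ 2 →
      par (emb n) a α ∈ E R (inr n) := fun a h0 h1 h2 => by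
    refine ⟨(par_mem_Dset_iff _ h0 hα).2 ?_, by rw [mem_ofPred_eq, norm_par _ h0.le]; exact h1⟩
    rw [ParCond, if_pos hn]
    exact hD.trans_le h2
  have hc : Continuous fun a => par (emb n) a α := (continuous_par _).comp (by fun_prop :
    Continuous fun a : ℝ => (a, α))
  rcases hr with hr | hr
  · refine ⟨(fun a => par (emb n) a α) '' Ioc 0 r, image_subset_iff.2 fun a ha =>
      hE a ha.1 (Or.inl (ha.2.trans_lt hr)) (sq_sub_inv_le ha.1 ha.2 (hr.trans hR1).le),
      isPreconnected_Ioc.image _ hc.continuousOn, ⟨r, ⟨hk0, le_rfl⟩, hpar⟩, fun m => ?_⟩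
    have h0 : 0 < min r (|m| + 1)⁻¹ := lt_min hk0 (by positivity)
    refine ⟨_, ⟨min r (|m| + 1)⁻¹, ⟨h0, min_le_left _ _⟩, rfl⟩, ?_⟩
    rw [scale, norm_par _ h0.le]
    have : |m| + 1 ≤ (min r (|m| + 1)⁻¹)⁻¹ := le_inv_of_le_inv₀ (by positivity) (min_le_right _ _)
    linarith [le_abs_self m]
  · refine ⟨(fun a => par (emb n) a α) '' Ici r, image_subset_iff.2 fun a ha =>
      hE a (hk0.trans_le ha) (Or.inr (hr.trans_le ha)) (sq_sub_inv_le' (by linarith) ha),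
      isPreconnected_Ici.image _ hc.continuousOn, ⟨r, self_mem_Ici, hpar⟩, fun m => ?_⟩
    have h0 : 0 < max r m := lt_max_of_lt_left hk0
    refine ⟨_, ⟨max r m, mem_Ici.2 (le_max_left _ _), rfl⟩, ?_⟩
    rw [scale, norm_par _ h0.le]
    linarith [le_max_right r m, inv_pos.2 h0]

/-! ### The sets `E_n` and their closures -/

lemma E_subset {R : ℝ} {n : Idx} (hk : k ∈ E R n) : k ∈ Dset n.num := by
  cases n <;> exact hk.1

lemma contAt_l (j : Fin 3) (hk : k ≠ 0) : ContinuousAt (l j) k := (diffAt_l j hk).continuousAt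

lemma isOpen_E (R : ℝ) (n : Idx) : IsOpen (E R n) := by
  have hD : ∀ n, IsOpen (Dset n) := fun n => isOpen_iff_mem_nhds.2 fun k hk => by
    have hs := Dset.nonSpecial hk
    have hl := fun j => continuous_re.continuousAt.comp (contAt_l j hs.1)
    have hz := fun j => continuous_re.continuousAt.comp (diffAt_z j hs.1 (lam_ne_zero hs)).continuousAt
    filter_upwards [(hl n#0).eventually_lt (hl n#1) hk.1, (hl n#1).eventually_lt (hl n#2) hk.2.1,
      (hz (zOrd n 0)).eventually_lt (hz (zOrd n 1)) hk.2.2.1,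
      (hz (zOrd n 1)).eventually_lt (hz (zOrd n 2)) hk.2.2.2] with w h1 h2 h3 h4
    exact ⟨h1, h2, h3, h4⟩
  cases n with
  | inl n => exact (hD n).inter ((isOpen_lt continuous_const continuous_norm).inter
      (isOpen_lt continuous_norm continuous_const))
  | inr n => exact (hD (emb n)).inter ((isOpen_lt continuous_norm continuous_const).union
      (isOpen_lt continuous_const continuous_norm))

lemma norm_of_closure_inl {R : ℝ} (hk : k ∈ closure (E R (inl n))) : 1 / R ≤ ‖k‖ ∧ ‖k‖ ≤ R :=
  closure_minimal (t := {k | 1 / R ≤ ‖k‖ ∧ ‖k‖ ≤ R}) (fun _ h => ⟨h.2.1.le, h.2.2.le⟩)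
    ((isClosed_le continuous_const continuous_norm).inter
      (isClosed_le continuous_norm continuous_const)) hk

lemma norm_of_closure_inr {R : ℝ} {n : Fin 6} (hk : k ∈ closure (E R (inr n))) : ‖k‖ ≤ 1 / R ∨ R ≤ ‖k‖ :=
  closure_minimal (t := {k | ‖k‖ ≤ 1 / R ∨ R ≤ ‖k‖}) (fun _ h => h.2.imp le_of_lt le_of_lt)
    ((isClosed_le continuous_norm continuous_const).union
      (isClosed_le continuous_const continuous_norm)) hk

lemma norm_ne_one_of_closure_inr {R : ℝ} (hR : 2 < R) {n : Fin 6} (hk : k ∈ closure (E R (inr n))) : ‖k‖ ≠ 1 := fun h => by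
  have : 1 / R < 1 := by rw [div_lt_one (by linarith)]; linarith
  rcases norm_of_closure_inr hk with h' | h' <;> linarith

section

variable {R : ℝ} {n : Idx} (hk : k ∈ closure (E R n)) (h0 : k ≠ 0)

include hk h0

lemma le_of_closure : (l n.num#0 k).re ≤ (l n.num#1 k).re ∧ (l n.num#1 k).re ≤ (l n.num#2 k).re := by
  have : (𝓝[E R n] k).NeBot := mem_closure_iff_nhdsWithin_neBot.1 hk
  have hl := fun j => (continuous_re.continuousAt.comp (contAt_l j h0)).continuousWithinAt
    (s := E R n) |>.tendsto
  exact ⟨le_of_tendsto_of_tendsto (hl _) (hl _) (eventually_mem_nhdsWithin.mono fun w hw =>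
      (E_subset hw).1.le), le_of_tendsto_of_tendsto (hl _) (hl _)
      (eventually_mem_nhdsWithin.mono fun w hw => (E_subset hw).2.1.le)⟩

lemma mem_Reg_of_closure (hl : lam k ≠ 0) : k ∈ Reg n.num := ⟨h0, hl, le_of_closure hk h0⟩

lemma zOrdAt_of_closure (hl : lam k ≠ 0) : ZOrdAt k n.num := by
  have : (𝓝[E R n] k).NeBot := mem_closure_iff_nhdsWithin_neBot.1 hk
  have hz := fun j => (continuous_re.continuousAt.comp
    (diffAt_z j h0 hl).continuousAt).continuousWithinAt (s := E R n) |>.tendsto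
  exact fun p r hpr => ⟨fun h => le_of_tendsto_of_tendsto (hz _) (hz _)
      (eventually_mem_nhdsWithin.mono fun w hw => (Dset.zOrdAt (E_subset hw) p r hpr).1 h),
    fun h => le_of_tendsto_of_tendsto (hz _) (hz _)
      (eventually_mem_nhdsWithin.mono fun w hw => (Dset.zOrdAt (E_subset hw) p r hpr).2 h)⟩

omit h0 in
lemma ordAt_of_closure (hns : NonSpecial k) : OrdAt k (lOrd n.num) :=
  ⟨hns, lOrd_injective _, (le_of_closure hk hns.1).1, (le_of_closure hk hns.1).2⟩

lemma l_eq_of_pow_six (h6 : k ^ 6 = -1) (p : Fin 3) : l n.num#p k = ![-1, 0, 1] p := by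
  obtain ⟨h1, h2⟩ := le_of_closure hk h0
  have hr := (isRoots_l h0).comp (lOrd_injective n.num)
  rw [lam_eq_zero h0 h6] at hr
  have hs := hr.sum
  have hp := hr.pair
  have hc : ∀ p, l n.num#p k = 0 ∨ l n.num#p k = 1 ∨ l n.num#p k = -1 := fun p => by
    have := (isRoots_l h0).cubic n.num#p
    rw [lam_eq_zero h0 h6] at this
    exact or_iff_not_imp_left.2 fun h => mul_self_eq_one_iff.1 (mul_left_cancel₀ h (by linear_combination this))
  have key : l n.num#0 k = -1 ∧ l n.num#1 k = 0 ∧ l n.num#2 k = 1 := by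
    revert h1 h2 hs hp
    rcases hc 0 with a | a | a <;> rcases hc 1 with b | b | b <;> rcases hc 2 with c | c | c <;>
      norm_num [a, b, c]
  cases p using fin3
  exacts [key.1, key.2.1, key.2.2]

end

section

variable {R : ℝ}

include hu

lemma exists_nearId_of_pow_six {κ : ℂ} (hκ : κ ∈ closure (E R (inl n)))
    (h6 : κ ^ 6 = -1) : ∃ η : ℂ → ℝ, (∀ᶠ k in 𝓝[E R (inl n)] κ, OrdAt k (lOrd n) ∧
      (frameL u T).NearId u T n k (η k)) ∧ Tendsto η (𝓝[E R (inl n)] κ) (𝓝 0) := by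
  have h0 : κ ≠ 0 := by rintro rfl; norm_num at h6
  obtain ⟨K, -, hK⟩ := exists_near_L hu
  have hl := l_eq_of_pow_six hκ h0 h6
  set ε : ℂ → ℝ := fun k => ∑ p, ‖l n#p k - ![-1, 0, 1] p‖ + ‖lam k‖ with hε
  have hε0 : Tendsto ε (𝓝[E R (inl n)] κ) (𝓝 0) := by
    have h1 : ContinuousAt ε κ := by
      refine ContinuousAt.add (tendsto_finsetSum _ fun p _ => ?_) (analyticAt_lam h0).continuousAt.norm
      exact ((contAt_l _ h0).sub continuousAt_const).norm
    have h2 : ε κ = 0 := by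
      simp only [hε, lam_eq_zero h0 h6, norm_zero, add_zero]
      exact Finset.sum_eq_zero fun p _ => by rw [norm_eq_zero, sub_eq_zero]; exact hl p
    rw [← h2]
    exact h1.continuousWithinAt
  refine ⟨fun k => K * ε k, ?_, by simpa using hε0.const_mul K⟩
  filter_upwards [eventually_mem_nhdsWithin,
    (hε0.eventually_lt_const (show (0 : ℝ) < 1 / 8 by norm_num))] with k hk hk'
  refine ⟨Dset.ordAt hk.1, fun r d C hC => hK ⟨Dset.ordAt hk.1, Dset.zOrdAt hk.1, fun p => ?_, ?_, hk'.le⟩ hC⟩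
  · have := le_sum_three (c := fun p => ‖l n#p k - ![-1, 0, 1] p‖) (fun _ => norm_nonneg _) p
    simp only [hε] at *
    linarith [norm_nonneg (lam k)]
  · have := sum_nonneg (s := Finset.univ) fun (p : Fin 3) _ =>
      norm_nonneg (l n#p k - ![-1, 0, 1] p)
    simp only [hε] at *
    linarith

lemma exists_nearId_of_scale {n : Fin 6} {fl : Filter ℂ} (hE : ∀ᶠ k in fl, k ∈ E R (inr n))
    (hs : Tendsto scale fl atTop) : ∃ η : ℂ → ℝ, (∀ᶠ k in fl, OrdAt k (lOrd (emb n)) ∧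
      (frameR u T).NearId u T (emb n) k (η k)) ∧ Tendsto η fl (𝓝 0) := by
  obtain ⟨m, -, hm⟩ := exists_rBound hu
  refine ⟨fun k => (145 + T) * m / scale k, ?_, tendsto_const_nhds.div_atTop hs⟩
  filter_upwards [hE, hs.eventually_ge_atTop 4] with k hk h4
  refine ⟨Dset.ordAt hk.1, fun r d C hC B hB x t hx ht p => ?_⟩
  have := near_R_of_bound hu hm (Dset.ordAt hk.1) h4 hB hC (fun p hp => ⟨contour_emb hp,
    (Dset.zOrdAt hk.1 p r hp).1 (contour_emb hp)⟩) hx ht p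
  rwa [mul_div_right_comm] at this

lemma mem_sing_iff {n : Idx} (hk : k ∈ closure (E R n)) (hns : NonSpecial k) :
    k ∈ sing u T R n ↔ ¬ n.Solv u T k := by
  have ho := ordAt_of_closure hk hns
  cases n with
  | inl n =>
    rw [← solvable_iff hu (n := n) ho]
    exact ⟨fun h => h.elim (fun h => h.2.2) fun h => absurd h.2.1 hns.2.2, fun h => Or.inl ⟨hk, hns, h⟩⟩
  | inr n =>
    rw [← tSolvable_iff hu (n := n) ho]
    exact ⟨fun h => h.2.2, fun h => ⟨hk, hns, h⟩⟩

lemma eventually_notMem_sing (hR : 2 < R) (n : Idx) (hk : k ∈ E R n) :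
    ∀ᶠ k' in 𝓝[≠] k, k' ∉ sing u T R n := by
  have hsub : E R n ⊆ Reg n.num := fun w hw =>
    mem_Reg_of_closure (subset_closure hw) (Dset.nonSpecial (E_subset hw)).1
      (lam_ne_zero (Dset.nonSpecial (E_subset hw)))
  set f := fun k => (n.frame u T).dMid u T n.num k * (n.frame u T).dTop u T n.num k with hf
  have han : AnalyticOnNhd ℂ f (E R n) := DifferentiableOn.analyticOnNhd (fun w hw =>
    ((diff_dMid hu (hsub hw) _).mul (diff_dTop hu (hsub hw) _)).mono hsub)
    (isOpen_E R n)
  by_contra hc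
  rw [not_eventually] at hc
  have hfr : ∃ᶠ w in 𝓝[≠] k, f w = 0 := by
    refine (hc.and_eventually (mem_nhdsWithin_of_mem_nhds ((isOpen_E R n).mem_nhds hk))).mono ?_
    rintro w ⟨hw, hwE⟩
    rw [not_not, mem_sing_iff hu (subset_closure hwE) (Dset.nonSpecial (E_subset hwE))] at hw
    by_contra h
    exact hw (mul_ne_zero_iff.1 h)
  have hno : ∀ U ⊆ E R n, IsPreconnected U → k ∈ U → ∀ w ∈ U, ¬ n.Solv u T w :=
    fun U hU hp hkU w hw hs => mul_ne_zero hs.1 hs.2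
      ((han.mono hU).eqOn_zero_of_preconnected_of_frequently_eq_zero hp hkU hfr hw)
  cases n with
  | inl n =>
    obtain ⟨U, hU, hp, hkU, κ, hκ, h6⟩ := exists_path_inl hR hk
    obtain ⟨η, h1, h2⟩ := exists_nearId_of_pow_six hu (closure_mono hU hκ) h6
    have : (𝓝[U] κ).NeBot := mem_closure_iff_nhdsWithin_neBot.1 hκ
    obtain ⟨w, hs, hw⟩ := (((tendsto_nu_of_nearId hu (n := inl n) h1 h2).1.filter_mono
      (nhdsWithin_mono κ hU)).and eventually_mem_nhdsWithin).exists
    exact hno U hU hp hkU w hw hs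
  | inr n =>
    obtain ⟨U, hU, hp, hkU, hm⟩ := exists_path_inr hR hk
    obtain ⟨η, h1, h2⟩ := exists_nearId_of_scale hu (R := R) (n := n)
      (fl := comap scale atTop ⊓ 𝓟 (E R (inr n))) (eventually_inf_principal.2 (by simp))
      (tendsto_comap.mono_left inf_le_left)
    have := (tendsto_nu_of_nearId hu (n := inr n) h1 h2).1
    rw [eventually_inf_principal, eventually_comap, eventually_atTop] at this
    obtain ⟨m, hm'⟩ := this
    obtain ⟨w, hw, hmw⟩ := hm m
    exact hno U hU hp hkU w hw (hm' _ hmw w rfl (hU hw))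

lemma contOn_S (n : Idx) :
    ContinuousOn (S u T n) {k | k ∈ closure (E R n) ∧ NonSpecial k ∧ k ∉ sing u T R n} := by
  set A := {k | k ∈ closure (E R n) ∧ NonSpecial k ∧ k ∉ sing u T R n}
  have ho : ∀ {k}, k ∈ A → OrdAt k (lOrd n.num) ∧ n.Solv u T k ∧ k ∈ Reg n.num := fun {k} h =>
    ⟨ordAt_of_closure h.1 h.2.1, not_not.1 fun hc => h.2.2 ((mem_sing_iff hu h.1 h.2.1).2 hc),
      mem_Reg_of_closure h.1 h.2.1.1 (lam_ne_zero h.2.1)⟩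
  have e : ∀ k ∈ A, S u T n k =
      Matrix.of fun i j => coord (l i k) ((n.frame u T).cvec u T n.num k (rk n.num j)) := fun k h => by
    rw [S_eq hu (ho h).1 (ho h).2.1]
    ext i j
    exact congrFun (P_inv_mulVec h.2.1 fun i => n.cmat u T k i j) i
  refine ContinuousOn.congr (fun k hk => ?_) e
  obtain ⟨h1, h2, h3⟩ := ho hk
  refine tendsto_pi_nhds.2 fun i => tendsto_pi_nhds.2 fun j => ?_
  have hc := fun a => tendsto_pi_nhds.1 ((diff_cvec hu h3 h1.ns _ h2.1 h2.2
    (rk n.num j)).mono fun w hw => (ho hw).2.2).continuousWithinAt.tendsto a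
  have hl := (contAt_l i h1.ns.1).continuousWithinAt (s := A) |>.tendsto
  simp only [of_apply, coord, lev]
  exact ((((hl.pow 2).sub_const 1).mul (hc 0)).add (hl.mul (hc 1)) |>.add (hc 2)).div
    (((hl.pow 2).const_mul 3).sub_const 1)
    ((isRoots_l h1.ns.1).three_sq_ne_zero (disc_ne_zero h1.ns) i)

variable (hx : 0 ≤ x) (ht : t ∈ Ico 0 T)

include hx ht

lemma analyticOnNhd_nu (n : Idx) : AnalyticOnNhd ℂ (nu u T n (yFun u x t) t) (E R n \ sing u T R n) := by
  have hcl := fun {k} (hk : k ∈ E R n) => subset_closure (s := E R n) hk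
  have hns := fun {k} (hk : k ∈ E R n) => Dset.nonSpecial (E_subset hk)
  have hreg : ∀ {k}, k ∈ E R n → k ∈ Reg n.num := fun hk =>
    mem_Reg_of_closure (hcl hk) (hns hk).1 (lam_ne_zero (hns hk))
  have hnhds : ∀ {k}, k ∈ E R n → Reg n.num ∈ 𝓝 k := fun hk =>
    mem_of_superset ((isOpen_E R n).mem_nhds hk) fun _ => hreg
  have hS : ∀ {k}, k ∈ E R n → (k ∉ sing u T R n ↔ n.Solv u T k) := fun {k} hk => by
    rw [mem_sing_iff hu (hcl hk) (hns hk), not_not]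
  have hopen : IsOpen (E R n \ sing u T R n) := isOpen_iff_mem_nhds.2 fun k hk => by
    have hM := ((diff_dMid hu (hreg hk.1) (n.frame u T)).differentiableAt (hnhds hk.1)).continuousAt
    have hD := ((diff_dTop hu (hreg hk.1) (n.frame u T)).differentiableAt (hnhds hk.1)).continuousAt
    have hs := (hS hk.1).1 hk.2
    filter_upwards [(isOpen_E R n).mem_nhds hk.1, hM.eventually_ne hs.1, hD.eventually_ne hs.2]
      with w hw h1 h2
    exact ⟨hw, (hS hw).2 ⟨h1, h2⟩⟩
  refine DifferentiableOn.analyticOnNhd (fun k hk => ?_) hopen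
  refine differentiableWithinAt_pi.2 fun j => ?_
  rw [← lOrd_rk n.num j]
  set p := rk n.num j
  have hs := (hS hk.1).1 hk.2
  have hc := fun a => differentiableAt_pi.1 ((diff_cvec hu (hreg hk.1) (hns hk.1) _
    hs.1 hs.2 p).differentiableAt (hnhds hk.1)) a
  have hP := fun a => diff_Psi hu (hreg hk.1) hx (Ico_subset_Icc_self ht) 0 a
  have hl := diffAt_l n.num#p (hns hk.1).1
  have hz := diffAt_z n.num#p (hns hk.1).1 (lam_ne_zero (hns hk.1))
  have hd : DifferentiableAt ℂ (fun k => (Psi u T (lam k) x t *ᵥ (n.frame u T).cvec u T n.num k p) 0 *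
      exp (-(l n.num#p k * yFun u x t + z n.num#p k * t))) k := by
    simp only [mulVec, dotProduct, sum_univ_three]
    exact ((((hP 0).mul (hc 0)).add ((hP 1).mul (hc 1))).add ((hP 2).mul (hc 2))).mul
      ((hl.mul_const _).add (hz.mul_const _)).neg.cexp
  have e : ∀ w ∈ E R n \ sing u T R n, _ := fun w hw => nu_apply hu
    (ordAt_of_closure (hcl hw.1) (hns hw.1)) ((hS hw.1).1 hw.2) hx ht p
  exact hd.differentiableWithinAt.congr e (e k hk)

lemma tendsto_nu_of_nonSpecial {n : Idx} (hk : k ∈ closure (E R n)) (hns : NonSpecial k)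
    (hs : k ∉ sing u T R n) : Tendsto (nu u T n (yFun u x t) t) (𝓝[E R n \ sing u T R n] k)
      (𝓝 (nu u T n (yFun u x t) t k)) := by
  rw [mem_sing_iff hu hk hns, not_not] at hs
  have ho := ordAt_of_closure hk hns
  have hr := mem_Reg_of_closure hk hns.1 (lam_ne_zero hns)
  have hA : ∀ w ∈ E R n \ sing u T R n, OrdAt w (lOrd n.num) := fun w hw => Dset.ordAt (E_subset hw.1)
  refine tendsto_pi_nhds.2 fun j => ?_
  rw [← lOrd_rk n.num j, nu_apply hu ho hs hx ht]
  refine tendsto_nu_of_cvec hu hA hr ?_ ?_ hx ht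
  · filter_upwards [eventually_mem_nhdsWithin] with w hw
    exact not_not.1 fun hc => hw.2 ((mem_sing_iff hu (subset_closure hw.1) (hA w hw).ns).2 hc)
  · exact ((diff_cvec hu hr hns _ hs.1 hs.2 _).mono fun w hw => ⟨(hA w hw).ns.1,
      lam_ne_zero (hA w hw).ns, (hA w hw).le01, (hA w hw).le12⟩).continuousWithinAt

lemma exists_tendsto_nu_of_nearId {n : Idx} {fl : Filter ℂ} {η : ℂ → ℝ}
    (hN : ∀ᶠ k in fl, OrdAt k (lOrd n.num) ∧ (n.frame u T).NearId u T n.num k (η k))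
    (hη : Tendsto η fl (𝓝 0)) (hl : ∀ p, ∃ a, Tendsto (fun k => l n.num#p k *
      ((n.frame u T).Y x t - yFun u x t)) fl (𝓝 a)) :
    ∃ v, Tendsto (nu u T n (yFun u x t) t) fl (𝓝 v) := by
  choose a ha using hl
  refine ⟨fun j => ((n.frame u T).ρ x t : ℂ)⁻¹ * exp (a (rk n.num j)), tendsto_pi_nhds.2 fun j => ?_⟩
  have := (tendsto_nu_of_nearId hu hN hη).2 x t hx ht _ _ (ha (rk n.num j))
  rwa [lOrd_rk] at this

lemma exists_tendsto_nu_of_scale {n : Fin 6} {fl : Filter ℂ}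
    (hE : ∀ᶠ k in fl, k ∈ E R (inr n)) (hs : Tendsto scale fl atTop) :
    ∃ v, Tendsto (nu u T (inr n) (yFun u x t) t) fl (𝓝 v) := by
  obtain ⟨η, h1, h2⟩ := exists_nearId_of_scale hu hE hs
  refine exists_tendsto_nu_of_nearId hu hx ht (n := inr n) h1 h2 fun p => ⟨0, ?_⟩
  simpa [Idx.frame, frameR] using tendsto_const_nhds

lemma exists_tendsto_nu (hR : 2 < R) {n : Idx} (hk : k ∈ closure (E R n)) (hs : k ∉ sing u T R n) :
    ∃ v, Tendsto (nu u T n (yFun u x t) t) (𝓝[E R n \ sing u T R n] k) (𝓝 v) := by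
  by_cases hns : NonSpecial k
  · exact ⟨_, tendsto_nu_of_nonSpecial hu hx ht hk hns hs⟩
  suffices h : ∃ v, Tendsto (nu u T n (yFun u x t) t) (𝓝[E R n] k) (𝓝 v) from
    h.imp fun v hv => hv.mono_left (nhdsWithin_mono _ sdiff_subset)
  have h6 : k ≠ 0 → k ^ 6 = -1 ∨ k ^ 6 = 1 := fun h0 => by
    by_contra hc
    push Not at hc
    exact hns ⟨h0, hc.1, hc.2⟩
  cases n with
  | inl n =>
    have h0 : k ≠ 0 := norm_pos_iff.1 (lt_of_lt_of_le (by apply one_div_pos.2; linarith)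
      (norm_of_closure_inl hk).1)
    rcases h6 h0 with h | h
    · obtain ⟨η, h1, h2⟩ := exists_nearId_of_pow_six hu hk h
      exact exists_tendsto_nu_of_nearId hu hx ht (n := inl n) h1 h2 fun p =>
        ⟨_, ((contAt_l _ h0).continuousWithinAt.tendsto.mul_const _)⟩
    · have hl : lam k ≠ 0 := fun hl => by
        have := disc_eq_zero h0 h
        norm_num [hl] at this
      have hr : k ∈ Reg n := mem_Reg_of_closure (n := inl n) hk h0 hl
      have hA : ∀ w ∈ E R (inl n), OrdAt w (lOrd n) := fun w hw => Dset.ordAt hw.1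
      obtain ⟨c, hc, hev⟩ : ∃ c : ℝ, 0 < c ∧ ∀ᶠ w in 𝓝[E R (inl n)] k, Solvable u T n w ∧
          c ≤ ‖deltaMid u T n w‖ ∧ c ≤ ‖deltaTop u T n w‖ := by
        by_contra hc
        exact hs (Or.inr ⟨hk, h, hc⟩)
      have hev' : ∀ᶠ w in 𝓝[E R (inl n)] k, Idx.Solv u T (inl n) w ∧
          c ≤ ‖deltaMid u T n w‖ ∧ c ≤ ‖deltaTop u T n w‖ := by
        filter_upwards [hev, eventually_mem_nhdsWithin] with w hw hwE
        exact ⟨(solvable_iff hu (hA w hwE)).1 hw.1, hw.2⟩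
      choose v hv using exists_tendsto_cvec hu hA hr h (zOrdAt_of_closure (n := inl n) hk h0 hl) hc hev'
      have hj := fun j => tendsto_nu_of_cvec hu (m := inl n) hA hr
        (hev'.mono fun w hw => hw.1) (hv (rk n j)) hx ht
      simp only [Idx.num, lOrd_rk] at hj
      exact ⟨_, tendsto_pi_nhds.2 hj⟩
  | inr n =>
    have h0 : k = 0 := by
      by_contra h0
      refine norm_ne_one_of_closure_inr hR hk ((pow_eq_one_iff_of_nonneg (norm_nonneg k)
        (n := 6) (by norm_num)).1 ?_)
      rw [← norm_pow]
      rcases h6 h0 with h | h <;> simp [h]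
    subst h0
    refine exists_tendsto_nu_of_scale hu hx ht eventually_mem_nhdsWithin ?_
    have h1 : Tendsto (fun k : ℂ => ‖k‖⁻¹) (𝓝[≠] 0) atTop := by
      simpa only [norm_inv] using tendsto_norm_inv_nhdsNE_zero_atTop (α := ℂ)
    refine tendsto_atTop_mono (f := fun k : ℂ => ‖k‖⁻¹) (fun k => ?_) (h1.mono_left
      (nhdsWithin_mono _ fun w hw => (Dset.nonSpecial (E_subset hw)).1))
    rw [scale]
    linarith [norm_nonneg k]

lemma exists_tendsto_nu_infty (n : Idx) :
    ∃ v, Tendsto (nu u T n (yFun u x t) t) (cocompact ℂ ⊓ 𝓟 (E R n \ sing u T R n)) (𝓝 v) := by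
  have hE : ∀ᶠ k in cocompact ℂ ⊓ 𝓟 (E R n \ sing u T R n), k ∈ E R n :=
    eventually_inf_principal.2 (Eventually.of_forall fun _ h => h.1)
  have hno : Tendsto norm (cocompact ℂ ⊓ 𝓟 (E R n \ sing u T R n)) atTop :=
    (tendsto_norm_cocompact_atTop (E := ℂ)).mono_left inf_le_left
  cases n with
  | inl n =>
    refine ⟨0, ?_⟩
    have : cocompact ℂ ⊓ 𝓟 (E R (inl n) \ sing u T R (inl n)) = ⊥ := by
      rw [← eventually_false_iff_eq_bot]
      filter_upwards [hE, hno.eventually_ge_atTop R] with k hk h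
      exact absurd hk.2.2 (not_lt.2 h)
    rw [this]
    exact tendsto_bot
  | inr n =>
    refine exists_tendsto_nu_of_scale hu hx ht hE (tendsto_atTop_mono (fun k => ?_) hno)
    rw [scale]
    linarith [inv_nonneg.2 (norm_nonneg k)]

lemma exists_extension (hR : 2 < R) (n : Idx) : ∃ ext : OnePoint ℂ → ℂ³,
    (∀ k ∈ closure (E R n), NonSpecial k → k ∉ sing u T R n →
      ext (k : OnePoint ℂ) = nu u T n (yFun u x t) t k) ∧
    ContinuousOn ext (closure ((fun k : ℂ => (k : OnePoint ℂ)) '' E R n) \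
      (fun k : ℂ => (k : OnePoint ℂ)) '' sing u T R n) := by
  set c : ℂ → OnePoint ℂ := fun k => (k : OnePoint ℂ)
  set G := E R n \ sing u T R n with hG
  set f : OnePoint ℂ → ℂ³ := fun p => p.elim 0 (nu u T n (yFun u x t) t)
  have hcl : closure (E R n) ⊆ closure G := by
    refine closure_minimal (fun k hk => ?_) isClosed_closure
    rw [mem_closure_iff_nhdsWithin_neBot]
    have h : ∀ᶠ w in 𝓝[≠] k, w ∈ G := (eventually_notMem_sing hu hR n hk).and
      (mem_nhdsWithin_of_mem_nhds ((isOpen_E R n).mem_nhds hk)) |>.mono fun w hw => ⟨hw.2, hw.1⟩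
    exact (NormedField.nhdsNE_neBot k).mono (le_inf nhdsWithin_le_nhds (le_principal_iff.2 h))
  have hemb := (OnePoint.isOpenEmbedding_coe (X := ℂ)).isEmbedding
  have hnh : ∀ k : ℂ, 𝓝[c '' G] (c k) = map c (𝓝[G] k) := fun k => (hemb.map_nhdsWithin_eq G k).symm
  have hmem : ∀ {k : ℂ} {s : Set ℂ}, c k ∈ closure (c '' s) ↔ k ∈ closure s := fun {k s} => by
    rw [hemb.closure_eq_preimage_closure_image]; rfl
  refine ⟨extendFrom (c '' G) f, fun k hk hns hs => ?_, continuousOn_extendFrom ?_ ?_⟩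
  · refine extendFrom_eq (hmem.2 (hcl hk)) ?_
    rw [hnh, tendsto_map'_iff]
    exact tendsto_nu_of_nonSpecial hu hx ht hk hns hs
  · refine sdiff_subset.trans (closure_minimal ?_ isClosed_closure)
    rintro _ ⟨k, hk, rfl⟩
    exact hmem.2 (hcl (subset_closure hk))
  · rintro p ⟨hp, hps⟩
    induction p using OnePoint.rec with
    | infty =>
      obtain ⟨v, hv⟩ := exists_tendsto_nu_infty hu hx ht (R := R) n
      refine ⟨v, ?_⟩
      have hrange : range c ∈ 𝓝[c '' G] OnePoint.infty :=
        mem_of_superset self_mem_nhdsWithin (image_subset_range c G)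
      rw [← map_comap_of_mem hrange, tendsto_map'_iff, nhdsWithin, comap_inf, comap_principal,
        preimage_image_eq G OnePoint.coe_injective]
      have := OnePoint.comap_coe_nhds_infty (X := ℂ)
      rw [coclosedCompact_eq_cocompact] at this
      rw [this]
      exact hv
    | coe k =>
      obtain ⟨v, hv⟩ := exists_tendsto_nu hu hx ht hR (hmem.1 hp) fun h => hps ⟨k, h, rfl⟩
      refine ⟨v, ?_⟩
      change Tendsto f (𝓝[c '' G] (c k)) _
      rw [hnh, tendsto_map'_iff]
      exact hv

end

end DegasperisProcesi

end

open DegasperisProcesi in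
theorem mainTheorem2 (u : ℝ → ℝ → ℝ) (T : ℝ) (hT : 0 < T) (hu : IsHalfLineSolution u T)
    (R : ℝ) (hR : 2 < R) :
    (∀ n : Idx,
      (∀ k ∈ E R n, ∀ᶠ k' in 𝓝[≠] k, k' ∉ sing u T R n) ∧
      ContinuousOn (S u T n) {k | k ∈ closure (E R n) ∧ NonSpecial k ∧ k ∉ sing u T R n} ∧
      ∀ y t : ℝ, (y, t) ∈ FΩ u T →
        AnalyticOnNhd ℂ (nu u T n y t) (E R n \ sing u T R n) ∧
        ∃ ext : OnePoint ℂ → Fin 3 → ℂ,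
          (∀ k ∈ closure (E R n), NonSpecial k → k ∉ sing u T R n →
            ext (k : OnePoint ℂ) = nu u T n y t k) ∧
          ContinuousOn ext (closure ((fun k : ℂ => (k : OnePoint ℂ)) '' E R n) \
            (fun k : ℂ => (k : OnePoint ℂ)) '' sing u T R n) ∧
          ∀ U : Set (OnePoint ℂ), IsOpen U →
            (fun k : ℂ => (k : OnePoint ℂ)) '' sing u T R n ⊆ U →
            ∃ C : ℝ, ∀ p ∈ closure ((fun k : ℂ => (k : OnePoint ℂ)) '' E R n) \ U,
              ‖ext p‖ ≤ C) ∧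
    (∀ m n : Idx, ∀ k ∈ closure (E R n) ∩ closure (E R m), NonSpecial k →
      k ∉ sing u T R n → k ∉ sing u T R m → ∀ y t : ℝ, (y, t) ∈ FΩ u T →
        nu u T n y t k = nu u T m y t k ᵥ* J u T m n y t k ∧
        J u T m n y t k * J u T n m y t k = 1) := by
  have : Fact (0 < T) := ⟨hT⟩
  refine ⟨fun n => ⟨fun k hk => eventually_notMem_sing hu hR n hk, contOn_S hu n, ?_⟩, ?_⟩
  · rintro y t ⟨⟨x, s⟩, ⟨hx, ht⟩, he⟩
    obtain ⟨rfl, rfl⟩ := Prod.mk.inj he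
    obtain ⟨ext, h1, h2⟩ := exists_extension hu hx ht hR n
    refine ⟨analyticOnNhd_nu hu hx ht n, ext, h1, h2, fun U hU hs => ?_⟩
    obtain ⟨C, hC⟩ := (isClosed_closure.sdiff hU).isCompact.bddAbove_image
      (h2.mono (Set.sdiff_subset_sdiff_right hs)).norm
    exact ⟨C, fun p hp => hC ⟨p, hp, rfl⟩⟩
  · rintro m n k ⟨hn, hm⟩ hns sn sm y t ⟨⟨x, s⟩, ⟨hx, ht⟩, he⟩
    obtain ⟨rfl, rfl⟩ := Prod.mk.inj he
    exact jump_relation hu (ordAt_of_closure hm hns) (ordAt_of_closure hn hns)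
      (not_not.1 fun h => sm ((mem_sing_iff hu hm hns).2 h))
      (not_not.1 fun h => sn ((mem_sing_iff hu hn hns).2 h)) hx ht
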